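/- **Setting.** Let $M$ be a closed (compact, boundaryless) manifold of dimension $d$ with a Riemannian metric, let $\mathcal X^1(M)$ be the set of $C^1$ vector fields on $M$ with the $C^1$-topology, and for $X\in\mathcal X^1(M)$ let $(\varphi_t)$ be its flow and $\operatorname{Sing}(X)$ its set of zeros. For $x\notin\operatorname{Sing}(X)$ let $\mathcal N(x)=X(x)^\perp\subset T_xM$; the linear Poincaré flow $\Psi_t:\mathcal N(x)\to\mathcal N(\varphi_t(x))$ is $D\varphi_t$ followed by the orthogonal projection to $X(\varphi_t(x))^\perp$. More generally, for $0\ne u\in T_xM$, the extended linear Poincaré flow $\widehat\Psi_t:u^\perp\to (D\varphi_t u)^\perp$ is $D\varphi_t$ followed by the orthogonal projection to $(D\varphi_tu)^\perp$. A splitting $\mathcal E\oplus\mathcal F$ into continuous subbundles of constant dimension, invariant under a linear flow $(A_t)$ over $(\varphi_t)$, is *$(\eta,T)$-dominated* ($\eta,T>0$) if $\|A_t|_{\mathcal E(x)}\|\cdot\|A_{-t}|_{\mathcal F(\varphi_t(x))}\|<e^{-\eta t}$ for all $x$ and all $t>T$, and *dominated* if it is so for some $\eta,T>0$; its *index* is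 $\dim\mathcal E$. A subbundle $\mathcal E$ is uniformly contracted if, for some $\eta,T>0$, $\|A_t|_{\mathcal E(x)}\|<e^{-\eta t}$ for all $x$ and $t>T$, and uniformly expanded if this holds with $A_{-t}$ in place of $A_t$. Let $\Lambda$ be a compact invariant set of $X$ and $0\le i\le d-1$. An invariant splitting $\mathcal N|_{\Lambda\setminus\operatorname{Sing}(X)}=\mathcal N_1\oplus\mathcal N_2$ for $(\Psi_t)$, with $\dim\mathcal N_1=i$ and $\dim\mathcal N_2=d-1-i$, is a *singular dominated splitting of index $i$* if it is dominated and each $\sigma\in\Lambda\cap\operatorname{Sing}(X)$ satisfies one of the following: * $(-)$ there is a dominated splitting $T_\sigma M=E^{ss}\oplus F$ for $(D\varphi_t)$ with $E^{ss}$ uniformly contracted, $\dim E^{ss}=i$ and $W^{ss}(\sigma)\cap\Lambda=\{\sigma\}$; * $(+)$ there is a dominated splitting $T_\sigma M=E\oplus E^{uu}$ for $(D\varphi_t)$ with $E^{uu}$ uniformly expanded, $\dim E^{uu}=d-1-i$ and $W^{uu}(\sigma)\cap\Lambda=\{\sigma\}$. Here $W^{ss}(\sigma)$ is the strong stable manifold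 tangent to $E^{ss}$, i.e. the set of points whose forward orbit converges to $\sigma$ exponentially at a rate stronger than every contraction rate along $F$; $W^{uu}(\sigma)$ is the analogous strong unstable manifold. For $\eta,T>0$, the singular dominated splitting is *completely $(\eta,T)$-dominated* if $\|\Psi_t|_{\mathcal N_1(x)}\|\cdot\|\Psi_{-t}|_{\mathcal N_2(\varphi_t(x))}\|<e^{-\eta t}$ for all $x\in\Lambda\setminus\operatorname{Sing}(X)$ and all $t\ge T$, and if at each $\sigma\in\Lambda\cap\operatorname{Sing}(X)$ a splitting as in $(-)$ or $(+)$ can be chosen such that, for every nonzero $u\in F$ (case $(-)$), respectively $u\in E$ (case $(+)$), the splitting of $u^\perp$ into the orthogonal projections of the two bundles of $T_\sigma M$ satisfies the same inequality for $(\widehat\Psi_t)$ and all $t\ge T$. **Theorem.** Let $X\in\mathcal X^1(M)$ and let $\Lambda$ be a compact invariant set with a singular dominated splitting $\mathcal N_1\oplus\mathcal N_2$ of index $i$. 1. There are $\eta',T'>0$, a $C^1$-neighborhood $\mathcal U$ of $X$ and a neighborhood $U$ of $\Lambda$ such that, for every $Y\in\mathcal U$, the maximal invariant set $\Lambda_Y=\{x:\varphi^Y_t(x)\in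 U\ \forall t\in\mathbb R\}$ of $Y$ in $U$ is compact and admits a singular dominated splitting of index $i$, which is $(\eta',T')$-dominated. 2. If $\eta,T>0$ and the splitting $\mathcal N_1\oplus\mathcal N_2$ is completely $(\eta,T)$-dominated, then there are a $C^1$-neighborhood $\mathcal U$ of $X$ and a neighborhood $U$ of $\Lambda$ such that, for every $Y\in\mathcal U$, the maximal invariant set of $Y$ in $U$ is compact and admits a singular dominated splitting of index $i$ which is completely $(\eta,T)$-dominated, with the same $\eta,T$. -/

import Mathlib

open Bundle Set Filter
open scoped Manifold ContDiff Topology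

noncomputable section

namespace SingDom

variable {d : ℕ} {M : Type*} [TopologicalSpace M] [ChartedSpace (EuclideanSpace ℝ (Fin d)) M]

/-- The tangent space `T_x M` of a manifold `M` of dimension `d` without boundary. -/
abbrev Tan (d : ℕ) {M : Type*} [TopologicalSpace M] [ChartedSpace (EuclideanSpace ℝ (Fin d)) M]
    (x : M) : Type := TangentSpace (𝓡 d) x

section Manifold

variable [IsManifold (𝓡 d) ∞ M]

variable (d M) in
/-- The set `𝒳¹(M)` of vector fields of class `C¹` on `M`. -/
abbrev VectorField : Type _ :=
  ContMDiffSection (𝓡 d) (EuclideanSpace ℝ (Fin d)) 1 (fun x : M ↦ TangentSpace (𝓡 d) x)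

/-- The expression of the vector field `X` in the chart of `M` centered at `x₀`. -/
def chartRep (X : VectorField d M) (x₀ : M) (p : EuclideanSpace ℝ (Fin d)) :
    EuclideanSpace ℝ (Fin d) :=
  (trivializationAt (EuclideanSpace ℝ (Fin d)) (fun x : M ↦ TangentSpace (𝓡 d) x) x₀
    ⟨(extChartAt (𝓡 d) x₀).symm p, X ((extChartAt (𝓡 d) x₀).symm p)⟩).2

/-- The fields `Y` that are `ε`-close to `X`, together with the first derivatives, on a subset `K`
of the domain of the coordinates given by the chart at `x₀`. -/
def c1Close (X : VectorField d M) (x₀ : M) (K : Set (EuclideanSpace ℝ (Fin d))) (ε : ℝ) :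
    Set (VectorField d M) :=
  {Y | ∀ p ∈ K, ‖chartRep Y x₀ p - chartRep X x₀ p‖ < ε ∧
    ‖fderiv ℝ (chartRep Y x₀) p - fderiv ℝ (chartRep X x₀) p‖ < ε}

/-- The `C¹`-topology on `𝒳¹(M)`: uniform closeness, together with first derivatives, on compact
subsets of charts. -/
instance c1Topology : TopologicalSpace (VectorField d M) :=
  TopologicalSpace.generateFrom
    {S | ∃ (X : VectorField d M) (x₀ : M) (K : Set (EuclideanSpace ℝ (Fin d))) (ε : ℝ),
      IsCompact K ∧ K ⊆ (extChartAt (𝓡 d) x₀).target ∧ 0 < ε ∧ S = c1Close X x₀ K ε}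

open Classical in
/-- The flow `φ_t` of `X`: `t ↦ φ_t(x)` is the integral curve of `X` through `x` (it exists and is
unique for a `C¹` vector field on a compact manifold without boundary). -/
def flow (X : VectorField d M) (t : ℝ) (x : M) : M :=
  if h : ∃ γ : ℝ → M, γ 0 = x ∧ IsMIntegralCurve (I := 𝓡 d) γ (fun y ↦ X y) then h.choose t else x

/-- The singularities of `X`. -/
def Sing (X : VectorField d M) : Set M := {x | X x = 0}

/-- Invariance of a set under the flow. -/
def IsInvariantSet (X : VectorField d M) (Λ : Set M) : Prop :=
  ∀ x ∈ Λ, ∀ t : ℝ, flow X t x ∈ Λ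

/-- The maximal invariant set of `X` in `U`. -/
def maxInvariant (X : VectorField d M) (U : Set M) : Set M := {x | ∀ t : ℝ, flow X t x ∈ U}

/-- The tangent flow `Dφ_t(x) : T_x M → T_{φ_t(x)} M`. -/
def tangentFlow (X : VectorField d M) (t : ℝ) (x : M) : Tan d x →L[ℝ] Tan d (flow X t x) :=
  mfderiv (𝓡 d) (𝓡 d) (flow X t) x

/-- The spaces `V x`, `x ∈ S`, depend continuously on `x`. For spaces of constant finite dimension
this amounts to the closedness of the total space inside `TM|_S`. -/
def IsContinuousFamily (S : Set M) (V : (x : M) → Submodule ℝ (Tan d x)) : Prop :=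
  ∃ C : Set (TangentBundle (𝓡 d) M), IsClosed C ∧
    ∀ x ∈ S, ∀ v : Tan d x, v ∈ V x ↔ (⟨x, v⟩ : TangentBundle (𝓡 d) M) ∈ C

end Manifold

section Riemannian

variable [IsManifold (𝓡 d) ∞ M] [RiemannianBundle (fun x : M ↦ TangentSpace (𝓡 d) x)]

/-- The norm `‖A|_V‖` of the restriction of a linear map to a subspace. -/
def restrNorm {x y : M} (A : Tan d x →L[ℝ] Tan d y) (V : Submodule ℝ (Tan d x)) : ℝ :=
  ‖A.comp V.subtypeL‖

/-- The orthogonal projection of `T_x M` onto the orthogonal complement of `u`. -/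
def normalProj {x : M} (u : Tan d x) : Tan d x →L[ℝ] Tan d x :=
  (ℝ ∙ u)ᗮ.starProjection

/-- The normal space `𝒩(x)`, the orthogonal complement of `X(x)`. -/
def normalSpace (X : VectorField d M) (x : M) : Submodule ℝ (Tan d x) := (ℝ ∙ (X x : Tan d x))ᗮ

/-- The linear Poincaré flow `Ψ_t(x) : 𝒩(x) → 𝒩(φ_t(x))`; the formula makes sense on `T_x M`, and
is only used on subspaces of `𝒩(x)` for regular `x`. -/
def poincareFlow (X : VectorField d M) (t : ℝ) (x : M) : Tan d x →L[ℝ] Tan d (flow X t x) :=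
  (normalProj (X (flow X t x) : Tan d (flow X t x))).comp (tangentFlow X t x)

/-- The extended linear Poincaré flow over the line `ℝu ⊆ T_x M`: the tangent flow followed by the
projection orthogonal to `Dφ_t(u)`. -/
def extPoincareFlow (X : VectorField d M) (t : ℝ) (x : M) (u : Tan d x) :
    Tan d x →L[ℝ] Tan d (flow X t x) :=
  (normalProj (tangentFlow X t x u)).comp (tangentFlow X t x)

/-- The splitting `B|_Λ = V ⊕ W` into continuous subbundles is invariant under the linear flow `A`
over the flow of `X`, the dimension of `V` is `i`, and the splitting is `(η, T)`-dominated. -/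
structure IsDominatedSplitting (X : VectorField d M)
    (A : (t : ℝ) → (x : M) → Tan d x →L[ℝ] Tan d (flow X t x)) (Λ : Set M)
    (B V W : (x : M) → Submodule ℝ (Tan d x)) (i : ℕ) (η T : ℝ) : Prop where
  continuous_left : IsContinuousFamily Λ V
  continuous_right : IsContinuousFamily Λ W
  sup_eq : ∀ x ∈ Λ, V x ⊔ W x = B x
  disjoint : ∀ x ∈ Λ, Disjoint (V x) (W x)
  index_eq : ∀ x ∈ Λ, Module.finrank ℝ (V x) = i
  invariant_left : ∀ x ∈ Λ, ∀ t : ℝ, (V x).map (A t x).toLinearMap = V (flow X t x)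
  invariant_right : ∀ x ∈ Λ, ∀ t : ℝ, (W x).map (A t x).toLinearMap = W (flow X t x)
  dominated : ∀ x ∈ Λ, ∀ t : ℝ, T < t →
    restrNorm (A t x) (V x) * restrNorm (A (-t) (flow X t x)) (W (flow X t x))
      < Real.exp (-(η * t))

/-- The strong stable manifold `W^{ss}(σ)` associated to a dominated splitting
`T_σ M = E^{ss} ⊕ F`: the points whose forward orbit converges to `σ` exponentially fast, at a rate
`l` strictly larger than all the contraction rates of the tangent flow along `F`. -/
def strongStable (X : VectorField d M) (σ : M) (F : (x : M) → Submodule ℝ (Tan d x)) : Set M :=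
  {y | ∃ l l' C : ℝ, 0 < l ∧ l' < l ∧
    (∀ t : ℝ, 0 ≤ t → Manifold.riemannianEDist (𝓡 d) (flow X t y) σ
      ≤ ENNReal.ofReal (C * Real.exp (-(l * t)))) ∧
    (∀ t : ℝ, 0 ≤ t → restrNorm (tangentFlow X (-t) σ) (F σ) ≤ C * Real.exp (l' * t))}

/-- The strong unstable manifold `W^{uu}(σ)` associated to a dominated splitting
`T_σ M = E ⊕ E^{uu}`: the strong stable manifold for the reversed time. -/
def strongUnstable (X : VectorField d M) (σ : M) (E : (x : M) → Submodule ℝ (Tan d x)) : Set M :=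
  {y | ∃ l l' C : ℝ, 0 < l ∧ l' < l ∧
    (∀ t : ℝ, 0 ≤ t → Manifold.riemannianEDist (𝓡 d) (flow X (-t) y) σ
      ≤ ENNReal.ofReal (C * Real.exp (-(l * t)))) ∧
    (∀ t : ℝ, 0 ≤ t → restrNorm (tangentFlow X t σ) (E σ) ≤ C * Real.exp (l' * t))}

/-- The bundle `V` is uniformly contracted over the singularity `σ`. -/
def IsContractedAt (X : VectorField d M) (σ : M) (V : (x : M) → Submodule ℝ (Tan d x)) : Prop :=
  ∃ η T : ℝ, 0 < η ∧ 0 < T ∧ ∀ t : ℝ, T < t →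
    restrNorm (tangentFlow X t σ) (V σ) < Real.exp (-(η * t))

/-- The bundle `V` is uniformly expanded over the singularity `σ`. -/
def IsExpandedAt (X : VectorField d M) (σ : M) (V : (x : M) → Submodule ℝ (Tan d x)) : Prop :=
  ∃ η T : ℝ, 0 < η ∧ 0 < T ∧ ∀ t : ℝ, T < t →
    restrNorm (tangentFlow X (-t) σ) (V σ) < Real.exp (-(η * t))

/-- `T_σ M = E ⊕ F` is dominated for the tangent flow, `E` is uniformly contracted of dimension `i`
and `W^{ss}(σ) ∩ Λ = {σ}`. Only the values of `E`, `F` at `σ` matter. -/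
def IsStableEscape (X : VectorField d M) (Λ : Set M) (i : ℕ) (σ : M)
    (E F : (x : M) → Submodule ℝ (Tan d x)) : Prop :=
  (∃ η T : ℝ, 0 < η ∧ 0 < T ∧
    IsDominatedSplitting X (tangentFlow X) {σ} (fun _ ↦ ⊤) E F i η T) ∧
  IsContractedAt X σ E ∧ strongStable X σ F ∩ Λ = {σ}

/-- `T_σ M = E ⊕ F` is dominated for the tangent flow, `F` is uniformly expanded of dimension
`d - 1 - i` (so that `E` has dimension `i + 1`) and `W^{uu}(σ) ∩ Λ = {σ}`.
Only the values of `E`, `F` at `σ` matter. -/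
def IsUnstableEscape (X : VectorField d M) (Λ : Set M) (i : ℕ) (σ : M)
    (E F : (x : M) → Submodule ℝ (Tan d x)) : Prop :=
  (∃ η T : ℝ, 0 < η ∧ 0 < T ∧
    IsDominatedSplitting X (tangentFlow X) {σ} (fun _ ↦ ⊤) E F (i + 1) η T) ∧
  Module.finrank ℝ (F σ) + i + 1 = d ∧
  IsExpandedAt X σ F ∧ strongUnstable X σ E ∩ Λ = {σ}

/-- `𝒩|_{Λ ∖ Sing X} = N₁ ⊕ N₂` is a singular dominated splitting of index `i` over the compact
invariant set `Λ`, with `dim N₁ = i` and `dim N₂ = d - 1 - i`. -/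
structure IsSingularDominated (X : VectorField d M) (Λ : Set M) (i : ℕ)
    (N₁ N₂ : (x : M) → Submodule ℝ (Tan d x)) : Prop where
  isCompact : IsCompact Λ
  isInvariant : IsInvariantSet X Λ
  index_lt : i < d
  dominated : ∃ η T : ℝ, 0 < η ∧ 0 < T ∧
    IsDominatedSplitting X (poincareFlow X) (Λ \ Sing X) (normalSpace X) N₁ N₂ i η T
  singular : ∀ σ ∈ Λ ∩ Sing X,
    (∃ E F, IsStableEscape X Λ i σ E F) ∨ (∃ E F, IsUnstableEscape X Λ i σ E F)

/-- Over every line `ℝu` of `G σ`, the splitting of the space `u^⊥` into the projections of `E σ`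
and `F σ` satisfies the domination inequality of the extended linear Poincaré flow for all times
`t ≥ T`. -/
def IsLineDominated (X : VectorField d M) (σ : M) (E F G : (x : M) → Submodule ℝ (Tan d x))
    (η T : ℝ) : Prop :=
  ∀ u ∈ G σ, u ≠ 0 → ∀ t : ℝ, T ≤ t →
    restrNorm (extPoincareFlow X t σ u) ((E σ).map (normalProj u).toLinearMap) *
      restrNorm (extPoincareFlow X (-t) (flow X t σ) (tangentFlow X t σ u))
        ((F (flow X t σ)).map (normalProj (tangentFlow X t σ u)).toLinearMap)
      < Real.exp (-(η * t))

/-- The singular dominated splitting `N₁ ⊕ N₂` satisfies the `(η, T)`-domination inequality, for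
all times `t ≥ T`, on the regular part of `Λ` and over the lines at the singularities of `Λ` that
compactify it: those contained in `F` if `T_σ M = E^{ss} ⊕ F`, in `E` if
`T_σ M = E ⊕ E^{uu}`. -/
structure IsCompletelyDominated (X : VectorField d M) (Λ : Set M) (i : ℕ)
    (N₁ N₂ : (x : M) → Submodule ℝ (Tan d x)) (η T : ℝ) : Prop where
  isSingularDominated : IsSingularDominated X Λ i N₁ N₂
  regular : ∀ x ∈ Λ \ Sing X, ∀ t : ℝ, T ≤ t →
    restrNorm (poincareFlow X t x) (N₁ x) *
      restrNorm (poincareFlow X (-t) (flow X t x)) (N₂ (flow X t x)) < Real.exp (-(η * t))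
  singular : ∀ σ ∈ Λ ∩ Sing X,
    (∃ E F, IsStableEscape X Λ i σ E F ∧ IsLineDominated X σ E F F η T) ∨
    (∃ E F, IsUnstableEscape X Λ i σ E F ∧ IsLineDominated X σ E F E η T)

end Riemannian

end SingDom

end

set_option linter.unusedSectionVars false

noncomputable section

namespace SingDom

open Module

/-! ### Invariant subspaces obtained from invariant cones -/

section Cones

variable {H : Type*} [NormedAddCommGroup H] [InnerProductSpace ℝ H] [FiniteDimensional ℝ H]


/-! The linear Poincaré flow lives over a noncompact set, the regular part of `Λ`, and the proof
starts by compactifying it. Take the unit vectors along `Y` at regular points whose whole `Y`-orbit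
stays close to `Λ`, for `Y` close to `X`. Their limits form a compact set `FlowData.limLines`,
invariant under the flow induced by `X` on unit tangent vectors, and over it the extended linear
Poincaré flow is a continuous cocycle. Over a regular point the only limit is the direction of `X`,
and the given splitting applies.

At a singularity of type (−) every limit line lies in `F` (`FlowData.IsEscape.limLines_mem`).
Otherwise, nearby orbits would carry a field direction inside a cone around `E^{ss}`. Followed
backward, the field stays in the cone and grows as long as the orbit is near the singularity. It is
bounded, so the orbit has to leave, and the exit points accumulate on a point of `Λ`, other than the
singularity, whose forward orbit converges at a strong stable rate. This is excluded by hypothesis.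
Over lines in `F`, the projections of `E^{ss}` and `F` form a dominated splitting
(`FlowData.exists_isDom_linesIn`). Type (+) is type (−) for reversed time. The pieces are glued into
a dominated splitting over the compact set of limit lines. The gluing needs no continuity check,
because uniform domination makes the bundles closed (`LinCocycle.isClosed_left`).

A dominated splitting over a compact set is robust: it is surrounded by cones that the time-`T₀` map
sends strictly inside themselves, an open condition in the system and the point
(`LinCocycle.exists_isRobustSplit`). By compactness, the directions of nearby fields along nearby
orbits fall in the open set where these cones work (`FlowData.eventually_near_dirLine`).

It remains to see that the singularities of nearby fields are again of type (−) or (+)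
(`FlowData.IsEscape.persist`). The splitting and the contraction persist by openness. For the strong
stable set, since limit lines lie in `F`, the field along nearby orbits points away from `E^{ss}`
whenever it is near the singularity. Along an orbit in the strong stable set its direction therefore
accumulates on `F`, so the field cannot decay faster than vectors of `F` do. But the field is
bounded by the distance to the singularity, which decays at a larger rate
(`FlowData.eq_of_mem_strongStable`).

For part 2, a strict inequality over the compact range `T ≤ t ≤ 2T` persists with the same
constants. Every `t ≥ T` is a multiple of such a time, and the inequalities multiply
(`LinCocycle.IsSplit.strictAt_of_Icc`).

All this is done for abstract families of flows (`FlowData`) whose tangent spaces sit in one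
Euclidean space. The manifold enters through an isometric embedding of its tangent bundle in a
trivial bundle (`exists_parsevalFrame`) and through the joint continuity of the tangent flow in the
field, the time and the vector (`continuous_tangentMap_flow`), a consequence of Grönwall estimates
in charts. -/

/-- Every subspace of dimension `j` has an orthonormal frame. -/
theorem exists_orthonormal_span_eq (W : Submodule ℝ H) {j : ℕ} (hj : finrank ℝ W = j) :
    ∃ f : Fin j → H, Orthonormal ℝ f ∧ Submodule.span ℝ (range f) = W := by
  subst hj
  let b := stdOrthonormalBasis ℝ W
  refine ⟨fun k ↦ (b k : H), ?_, ?_⟩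
  · exact b.orthonormal.comp_linearIsometry W.subtypeₗᵢ
  · have h := b.toBasis.span_eq
    rw [OrthonormalBasis.coe_toBasis] at h
    have h2 := congrArg (Submodule.map W.subtype) h
    rw [Submodule.map_span, Submodule.map_top, Submodule.range_subtype, ← range_comp] at h2
    exact h2

/-- Frames stand in for the Grassmannian: limits of subspaces of constant dimension are taken
through orthonormal frames. -/
theorem isCompact_setOf_orthonormal (j : ℕ) : IsCompact {f : Fin j → H | Orthonormal ℝ f} := by
  refine Metric.isCompact_of_isClosed_isBounded ?_ ?_
  · have : {f : Fin j → H | Orthonormal ℝ f} =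
        ⋂ (k : Fin j) (l : Fin j), {f | inner ℝ (f k) (f l) = if k = l then (1 : ℝ) else 0} := by
      ext f
      simp [orthonormal_iff_ite]
    rw [this]
    refine isClosed_iInter fun k ↦ isClosed_iInter fun l ↦ isClosed_eq ?_ continuous_const
    fun_prop
  · refine (Metric.isBounded_closedBall (x := (0 : Fin j → H)) (r := 1)).subset fun f hf ↦ ?_
    rw [mem_closedBall_zero_iff, pi_norm_le_iff_of_nonneg zero_le_one]
    exact fun k ↦ (hf.1 k).le

theorem mem_span_range_iff_sum {j : ℕ} (f : Fin j → H) (x : H) :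
    x ∈ Submodule.span ℝ (range f) ↔ ∃ c : Fin j → ℝ, ∑ k, c k • f k = x :=
  Submodule.mem_span_range_iff_exists_fun ℝ

theorem finrank_span_orthonormal {j : ℕ} {f : Fin j → H} (hf : Orthonormal ℝ f) :
    finrank ℝ (Submodule.span ℝ (range f)) = j := by
  simpa using finrank_span_eq_card hf.linearIndependent

/-- Composition of the first `n` terms of a sequence of operators. -/
def iterComp (S : ℕ → H →L[ℝ] H) : ℕ → H →L[ℝ] H
  | 0 => ContinuousLinearMap.id ℝ H
  | n + 1 => (S n).comp (iterComp S n)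

/-- Two complementary subspaces of a finite dimensional space, by dimension. -/
theorem sup_eq_of_finrank {N V W : Submodule ℝ H} (hV : V ≤ N) (hW : W ≤ N) (hd : Disjoint V W)
    (h : finrank ℝ V + finrank ℝ W = finrank ℝ N) : V ⊔ W = N := by
  refine Submodule.eq_of_le_of_finrank_eq (sup_le hV hW) ?_
  have := Submodule.finrank_sup_add_finrank_inf_eq V W
  rw [hd.eq_bot, finrank_bot] at this
  omega

/-- For a sequence of operators preserving a sequence of cones `‖q x‖ ≤ ‖p x‖` and dominating on
them, the vectors that stay in the complementary cones form a subspace. -/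
theorem exists_submodule_of_cones (N : ℕ → Submodule ℝ H) (S p q : ℕ → H →L[ℝ] H) (i j : ℕ)
    (hS : ∀ n, ∀ x ∈ N n, S n x ∈ N (n + 1))
    (hinj : ∀ n, ∀ x ∈ N n, S n x = 0 → x = 0)
    (hdim : ∀ n, finrank ℝ (N n) = i + j)
    (hcone : ∀ n, ∀ x ∈ N n, x ≠ 0 → ‖q n x‖ ≤ ‖p n x‖ →
      ‖q (n + 1) (S n x)‖ < ‖p (n + 1) (S n x)‖)
    (hdom : ∀ n, ∀ x ∈ N n, ∀ y ∈ N n, ‖p (n + 1) (S n x)‖ ≤ ‖q (n + 1) (S n x)‖ →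
      ‖q n y‖ ≤ ‖p n y‖ → ‖y‖ * ‖S n x‖ ≤ 1 / 2 * (‖x‖ * ‖S n y‖))
    (hW : ∀ n, ∃ W ≤ N n, finrank ℝ W = j ∧ ∀ x ∈ W, x ≠ 0 → ‖p n x‖ < ‖q n x‖)
    (hV : ∃ V ≤ N 0, finrank ℝ V = i ∧ ∀ x ∈ V, x ≠ 0 → ‖q 0 x‖ < ‖p 0 x‖) :
    ∃ R ≤ N 0, finrank ℝ R = j ∧ ∀ x, x ∈ R ↔
      x ∈ N 0 ∧ ∀ n, ‖p n (iterComp S n x)‖ ≤ ‖q n (iterComp S n x)‖ := by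
  set g := iterComp S with hg
  have g0 : ∀ x, g 0 x = x := fun x ↦ rfl
  have gs : ∀ n x, g (n + 1) x = S n (g n x) := fun n x ↦ rfl
  have gmem : ∀ n, ∀ x ∈ N 0, g n x ∈ N n := by
    intro n x hx
    induction n with
    | zero => exact hx
    | succ n ih => exact hS n _ ih
  have ginj : ∀ n, ∀ x ∈ N 0, g n x = 0 → x = 0 := by
    intro n x hx
    induction n with
    | zero => exact id
    | succ n ih => exact fun h ↦ ih (hinj n _ (gmem n x hx) h)
  -- pullback of the cones
  let K : ℕ → Set H := fun n ↦ {x | x ∈ N 0 ∧ ‖p n (g n x)‖ ≤ ‖q n (g n x)‖}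
  have hKclosed : ∀ n, IsClosed (K n) := fun n ↦
    (Submodule.closed_of_finiteDimensional (N 0)).inter
      (isClosed_le (f := fun x ↦ ‖p n (g n x)‖) (g := fun x ↦ ‖q n (g n x)‖)
        (by fun_prop) (by fun_prop))
  have hKanti : ∀ n, K (n + 1) ⊆ K n := by
    rintro n x ⟨hx, h⟩
    refine ⟨hx, ?_⟩
    by_contra hc
    push Not at hc
    have hx0 : g n x ≠ 0 := by
      intro h0
      simp [h0] at hc
    exact absurd h (not_le.2 (hcone n _ (gmem n x hx) hx0 hc.le))
  -- The frames whose span lies in the pulled-back cone form a decreasing sequence of closed subsets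
  -- of a compact set. Each is nonempty, as it contains a frame of the preimage of `W` under `g n`.
  let Fr : ℕ → Set (Fin j → H) := fun n ↦
    {f | Orthonormal ℝ f ∧ ∀ c : Fin j → ℝ, ∑ k, c k • f k ∈ K n}
  have hFrne : ∀ n, (Fr n).Nonempty := by
    intro n
    obtain ⟨W, hWN, hWj, hWc⟩ := hW n
    let G : N 0 →ₗ[ℝ] N n := (g n).toLinearMap.restrict (gmem n)
    have hGinj : Function.Injective G := by
      rw [← LinearMap.ker_eq_bot, LinearMap.ker_eq_bot']
      intro x hx
      have : g n x = 0 := congrArg Subtype.val hx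
      exact Subtype.ext (ginj n x x.2 this)
    let e : N 0 ≃ₗ[ℝ] N n := LinearMap.linearEquivOfInjective G hGinj (by rw [hdim, hdim])
    let W' : Submodule ℝ H := ((W.comap (N n).subtype).map e.symm.toLinearMap).map (N 0).subtype
    have hW' : finrank ℝ W' = j := by
      rw [Submodule.finrank_map_subtype_eq, LinearEquiv.finrank_map_eq,
        (Submodule.comapSubtypeEquivOfLe hWN).finrank_eq, hWj]
    obtain ⟨f, hf, hspan⟩ := exists_orthonormal_span_eq W' hW'
    refine ⟨f, hf, fun c ↦ ?_⟩
    have hmem : ∑ k, c k • f k ∈ W' := by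
      rw [← hspan, mem_span_range_iff_sum]
      exact ⟨c, rfl⟩
    obtain ⟨y, hy, hyx⟩ := hmem
    obtain ⟨w, hw, hwy⟩ := hy
    rw [← hyx]
    refine ⟨y.2, ?_⟩
    have hgy : g n y = w := by
      have : G y = w := by
        rw [← hwy]
        exact LinearEquiv.apply_symm_apply e w
      rw [← this]
      rfl
    change ‖p n (g n y)‖ ≤ ‖q n (g n y)‖
    rw [hgy]
    by_cases hw0 : (w : H) = 0
    · simp [hw0]
    · exact (hWc _ hw hw0).le
  have hFrclosed : ∀ n, IsClosed (Fr n) := by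
    intro n
    have : Fr n = {f | Orthonormal ℝ f} ∩ ⋂ c : Fin j → ℝ, {f | ∑ k, c k • f k ∈ K n} := by
      ext f
      simp [Fr]
    rw [this]
    refine (isCompact_setOf_orthonormal j).isClosed.inter (isClosed_iInter fun c ↦ ?_)
    exact (hKclosed n).preimage (f := fun f : Fin j → H ↦ ∑ k, c k • f k) (by fun_prop)
  obtain ⟨f, hf⟩ := IsCompact.nonempty_iInter_of_sequence_nonempty_isCompact_isClosed Fr
    (fun n f hf ↦ ⟨hf.1, fun c ↦ hKanti n (hf.2 c)⟩) hFrne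
    ((isCompact_setOf_orthonormal j).of_isClosed_subset (hFrclosed 0) fun f hf ↦ hf.1) hFrclosed
  have hf' : ∀ n, f ∈ Fr n := by simpa using hf
  let R := Submodule.span ℝ (range f)
  have hRK : ∀ x ∈ R, ∀ n, x ∈ K n := by
    intro x hx n
    obtain ⟨c, rfl⟩ := (mem_span_range_iff_sum f x).1 hx
    exact (hf' n).2 c
  have hRN : R ≤ N 0 := fun x hx ↦ (hRK x hx 0).1
  have hRj : finrank ℝ R = j := finrank_span_orthonormal (hf' 0).1
  refine ⟨R, hRN, hRj, fun x ↦ ⟨fun hx ↦ ⟨hRN hx, fun n ↦ (hRK x hx n).2⟩, ?_⟩⟩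
  -- The reverse inclusion. The vector is `y + s` with `y ∈ V` and `s ∈ R`. If `y ≠ 0`, then `y`
  -- remains in the opposite cones and outgrows both `s` and `y + s`, although it is their
  -- difference.
  rintro ⟨hxN, hxc⟩
  obtain ⟨V, hVN, hVi, hVc⟩ := hV
  have hdisj : Disjoint V R := by
    rw [Submodule.disjoint_def]
    intro y hyV hyR
    by_contra hy
    exact absurd (hVc y hyV hy) (not_lt.2 (hRK y hyR 0).2)
  have hsup : V ⊔ R = N 0 := sup_eq_of_finrank hVN hRN hdisj (by rw [hVi, hRj, hdim])
  rw [← hsup, Submodule.mem_sup] at hxN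
  obtain ⟨y, hyV, s, hsR, rfl⟩ := hxN
  suffices y = 0 by rw [this, zero_add]; exact hsR
  by_contra hy0
  have hyc : ∀ n, ‖q n (g n y)‖ < ‖p n (g n y)‖ := by
    intro n
    induction n with
    | zero => exact hVc y hyV hy0
    | succ n ih =>
      exact hcone n _ (gmem n y (hVN hyV)) (fun h ↦ hy0 (ginj n y (hVN hyV) h)) ih.le
  have key : ∀ z ∈ N 0, (∀ n, ‖p n (g n z)‖ ≤ ‖q n (g n z)‖) → ∀ n,
      ‖y‖ * ‖g n z‖ ≤ (1 / 2) ^ n * (‖z‖ * ‖g n y‖) := by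
    intro z hz hzc n
    induction n with
    | zero => simp [g0, mul_comm]
    | succ n ih =>
      have h1 := hdom n _ (gmem n z hz) _ (gmem n y (hVN hyV)) (hzc (n + 1)) (hyc n).le
      rw [← gs, ← gs] at h1
      have hpos : 0 < ‖g n y‖ := norm_pos_iff.2 fun h ↦ hy0 (ginj n y (hVN hyV) h)
      refine le_of_mul_le_mul_left ?_ hpos
      calc ‖g n y‖ * (‖y‖ * ‖g (n + 1) z‖) = ‖y‖ * (‖g n y‖ * ‖g (n + 1) z‖) := by ring
        _ ≤ ‖y‖ * (1 / 2 * (‖g n z‖ * ‖g (n + 1) y‖)) := by gcongr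
        _ = 1 / 2 * ‖g (n + 1) y‖ * (‖y‖ * ‖g n z‖) := by ring
        _ ≤ 1 / 2 * ‖g (n + 1) y‖ * ((1 / 2) ^ n * (‖z‖ * ‖g n y‖)) := by gcongr
        _ = ‖g n y‖ * ((1 / 2) ^ (n + 1) * (‖z‖ * ‖g (n + 1) y‖)) := by ring
  have k1 := key s (hRN hsR) fun n ↦ (hRK s hsR n).2
  have k2 := key (y + s) (add_mem (hVN hyV) (hRN hsR)) hxc
  have hlim : Tendsto (fun n : ℕ ↦ (1 / 2 : ℝ) ^ n * (‖s‖ + ‖y + s‖)) atTop (𝓝 0) := by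
    simpa using (tendsto_pow_atTop_nhds_zero_of_lt_one (r := (1 / 2 : ℝ)) (by norm_num)
      (by norm_num)).mul_const (‖s‖ + ‖y + s‖)
  obtain ⟨n, hn⟩ := (hlim.eventually (gt_mem_nhds (norm_pos_iff.2 hy0))).exists
  have hpos : 0 < ‖g n y‖ := norm_pos_iff.2 fun h ↦ hy0 (ginj n y (hVN hyV) h)
  have h3 : ‖g n y‖ ≤ ‖g n (y + s)‖ + ‖g n s‖ := by
    have : g n y = g n (y + s) - g n s := by simp
    rw [this]
    exact norm_sub_le _ _
  have h4 : ‖y‖ * ‖g n y‖ ≤ (1 / 2) ^ n * (‖s‖ + ‖y + s‖) * ‖g n y‖ := by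
    calc ‖y‖ * ‖g n y‖ ≤ ‖y‖ * (‖g n (y + s)‖ + ‖g n s‖) := by gcongr
      _ ≤ (1 / 2) ^ n * (‖y + s‖ * ‖g n y‖) + (1 / 2) ^ n * (‖s‖ * ‖g n y‖) := by
        rw [mul_add]
        exact add_le_add (k2 n) (k1 n)
      _ = _ := by ring
  exact absurd (le_of_mul_le_mul_right h4 hpos) (not_le.2 hn)

end Cones

/-! ### Linear cocycles; uniqueness and closedness of dominated splittings -/

/-- A family, indexed by `P`, of linear cocycles over flows on `B`. The fibre over `b` is the range
of the projection `A Y 0 b` of the ambient space `H`. -/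
structure LinCocycle (P B H : Type*) [TopologicalSpace P] [TopologicalSpace B]
    [NormedAddCommGroup H] [InnerProductSpace ℝ H] where
  Φ : P → ℝ → B → B
  A : P → ℝ → B → H →L[ℝ] H
  continuous_Φ : Continuous fun z : P × ℝ × B ↦ Φ z.1 z.2.1 z.2.2
  continuous_A : Continuous fun z : P × ℝ × B ↦ A z.1 z.2.1 z.2.2
  Φ_zero : ∀ Y b, Φ Y 0 b = b
  Φ_add : ∀ Y s t b, Φ Y (s + t) b = Φ Y s (Φ Y t b)
  A_add : ∀ Y s t b, A Y (s + t) b = (A Y s (Φ Y t b)).comp (A Y t b)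

namespace LinCocycle

variable {P B H : Type*} [TopologicalSpace P] [TopologicalSpace B]
  [NormedAddCommGroup H] [InnerProductSpace ℝ H] [FiniteDimensional ℝ H]

/-- Time reversal. -/
def rev (C : LinCocycle P B H) : LinCocycle P B H where
  Φ Y t b := C.Φ Y (-t) b
  A Y t b := C.A Y (-t) b
  continuous_Φ := C.continuous_Φ.comp (f := fun z : P × ℝ × B ↦ (z.1, -z.2.1, z.2.2))
    (by fun_prop)
  continuous_A := C.continuous_A.comp (f := fun z : P × ℝ × B ↦ (z.1, -z.2.1, z.2.2))
    (by fun_prop)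
  Φ_zero Y b := by simp [C.Φ_zero]
  Φ_add Y s t b := by rw [neg_add, C.Φ_add]
  A_add Y s t b := by rw [neg_add, C.A_add]

/-- The fibre over `b`. -/
def fib (C : LinCocycle P B H) (Y : P) (b : B) : Submodule ℝ H := (C.A Y 0 b).range

variable (C : LinCocycle P B H) (Y : P) (b : B)

theorem rev_Φ (t : ℝ) : C.rev.Φ Y t b = C.Φ Y (-t) b := rfl

theorem rev_A (t : ℝ) : C.rev.A Y t b = C.A Y (-t) b := rfl

theorem rev_fib : C.rev.fib Y b = C.fib Y b := by
  simp [fib, rev_A]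

theorem rev_rev : C.rev.rev = C := by
  cases C
  simp [rev]

theorem A_add_apply (s t : ℝ) (x : H) : C.A Y (s + t) b x = C.A Y s (C.Φ Y t b) (C.A Y t b x) := by
  rw [C.A_add]; rfl

theorem A_zero_apply_of_mem {x : H} (hx : x ∈ C.fib Y b) : C.A Y 0 b x = x := by
  obtain ⟨y, rfl⟩ := hx
  have := C.A_add_apply Y b 0 0 y
  rw [C.Φ_zero, add_zero] at this
  exact this.symm

theorem mem_fib_iff {x : H} : x ∈ C.fib Y b ↔ C.A Y 0 b x = x :=
  ⟨C.A_zero_apply_of_mem Y b, fun h ↦ ⟨x, h⟩⟩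

theorem A_mem_fib (t : ℝ) (x : H) : C.A Y t b x ∈ C.fib Y (C.Φ Y t b) := by
  refine ⟨C.A Y t b x, ?_⟩
  have := C.A_add_apply Y b 0 t x
  rw [zero_add] at this
  exact this.symm

theorem Φ_neg_Φ (t : ℝ) : C.Φ Y (-t) (C.Φ Y t b) = b := by
  rw [← C.Φ_add, neg_add_cancel, C.Φ_zero]

theorem Φ_Φ_neg (t : ℝ) : C.Φ Y t (C.Φ Y (-t) b) = b := by
  rw [← C.Φ_add, add_neg_cancel, C.Φ_zero]

theorem A_neg_A {x : H} (hx : x ∈ C.fib Y b) (t : ℝ) :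
    C.A Y (-t) (C.Φ Y t b) (C.A Y t b x) = x := by
  rw [← C.A_add_apply, neg_add_cancel, C.A_zero_apply_of_mem Y b hx]

theorem A_A_neg {x : H} (hx : x ∈ C.fib Y b) (t : ℝ) :
    C.A Y t (C.Φ Y (-t) b) (C.A Y (-t) b x) = x := by
  rw [← C.A_add_apply, add_neg_cancel, C.A_zero_apply_of_mem Y b hx]

theorem eq_zero_of_A_eq_zero {x : H} (hx : x ∈ C.fib Y b) {t : ℝ} (h : C.A Y t b x = 0) :
    x = 0 := by
  rw [← C.A_neg_A Y b hx t, h, map_zero]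

theorem A_pos {x : H} (hx : x ∈ C.fib Y b) (hx0 : x ≠ 0) (t : ℝ) : 0 < ‖C.A Y t b x‖ :=
  norm_pos_iff.2 fun h ↦ hx0 (C.eq_zero_of_A_eq_zero Y b hx h)

theorem injOn_A (t : ℝ) : InjOn (C.A Y t b) (C.fib Y b) := by
  intro x hx y hy h
  rw [← C.A_neg_A Y b hx t, h, C.A_neg_A Y b hy t]

theorem finrank_map {S : Submodule ℝ H} (hS : S ≤ C.fib Y b) (t : ℝ) :
    finrank ℝ (S.map (C.A Y t b).toLinearMap) = finrank ℝ S := by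
  have h : Function.Injective ((C.A Y t b).toLinearMap.domRestrict S) := by
    intro x y hxy
    exact Subtype.ext (C.injOn_A Y b t (hS x.2) (hS y.2) hxy)
  have h2 := LinearMap.finrank_range_of_inj h
  rwa [LinearMap.range_domRestrict] at h2

theorem continuous_A_apply : Continuous fun z : P × ℝ × B × H ↦ C.A z.1 z.2.1 z.2.2.1 z.2.2.2 :=
  (C.continuous_A.comp (f := fun z : P × ℝ × B × H ↦ (z.1, z.2.1, z.2.2.1))
    (by fun_prop)).clm_apply (by fun_prop)

/-- The vectors of `S` grow under the cocycle at a strictly slower rate than the other ones. -/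
def IsSlow (S : Submodule ℝ H) : Prop :=
  S ≤ C.fib Y b ∧ ∀ x ∈ C.fib Y b, x ∉ S → ∀ s ∈ S,
    Tendsto (fun t ↦ ‖C.A Y t b s‖ / ‖C.A Y t b x‖) atTop (𝓝 0)

variable {C Y b}

/-- If they differed, equality of dimensions would give a vector of each outside the other. The
quotient of their growths and its inverse would both tend to zero. -/
theorem IsSlow.eq {S S' : Submodule ℝ H} (h : C.IsSlow Y b S) (h' : C.IsSlow Y b S')
    (hd : finrank ℝ S = finrank ℝ S') : S = S' := by
  by_contra hne
  have h1 : ¬ S ≤ S' := fun hle ↦ hne (Submodule.eq_of_le_of_finrank_eq hle hd)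
  have h2 : ¬ S' ≤ S := fun hle ↦ hne (Submodule.eq_of_le_of_finrank_eq hle hd.symm).symm
  obtain ⟨s, hs, hs'⟩ := SetLike.not_le_iff_exists.1 h1
  obtain ⟨x, hx, hx'⟩ := SetLike.not_le_iff_exists.1 h2
  have t1 := h.2 x (h'.1 hx) hx' s hs
  have t2 := h'.2 s (h.1 hs) hs' x hx
  have t3 := t1.mul t2
  have s0 : s ≠ 0 := fun h0 ↦ hs' (h0 ▸ zero_mem _)
  have x0 : x ≠ 0 := fun h0 ↦ hx' (h0 ▸ zero_mem _)
  have : (fun t ↦ ‖C.A Y t b s‖ / ‖C.A Y t b x‖ * (‖C.A Y t b x‖ / ‖C.A Y t b s‖)) =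
      fun _ ↦ (1 : ℝ) := by
    funext t
    have p1 := C.A_pos Y b (h.1 hs) s0 t
    have p2 := C.A_pos Y b (h'.1 hx) x0 t
    field_simp
  rw [this, mul_zero] at t3
  exact one_ne_zero (tendsto_nhds_unique tendsto_const_nhds t3)

/-- Slowness only depends on large times, so it moves along orbits. With `IsSlow.eq` this gives
invariance under every real time of subspaces constructed from the multiples of one time. -/
theorem IsSlow.map {S : Submodule ℝ H} (h : C.IsSlow Y b S) (τ : ℝ) :
    C.IsSlow Y (C.Φ Y τ b) (S.map (C.A Y τ b).toLinearMap) := by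
  refine ⟨?_, ?_⟩
  · rintro _ ⟨x, -, rfl⟩
    exact C.A_mem_fib Y b τ x
  · rintro x hx hxS _ ⟨s, hs, rfl⟩
    have hx2 : C.A Y (-τ) (C.Φ Y τ b) x ∈ C.fib Y b := by
      have := C.A_mem_fib Y (C.Φ Y τ b) (-τ) x
      rwa [C.Φ_neg_Φ] at this
    have hxe : C.A Y τ b (C.A Y (-τ) (C.Φ Y τ b) x) = x := by
      have := C.A_A_neg Y (C.Φ Y τ b) hx (t := τ)
      rwa [C.Φ_neg_Φ] at this
    have hx3 : C.A Y (-τ) (C.Φ Y τ b) x ∉ S := fun hc ↦ hxS ⟨_, hc, hxe⟩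
    have := (h.2 _ hx2 hx3 s hs).comp (tendsto_atTop_add_const_right atTop τ tendsto_id)
    refine this.congr fun t ↦ ?_
    simp only [Function.comp, id]
    rw [C.A_add_apply, C.A_add_apply, hxe]
    rfl

variable (C Y b)

/-- Domination at a point, for all times `t ≥ T`. -/
def DomAt (V W : Submodule ℝ H) (η T : ℝ) : Prop :=
  ∀ t ≥ T, ∀ v ∈ V, ∀ w ∈ W,
    ‖C.A Y t b v‖ * ‖w‖ ≤ Real.exp (-(η * t)) * (‖v‖ * ‖C.A Y t b w‖)

variable {C Y b}

theorem DomAt.disjoint {V W : Submodule ℝ H} {η T : ℝ} (hη : 0 < η) (h : C.DomAt Y b V W η T)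
    (hV : V ≤ C.fib Y b) : Disjoint V W := by
  rw [Submodule.disjoint_def]
  intro x hxV hxW
  by_contra hx
  have h1 := h (max T 1) (le_max_left _ _) x hxV x hxW
  have p1 := C.A_pos Y b (hV hxV) hx (max T 1)
  have p2 := norm_pos_iff.2 hx
  have h2 : Real.exp (-(η * max T 1)) < 1 := by
    rw [Real.exp_lt_one_iff]
    have : 0 < max T 1 := lt_of_lt_of_le one_pos (le_max_right _ _)
    nlinarith [mul_pos hη this]
  nlinarith [mul_pos p1 p2]

/-- A vector outside `V` has a nonzero component `w` in `W`, which prevails: the image of the vector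
is eventually at least half as long as that of `w`, while images of vectors of `V` are exponentially
shorter than that of `w`. -/
theorem DomAt.isSlow {V W : Submodule ℝ H} {η T : ℝ} (hη : 0 < η) (h : C.DomAt Y b V W η T)
    (hsup : V ⊔ W = C.fib Y b) : C.IsSlow Y b V := by
  have hV : V ≤ C.fib Y b := hsup ▸ le_sup_left
  have hW : W ≤ C.fib Y b := hsup ▸ le_sup_right
  refine ⟨hV, fun x hx hxV s hs ↦ ?_⟩
  rw [← hsup, Submodule.mem_sup] at hx
  obtain ⟨v, hv, w, hw, rfl⟩ := hx
  have hw0 : w ≠ 0 := by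
    rintro rfl
    exact hxV (by simpa using hv)
  have hwpos := norm_pos_iff.2 hw0
  have hE : Tendsto (fun t : ℝ ↦ Real.exp (-(η * t))) atTop (𝓝 0) :=
    Real.tendsto_exp_atBot.comp (tendsto_neg_atTop_atBot.comp (tendsto_id.const_mul_atTop hη))
  have hub : Tendsto (fun t : ℝ ↦ 2 * (Real.exp (-(η * t)) * (‖s‖ / ‖w‖))) atTop (𝓝 0) := by
    simpa using (hE.mul_const (‖s‖ / ‖w‖)).const_mul 2
  have hv2 : ∀ᶠ t in atTop, Real.exp (-(η * t)) * (‖v‖ / ‖w‖) < 1 / 2 := by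
    have : Tendsto (fun t : ℝ ↦ Real.exp (-(η * t)) * (‖v‖ / ‖w‖)) atTop (𝓝 0) := by
      simpa using hE.mul_const (‖v‖ / ‖w‖)
    exact this.eventually (gt_mem_nhds (by norm_num))
  refine squeeze_zero' (Eventually.of_forall fun t ↦ by positivity) ?_ hub
  filter_upwards [hv2, eventually_ge_atTop T] with t ht hT
  have a0 := C.A_pos Y b (hW hw) hw0 t
  have b1 : ‖C.A Y t b v‖ ≤ Real.exp (-(η * t)) * (‖v‖ / ‖w‖) * ‖C.A Y t b w‖ := by
    have := h t hT v hv w hw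
    rw [mul_comm, ← le_div_iff₀' hwpos] at this
    calc _ ≤ _ := this
      _ = _ := by ring
  have b2 : ‖C.A Y t b s‖ ≤ Real.exp (-(η * t)) * (‖s‖ / ‖w‖) * ‖C.A Y t b w‖ := by
    have := h t hT s hs w hw
    rw [mul_comm, ← le_div_iff₀' hwpos] at this
    calc _ ≤ _ := this
      _ = _ := by ring
  have b3 : ‖C.A Y t b w‖ / 2 ≤ ‖C.A Y t b (v + w)‖ := by
    have h1 : ‖C.A Y t b w‖ ≤ ‖C.A Y t b (v + w)‖ + ‖C.A Y t b v‖ := by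
      have : C.A Y t b w = C.A Y t b (v + w) - C.A Y t b v := by simp
      rw [this]
      exact norm_sub_le _ _
    have h2 := mul_le_mul_of_nonneg_right ht.le a0.le
    linarith
  have hpos : 0 < ‖C.A Y t b (v + w)‖ := lt_of_lt_of_le (by positivity) b3
  rw [div_le_iff₀ hpos]
  calc ‖C.A Y t b s‖ ≤ Real.exp (-(η * t)) * (‖s‖ / ‖w‖) * ‖C.A Y t b w‖ := b2
    _ = 2 * (Real.exp (-(η * t)) * (‖s‖ / ‖w‖)) * (‖C.A Y t b w‖ / 2) := by ring
    _ ≤ _ := by gcongr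

variable (C Y)

/-- Invariant splitting of the fibres over an invariant set. -/
structure IsSplit (K : Set B) (V W : B → Submodule ℝ H) (i : ℕ) : Prop where
  inv : ∀ b ∈ K, ∀ t, C.Φ Y t b ∈ K
  sup_eq : ∀ b ∈ K, V b ⊔ W b = C.fib Y b
  disj : ∀ b ∈ K, Disjoint (V b) (W b)
  rank : ∀ b ∈ K, finrank ℝ (V b) = i
  map_left : ∀ b ∈ K, ∀ t, ∀ v ∈ V b, C.A Y t b v ∈ V (C.Φ Y t b)
  map_right : ∀ b ∈ K, ∀ t, ∀ w ∈ W b, C.A Y t b w ∈ W (C.Φ Y t b)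

variable {C Y} {K : Set B} {V W : B → Submodule ℝ H} {i : ℕ}

theorem IsSplit.left_le (h : C.IsSplit Y K V W i) (hb : b ∈ K) : V b ≤ C.fib Y b :=
  h.sup_eq b hb ▸ le_sup_left

theorem IsSplit.right_le (h : C.IsSplit Y K V W i) (hb : b ∈ K) : W b ≤ C.fib Y b :=
  h.sup_eq b hb ▸ le_sup_right

theorem IsSplit.finrank_add (h : C.IsSplit Y K V W i) (hb : b ∈ K) :
    i + finrank ℝ (W b) = finrank ℝ (C.fib Y b) := by
  have := Submodule.finrank_sup_add_finrank_inf_eq (V b) (W b)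
  rw [(h.disj b hb).eq_bot, finrank_bot, h.sup_eq b hb, h.rank b hb] at this
  omega

theorem IsSplit.rev {j m : ℕ} (h : C.IsSplit Y K V W i) (hm : ∀ b, finrank ℝ (C.fib Y b) = m)
    (hj : i + j = m) : C.rev.IsSplit Y K W V j where
  inv b hb t := h.inv b hb (-t)
  sup_eq b hb := by rw [sup_comm, h.sup_eq b hb, rev_fib]
  disj b hb := (h.disj b hb).symm
  rank b hb := by
    have := h.finrank_add hb
    rw [hm] at this
    omega
  map_left b hb t := h.map_right b hb (-t)
  map_right b hb t := h.map_left b hb (-t)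

theorem IsSplit.mono {K' : Set B} (h : C.IsSplit Y K V W i) (hK : K' ⊆ K)
    (hinv : ∀ b ∈ K', ∀ t, C.Φ Y t b ∈ K') : C.IsSplit Y K' V W i where
  inv := hinv
  sup_eq b hb := h.sup_eq b (hK hb)
  disj b hb := h.disj b (hK hb)
  rank b hb := h.rank b (hK hb)
  map_left b hb := h.map_left b (hK hb)
  map_right b hb := h.map_right b (hK hb)

variable (C Y K V W) in
/-- Uniform domination over a set. -/
def IsDom (η T : ℝ) : Prop := ∀ b ∈ K, C.DomAt Y b (V b) (W b) η T

/-- The inequality over the orbit segment from `C.Φ Y (-t) b` to `b`, read backward. -/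
theorem IsDom.rev {η T : ℝ} (h : C.IsSplit Y K V W i) (hd : C.IsDom Y K V W η T) :
    C.rev.IsDom Y K W V η T := by
  intro b hb t ht w hw v hv
  have h1 := hd (C.Φ Y (-t) b) (h.inv b hb _) t ht _ (h.map_left b hb (-t) v hv) _
    (h.map_right b hb (-t) w hw)
  rw [C.A_A_neg Y b (h.left_le hb hv), C.A_A_neg Y b (h.right_le hb hw)] at h1
  simp only [rev_A]
  calc _ = ‖v‖ * ‖C.A Y (-t) b w‖ := by ring
    _ ≤ _ := h1
    _ = _ := by ring

theorem IsDom.weaken {η T η' T' : ℝ} (hd : C.IsDom Y K V W η T) (hη : η' ≤ η) (hT : T ≤ T')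
    (hT0 : 0 ≤ T) : C.IsDom Y K V W η' T' := by
  intro b hb t ht v hv w hw
  refine (hd b hb t (hT.trans ht) v hv w hw).trans ?_
  have : 0 ≤ t := hT0.trans (hT.trans ht)
  gcongr

/-- Dominated splittings of the same index agree, at the points where both are defined. -/
theorem IsSplit.eq_of_isDom {K' : Set B} {V' W' : B → Submodule ℝ H} {η T η' T' : ℝ}
    (hη : 0 < η) (hη' : 0 < η')
    (h : C.IsSplit Y K V W i) (hd : C.IsDom Y K V W η T)
    (h' : C.IsSplit Y K' V' W' i) (hd' : C.IsDom Y K' V' W' η' T') (hb : b ∈ K) (hb' : b ∈ K') :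
    V b = V' b ∧ W b = W' b := by
  have e1 : V b = V' b := ((hd b hb).isSlow hη (h.sup_eq b hb)).eq
    ((hd' b hb').isSlow hη' (h'.sup_eq b hb')) (by rw [h.rank b hb, h'.rank b hb'])
  refine ⟨e1, ?_⟩
  -- The right bundles are the slow ones for reversed time.
  have d := IsDom.rev h hd
  have d' := IsDom.rev h' hd'
  refine ((d b hb).isSlow hη ?_).eq ((d' b hb').isSlow hη' ?_) ?_
  · rw [sup_comm, h.sup_eq b hb, rev_fib]
  · rw [sup_comm, h'.sup_eq b hb', rev_fib]
  · have := h.finrank_add hb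
    have := h'.finrank_add hb'
    omega

/-- The left bundle of a uniformly dominated splitting is closed. -/
theorem isClosed_left {m : ℕ} {η T : ℝ} (hm : ∀ b, finrank ℝ (C.fib Y b) = m) (hK : IsClosed K)
    (h : C.IsSplit Y K V W i) (hη : 0 < η) (hd : C.IsDom Y K V W η T) :
    IsClosed {z : B × H | z.1 ∈ K ∧ z.2 ∈ V z.1} := by
  by_cases hKe : K = ∅
  · simp [hKe]
  obtain ⟨b₁, hb₁⟩ := nonempty_iff_ne_empty.2 hKe
  set j := m - i with hj
  have hij : i + j = m := by
    have := h.finrank_add hb₁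
    rw [hm] at this
    omega
  have hWj : ∀ b ∈ K, finrank ℝ (W b) = j := by
    intro b hb
    have := h.finrank_add hb
    rw [hm] at this
    omega
  -- Off `K` an irrelevant frame is used, so that the frames are a total function with values in a
  -- compact set.
  have exF : ∀ b, ∃ f : Fin i → H, Orthonormal ℝ f ∧ (b ∈ K → Submodule.span ℝ (range f) = V b) := by
    intro b
    by_cases hb : b ∈ K
    · obtain ⟨f, hf, hs⟩ := exists_orthonormal_span_eq (V b) (h.rank b hb)
      exact ⟨f, hf, fun _ ↦ hs⟩
    · obtain ⟨f, hf, hs⟩ := exists_orthonormal_span_eq (V b₁) (h.rank b₁ hb₁)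
      exact ⟨f, hf, fun hc ↦ absurd hc hb⟩
  have exG : ∀ b, ∃ f : Fin j → H, Orthonormal ℝ f ∧ (b ∈ K → Submodule.span ℝ (range f) = W b) := by
    intro b
    by_cases hb : b ∈ K
    · obtain ⟨f, hf, hs⟩ := exists_orthonormal_span_eq (W b) (hWj b hb)
      exact ⟨f, hf, fun _ ↦ hs⟩
    · obtain ⟨f, hf, hs⟩ := exists_orthonormal_span_eq (W b₁) (hWj b₁ hb₁)
      exact ⟨f, hf, fun hc ↦ absurd hc hb⟩
  choose f hf hfs using exF
  choose g hg hgs using exG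
  rw [isClosed_iff_ultrafilter]
  rintro ⟨b, v⟩ 𝒢 h𝒢 hS
  have hb1 : Tendsto Prod.fst (𝒢 : Filter (B × H)) (𝓝 b) :=
    (continuous_fst.tendsto (b, v)).mono_left h𝒢
  have hv1 : Tendsto Prod.snd (𝒢 : Filter (B × H)) (𝓝 v) :=
    (continuous_snd.tendsto (b, v)).mono_left h𝒢
  have hKev : ∀ᶠ z in (𝒢 : Filter (B × H)), z.1 ∈ K := mem_of_superset hS fun z hz ↦ hz.1
  have hVev : ∀ᶠ z in (𝒢 : Filter (B × H)), z.2 ∈ V z.1 := mem_of_superset hS fun z hz ↦ hz.2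
  have hbK : b ∈ K := hK.mem_of_tendsto hb1 hKev
  refine ⟨hbK, ?_⟩
  obtain ⟨f', hf', hft⟩ := (isCompact_setOf_orthonormal (H := H) i).ultrafilter_le_nhds
    (𝒢.map fun z : B × H ↦ f z.1) (le_principal_iff.2 (Ultrafilter.mem_map.2 (univ_mem' fun z ↦ hf z.1)))
  obtain ⟨g', hg', hgt⟩ := (isCompact_setOf_orthonormal (H := H) j).ultrafilter_le_nhds
    (𝒢.map fun z : B × H ↦ g z.1) (le_principal_iff.2 (Ultrafilter.mem_map.2 (univ_mem' fun z ↦ hg z.1)))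
  have hft' : Tendsto (fun z : B × H ↦ f z.1) 𝒢 (𝓝 f') := hft
  have hgt' : Tendsto (fun z : B × H ↦ g z.1) 𝒢 (𝓝 g') := hgt
  have hfk : ∀ c : Fin i → ℝ, Tendsto (fun z : B × H ↦ ∑ k, c k • f z.1 k) 𝒢 (𝓝 (∑ k, c k • f' k)) :=
    fun c ↦ tendsto_finsetSum _ fun k _ ↦ ((tendsto_pi_nhds.1 hft' k).const_smul (c k))
  have hgk : ∀ c : Fin j → ℝ, Tendsto (fun z : B × H ↦ ∑ k, c k • g z.1 k) 𝒢 (𝓝 (∑ k, c k • g' k)) :=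
    fun c ↦ tendsto_finsetSum _ fun k _ ↦ ((tendsto_pi_nhds.1 hgt' k).const_smul (c k))
  have hA : ∀ t {x : B × H → H} {x' : H}, Tendsto x 𝒢 (𝓝 x') →
      Tendsto (fun z ↦ C.A Y t z.1 (x z)) 𝒢 (𝓝 (C.A Y t b x')) := fun t x x' hx ↦
    (C.continuous_A_apply.tendsto (Y, t, b, x')).comp
      (tendsto_const_nhds.prodMk_nhds (tendsto_const_nhds.prodMk_nhds (hb1.prodMk_nhds hx)))
  set V' := Submodule.span ℝ (range f')
  set W' := Submodule.span ℝ (range g')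
  have hmemV : ∀ b' ∈ K, ∀ c : Fin i → ℝ, ∑ k, c k • f b' k ∈ V b' := fun b' hb' c ↦ by
    rw [← hfs b' hb', mem_span_range_iff_sum]; exact ⟨c, rfl⟩
  have hmemW : ∀ b' ∈ K, ∀ c : Fin j → ℝ, ∑ k, c k • g b' k ∈ W b' := fun b' hb' c ↦ by
    rw [← hgs b' hb', mem_span_range_iff_sum]; exact ⟨c, rfl⟩
  have hV'le : V' ≤ C.fib Y b := by
    intro x hx
    obtain ⟨c, rfl⟩ := (mem_span_range_iff_sum f' x).1 hx
    rw [mem_fib_iff]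
    refine tendsto_nhds_unique (hA 0 (hfk c)) ((hfk c).congr' ?_)
    filter_upwards [hKev] with z hz
    exact (C.A_zero_apply_of_mem Y z.1 (h.left_le hz (hmemV _ hz c))).symm
  have hW'le : W' ≤ C.fib Y b := by
    intro x hx
    obtain ⟨c, rfl⟩ := (mem_span_range_iff_sum g' x).1 hx
    rw [mem_fib_iff]
    refine tendsto_nhds_unique (hA 0 (hgk c)) ((hgk c).congr' ?_)
    filter_upwards [hKev] with z hz
    exact (C.A_zero_apply_of_mem Y z.1 (h.right_le hz (hmemW _ hz c))).symm
  have hdom' : C.DomAt Y b V' W' η T := by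
    intro t ht x hx y hy
    obtain ⟨c, rfl⟩ := (mem_span_range_iff_sum f' x).1 hx
    obtain ⟨e, rfl⟩ := (mem_span_range_iff_sum g' y).1 hy
    refine le_of_tendsto_of_tendsto ((hA t (hfk c)).norm.mul (hgk e).norm)
      (((hfk c).norm.mul (hA t (hgk e)).norm).const_mul _) ?_
    filter_upwards [hKev] with z hz
    exact hd z.1 hz t ht _ (hmemV _ hz c) _ (hmemW _ hz e)
  -- The limit subspaces still satisfy the domination inequality. They are therefore transverse,
  -- fill the fibre by dimension, and uniqueness identifies the limit of the left bundles with `V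
  -- b`.
  have hsup' : V' ⊔ W' = C.fib Y b := by
    refine sup_eq_of_finrank hV'le hW'le (hdom'.disjoint hη hV'le) ?_
    rw [finrank_span_orthonormal hf', finrank_span_orthonormal hg', hm, hij]
  have hVV' : V' = V b := (hdom'.isSlow hη hsup').eq ((hd b hbK).isSlow hη (h.sup_eq b hbK))
    (by rw [finrank_span_orthonormal hf', h.rank b hbK])
  change v ∈ V b
  rw [← hVV']
  -- The limit vector is recovered from its coordinates in the converging frames.
  have hvlim : Tendsto (fun z : B × H ↦ ∑ k, inner ℝ (f z.1 k) z.2 • f z.1 k) 𝒢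
      (𝓝 (∑ k, inner ℝ (f' k) v • f' k)) :=
    tendsto_finsetSum _ fun k _ ↦
      ((tendsto_pi_nhds.1 hft' k).inner hv1).smul (tendsto_pi_nhds.1 hft' k)
  have : v = ∑ k, inner ℝ (f' k) v • f' k := by
    refine tendsto_nhds_unique hv1 (hvlim.congr' ?_)
    filter_upwards [hKev, hVev] with z hz hz2
    rw [← hfs _ hz] at hz2
    obtain ⟨c, hc⟩ := (mem_span_range_iff_sum _ _).1 hz2
    rw [← hc]
    refine Finset.sum_congr rfl fun k _ ↦ ?_
    rw [(hf z.1).inner_right_fintype]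
  rw [this, mem_span_range_iff_sum]
  exact ⟨_, rfl⟩

end LinCocycle

/-! ### Cone fields around a dominated splitting and its robustness -/

/-- The pattern of the openness arguments below: membership in a bundle or in a cone is closed, the
inequality required there is strict, and compactness of the unit sphere then makes the neighbourhood
uniform. -/
theorem eventually_imp_of_isClosed_isOpen {Z : Type*} [TopologicalSpace Z] {R Q : Z → Prop}
    (hR : IsClosed {z | R z}) (hQ : IsOpen {z | Q z}) {z₀ : Z} (h : R z₀ → Q z₀) :
    ∀ᶠ z in 𝓝 z₀, R z → Q z := by
  have : IsOpen {z | R z → Q z} := by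
    have h2 : {z | R z → Q z} = {z | R z}ᶜ ∪ {z | Q z} := by
      ext z
      simp [imp_iff_not_or]
    rw [h2]
    exact hR.isOpen_compl.union hQ
  exact this.mem_nhds h

namespace LinCocycle

variable {P B H : Type*} [TopologicalSpace P] [TopologicalSpace B]
  [NormedAddCommGroup H] [InnerProductSpace ℝ H] [FiniteDimensional ℝ H]
  {C : LinCocycle P B H} {X Y : P} {b : B} {K : Set B} {V W : B → Submodule ℝ H} {i : ℕ}

/-- The angle of two transverse closed bundles over a compact set is bounded below. -/
theorem exists_angle_bound [CompactSpace B]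
    (hd : ∀ b ∈ K, Disjoint (V b) (W b))
    (hV : IsClosed {z : B × H | z.1 ∈ K ∧ z.2 ∈ V z.1})
    (hW : IsClosed {z : B × H | z.1 ∈ K ∧ z.2 ∈ W z.1}) :
    ∃ c > 0, ∀ b ∈ K, ∀ v ∈ V b, ∀ w ∈ W b, ‖v‖ ≤ c * ‖v + w‖ := by
  let Q : Set (B × H × H) := {z | (z.1 ∈ K ∧ z.2.1 ∈ V z.1) ∧ (z.1 ∈ K ∧ z.2.2 ∈ W z.1)} ∩
    (univ ×ˢ (Metric.sphere 0 1 ×ˢ Metric.closedBall 0 2))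
  have hQ : IsCompact Q := by
    refine IsCompact.inter_left (isCompact_univ.prod ((isCompact_sphere _ _).prod
      (isCompact_closedBall _ _))) ?_
    exact (hV.preimage (f := fun z : B × H × H ↦ (z.1, z.2.1)) (by fun_prop)).inter
      (hW.preimage (f := fun z : B × H × H ↦ (z.1, z.2.2)) (by fun_prop))
  have hne : ∀ z ∈ Q, 0 < ‖z.2.1 + z.2.2‖ := by
    rintro ⟨b, v, w⟩ ⟨⟨⟨hb, hv⟩, -, hw⟩, -, hv1, -⟩
    refine norm_pos_iff.2 fun h0 ↦ ?_
    have hvw : v ∈ W b := by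
      have : v = -w := eq_neg_of_add_eq_zero_left h0
      rw [this]
      exact neg_mem hw
    have := (Submodule.disjoint_def.1 (hd b hb)) v hv hvw
    simp [this] at hv1
  have hmin : ∃ c > 0, ∀ z ∈ Q, c ≤ ‖z.2.1 + z.2.2‖ := by
    rcases Q.eq_empty_or_nonempty with h | h
    · exact ⟨1, one_pos, by simp [h]⟩
    · obtain ⟨z, hz, hzm⟩ := hQ.exists_isMinOn h
        (f := fun z : B × H × H ↦ ‖z.2.1 + z.2.2‖) (by fun_prop)
      exact ⟨_, hne z hz, fun z' hz' ↦ hzm hz'⟩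
  obtain ⟨c, hc, hcQ⟩ := hmin
  -- When `‖w‖ ≤ 2 * ‖v‖`, dividing by `‖v‖` brings the pair into the compact set `Q` and gives
  -- `c⁻¹`; otherwise the triangle inequality alone gives `1`.
  refine ⟨max c⁻¹ 1, by positivity, fun b hb v hv w hw ↦ ?_⟩
  by_cases hv0 : v = 0
  · simp only [hv0, norm_zero]
    positivity
  have hvp := norm_pos_iff.2 hv0
  by_cases hw2 : ‖w‖ ≤ 2 * ‖v‖
  · have := hcQ (b, ‖v‖⁻¹ • v, ‖v‖⁻¹ • w) ⟨⟨⟨hb, Submodule.smul_mem _ _ hv⟩, hb,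
      Submodule.smul_mem _ _ hw⟩, mem_univ _, by
        simp [norm_smul, hvp.ne'], by
        simp only [mem_closedBall_zero_iff, norm_smul, norm_inv, norm_norm]
        rw [inv_mul_le_iff₀ hvp]
        linarith⟩
    simp only [← smul_add, norm_smul, norm_inv, norm_norm] at this
    rw [le_inv_mul_iff₀ hvp] at this
    calc ‖v‖ = c⁻¹ * (‖v‖ * c) := by field_simp
      _ ≤ c⁻¹ * ‖v + w‖ := by gcongr
      _ ≤ _ := by gcongr; exact le_max_left _ _
  · have : ‖w‖ ≤ ‖v + w‖ + ‖v‖ := by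
      have : w = (v + w) - v := by simp
      nth_rw 1 [this]
      exact norm_sub_le _ _
    calc ‖v‖ ≤ 1 * ‖v + w‖ := by linarith
      _ ≤ _ := by gcongr; exact le_max_right _ _

/-- The projections associated to a continuous splitting extend continuously. -/
theorem exists_continuous_proj [CompactSpace B] [T2Space B] (hK : IsClosed K)
    (h : C.IsSplit X K V W i)
    (hV : IsClosed {z : B × H | z.1 ∈ K ∧ z.2 ∈ V z.1})
    (hW : IsClosed {z : B × H | z.1 ∈ K ∧ z.2 ∈ W z.1}) :
    ∃ p : B → H →L[ℝ] H, Continuous p ∧ ∀ b ∈ K, ∀ v ∈ V b, ∀ w ∈ W b, p b (v + w) = v := by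
  obtain ⟨c, hc, hcb⟩ := exists_angle_bound h.disj hV hW
  have ex : ∀ b : K, ∃ L : H →L[ℝ] H, ∀ v ∈ V b, ∀ w ∈ W b, L (v + w) = v := by
    rintro ⟨b, hb⟩
    obtain ⟨V', hV', hcompl⟩ := (h.disj b hb).exists_isCompl
    refine ⟨(V'.subtype ∘ₗ Submodule.projectionOnto _ _ hcompl).toContinuousLinearMap,
      fun v hv w hw ↦ ?_⟩
    have e1 := Submodule.projectionOnto_apply_left hcompl ⟨v, hV' hv⟩
    have e2 := Submodule.projectionOnto_apply_right hcompl ⟨w, hw⟩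
    simp only [LinearMap.coe_toContinuousLinearMap', LinearMap.comp_apply, map_add]
    rw [e1, e2]
    simp
  choose L hL using ex
  let q : K → H →L[ℝ] H := fun b ↦ (L b).comp (C.A X 0 b)
  have hqV : ∀ (b : K) x, q b x ∈ V b ∧ C.A X 0 b x - q b x ∈ W b ∧ ‖q b x‖ ≤ c * ‖C.A X 0 b x‖ := by
    intro b x
    have hx : C.A X 0 b x ∈ C.fib X b := ⟨x, rfl⟩
    rw [← h.sup_eq b b.2, Submodule.mem_sup] at hx
    obtain ⟨v, hv, w, hw, hvw⟩ := hx
    have : q b x = v := by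
      change L b (C.A X 0 b x) = v
      rw [← hvw, hL b v hv w hw]
    rw [this, ← hvw]
    exact ⟨hv, by simpa using hw, hcb b b.2 v hv w hw⟩
  -- The angle bound keeps the values bounded along an ultrafilter. The bundles are closed, so the
  -- limit and its complement lie in `V b` and `W b`, which characterizes the value at `b`.
  have hqc : Continuous q := by
    rw [continuous_clm_apply]
    intro x
    rw [continuous_iff_ultrafilter]
    intro b 𝒢 h𝒢
    have hb : Tendsto (fun b : K ↦ (b : B)) 𝒢 (𝓝 (b : B)) :=
      (continuous_subtype_val.tendsto b).mono_left h𝒢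
    have hA : Tendsto (fun b : K ↦ C.A X 0 b x) 𝒢 (𝓝 (C.A X 0 b x)) :=
      (C.continuous_A_apply.tendsto (X, 0, (b : B), x)).comp
        (tendsto_const_nhds.prodMk_nhds (tendsto_const_nhds.prodMk_nhds
          (hb.prodMk_nhds tendsto_const_nhds)))
    have hbd : ∀ᶠ b' in (𝒢 : Filter K), q b' x ∈ Metric.closedBall (0 : H)
        (c * (‖C.A X 0 b x‖ + 1)) := by
      filter_upwards [hA.norm.eventually (gt_mem_nhds (lt_add_one _))] with b' hb'
      rw [mem_closedBall_zero_iff]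
      exact (hqV b' x).2.2.trans (by gcongr)
    obtain ⟨v, -, hv⟩ := (isCompact_closedBall (0 : H)
      (c * (‖C.A X 0 b x‖ + 1))).ultrafilter_le_nhds (𝒢.map fun b' ↦ q b' x)
      (le_principal_iff.2 hbd)
    have hv' : Tendsto (fun b' ↦ q b' x) 𝒢 (𝓝 v) := hv
    have m1 := hV.mem_of_tendsto (hb.prodMk_nhds hv')
      (Eventually.of_forall fun b' ↦ ⟨b'.2, (hqV b' x).1⟩)
    have m2 := hW.mem_of_tendsto (hb.prodMk_nhds (hA.sub hv'))
      (Eventually.of_forall fun b' ↦ ⟨b'.2, (hqV b' x).2.1⟩)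
    have : q b x = v := by
      change L b (C.A X 0 b x) = v
      have := hL b v m1.2 _ m2.2
      rwa [add_sub_cancel] at this
    rw [this]
    exact hv'
  -- The extended maps need not be projections off `K`: the cones only compare `‖p b x‖` with `‖x -
  -- p b x‖`.
  have : TietzeExtension (H →L[ℝ] H) := TietzeExtension.of_tvs ℝ
  obtain ⟨g, hg⟩ := ContinuousMap.exists_restrict_eq hK (⟨q, hqc⟩ : C(K, H →L[ℝ] H))
  refine ⟨g, g.continuous, fun b hb v hv w hw ↦ ?_⟩
  have e : g b = q ⟨b, hb⟩ := congrArg (fun f : C(K, H →L[ℝ] H) ↦ f ⟨b, hb⟩) hg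
  rw [e]
  change L ⟨b, hb⟩ (C.A X 0 b (v + w)) = v
  rw [C.A_zero_apply_of_mem X b (add_mem (h.left_le hb hv) (h.right_le hb hw)),
    hL ⟨b, hb⟩ v hv w hw]

end LinCocycle

/-- An open cone condition on a subspace persists on nearby subspaces. -/
theorem eventually_exists_submodule {Z H : Type*} [TopologicalSpace Z] [NormedAddCommGroup H]
    [InnerProductSpace ℝ H] [FiniteDimensional ℝ H] {a q₁ q₂ : Z → H →L[ℝ] H}
    (ha : Continuous a) (h₁ : Continuous q₁) (h₂ : Continuous q₂) {z₀ : Z} (V : Submodule ℝ H)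
    (hV : ∀ x ∈ V, a z₀ x = x) (hq : ∀ x ∈ V, x ≠ 0 → ‖q₁ z₀ x‖ < ‖q₂ z₀ x‖) :
    ∀ᶠ z in 𝓝 z₀, ∃ V' ≤ (a z).range, finrank ℝ V' = finrank ℝ V ∧
      ∀ x ∈ V', x ≠ 0 → ‖q₁ z x‖ < ‖q₂ z x‖ := by
  have hS : IsCompact ((V : Set H) ∩ Metric.sphere 0 1) :=
    (isCompact_sphere _ _).inter_left (Submodule.closed_of_finiteDimensional V)
  have hev : ∀ᶠ z in 𝓝 z₀, ∀ x ∈ (V : Set H) ∩ Metric.sphere 0 1,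
      ‖q₁ z (a z x)‖ < ‖q₂ z (a z x)‖ := by
    refine hS.eventually_forall_of_forall_eventually fun x hx ↦ ?_
    have hop : IsOpen {y : Z × H | ‖q₁ y.1 (a y.1 y.2)‖ < ‖q₂ y.1 (a y.1 y.2)‖} := by
      refine isOpen_lt ?_ ?_
      · exact ((h₁.comp continuous_fst).clm_apply
          ((ha.comp continuous_fst).clm_apply continuous_snd)).norm
      · exact ((h₂.comp continuous_fst).clm_apply
          ((ha.comp continuous_fst).clm_apply continuous_snd)).norm
    refine hop.mem_nhds ?_
    change ‖q₁ z₀ (a z₀ x)‖ < ‖q₂ z₀ (a z₀ x)‖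
    rw [hV x hx.1]
    refine hq x hx.1 fun h0 ↦ ?_
    have := hx.2
    simp [h0] at this
  filter_upwards [hev] with z hz
  have hz' : ∀ x ∈ V, x ≠ 0 → ‖q₁ z (a z x)‖ < ‖q₂ z (a z x)‖ := by
    intro x hx hx0
    have hp := norm_pos_iff.2 hx0
    have := hz (‖x‖⁻¹ • x) ⟨V.smul_mem _ hx, by simp [norm_smul, hp.ne']⟩
    simp only [map_smul, norm_smul, norm_inv, norm_norm] at this
    exact lt_of_mul_lt_mul_left this (by positivity)
  -- The image keeps the dimension because the strict inequality fails on the kernel of `a z`.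
  refine ⟨V.map (a z).toLinearMap, ?_, ?_, ?_⟩
  · rintro _ ⟨x, -, rfl⟩
    exact ⟨x, rfl⟩
  · have h : Function.Injective ((a z).toLinearMap.domRestrict V) := by
      rw [← LinearMap.ker_eq_bot, LinearMap.ker_eq_bot']
      intro x hx
      by_contra hx0
      have h1 := hz' x x.2 fun h ↦ hx0 (Subtype.ext h)
      have h2 : a z x = 0 := hx
      simp [h2] at h1
    have h2 := LinearMap.finrank_range_of_inj h
    rwa [LinearMap.range_domRestrict] at h2
  · rintro _ ⟨x, hx, rfl⟩ hx0
    refine hz' x hx fun h ↦ hx0 ?_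
    rw [h]
    exact map_zero _

namespace LinCocycle

variable {P B H : Type*} [TopologicalSpace P] [TopologicalSpace B]
  [NormedAddCommGroup H] [InnerProductSpace ℝ H] [FiniteDimensional ℝ H]
  {C : LinCocycle P B H} {X Y : P} {b : B} {K : Set B} {V W : B → Submodule ℝ H} {i j : ℕ}

variable (C Y) in
/-- The points whose orbit stays in `O`. -/
def orbitIn (O : Set (P × B)) : Set B := {b | ∀ t, (Y, C.Φ Y t b) ∈ O}

theorem orbitIn_inv {O : Set (P × B)} (hb : b ∈ C.orbitIn Y O) (t : ℝ) :
    C.Φ Y t b ∈ C.orbitIn Y O := fun s ↦ by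
  rw [← C.Φ_add]
  exact hb _

/-- Cone conditions for the time-`T₀` maps along an orbit provide an invariant subspace. -/
theorem exists_submodule_stay (D : LinCocycle P B H) (Y : P) (b : B) (T₀ : ℝ)
    (p q : B → H →L[ℝ] H)
    (hdim : ∀ t, finrank ℝ (D.fib Y (D.Φ Y t b)) = i + j)
    (hcone : ∀ t, ∀ x ∈ D.fib Y (D.Φ Y t b), x ≠ 0 →
      ‖q (D.Φ Y t b) x‖ ≤ ‖p (D.Φ Y t b) x‖ →
      ‖q (D.Φ Y T₀ (D.Φ Y t b)) (D.A Y T₀ (D.Φ Y t b) x)‖ <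
        ‖p (D.Φ Y T₀ (D.Φ Y t b)) (D.A Y T₀ (D.Φ Y t b) x)‖)
    (hdom : ∀ t, ∀ x ∈ D.fib Y (D.Φ Y t b), ∀ y ∈ D.fib Y (D.Φ Y t b),
      ‖p (D.Φ Y T₀ (D.Φ Y t b)) (D.A Y T₀ (D.Φ Y t b) x)‖ ≤
        ‖q (D.Φ Y T₀ (D.Φ Y t b)) (D.A Y T₀ (D.Φ Y t b) x)‖ →
      ‖q (D.Φ Y t b) y‖ ≤ ‖p (D.Φ Y t b) y‖ →
      ‖y‖ * ‖D.A Y T₀ (D.Φ Y t b) x‖ ≤ 1 / 2 * (‖x‖ * ‖D.A Y T₀ (D.Φ Y t b) y‖))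
    (hW : ∀ t, ∃ W ≤ D.fib Y (D.Φ Y t b), finrank ℝ W = j ∧
      ∀ x ∈ W, x ≠ 0 → ‖p (D.Φ Y t b) x‖ < ‖q (D.Φ Y t b) x‖)
    (hV : ∀ t, ∃ V ≤ D.fib Y (D.Φ Y t b), finrank ℝ V = i ∧
      ∀ x ∈ V, x ≠ 0 → ‖q (D.Φ Y t b) x‖ < ‖p (D.Φ Y t b) x‖) :
    ∃ R ≤ D.fib Y b, finrank ℝ R = j ∧ ∀ x, x ∈ R ↔ x ∈ D.fib Y b ∧ ∀ n : ℕ,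
      ‖p (D.Φ Y (n * T₀) b) (D.A Y (n * T₀) b x)‖ ≤
        ‖q (D.Φ Y (n * T₀) b) (D.A Y (n * T₀) b x)‖ := by
  have hstep : ∀ n : ℕ, D.Φ Y T₀ (D.Φ Y (n * T₀) b) = D.Φ Y ((n + 1 : ℕ) * T₀) b := fun n ↦ by
    rw [← D.Φ_add]
    congr 1
    push_cast
    ring
  have h0 : D.Φ Y ((0 : ℕ) * T₀) b = b := by simp [D.Φ_zero]
  obtain ⟨R, hR, hRj, hRx⟩ := exists_submodule_of_cones
    (fun n : ℕ ↦ D.fib Y (D.Φ Y (n * T₀) b)) (fun n : ℕ ↦ D.A Y T₀ (D.Φ Y (n * T₀) b))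
    (fun n : ℕ ↦ p (D.Φ Y (n * T₀) b)) (fun n : ℕ ↦ q (D.Φ Y (n * T₀) b)) i j
    (fun n x hx ↦ by rw [← hstep]; exact D.A_mem_fib Y _ T₀ x)
    (fun n x hx h ↦ D.eq_zero_of_A_eq_zero Y _ hx h)
    (fun n ↦ hdim _)
    (fun n x hx hx0 h ↦ by simp only [← hstep]; exact hcone _ x hx hx0 h)
    (fun n x hx y hy h h' ↦ by
      simp only [← hstep] at h
      exact hdom _ x hx y hy h h')
    (fun n ↦ hW _) (hV _)
  rw [h0] at hR
  refine ⟨R, hR, hRj, fun x ↦ ?_⟩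
  rw [hRx, h0]
  refine and_congr_right fun hx ↦ forall_congr' fun n ↦ ?_
  have : iterComp (fun n : ℕ ↦ D.A Y T₀ (D.Φ Y (n * T₀) b)) n x = D.A Y (n * T₀) b x := by
    induction n with
    | zero => simp [iterComp, D.A_zero_apply_of_mem Y b hx]
    | succ n ih =>
      change D.A Y T₀ (D.Φ Y (n * T₀) b) (iterComp _ n x) = _
      rw [ih, ← D.A_add_apply]
      congr 2
      push_cast
      ring
  rw [this]

variable (C) in
/-- Cone conditions satisfied by the time-`T₀` map at `b`. -/
structure ConeAt (p : B → H →L[ℝ] H) (T₀ M₁ : ℝ) (i j : ℕ) (Y : P) (b : B) : Prop where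
  cone : ∀ x ∈ C.fib Y b, x ≠ 0 → ‖p b x‖ ≤ ‖x - p b x‖ →
    ‖p (C.Φ Y T₀ b) (C.A Y T₀ b x)‖ < ‖C.A Y T₀ b x - p (C.Φ Y T₀ b) (C.A Y T₀ b x)‖
  dom : ∀ x ∈ C.fib Y b, ∀ y ∈ C.fib Y b, ‖p b x‖ ≤ ‖x - p b x‖ →
    ‖C.A Y T₀ b y - p (C.Φ Y T₀ b) (C.A Y T₀ b y)‖ ≤ ‖p (C.Φ Y T₀ b) (C.A Y T₀ b y)‖ →
    ‖C.A Y T₀ b y‖ * ‖x‖ ≤ 1 / 2 * (‖y‖ * ‖C.A Y T₀ b x‖)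
  left : ∃ V ≤ C.fib Y b, finrank ℝ V = i ∧ ∀ x ∈ V, x ≠ 0 → ‖x - p b x‖ < ‖p b x‖
  right : ∃ W ≤ C.fib Y b, finrank ℝ W = j ∧ ∀ x ∈ W, x ≠ 0 → ‖p b x‖ < ‖x - p b x‖
  bound : ∀ t ∈ Icc (-T₀) T₀, ‖C.A Y t b‖ ≤ M₁

/-- For `x = v + w` over `K` the cone condition reads `‖v‖ ≤ ‖w‖`, and the time-`T₀` map divides the
ratio `‖v‖ / ‖w‖` by at least 16. The cone inequalities thus hold with a margin at `(X, b)` and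
extend to a neighbourhood. -/
theorem eventually_coneAt {p : B → H →L[ℝ] H} (hp : Continuous p) {T₀ M₁ η T : ℝ} {m : ℕ}
    (hm : ∀ b, finrank ℝ (C.fib X b) = m) (hij : i + j = m)
    (h : C.IsSplit X K V W i) (hd : C.IsDom X K V W η T) (hT : T ≤ T₀)
    (hexp : Real.exp (-(η * T₀)) ≤ 1 / 16)
    (hpK : ∀ b ∈ K, ∀ v ∈ V b, ∀ w ∈ W b, p b (v + w) = v) (hb : b ∈ K)
    (hM : ∀ t ∈ Icc (-T₀) T₀, ‖C.A X t b‖ < M₁) :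
    ∀ᶠ z in 𝓝 (X, b), C.ConeAt p T₀ M₁ i j z.1 z.2 := by
  set b' := C.Φ X T₀ b with hb'
  have hb'K : b' ∈ K := h.inv b hb T₀
  have hpV : ∀ b ∈ K, ∀ v ∈ V b, p b v = v := fun b hb v hv ↦ by
    simpa using hpK b hb v hv 0 (zero_mem _)
  have hpW : ∀ b ∈ K, ∀ w ∈ W b, p b w = 0 := fun b hb w hw ↦ by
    simpa using hpK b hb 0 (zero_mem _) w hw
  have hdom1 : ∀ v ∈ V b, ∀ w ∈ W b, ‖C.A X T₀ b v‖ * ‖w‖ ≤ 1 / 16 * (‖v‖ * ‖C.A X T₀ b w‖) :=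
    fun v hv w hw ↦ (hd b hb T₀ hT v hv w hw).trans (by gcongr)
  -- continuity of the data
  have cx : Continuous fun z : (P × B) × H ↦ C.A z.1.1 T₀ z.1.2 z.2 :=
    C.continuous_A_apply.comp (f := fun z : (P × B) × H ↦ (z.1.1, T₀, z.1.2, z.2)) (by fun_prop)
  have c0 : Continuous fun z : (P × B) × H ↦ C.A z.1.1 0 z.1.2 z.2 :=
    C.continuous_A_apply.comp (f := fun z : (P × B) × H ↦ (z.1.1, 0, z.1.2, z.2)) (by fun_prop)
  have cΦ : Continuous fun z : (P × B) × H ↦ C.Φ z.1.1 T₀ z.1.2 :=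
    C.continuous_Φ.comp (f := fun z : (P × B) × H ↦ (z.1.1, T₀, z.1.2)) (by fun_prop)
  have cp : Continuous fun z : (P × B) × H ↦ p z.1.2 z.2 :=
    (hp.comp (continuous_snd.comp continuous_fst)).clm_apply continuous_snd
  have cpx : Continuous fun z : (P × B) × H ↦ p (C.Φ z.1.1 T₀ z.1.2) (C.A z.1.1 T₀ z.1.2 z.2) :=
    (hp.comp cΦ).clm_apply cx
  have hS : IsCompact (Metric.sphere (0 : H) 1) := isCompact_sphere _ _
  have nz : ∀ {x : H}, x ∈ Metric.sphere (0 : H) 1 → x ≠ 0 := by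
    rintro x hx rfl
    simp at hx
  -- cone invariance
  have e1 : ∀ᶠ z in 𝓝 (X, b), ∀ x ∈ Metric.sphere (0 : H) 1,
      (C.A z.1 0 z.2 x = x ∧ ‖p z.2 x‖ ≤ ‖x - p z.2 x‖) →
      ‖p (C.Φ z.1 T₀ z.2) (C.A z.1 T₀ z.2 x)‖ <
        ‖C.A z.1 T₀ z.2 x - p (C.Φ z.1 T₀ z.2) (C.A z.1 T₀ z.2 x)‖ := by
    refine hS.eventually_forall_of_forall_eventually fun x hx ↦ ?_
    refine eventually_imp_of_isClosed_isOpen (Z := (P × B) × H)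
      (R := fun z ↦ C.A z.1.1 0 z.1.2 z.2 = z.2 ∧ ‖p z.1.2 z.2‖ ≤ ‖z.2 - p z.1.2 z.2‖)
      (Q := fun z ↦ ‖p (C.Φ z.1.1 T₀ z.1.2) (C.A z.1.1 T₀ z.1.2 z.2)‖ <
        ‖C.A z.1.1 T₀ z.1.2 z.2 - p (C.Φ z.1.1 T₀ z.1.2) (C.A z.1.1 T₀ z.1.2 z.2)‖)
      ((isClosed_eq c0 continuous_snd).inter (isClosed_le cp.norm (continuous_snd.sub cp).norm))
      (isOpen_lt cpx.norm (cx.sub cpx).norm) ?_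
    rintro ⟨hxf, hxc⟩
    have hx0 := nz hx
    rw [← mem_fib_iff, ← h.sup_eq b hb, Submodule.mem_sup] at hxf
    obtain ⟨v, hv, w, hw, hvw⟩ := hxf
    simp only at hvw hxc ⊢
    rw [← hvw] at hxc ⊢
    rw [hpK b hb v hv w hw] at hxc
    rw [map_add, hpK b' hb'K _ (h.map_left b hb T₀ v hv) _ (h.map_right b hb T₀ w hw)]
    simp only [add_sub_cancel_left] at hxc ⊢
    have hw0 : w ≠ 0 := by
      rintro rfl
      simp only [norm_zero, norm_le_zero_iff] at hxc
      exact hx0 (by rw [← hvw, hxc, add_zero])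
    have p1 := norm_pos_iff.2 hw0
    have p2 := C.A_pos X b (h.right_le hb hw) hw0 T₀
    have := hdom1 v hv w hw
    have h3 : ‖C.A X T₀ b v‖ * ‖w‖ ≤ (1 / 16 * ‖C.A X T₀ b w‖) * ‖w‖ := by
      refine this.trans ?_
      nlinarith [norm_nonneg (C.A X T₀ b w)]
    have := le_of_mul_le_mul_right h3 p1
    linarith
  -- domination on cones
  have e2 : ∀ᶠ z in 𝓝 (X, b), ∀ xy ∈ Metric.sphere (0 : H) 1 ×ˢ Metric.sphere (0 : H) 1,
      (C.A z.1 0 z.2 xy.1 = xy.1 ∧ C.A z.1 0 z.2 xy.2 = xy.2 ∧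
        ‖p z.2 xy.1‖ ≤ ‖xy.1 - p z.2 xy.1‖ ∧
        ‖C.A z.1 T₀ z.2 xy.2 - p (C.Φ z.1 T₀ z.2) (C.A z.1 T₀ z.2 xy.2)‖ ≤
          ‖p (C.Φ z.1 T₀ z.2) (C.A z.1 T₀ z.2 xy.2)‖) →
      ‖C.A z.1 T₀ z.2 xy.2‖ < 1 / 2 * ‖C.A z.1 T₀ z.2 xy.1‖ := by
    refine (hS.prod hS).eventually_forall_of_forall_eventually fun xy hxy ↦ ?_
    have f1 : Continuous fun z : (P × B) × H × H ↦ (z.1, z.2.1) := by fun_prop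
    have f2 : Continuous fun z : (P × B) × H × H ↦ (z.1, z.2.2) := by fun_prop
    refine eventually_imp_of_isClosed_isOpen (Z := (P × B) × H × H)
      (R := fun z ↦ C.A z.1.1 0 z.1.2 z.2.1 = z.2.1 ∧ C.A z.1.1 0 z.1.2 z.2.2 = z.2.2 ∧
        ‖p z.1.2 z.2.1‖ ≤ ‖z.2.1 - p z.1.2 z.2.1‖ ∧
        ‖C.A z.1.1 T₀ z.1.2 z.2.2 - p (C.Φ z.1.1 T₀ z.1.2) (C.A z.1.1 T₀ z.1.2 z.2.2)‖ ≤
          ‖p (C.Φ z.1.1 T₀ z.1.2) (C.A z.1.1 T₀ z.1.2 z.2.2)‖)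
      (Q := fun z ↦ ‖C.A z.1.1 T₀ z.1.2 z.2.2‖ < 1 / 2 * ‖C.A z.1.1 T₀ z.1.2 z.2.1‖)
      ((isClosed_eq (c0.comp f1) (by fun_prop)).inter ((isClosed_eq (c0.comp f2) (by fun_prop)).inter
        ((isClosed_le (cp.comp f1).norm (((by fun_prop : Continuous fun z : (P × B) × H × H ↦ z.2.1)).sub (cp.comp f1)).norm).inter
        (isClosed_le ((cx.comp f2).sub (cpx.comp f2)).norm (cpx.comp f2).norm))))
      (isOpen_lt (cx.comp f2).norm ((cx.comp f1).norm.const_mul _)) ?_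
    obtain ⟨x, y⟩ := xy
    obtain ⟨hx, hy⟩ := hxy
    rintro ⟨hxf, hyf, hxc, hyc⟩
    simp only at hx hy hxf hyf hxc hyc ⊢
    have hx1 : ‖x‖ = 1 := by simpa using hx
    have hy1 : ‖y‖ = 1 := by simpa using hy
    rw [← mem_fib_iff, ← h.sup_eq b hb, Submodule.mem_sup] at hxf hyf
    obtain ⟨v, hv, w, hw, rfl⟩ := hxf
    obtain ⟨v₂, hv₂, w₂, hw₂, rfl⟩ := hyf
    rw [hpK b hb v hv w hw] at hxc
    rw [map_add, hpK b' hb'K _ (h.map_left b hb T₀ v₂ hv₂) _ (h.map_right b hb T₀ w₂ hw₂)] at hyc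
    simp only [add_sub_cancel_left, map_add] at hxc hyc ⊢
    -- For unit vectors the cone conditions give `‖w‖ ≥ 1/2` and `‖v₂‖ ≤ 16/15`. The image of `v₂ +
    -- w₂` then has norm at most `4/15` of that of the image of `w`, and the image of `v + w` at
    -- least `15/16` of it.
    have n1 : ‖v + w‖ ≤ 2 * ‖w‖ := (norm_add_le _ _).trans (by linarith)
    have hwp : 0 < ‖w‖ := by linarith
    have hw0 : w ≠ 0 := norm_pos_iff.1 hwp
    have p2 := C.A_pos X b (h.right_le hb hw) hw0 T₀
    have d1 := hdom1 v hv w hw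
    have d1' : ‖C.A X T₀ b v‖ ≤ 1 / 16 * ‖C.A X T₀ b w‖ := by
      refine le_of_mul_le_mul_right ?_ hwp
      refine d1.trans ?_
      nlinarith
    have n2 : ‖C.A X T₀ b w‖ ≤ ‖C.A X T₀ b v + C.A X T₀ b w‖ + ‖C.A X T₀ b v‖ := by
      have : C.A X T₀ b w = (C.A X T₀ b v + C.A X T₀ b w) - C.A X T₀ b v := by simp
      nth_rw 1 [this]
      exact norm_sub_le _ _
    have n3 : ‖C.A X T₀ b v₂ + C.A X T₀ b w₂‖ ≤ 2 * ‖C.A X T₀ b v₂‖ :=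
      (norm_add_le _ _).trans (by linarith)
    have hv₂0 : v₂ ≠ 0 := by
      rintro rfl
      simp only [map_zero, norm_zero, norm_le_zero_iff] at hyc
      have := C.eq_zero_of_A_eq_zero X b (h.right_le hb hw₂) hyc
      simp [this] at hy1
    have pv := norm_pos_iff.2 hv₂0
    have pAv := C.A_pos X b (h.left_le hb hv₂) hv₂0 T₀
    have d2 := hdom1 v₂ hv₂ w₂ hw₂
    have d2' : ‖w₂‖ ≤ 1 / 16 * ‖v₂‖ := by
      refine le_of_mul_le_mul_left ?_ pAv
      refine d2.trans ?_
      nlinarith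
    have n4 : ‖v₂ + w₂‖ ≥ 15 / 16 * ‖v₂‖ := by
      have : ‖v₂‖ ≤ ‖v₂ + w₂‖ + ‖w₂‖ := by
        have : v₂ = (v₂ + w₂) - w₂ := by simp
        nth_rw 1 [this]
        exact norm_sub_le _ _
      linarith
    have d3 := hdom1 v₂ hv₂ w hw
    have hv2le : ‖v₂‖ ≤ 16 / 15 := by linarith
    have hwge : 1 / 2 ≤ ‖w‖ := by linarith
    have d4 : ‖C.A X T₀ b v₂‖ * (1 / 2) ≤ 1 / 16 * (16 / 15 * ‖C.A X T₀ b w‖) := by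
      calc _ ≤ ‖C.A X T₀ b v₂‖ * ‖w‖ := by gcongr
        _ ≤ _ := d3
        _ ≤ _ := by gcongr
    linarith
  -- subspaces in the cones
  have cA0 : Continuous fun z : P × B ↦ C.A z.1 0 z.2 :=
    C.continuous_A.comp (f := fun z : P × B ↦ (z.1, 0, z.2)) (by fun_prop)
  have cpz : Continuous fun z : P × B ↦ p z.2 := hp.comp continuous_snd
  have e3 := eventually_exists_submodule (z₀ := (X, b)) cA0
    ((continuous_const (y := ContinuousLinearMap.id ℝ H)).sub cpz) cpz (V b)
    (fun x hx ↦ C.A_zero_apply_of_mem X b (h.left_le hb hx))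
    (fun x hx hx0 ↦ by simpa [hpV b hb x hx] using hx0)
  have e4 := eventually_exists_submodule (z₀ := (X, b)) cA0
    cpz ((continuous_const (y := ContinuousLinearMap.id ℝ H)).sub cpz) (W b)
    (fun x hx ↦ C.A_zero_apply_of_mem X b (h.right_le hb hx))
    (fun x hx hx0 ↦ by simpa [hpW b hb x hx] using hx0)
  have e5 : ∀ᶠ z in 𝓝 (X, b), ∀ t ∈ Icc (-T₀) T₀, ‖C.A z.1 t z.2‖ < M₁ := by
    refine isCompact_Icc.eventually_forall_of_forall_eventually fun t ht ↦ ?_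
    have : Continuous fun z : (P × B) × ℝ ↦ ‖C.A z.1.1 z.2 z.1.2‖ :=
      (C.continuous_A.comp (f := fun z : (P × B) × ℝ ↦ (z.1.1, z.2, z.1.2)) (by fun_prop)).norm
    exact (isOpen_lt this continuous_const).mem_nhds (hM t ht)
  have hWj : finrank ℝ (W b) = j := by
    have := h.finrank_add hb
    rw [hm] at this
    omega
  have key : ∀ {x : H}, x ≠ 0 → ‖x‖⁻¹ • x ∈ Metric.sphere (0 : H) 1 := fun {x} hx ↦ by
    simp [norm_smul, (norm_pos_iff.2 hx).ne']
  filter_upwards [e1, e2, e3, e4, e5] with z h1 h2 h3 h4 h5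
  refine ⟨?_, ?_, ?_, ?_, fun t ht ↦ (h5 t ht).le⟩
  · intro x hx hx0 hxc
    have hp := inv_pos.2 (norm_pos_iff.2 hx0)
    have := h1 _ (key hx0) ⟨by rw [map_smul, C.A_zero_apply_of_mem _ _ hx], by
      rw [map_smul, ← smul_sub, norm_smul, norm_smul]; gcongr⟩
    rw [map_smul, map_smul, ← smul_sub, norm_smul, norm_smul] at this
    exact lt_of_mul_lt_mul_left this (norm_nonneg _)
  · intro x hx y hy hxc hyc
    by_cases hx0 : x = 0
    · simp [hx0]
    by_cases hy0 : y = 0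
    · simp [hy0]
    have := h2 (‖x‖⁻¹ • x, ‖y‖⁻¹ • y) ⟨key hx0, key hy0⟩
      ⟨by simp only [map_smul, C.A_zero_apply_of_mem _ _ hx],
        by simp only [map_smul, C.A_zero_apply_of_mem _ _ hy], by
        simp only [map_smul, ← smul_sub, norm_smul]; gcongr, by
        simp only [map_smul, ← smul_sub, norm_smul]; gcongr⟩
    simp only [map_smul, norm_smul, norm_inv, norm_norm] at this
    have px := norm_pos_iff.2 hx0
    have py := norm_pos_iff.2 hy0
    rw [inv_mul_lt_iff₀ py] at this
    calc _ ≤ ‖y‖ * (1 / 2 * (‖x‖⁻¹ * ‖C.A z.1 T₀ z.2 x‖)) * ‖x‖ := by gcongr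
      _ = _ := by field_simp
  · obtain ⟨V', a1, a2, a3⟩ := h3
    exact ⟨V', a1, a2.trans (h.rank b hb), a3⟩
  · obtain ⟨V', a1, a2, a3⟩ := h4
    exact ⟨V', a1, a2.trans hWj, a3⟩

end LinCocycle

theorem tendsto_exp_neg_mul {η : ℝ} (hη : 0 < η) :
    Tendsto (fun t : ℝ ↦ Real.exp (-(η * t))) atTop (𝓝 0) :=
  Real.tendsto_exp_atBot.comp (tendsto_neg_atTop_atBot.comp (tendsto_id.const_mul_atTop hη))

namespace LinCocycle

variable {P B H : Type*} [TopologicalSpace P] [TopologicalSpace B]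
  [NormedAddCommGroup H] [InnerProductSpace ℝ H] [FiniteDimensional ℝ H]
  {C : LinCocycle P B H} {X Y : P} {b : B} {K : Set B} {V W : B → Submodule ℝ H} {i j : ℕ}

/-- Cone conditions for the time-`T₀` map provide domination for all large times. -/
theorem domAt_of_stay (D : LinCocycle P B H) (Y : P) (b : B) {T₀ M₁ η T : ℝ} (hT₀ : 0 < T₀)
    (p q : B → H →L[ℝ] H)
    (hcone : ∀ t, ∀ x ∈ D.fib Y (D.Φ Y t b), x ≠ 0 →
      ‖q (D.Φ Y t b) x‖ ≤ ‖p (D.Φ Y t b) x‖ →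
      ‖q (D.Φ Y T₀ (D.Φ Y t b)) (D.A Y T₀ (D.Φ Y t b) x)‖ <
        ‖p (D.Φ Y T₀ (D.Φ Y t b)) (D.A Y T₀ (D.Φ Y t b) x)‖)
    (hdom : ∀ t, ∀ x ∈ D.fib Y (D.Φ Y t b), ∀ y ∈ D.fib Y (D.Φ Y t b),
      ‖p (D.Φ Y T₀ (D.Φ Y t b)) (D.A Y T₀ (D.Φ Y t b) x)‖ ≤
        ‖q (D.Φ Y T₀ (D.Φ Y t b)) (D.A Y T₀ (D.Φ Y t b) x)‖ →
      ‖q (D.Φ Y t b) y‖ ≤ ‖p (D.Φ Y t b) y‖ →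
      ‖y‖ * ‖D.A Y T₀ (D.Φ Y t b) x‖ ≤ 1 / 2 * (‖x‖ * ‖D.A Y T₀ (D.Φ Y t b) y‖))
    (hM : ∀ t, ∀ s ∈ Icc (-T₀) T₀, ‖D.A Y s (D.Φ Y t b)‖ ≤ M₁)
    (hT : ∀ t ≥ T, ∀ n : ℕ, t < (n + 1) * T₀ → M₁ * M₁ * (1 / 2) ^ n ≤ Real.exp (-(η * t)))
    (hT1 : 0 < T)
    {R S : Submodule ℝ H} (hR : R ≤ D.fib Y b) (hS : S ≤ D.fib Y b)
    (hRc : ∀ x ∈ R, ∀ n : ℕ, ‖p (D.Φ Y (n * T₀) b) (D.A Y (n * T₀) b x)‖ ≤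
        ‖q (D.Φ Y (n * T₀) b) (D.A Y (n * T₀) b x)‖)
    (hSc : ∀ x ∈ S, ‖q b x‖ ≤ ‖p b x‖) : D.DomAt Y b R S η T := by
  intro t ht x hx y hy
  by_cases hy0 : y = 0
  · simp [hy0]
  have hstep : ∀ n : ℕ, D.Φ Y T₀ (D.Φ Y (n * T₀) b) = D.Φ Y ((n + 1 : ℕ) * T₀) b := fun n ↦ by
    rw [← D.Φ_add]
    congr 1
    push_cast
    ring
  have hAstep : ∀ (n : ℕ) z, D.A Y T₀ (D.Φ Y (n * T₀) b) (D.A Y (n * T₀) b z) =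
      D.A Y ((n + 1 : ℕ) * T₀) b z := fun n z ↦ by
    rw [← D.A_add_apply]
    congr 2
    push_cast
    ring
  have hyc : ∀ n : ℕ, ‖q (D.Φ Y (n * T₀) b) (D.A Y (n * T₀) b y)‖ ≤
      ‖p (D.Φ Y (n * T₀) b) (D.A Y (n * T₀) b y)‖ := by
    intro n
    induction n with
    | zero => simpa [D.Φ_zero, D.A_zero_apply_of_mem Y b (hS hy)] using hSc y hy
    | succ n ih =>
      have := hcone (n * T₀) _ (D.A_mem_fib Y b _ y)
        (norm_pos_iff.1 (D.A_pos Y b (hS hy) hy0 _)) ih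
      rw [hAstep, hstep] at this
      exact this.le
  have key : ∀ n : ℕ, ‖y‖ * ‖D.A Y (n * T₀) b x‖ ≤
      (1 / 2) ^ n * (‖x‖ * ‖D.A Y (n * T₀) b y‖) := by
    intro n
    induction n with
    | zero =>
      simp [D.A_zero_apply_of_mem Y b (hS hy), D.A_zero_apply_of_mem Y b (hR hx), mul_comm]
    | succ n ih =>
      have h1 := hdom (n * T₀) _ (D.A_mem_fib Y b _ x) _ (D.A_mem_fib Y b _ y)
        (by rw [hAstep, hstep]; exact hRc x hx (n + 1)) (hyc n)
      rw [hAstep, hAstep] at h1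
      have hpos := D.A_pos Y b (hS hy) hy0 (n * T₀)
      set a := ‖D.A Y (n * T₀) b y‖
      set c := ‖D.A Y (n * T₀) b x‖
      set a' := ‖D.A Y ((n + 1 : ℕ) * T₀) b y‖
      set c' := ‖D.A Y ((n + 1 : ℕ) * T₀) b x‖
      refine le_of_mul_le_mul_left ?_ hpos
      calc a * (‖y‖ * c') = ‖y‖ * (a * c') := by ring
        _ ≤ ‖y‖ * (1 / 2 * (c * a')) := by gcongr
        _ = 1 / 2 * a' * (‖y‖ * c) := by ring
        _ ≤ 1 / 2 * a' * ((1 / 2) ^ n * (‖x‖ * a)) := by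
          have : 0 ≤ a' := norm_nonneg _
          gcongr
        _ = a * ((1 / 2) ^ (n + 1) * (‖x‖ * a')) := by ring
  have ht0 : 0 ≤ t := hT1.le.trans ht
  -- The remaining time is less than `T₀` and costs one factor `M₁` for each of the two vectors.
  let n := ⌊t / T₀⌋₊
  have hn1 : n * T₀ ≤ t := by
    have := Nat.floor_le (div_nonneg ht0 hT₀.le)
    rwa [le_div_iff₀ hT₀] at this
  have hn2 : t < (n + 1) * T₀ := by
    have := Nat.lt_floor_add_one (t / T₀)
    rwa [div_lt_iff₀ hT₀] at this
  set r := t - n * T₀ with hr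
  have hrI : r ∈ Icc (-T₀) T₀ := ⟨by linarith, by linarith⟩
  have hrI' : -r ∈ Icc (-T₀) T₀ := ⟨by linarith, by linarith⟩
  have hAx : ‖D.A Y t b x‖ ≤ M₁ * ‖D.A Y (n * T₀) b x‖ := by
    have : t = r + n * T₀ := by ring
    nth_rw 1 [this]
    rw [D.A_add_apply]
    exact (ContinuousLinearMap.le_opNorm _ _).trans (by gcongr; exact hM _ _ hrI)
  have hAy : ‖D.A Y (n * T₀) b y‖ ≤ M₁ * ‖D.A Y t b y‖ := by
    have : (n : ℝ) * T₀ = -r + t := by ring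
    rw [this, D.A_add_apply]
    exact (ContinuousLinearMap.le_opNorm _ _).trans (by gcongr; exact hM _ _ hrI')
  have hM0 : 0 ≤ M₁ := (norm_nonneg _).trans (hM 0 _ hrI)
  calc ‖D.A Y t b x‖ * ‖y‖ ≤ M₁ * ‖D.A Y (n * T₀) b x‖ * ‖y‖ := by gcongr
    _ = M₁ * (‖y‖ * ‖D.A Y (n * T₀) b x‖) := by ring
    _ ≤ M₁ * ((1 / 2) ^ n * (‖x‖ * ‖D.A Y (n * T₀) b y‖)) := mul_le_mul_of_nonneg_left (key n) hM0
    _ ≤ M₁ * ((1 / 2) ^ n * (‖x‖ * (M₁ * ‖D.A Y t b y‖))) := by gcongr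
    _ = M₁ * M₁ * (1 / 2) ^ n * (‖x‖ * ‖D.A Y t b y‖) := by ring
    _ ≤ _ := by gcongr; exact hT t ht n hn2

/-- Halving at each step of length `T₀` is decay at rate `log 2 / T₀`. Half of this rate is kept as
`η`; the other half absorbs the factor `2 * M * M`. -/
theorem exists_rate {T₀ : ℝ} (hT₀ : 0 < T₀) (M : ℝ) : ∃ η > 0, ∃ T > 0, ∀ t ≥ T, ∀ n : ℕ,
    t < (n + 1) * T₀ → M * M * (1 / 2) ^ n ≤ Real.exp (-(η * t)) := by
  have hlog : 0 < Real.log 2 := Real.log_pos one_lt_two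
  set η := Real.log 2 / T₀ / 2 with hη
  have hηp : 0 < η := by positivity
  have h1 : Tendsto (fun t : ℝ ↦ M * M * 2 * Real.exp (-(η * t))) atTop (𝓝 0) := by
    simpa using (tendsto_exp_neg_mul hηp).const_mul (M * M * 2)
  obtain ⟨T, hT⟩ := eventually_atTop.1 (h1.eventually (gt_mem_nhds one_pos))
  refine ⟨η, hηp, max T 1, by positivity, fun t ht n hn ↦ ?_⟩
  have h2 := hT t ((le_max_left _ _).trans ht)
  have h3 : (1 / 2 : ℝ) ^ n ≤ 2 * Real.exp (-(2 * η * t)) := by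
    have : (1 / 2 : ℝ) ^ n = 2 * Real.exp (-(Real.log 2 * (n + 1))) := by
      rw [mul_add, mul_one, neg_add, Real.exp_add, Real.exp_neg (Real.log 2),
        Real.exp_log two_pos, mul_comm (Real.log 2), ← mul_neg, ← Real.log_inv, mul_comm (n : ℝ),
        Real.exp_mul, Real.exp_log (by norm_num)]
      rw [Real.rpow_natCast]
      field_simp
    rw [this]
    have : 2 * η * t ≤ Real.log 2 * (n + 1) := by
      have e : 2 * η = Real.log 2 / T₀ := by rw [hη]; ring
      rw [e, div_mul_eq_mul_div, div_le_iff₀ hT₀]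
      nlinarith
    gcongr
  have h4 : Real.exp (-(2 * η * t)) = Real.exp (-(η * t)) * Real.exp (-(η * t)) := by
    rw [← Real.exp_add]; ring_nf
  have hE := Real.exp_pos (-(η * t))
  calc M * M * (1 / 2) ^ n ≤ M * M * (2 * (Real.exp (-(η * t)) * Real.exp (-(η * t)))) := by
        rw [← h4]
        have := mul_self_nonneg M
        gcongr
    _ = (M * M * 2 * Real.exp (-(η * t))) * Real.exp (-(η * t)) := by ring
    _ ≤ 1 * Real.exp (-(η * t)) := by gcongr
    _ = _ := one_mul _

variable (C) in
/-- A family of dominated splittings over the orbits, for all parameters, that stay in the open set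
`O`; the bundles are closed. -/
structure IsRobustSplit (O : Set (P × B)) (𝒱 𝒲 : P → B → Submodule ℝ H) (i : ℕ) : Prop where
  isOpen : IsOpen O
  split : ∀ Y, C.IsSplit Y (C.orbitIn Y O) (𝒱 Y) (𝒲 Y) i
  dom : ∃ η > 0, ∃ T > 0, ∀ Y, C.IsDom Y (C.orbitIn Y O) (𝒱 Y) (𝒲 Y) η T
  closed_left : ∃ S : Set (P × B × H), IsClosed S ∧
    ∀ Y, ∀ b ∈ C.orbitIn Y O, ∀ x, x ∈ 𝒱 Y b ↔ (Y, b, x) ∈ S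
  closed_right : ∃ S : Set (P × B × H), IsClosed S ∧
    ∀ Y, ∀ b ∈ C.orbitIn Y O, ∀ x, x ∈ 𝒲 Y b ↔ (Y, b, x) ∈ S

/-- Dominated splittings over a compact set extend to the neighbouring orbits of the neighbouring
systems. -/
theorem exists_isRobustSplit [CompactSpace B] [T2Space B] {m : ℕ} {η T : ℝ}
    (hm : ∀ Y b, finrank ℝ (C.fib Y b) = m) (hi : i ≤ m) (hK : IsClosed K)
    (h : C.IsSplit X K V W i) (hη : 0 < η) (hd : C.IsDom X K V W η T) :
    ∃ O 𝒱 𝒲, C.IsRobustSplit O 𝒱 𝒲 i ∧ ∀ b ∈ K, (X, b) ∈ O := by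
  obtain ⟨j, hij⟩ := Nat.exists_eq_add_of_le hi
  have hV := isClosed_left (hm X) hK h hη hd
  have hW : IsClosed {z : B × H | z.1 ∈ K ∧ z.2 ∈ W z.1} :=
    isClosed_left (C := C.rev) (m := m) (fun b ↦ by rw [rev_fib, hm]) hK (h.rev (hm X) hij.symm) hη
      (IsDom.rev h hd)
  obtain ⟨p, hp, hpK⟩ := exists_continuous_proj hK h hV hW
  obtain ⟨T₀, hT₀, hT₀T, hexp⟩ : ∃ T₀ > 0, T ≤ T₀ ∧ Real.exp (-(η * T₀)) ≤ 1 / 16 := by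
    have := ((tendsto_exp_neg_mul hη).eventually (gt_mem_nhds (by norm_num : (0 : ℝ) < 1 / 16))).and
      ((eventually_gt_atTop 0).and (eventually_ge_atTop T))
    obtain ⟨t, h1, h2, h3⟩ := this.exists
    exact ⟨t, h2, h3, h1.le⟩
  obtain ⟨M₁, hM₁⟩ : ∃ M₁, ∀ b ∈ K, ∀ t ∈ Icc (-T₀) T₀, ‖C.A X t b‖ < M₁ := by
    have hc : IsCompact (Icc (-T₀) T₀ ×ˢ K) := isCompact_Icc.prod hK.isCompact
    have hf : Continuous fun z : ℝ × B ↦ C.A X z.1 z.2 :=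
      C.continuous_A.comp (f := fun z : ℝ × B ↦ (X, z.1, z.2)) (by fun_prop)
    obtain ⟨M, hM⟩ := hc.exists_bound_of_continuousOn hf.continuousOn
    exact ⟨M + 1, fun b hb t ht ↦ (hM (t, b) ⟨ht, hb⟩).trans_lt (lt_add_one _)⟩
  let O : Set (P × B) := interior {z | C.ConeAt p T₀ M₁ i j z.1 z.2}
  have hKO : ∀ b ∈ K, (X, b) ∈ O := fun b hb ↦ mem_interior_iff_mem_nhds.2
    (eventually_coneAt hp (hm X) hij.symm h hd hT₀T hexp hpK hb (hM₁ b hb))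
  have hO : ∀ Y, ∀ b ∈ C.orbitIn Y O, ∀ t, C.ConeAt p T₀ M₁ i j Y (C.Φ Y t b) :=
    fun Y b hb t ↦ (interior_subset (s := {z : P × B | C.ConeAt p T₀ M₁ i j z.1 z.2}) (hb t) :)
  -- The candidates are cut out by closed conditions for all `(Y, b)` at once, so closedness in the
  -- parameter comes for free. The slices are shown to be subspaces only over orbits in `O`.
  let Vs : Set (P × B × H) := {z | C.A z.1 0 z.2.1 z.2.2 = z.2.2 ∧ ∀ n : ℕ,
    ‖C.A z.1 (n * T₀) z.2.1 z.2.2 - p (C.Φ z.1 (n * T₀) z.2.1) (C.A z.1 (n * T₀) z.2.1 z.2.2)‖ ≤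
      ‖p (C.Φ z.1 (n * T₀) z.2.1) (C.A z.1 (n * T₀) z.2.1 z.2.2)‖}
  let Ws : Set (P × B × H) := {z | C.A z.1 0 z.2.1 z.2.2 = z.2.2 ∧ ∀ n : ℕ,
    ‖p (C.Φ z.1 (-(n * T₀)) z.2.1) (C.A z.1 (-(n * T₀)) z.2.1 z.2.2)‖ ≤
    ‖C.A z.1 (-(n * T₀)) z.2.1 z.2.2 -
      p (C.Φ z.1 (-(n * T₀)) z.2.1) (C.A z.1 (-(n * T₀)) z.2.1 z.2.2)‖}
  have cA : ∀ t, Continuous fun z : P × B × H ↦ C.A z.1 t z.2.1 z.2.2 := fun t ↦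
    C.continuous_A_apply.comp (f := fun z : P × B × H ↦ (z.1, t, z.2.1, z.2.2)) (by fun_prop)
  have cp : ∀ t, Continuous fun z : P × B × H ↦ p (C.Φ z.1 t z.2.1) (C.A z.1 t z.2.1 z.2.2) :=
    fun t ↦ (hp.comp (C.continuous_Φ.comp (f := fun z : P × B × H ↦ (z.1, t, z.2.1))
      (by fun_prop))).clm_apply (cA t)
  have hVs : IsClosed Vs := by
    have : Vs = {z | C.A z.1 0 z.2.1 z.2.2 = z.2.2} ∩ ⋂ n : ℕ, {z |
        ‖C.A z.1 (n * T₀) z.2.1 z.2.2 -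
          p (C.Φ z.1 (n * T₀) z.2.1) (C.A z.1 (n * T₀) z.2.1 z.2.2)‖ ≤
        ‖p (C.Φ z.1 (n * T₀) z.2.1) (C.A z.1 (n * T₀) z.2.1 z.2.2)‖} := by
      ext z
      simp [Vs]
    rw [this]
    exact (isClosed_eq (cA 0) (by fun_prop)).inter
      (isClosed_iInter fun n ↦ isClosed_le ((cA _).sub (cp _)).norm (cp _).norm)
  have hWs : IsClosed Ws := by
    have : Ws = {z | C.A z.1 0 z.2.1 z.2.2 = z.2.2} ∩ ⋂ n : ℕ, {z |
        ‖p (C.Φ z.1 (-(n * T₀)) z.2.1) (C.A z.1 (-(n * T₀)) z.2.1 z.2.2)‖ ≤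
        ‖C.A z.1 (-(n * T₀)) z.2.1 z.2.2 -
          p (C.Φ z.1 (-(n * T₀)) z.2.1) (C.A z.1 (-(n * T₀)) z.2.1 z.2.2)‖} := by
      ext z
      simp [Ws]
    rw [this]
    exact (isClosed_eq (cA 0) (by fun_prop)).inter
      (isClosed_iInter fun n ↦ isClosed_le (cp _).norm ((cA _).sub (cp _)).norm)
  let q : B → H →L[ℝ] H := fun b ↦ ContinuousLinearMap.id ℝ H - p b
  have hq : ∀ b x, q b x = x - p b x := fun b x ↦ rfl
  -- forward and backward cone conditions
  have fcone : ∀ Y, ∀ b ∈ C.orbitIn Y O, ∀ t, ∀ x ∈ C.fib Y (C.Φ Y t b), x ≠ 0 →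
      ‖p (C.Φ Y t b) x‖ ≤ ‖q (C.Φ Y t b) x‖ →
      ‖p (C.Φ Y T₀ (C.Φ Y t b)) (C.A Y T₀ (C.Φ Y t b) x)‖ <
        ‖q (C.Φ Y T₀ (C.Φ Y t b)) (C.A Y T₀ (C.Φ Y t b) x)‖ :=
    fun Y b hb t ↦ (hO Y b hb t).cone
  have fdom : ∀ Y, ∀ b ∈ C.orbitIn Y O, ∀ t, ∀ x ∈ C.fib Y (C.Φ Y t b),
      ∀ y ∈ C.fib Y (C.Φ Y t b),
      ‖q (C.Φ Y T₀ (C.Φ Y t b)) (C.A Y T₀ (C.Φ Y t b) x)‖ ≤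
        ‖p (C.Φ Y T₀ (C.Φ Y t b)) (C.A Y T₀ (C.Φ Y t b) x)‖ →
      ‖p (C.Φ Y t b) y‖ ≤ ‖q (C.Φ Y t b) y‖ →
      ‖y‖ * ‖C.A Y T₀ (C.Φ Y t b) x‖ ≤ 1 / 2 * (‖x‖ * ‖C.A Y T₀ (C.Φ Y t b) y‖) :=
    fun Y b hb t x hx y hy h1 h2 ↦ by
      rw [mul_comm]
      exact (hO Y b hb t).dom y hy x hx h2 h1
  have hback : ∀ Y b t, C.Φ Y T₀ (C.rev.Φ Y T₀ (C.rev.Φ Y t b)) = C.rev.Φ Y t b := fun Y b t ↦ by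
    rw [rev_Φ, C.Φ_Φ_neg]
  have hbackA : ∀ Y b t x, x ∈ C.rev.fib Y (C.rev.Φ Y t b) →
      C.A Y T₀ (C.rev.Φ Y T₀ (C.rev.Φ Y t b)) (C.rev.A Y T₀ (C.rev.Φ Y t b) x) = x :=
    fun Y b t x hx ↦ by
      rw [rev_Φ, rev_A]
      exact C.A_A_neg Y _ (by rwa [rev_fib] at hx) T₀
  have hOr : ∀ Y, ∀ b ∈ C.orbitIn Y O, ∀ t, C.ConeAt p T₀ M₁ i j Y (C.rev.Φ Y t b) :=
    fun Y b hb t ↦ hO Y b hb (-t)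
  have hOr2 : ∀ Y, ∀ b ∈ C.orbitIn Y O, ∀ t,
      C.ConeAt p T₀ M₁ i j Y (C.rev.Φ Y T₀ (C.rev.Φ Y t b)) :=
    fun Y b hb t ↦ by
      rw [← C.rev.Φ_add]
      exact hOr Y b hb _
  have hfibr : ∀ Y b t (x : H), C.rev.A Y T₀ (C.rev.Φ Y t b) x ∈
      C.fib Y (C.rev.Φ Y T₀ (C.rev.Φ Y t b)) := fun Y b t x ↦ by
    have := C.rev.A_mem_fib Y (C.rev.Φ Y t b) T₀ x
    rwa [rev_fib] at this
  -- The contrapositive of forward invariance: a backward image outside the open complementary cone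
  -- would lie in the closed forward cone, so the vector itself would lie strictly inside that cone.
  have bcone : ∀ Y, ∀ b ∈ C.orbitIn Y O, ∀ t, ∀ x ∈ C.rev.fib Y (C.rev.Φ Y t b), x ≠ 0 →
      ‖q (C.rev.Φ Y t b) x‖ ≤ ‖p (C.rev.Φ Y t b) x‖ →
      ‖q (C.rev.Φ Y T₀ (C.rev.Φ Y t b)) (C.rev.A Y T₀ (C.rev.Φ Y t b) x)‖ <
        ‖p (C.rev.Φ Y T₀ (C.rev.Φ Y t b)) (C.rev.A Y T₀ (C.rev.Φ Y t b) x)‖ := by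
    intro Y b hb t x hx hx0 hc
    by_contra hcon
    push Not at hcon
    have := (hOr2 Y b hb t).cone _ (hfibr Y b t x)
      (norm_pos_iff.1 (C.rev.A_pos Y _ hx hx0 T₀)) hcon
    rw [hback, hbackA Y b t x hx] at this
    exact absurd hc (not_le.2 this)
  have bdom : ∀ Y, ∀ b ∈ C.orbitIn Y O, ∀ t, ∀ x ∈ C.rev.fib Y (C.rev.Φ Y t b),
      ∀ y ∈ C.rev.fib Y (C.rev.Φ Y t b),
      ‖p (C.rev.Φ Y T₀ (C.rev.Φ Y t b)) (C.rev.A Y T₀ (C.rev.Φ Y t b) x)‖ ≤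
        ‖q (C.rev.Φ Y T₀ (C.rev.Φ Y t b)) (C.rev.A Y T₀ (C.rev.Φ Y t b) x)‖ →
      ‖q (C.rev.Φ Y t b) y‖ ≤ ‖p (C.rev.Φ Y t b) y‖ →
      ‖y‖ * ‖C.rev.A Y T₀ (C.rev.Φ Y t b) x‖ ≤
        1 / 2 * (‖x‖ * ‖C.rev.A Y T₀ (C.rev.Φ Y t b) y‖) := by
    intro Y b hb t x hx y hy h1 h2
    have := (hOr2 Y b hb t).dom _ (hfibr Y b t x) _ (hfibr Y b t y) h1
      (by rw [hback, hbackA Y b t y hy]; exact h2)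
    rw [hbackA Y b t y hy, hbackA Y b t x hx] at this
    linarith
  have exV : ∀ Y, ∀ b ∈ C.orbitIn Y O, ∃ R ≤ C.fib Y b, finrank ℝ R = i ∧
      ∀ x, x ∈ R ↔ (Y, b, x) ∈ Vs := by
    intro Y b hb
    obtain ⟨R, h1, h2, h3⟩ := exists_submodule_stay (i := j) (j := i) C Y b T₀ q p
      (fun t ↦ by rw [hm, hij, add_comm]) (fcone Y b hb) (fdom Y b hb)
      (fun t ↦ (hO Y b hb t).left) (fun t ↦ (hO Y b hb t).right)
    refine ⟨R, h1, h2, fun x ↦ (h3 x).trans ?_⟩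
    rw [mem_fib_iff]
    rfl
  have exW : ∀ Y, ∀ b ∈ C.orbitIn Y O, ∃ R ≤ C.fib Y b, finrank ℝ R = j ∧
      ∀ x, x ∈ R ↔ (Y, b, x) ∈ Ws := by
    intro Y b hb
    obtain ⟨R, h1, h2, h3⟩ := exists_submodule_stay (i := i) (j := j) C.rev Y b T₀ p q
      (fun t ↦ by rw [rev_fib, hm, hij]) (bcone Y b hb) (bdom Y b hb)
      (fun t ↦ by rw [rev_fib]; exact (hOr Y b hb t).right)
      (fun t ↦ by rw [rev_fib]; exact (hOr Y b hb t).left)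
    rw [rev_fib] at h1
    refine ⟨R, h1, h2, fun x ↦ (h3 x).trans ?_⟩
    rw [rev_fib, mem_fib_iff]
    rfl
  -- Over orbits in `O` the span is the slice itself; elsewhere it is only a default value.
  let 𝒱 : P → B → Submodule ℝ H := fun Y b ↦ Submodule.span ℝ {x | (Y, b, x) ∈ Vs}
  let 𝒲 : P → B → Submodule ℝ H := fun Y b ↦ Submodule.span ℝ {x | (Y, b, x) ∈ Ws}
  have h𝒱 : ∀ Y, ∀ b ∈ C.orbitIn Y O, 𝒱 Y b ≤ C.fib Y b ∧ finrank ℝ (𝒱 Y b) = i ∧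
      ∀ x, x ∈ 𝒱 Y b ↔ (Y, b, x) ∈ Vs := by
    intro Y b hb
    obtain ⟨R, h1, h2, h3⟩ := exV Y b hb
    have : 𝒱 Y b = R := by
      have : {x | (Y, b, x) ∈ Vs} = (R : Set H) := by ext x; exact (h3 x).symm
      simp only [𝒱, this, Submodule.span_eq]
    rw [this]
    exact ⟨h1, h2, h3⟩
  have h𝒲 : ∀ Y, ∀ b ∈ C.orbitIn Y O, 𝒲 Y b ≤ C.fib Y b ∧ finrank ℝ (𝒲 Y b) = j ∧
      ∀ x, x ∈ 𝒲 Y b ↔ (Y, b, x) ∈ Ws := by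
    intro Y b hb
    obtain ⟨R, h1, h2, h3⟩ := exW Y b hb
    have : 𝒲 Y b = R := by
      have : {x | (Y, b, x) ∈ Ws} = (R : Set H) := by ext x; exact (h3 x).symm
      simp only [𝒲, this, Submodule.span_eq]
    rw [this]
    exact ⟨h1, h2, h3⟩
  have hV0 : ∀ Y, ∀ b ∈ C.orbitIn Y O, ∀ x ∈ 𝒱 Y b, ‖q b x‖ ≤ ‖p b x‖ := by
    intro Y b hb x hx
    have h1 := ((h𝒱 Y b hb).2.2 x).1 hx
    simpa [C.Φ_zero, hq, h1.1] using h1.2 0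
  have hW0 : ∀ Y, ∀ b ∈ C.orbitIn Y O, ∀ x ∈ 𝒲 Y b, ‖p b x‖ ≤ ‖q b x‖ := by
    intro Y b hb x hx
    have h1 := ((h𝒲 Y b hb).2.2 x).1 hx
    simpa [C.Φ_zero, hq, h1.1] using h1.2 0
  obtain ⟨η', hη', T', hT', hrate⟩ := exists_rate hT₀ M₁
  have dV : ∀ Y, ∀ b ∈ C.orbitIn Y O, C.DomAt Y b (𝒱 Y b) (𝒲 Y b) η' T' := fun Y b hb ↦
    domAt_of_stay C Y b hT₀ q p (fcone Y b hb) (fdom Y b hb) (fun t ↦ (hO Y b hb t).bound)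
      hrate hT' (h𝒱 Y b hb).1 (h𝒲 Y b hb).1
      (fun x hx ↦ (((h𝒱 Y b hb).2.2 x).1 hx).2) (hW0 Y b hb)
  have dW : ∀ Y, ∀ b ∈ C.orbitIn Y O, C.rev.DomAt Y b (𝒲 Y b) (𝒱 Y b) η' T' := fun Y b hb ↦
    domAt_of_stay C.rev Y b hT₀ p q (bcone Y b hb) (bdom Y b hb)
      (fun t s hs ↦ (hOr Y b hb t).bound (-s) ⟨by linarith [hs.2], by linarith [hs.1]⟩)
      hrate hT' (by rw [rev_fib]; exact (h𝒲 Y b hb).1) (by rw [rev_fib]; exact (h𝒱 Y b hb).1)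
      (fun x hx ↦ (((h𝒲 Y b hb).2.2 x).1 hx).2) (hV0 Y b hb)
  have hdisj : ∀ Y, ∀ b ∈ C.orbitIn Y O, Disjoint (𝒱 Y b) (𝒲 Y b) := fun Y b hb ↦
    (dV Y b hb).disjoint hη' (h𝒱 Y b hb).1
  have hsup : ∀ Y, ∀ b ∈ C.orbitIn Y O, 𝒱 Y b ⊔ 𝒲 Y b = C.fib Y b := fun Y b hb ↦
    sup_eq_of_finrank (h𝒱 Y b hb).1 (h𝒲 Y b hb).1 (hdisj Y b hb)
      (by rw [(h𝒱 Y b hb).2.1, (h𝒲 Y b hb).2.1, hm, hij])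
  have slV : ∀ Y, ∀ b ∈ C.orbitIn Y O, C.IsSlow Y b (𝒱 Y b) := fun Y b hb ↦
    (dV Y b hb).isSlow hη' (hsup Y b hb)
  have slW : ∀ Y, ∀ b ∈ C.orbitIn Y O, C.rev.IsSlow Y b (𝒲 Y b) := fun Y b hb ↦
    (dW Y b hb).isSlow hη' (by rw [sup_comm, hsup Y b hb, rev_fib])
  refine ⟨O, 𝒱, 𝒲, ⟨isOpen_interior, fun Y ↦ ⟨fun b hb t ↦ orbitIn_inv hb t, hsup Y, hdisj Y,
    fun b hb ↦ (h𝒱 Y b hb).2.1, fun b hb t v hv ↦ ?_, fun b hb t w hw ↦ ?_⟩,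
    ⟨η', hη', T', hT', dV⟩, ⟨Vs, hVs, fun Y b hb ↦ (h𝒱 Y b hb).2.2⟩,
    ⟨Ws, hWs, fun Y b hb ↦ (h𝒲 Y b hb).2.2⟩⟩, hKO⟩
  · have e := ((slV Y b hb).map t).eq (slV Y _ (orbitIn_inv hb t)) (by
      rw [C.finrank_map Y b (h𝒱 Y b hb).1, (h𝒱 Y b hb).2.1, (h𝒱 Y _ (orbitIn_inv hb t)).2.1])
    rw [← e]
    exact ⟨v, hv, rfl⟩
  · have h1 := (slW Y b hb).map (-t)
    simp only [rev_Φ, rev_A, neg_neg] at h1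
    have e := h1.eq (slW Y _ (orbitIn_inv hb t)) (by
      rw [C.finrank_map Y b (h𝒲 Y b hb).1, (h𝒲 Y b hb).2.1, (h𝒲 Y _ (orbitIn_inv hb t)).2.1])
    rw [← e]
    exact ⟨w, hw, rfl⟩

end LinCocycle

/-! ### Strict domination with prescribed constants -/

namespace LinCocycle

variable {P B H : Type*} [TopologicalSpace P] [TopologicalSpace B]
  [NormedAddCommGroup H] [InnerProductSpace ℝ H] [FiniteDimensional ℝ H]
  {C : LinCocycle P B H} {X Y : P} {b : B} {K : Set B} {V W : B → Submodule ℝ H} {i j : ℕ}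

variable (C Y b) in
/-- Strict domination at a point and for a given time. -/
def StrictAt (V W : Submodule ℝ H) (η t : ℝ) : Prop :=
  ∀ v ∈ V, ∀ w ∈ W, v ≠ 0 → w ≠ 0 →
    ‖C.A Y t b v‖ * ‖w‖ < Real.exp (-(η * t)) * (‖v‖ * ‖C.A Y t b w‖)

/-- With `n` the integer part of `t / T`, the time `t / n` lies between `T` and `2 * T`, and strict
inequalities multiply along the orbit. A compact range of times thus controls all `t ≥ T` without
loss on `η`. -/
theorem IsSplit.strictAt_of_Icc {η T : ℝ} (hT : 0 < T) (h : C.IsSplit Y K V W i)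
    (hs : ∀ b ∈ K, ∀ t ∈ Icc T (2 * T), C.StrictAt Y b (V b) (W b) η t) :
    ∀ b ∈ K, ∀ t ≥ T, C.StrictAt Y b (V b) (W b) η t := by
  have key : ∀ s ∈ Icc T (2 * T), ∀ n : ℕ, ∀ b ∈ K,
      C.StrictAt Y b (V b) (W b) η (((n + 1 : ℕ) : ℝ) * s) := by
    intro s hsI n b hb
    induction n with
    | zero => simpa using hs b hb s hsI
    | succ n ih =>
      intro v hv w hw hv0 hw0
      have e : (((n + 1 + 1 : ℕ) : ℝ)) * s = s + ((n + 1 : ℕ) : ℝ) * s := by push_cast; ring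
      rw [e, C.A_add_apply, C.A_add_apply]
      set τ := ((n + 1 : ℕ) : ℝ) * s
      have a1 := C.A_pos Y b (h.left_le hb hv) hv0 τ
      have a2 := C.A_pos Y b (h.right_le hb hw) hw0 τ
      have h1 := ih v hv w hw hv0 hw0
      have h2 := hs _ (h.inv b hb τ) s hsI _ (h.map_left b hb τ v hv) _ (h.map_right b hb τ w hw)
        (norm_pos_iff.1 a1) (norm_pos_iff.1 a2)
      have hexp : Real.exp (-(η * (s + τ))) = Real.exp (-(η * s)) * Real.exp (-(η * τ)) := by
        rw [← Real.exp_add]; ring_nf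
      rw [hexp]
      have hwp := norm_pos_iff.2 hw0
      set c := ‖C.A Y s (C.Φ Y τ b) (C.A Y τ b v)‖
      set c' := ‖C.A Y s (C.Φ Y τ b) (C.A Y τ b w)‖
      have hc' : 0 ≤ c' := norm_nonneg _
      have hE := Real.exp_pos (-(η * s))
      refine lt_of_mul_lt_mul_left ?_ a2.le
      calc ‖C.A Y τ b w‖ * (c * ‖w‖) = (c * ‖C.A Y τ b w‖) * ‖w‖ := by ring
        _ < (Real.exp (-(η * s)) * (‖C.A Y τ b v‖ * c')) * ‖w‖ := by gcongr
        _ = Real.exp (-(η * s)) * c' * (‖C.A Y τ b v‖ * ‖w‖) := by ring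
        _ ≤ Real.exp (-(η * s)) * c' * (Real.exp (-(η * τ)) * (‖v‖ * ‖C.A Y τ b w‖)) := by
          gcongr
        _ = _ := by ring
  intro b hb t ht
  set n := ⌊t / T⌋₊ with hn
  have ht0 : 0 < t := hT.trans_le ht
  have hn1 : 1 ≤ n := by
    rw [hn, Nat.one_le_floor_iff, le_div_iff₀ hT]
    linarith
  obtain ⟨k, hk⟩ := Nat.exists_eq_add_of_le' hn1
  have hnp : (0 : ℝ) < n := by exact_mod_cast hn1
  have h1 : n * T ≤ t := by
    have := Nat.floor_le (div_pos ht0 hT).le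
    rwa [le_div_iff₀ hT] at this
  have h2 : t < (n + 1) * T := by
    have := Nat.lt_floor_add_one (t / T)
    rwa [div_lt_iff₀ hT] at this
  have hsI : t / n ∈ Icc T (2 * T) := by
    refine ⟨by rw [le_div_iff₀ hnp]; linarith, ?_⟩
    rw [div_le_iff₀ hnp]
    have : (1 : ℝ) ≤ n := by exact_mod_cast hn1
    nlinarith
  have := key (t / n) hsI k b hb
  rw [← hk] at this
  rwa [mul_div_cancel₀ _ hnp.ne'] at this

theorem IsRobustSplit.mono {O O' : Set (P × B)} {𝒱 𝒲 : P → B → Submodule ℝ H}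
    (h : C.IsRobustSplit O 𝒱 𝒲 i) (hO' : IsOpen O') (hsub : O' ⊆ O) :
    C.IsRobustSplit O' 𝒱 𝒲 i := by
  have hs : ∀ Y, C.orbitIn Y O' ⊆ C.orbitIn Y O := fun Y b hb t ↦ hsub (hb t)
  obtain ⟨η, hη, T, hT, hd⟩ := h.dom
  obtain ⟨S₁, hS₁, h₁⟩ := h.closed_left
  obtain ⟨S₂, hS₂, h₂⟩ := h.closed_right
  exact ⟨hO', fun Y ↦ (h.split Y).mono (hs Y) fun b hb t ↦ orbitIn_inv hb t,
    ⟨η, hη, T, hT, fun Y b hb ↦ hd Y b (hs Y hb)⟩, ⟨S₁, hS₁, fun Y b hb ↦ h₁ Y b (hs Y hb)⟩,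
    ⟨S₂, hS₂, fun Y b hb ↦ h₂ Y b (hs Y hb)⟩⟩

/-- A strict domination inequality persists, with the same constants. -/
theorem IsRobustSplit.exists_strict {O : Set (P × B)} {𝒱 𝒲 : P → B → Submodule ℝ H}
    (h : C.IsRobustSplit O 𝒱 𝒲 i) (hKO : ∀ b ∈ K, (X, b) ∈ O)
    (hinv : ∀ b ∈ K, ∀ t, C.Φ X t b ∈ K) {η T : ℝ} (hT : 0 < T)
    (hs : ∀ b ∈ K, ∀ t ∈ Icc T (2 * T), C.StrictAt X b (𝒱 X b) (𝒲 X b) η t) :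
    ∃ O' ⊆ O, C.IsRobustSplit O' 𝒱 𝒲 i ∧ (∀ b ∈ K, (X, b) ∈ O') ∧
      ∀ Y, ∀ b ∈ C.orbitIn Y O', ∀ t ≥ T, C.StrictAt Y b (𝒱 Y b) (𝒲 Y b) η t := by
  obtain ⟨S₁, hS₁, h₁⟩ := h.closed_left
  obtain ⟨S₂, hS₂, h₂⟩ := h.closed_right
  have hKin : K ⊆ C.orbitIn X O := fun b hb t ↦ hKO _ (hinv b hb t)
  -- For unit vectors of the bundles, which are traces of the closed sets `S₁` and `S₂`, and for
  -- times in a compact interval, strictness is an open condition on `(Y, b)`.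
  let G : Set (P × B) := {z | ∀ y ∈ Icc T (2 * T) ×ˢ Metric.sphere (0 : H) 1 ×ˢ
    Metric.sphere (0 : H) 1, ((z.1, z.2, y.2.1) ∈ S₁ ∧ (z.1, z.2, y.2.2) ∈ S₂) →
    ‖C.A z.1 y.1 z.2 y.2.1‖ < Real.exp (-(η * y.1)) * ‖C.A z.1 y.1 z.2 y.2.2‖}
  have hG : ∀ b ∈ K, G ∈ 𝓝 (X, b) := by
    intro b hb
    refine (isCompact_Icc.prod ((isCompact_sphere (0 : H) 1).prod
      (isCompact_sphere (0 : H) 1))).eventually_forall_of_forall_eventually fun y hy ↦ ?_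
    have c1 : Continuous fun z : (P × B) × ℝ × H × H ↦ C.A z.1.1 z.2.1 z.1.2 z.2.2.1 :=
      C.continuous_A_apply.comp
        (f := fun z : (P × B) × ℝ × H × H ↦ (z.1.1, z.2.1, z.1.2, z.2.2.1)) (by fun_prop)
    have c2 : Continuous fun z : (P × B) × ℝ × H × H ↦ C.A z.1.1 z.2.1 z.1.2 z.2.2.2 :=
      C.continuous_A_apply.comp
        (f := fun z : (P × B) × ℝ × H × H ↦ (z.1.1, z.2.1, z.1.2, z.2.2.2)) (by fun_prop)
    refine eventually_imp_of_isClosed_isOpen (Z := (P × B) × ℝ × H × H)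
      (R := fun z ↦ (z.1.1, z.1.2, z.2.2.1) ∈ S₁ ∧ (z.1.1, z.1.2, z.2.2.2) ∈ S₂)
      (Q := fun z ↦ ‖C.A z.1.1 z.2.1 z.1.2 z.2.2.1‖ <
        Real.exp (-(η * z.2.1)) * ‖C.A z.1.1 z.2.1 z.1.2 z.2.2.2‖)
      ((hS₁.preimage (f := fun z : (P × B) × ℝ × H × H ↦ (z.1.1, z.1.2, z.2.2.1))
        (by fun_prop)).inter
        (hS₂.preimage (f := fun z : (P × B) × ℝ × H × H ↦ (z.1.1, z.1.2, z.2.2.2))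
        (by fun_prop))) (isOpen_lt c1.norm (Continuous.mul (by fun_prop) c2.norm)) ?_
    rintro ⟨m1, m2⟩
    obtain ⟨ht, hv, hw⟩ := hy
    have hv1 : ‖y.2.1‖ = 1 := by simpa using hv
    have hw1 : ‖y.2.2‖ = 1 := by simpa using hw
    have := hs b hb y.1 ht y.2.1 ((h₁ X b (hKin hb) _).2 m1) y.2.2 ((h₂ X b (hKin hb) _).2 m2)
      (norm_ne_zero_iff.1 (by rw [hv1]; exact one_ne_zero))
      (norm_ne_zero_iff.1 (by rw [hw1]; exact one_ne_zero))
    rwa [hv1, hw1, mul_one, one_mul] at this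
  refine ⟨O ∩ interior G, inter_subset_left, h.mono (h.isOpen.inter isOpen_interior)
    inter_subset_left, fun b hb ↦ ⟨hKO b hb, mem_interior_iff_mem_nhds.2 (hG b hb)⟩, fun Y ↦ ?_⟩
  have hsp := (h.mono (h.isOpen.inter isOpen_interior) (inter_subset_left (t := interior G))).split Y
  refine hsp.strictAt_of_Icc hT fun b hb t ht v hv w hw hv0 hw0 ↦ ?_
  have hbO : b ∈ C.orbitIn Y O := fun s ↦ (hb s).1
  have hbG : (Y, b) ∈ G := by
    have := (hb 0).2
    rw [C.Φ_zero] at this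
    exact interior_subset this
  have pv := norm_pos_iff.2 hv0
  have pw := norm_pos_iff.2 hw0
  have := hbG (t, ‖v‖⁻¹ • v, ‖w‖⁻¹ • w) ⟨ht, by simp [norm_smul, pv.ne'],
    by simp [norm_smul, pw.ne']⟩ ⟨(h₁ Y b hbO _).1 (Submodule.smul_mem _ _ hv),
      (h₂ Y b hbO _).1 (Submodule.smul_mem _ _ hw)⟩
  simp only [map_smul, norm_smul, norm_inv, norm_norm] at this
  rw [inv_mul_lt_iff₀ pv] at this
  calc _ < (‖v‖ * (Real.exp (-(η * t)) * (‖w‖⁻¹ * ‖C.A Y t b w‖))) * ‖w‖ := by gcongr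
    _ = _ := by field_simp

end LinCocycle

/-! ### Families of flows and the extended linear Poincaré flow -/

/-- A family of flows on `M` with the data that are relevant for the linear Poincaré flow: tangent
spaces are subspaces, the ranges of the projections `pr x`, of a Euclidean space `H`. -/
structure FlowData (P M H : Type*) [TopologicalSpace P] [TopologicalSpace M]
    [NormedAddCommGroup H] [InnerProductSpace ℝ H] where
  φ : P → ℝ → M → M
  D : P → ℝ → M → H →L[ℝ] H
  ξ : P → M → H
  pr : M → H →L[ℝ] H
  d : ℕ
  dist : M → M → ENNReal
  continuous_φ : Continuous fun z : P × ℝ × M ↦ φ z.1 z.2.1 z.2.2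
  continuous_D : Continuous fun z : P × ℝ × M ↦ D z.1 z.2.1 z.2.2
  continuous_ξ : Continuous fun z : P × M ↦ ξ z.1 z.2
  φ_zero : ∀ Y x, φ Y 0 x = x
  φ_add : ∀ Y s t x, φ Y (s + t) x = φ Y s (φ Y t x)
  D_zero : ∀ Y x, D Y 0 x = pr x
  D_add : ∀ Y s t x, D Y (s + t) x = (D Y s (φ Y t x)).comp (D Y t x)
  finrank_range : ∀ x, finrank ℝ (pr x).range = d
  pr_symm : ∀ x u v, inner ℝ (pr x u) v = inner ℝ u (pr x v)
  pr_ξ : ∀ Y x, pr x (ξ Y x) = ξ Y x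
  D_ξ : ∀ Y t x, D Y t x (ξ Y x) = ξ Y (φ Y t x)
  dist_self : ∀ x, dist x x = 0
  dist_comm : ∀ x y, dist x y = dist y x
  dist_triangle : ∀ x y z, dist x z ≤ dist x y + dist y z
  eventually_dist_lt : ∀ x, ∀ c > 0, ∀ᶠ y in 𝓝 x, dist y x < c
  exists_dist_lt : ∀ x, ∀ s ∈ 𝓝 x, ∃ c > 0, ∀ y, dist y x < c → y ∈ s
  dist_φ_le : ∀ Y x s t, s ≤ t → ∀ c : ℝ, (∀ r ∈ Icc s t, ‖ξ Y (φ Y r x)‖ ≤ c) →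
    dist (φ Y s x) (φ Y t x) ≤ ENNReal.ofReal (c * (t - s))
  ξ_le_dist : ∀ Y σ, ξ Y σ = 0 → ∃ c : ℝ, ∀ᶠ y in 𝓝 σ, ∀ r : ℝ, 0 ≤ r →
    dist y σ ≤ ENNReal.ofReal r → ‖ξ Y y‖ ≤ c * r

namespace FlowData

variable {P M H : Type*} [TopologicalSpace P] [TopologicalSpace M]
  [NormedAddCommGroup H] [InnerProductSpace ℝ H] [FiniteDimensional ℝ H]

/-- Time reversal. -/
def rev (F : FlowData P M H) : FlowData P M H where
  φ Y t x := F.φ Y (-t) x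
  D Y t x := F.D Y (-t) x
  -- The field is not negated. The structure only involves its norm, its membership in the tangent
  -- spaces and its invariance under the tangent flow, and in this way both time directions have the
  -- same limit lines by definition.
  ξ := F.ξ
  pr := F.pr
  d := F.d
  dist := F.dist
  continuous_φ := F.continuous_φ.comp (f := fun z : P × ℝ × M ↦ (z.1, -z.2.1, z.2.2))
    (by fun_prop)
  continuous_D := F.continuous_D.comp (f := fun z : P × ℝ × M ↦ (z.1, -z.2.1, z.2.2))
    (by fun_prop)
  continuous_ξ := F.continuous_ξ
  φ_zero Y x := by simp [F.φ_zero]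
  φ_add Y s t x := by rw [neg_add, F.φ_add]
  D_zero Y x := by simp [F.D_zero]
  D_add Y s t x := by rw [neg_add, F.D_add]
  finrank_range := F.finrank_range
  pr_symm := F.pr_symm
  pr_ξ := F.pr_ξ
  D_ξ Y t x := F.D_ξ Y (-t) x
  dist_self := F.dist_self
  dist_comm := F.dist_comm
  dist_triangle := F.dist_triangle
  eventually_dist_lt := F.eventually_dist_lt
  exists_dist_lt := F.exists_dist_lt
  dist_φ_le Y x s t hst c hc := by
    have := F.dist_φ_le Y x (-t) (-s) (neg_le_neg hst) c fun r hr ↦ by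
      have := hc (-r) ⟨by linarith [hr.2], by linarith [hr.1]⟩
      rwa [neg_neg] at this
    rw [F.dist_comm]
    refine this.trans (le_of_eq ?_)
    congr 1
    ring
  ξ_le_dist := F.ξ_le_dist

variable (F : FlowData P M H)

/-- The tangent cocycle. -/
def tan : LinCocycle P M H where
  Φ := F.φ
  A := F.D
  continuous_Φ := F.continuous_φ
  continuous_A := F.continuous_D
  Φ_zero := F.φ_zero
  Φ_add := F.φ_add
  A_add := F.D_add

theorem rev_tan : F.rev.tan = F.tan.rev := rfl

theorem tan_fib (Y : P) (x : M) : F.tan.fib Y x = (F.pr x).range := by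
  change (F.D Y 0 x).range = _
  rw [F.D_zero]

theorem mem_tan_fib {Y : P} {x : M} {v : H} : v ∈ F.tan.fib Y x ↔ F.pr x v = v := by
  rw [LinCocycle.mem_fib_iff]
  change F.D Y 0 x v = v ↔ _
  rw [F.D_zero]

theorem ξ_mem (Y : P) (x : M) : F.ξ Y x ∈ F.tan.fib Y x := F.mem_tan_fib.2 (F.pr_ξ Y x)

theorem ξ_φ_ne_zero {Y : P} {x : M} (h : F.ξ Y x ≠ 0) (t : ℝ) : F.ξ Y (F.φ Y t x) ≠ 0 := by
  rw [← F.D_ξ]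
  exact norm_pos_iff.1 (F.tan.A_pos Y x (F.ξ_mem Y x) h t)

/-- The projection orthogonal to a unit vector `u`. -/
def orthProj (u : H) : H →L[ℝ] H := ContinuousLinearMap.id ℝ H - (innerSL ℝ u).smulRight u

theorem orthProj_apply (u x : H) : orthProj u x = x - inner ℝ u x • u := by
  simp [orthProj]

theorem continuous_orthProj : Continuous (orthProj : H → H →L[ℝ] H) := by
  refine continuous_const.sub ?_
  have := (ContinuousLinearMap.smulRightL ℝ H H).continuous₂
  exact this.comp ((innerSL ℝ (E := H)).continuous.prodMk continuous_id)

theorem orthProj_self {u : H} (hu : ‖u‖ = 1) : orthProj u u = 0 := by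
  simp [orthProj_apply, hu]

theorem inner_orthProj {u : H} (hu : ‖u‖ = 1) (x : H) : inner ℝ u (orthProj u x) = 0 := by
  simp [orthProj_apply, inner_sub_right, inner_smul_right, hu]

theorem orthProj_of_inner_eq_zero {u x : H} (h : inner ℝ u x = 0) : orthProj u x = x := by
  simp [orthProj_apply, h]

theorem norm_orthProj_le {u : H} (hu : ‖u‖ = 1) (x : H) : ‖orthProj u x‖ ≤ ‖x‖ := by
  have h : ‖x‖ ^ 2 = ‖orthProj u x‖ ^ 2 + ‖inner ℝ u x • u‖ ^ 2 := by
    have e : x = orthProj u x + inner ℝ u x • u := by simp [orthProj_apply]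
    nth_rw 1 [e]
    rw [pow_two, norm_add_sq_eq_norm_sq_add_norm_sq_real, pow_two, pow_two]
    rw [inner_smul_right, real_inner_comm u (orthProj u x), inner_orthProj hu, mul_zero]
  have := sq_nonneg ‖inner ℝ u x • u‖
  exact le_of_sq_le_sq (by linarith) (norm_nonneg _)

/-- The unit tangent vectors. -/
def Line : Type _ := {z : M × H // ‖z.2‖ = 1 ∧ F.pr z.1 z.2 = z.2}

instance : TopologicalSpace F.Line := inferInstanceAs (TopologicalSpace {z : M × H // _})

theorem continuous_pr [Nonempty P] : Continuous F.pr := by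
  have Y : P := Classical.arbitrary P
  have : F.pr = fun x ↦ F.D Y 0 x := by
    funext x
    rw [F.D_zero]
  rw [this]
  exact F.continuous_D.comp (f := fun x : M ↦ (Y, 0, x)) (by fun_prop)

instance [T2Space M] : T2Space F.Line := inferInstanceAs (T2Space {z : M × H // _})

theorem continuous_line_val : Continuous (fun b : F.Line ↦ b.1) := continuous_subtype_val

instance [CompactSpace M] [Nonempty P] : CompactSpace F.Line := by
  suffices h : IsCompact {z : M × H | ‖z.2‖ = 1 ∧ F.pr z.1 z.2 = z.2} from
    isCompact_iff_compactSpace.1 h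
  have hc : IsCompact ((univ : Set M) ×ˢ Metric.sphere (0 : H) 1) :=
    isCompact_univ.prod (isCompact_sphere _ _)
  refine hc.of_isClosed_subset ?_ fun z hz ↦ ⟨mem_univ _, by simpa using hz.1⟩
  refine (isClosed_eq (by fun_prop) continuous_const).inter (isClosed_eq ?_ continuous_snd)
  exact (F.continuous_pr.comp continuous_fst).clm_apply continuous_snd

variable {F}

theorem Line.mem_fib (Y : P) (b : F.Line) : b.1.2 ∈ F.tan.fib Y b.1.1 := F.mem_tan_fib.2 b.2.2

theorem Line.D_pos (Y : P) (t : ℝ) (b : F.Line) : 0 < ‖F.D Y t b.1.1 b.1.2‖ :=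
  F.tan.A_pos Y b.1.1 (b.mem_fib Y) (norm_pos_iff.1 (by rw [b.2.1]; exact one_pos)) t

variable (F)

/-- The flow induced on unit vectors. -/
def lineFlow (Y : P) (t : ℝ) (b : F.Line) : F.Line :=
  ⟨(F.φ Y t b.1.1, ‖F.D Y t b.1.1 b.1.2‖⁻¹ • F.D Y t b.1.1 b.1.2),
    by simp [norm_smul, (Line.D_pos Y t b).ne'],
    by
      have : F.D Y t b.1.1 b.1.2 ∈ F.tan.fib Y (F.φ Y t b.1.1) := F.tan.A_mem_fib Y b.1.1 t b.1.2
      simp only [map_smul]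
      rw [F.mem_tan_fib.1 this]⟩

/-- Removing the component along `u` changes the image by a multiple of `u'`, which the last
projection kills. The cocycle property of the extended linear Poincaré flow follows. -/
theorem orthProj_D_orthProj {Y : P} {t : ℝ} {x : M} {u u' : H} (hu' : ‖u'‖ = 1)
    {c : ℝ} (h : F.D Y t x u = c • u') (y : H) :
    orthProj u' (F.D Y t x (orthProj u y)) = orthProj u' (F.D Y t x y) := by
  rw [orthProj_apply u y, map_sub, map_sub, map_smul, h, map_smul, map_smul, orthProj_self hu']
  simp

theorem D_line (Y : P) (t : ℝ) (b : F.Line) : F.D Y t b.1.1 b.1.2 =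
    ‖F.D Y t b.1.1 b.1.2‖ • (F.lineFlow Y t b).1.2 := by
  simp [lineFlow, (Line.D_pos Y t b).ne', smul_smul]

/-- The cocycle of the extended linear Poincaré flow. -/
def ext : LinCocycle P F.Line H where
  Φ := F.lineFlow
  A Y t b := (orthProj (F.lineFlow Y t b).1.2).comp ((F.D Y t b.1.1).comp (orthProj b.1.2))
  continuous_Φ := by
    have hD : Continuous fun z : P × ℝ × F.Line ↦ F.D z.1 z.2.1 z.2.2.1.1 z.2.2.1.2 :=
      (F.continuous_D.comp (f := fun z : P × ℝ × F.Line ↦ (z.1, z.2.1, z.2.2.1.1))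
        (by have := F.continuous_line_val; fun_prop)).clm_apply
        (by have := F.continuous_line_val; fun_prop)
    refine Continuous.subtype_mk ((F.continuous_φ.comp
      (f := fun z : P × ℝ × F.Line ↦ (z.1, z.2.1, z.2.2.1.1))
        (by have := F.continuous_line_val; fun_prop)).prodMk ?_) _
    exact (hD.norm.inv₀ fun z ↦ (Line.D_pos z.1 z.2.1 z.2.2).ne').smul hD
  continuous_A := by
    have hl := F.continuous_line_val
    have hD : Continuous fun z : P × ℝ × F.Line ↦ F.D z.1 z.2.1 z.2.2.1.1 z.2.2.1.2 :=
      (F.continuous_D.comp (f := fun z : P × ℝ × F.Line ↦ (z.1, z.2.1, z.2.2.1.1))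
        (by fun_prop)).clm_apply (by fun_prop)
    have h1 : Continuous fun z : P × ℝ × F.Line ↦ (F.lineFlow z.1 z.2.1 z.2.2).1.2 :=
      (hD.norm.inv₀ fun z ↦ (Line.D_pos z.1 z.2.1 z.2.2).ne').smul hD
    refine (continuous_orthProj.comp h1).clm_comp (Continuous.clm_comp ?_
      (continuous_orthProj.comp (by fun_prop)))
    exact F.continuous_D.comp (f := fun z : P × ℝ × F.Line ↦ (z.1, z.2.1, z.2.2.1.1)) (by fun_prop)
  Φ_zero Y b := by
    refine Subtype.ext (Prod.ext (F.φ_zero Y b.1.1) ?_)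
    simp only [lineFlow, F.D_zero, b.2.2, b.2.1]
    simp
  Φ_add Y s t b := by
    refine Subtype.ext (Prod.ext (F.φ_add Y s t b.1.1) ?_)
    have hp := Line.D_pos Y t b
    simp only [lineFlow, F.D_add, ContinuousLinearMap.comp_apply, map_smul, norm_smul, norm_inv,
      norm_norm, smul_smul]
    congr 1
    field_simp
  A_add Y s t b := by
    ext x
    simp only [ContinuousLinearMap.comp_apply]
    have e : F.lineFlow Y (s + t) b = F.lineFlow Y s (F.lineFlow Y t b) := by
      refine Subtype.ext (Prod.ext (F.φ_add Y s t b.1.1) ?_)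
      have hp := Line.D_pos Y t b
      simp only [lineFlow, F.D_add, ContinuousLinearMap.comp_apply, map_smul, norm_smul, norm_inv,
        norm_norm, smul_smul]
      congr 1
      field_simp
    rw [e, F.D_add]
    have h1 := F.D_line Y s (F.lineFlow Y t b)
    have hx : (F.lineFlow Y t b).1.1 = F.φ Y t b.1.1 := rfl
    rw [hx] at h1 ⊢
    rw [F.orthProj_D_orthProj (F.lineFlow Y s (F.lineFlow Y t b)).2.1 h1,
      F.orthProj_D_orthProj (F.lineFlow Y s (F.lineFlow Y t b)).2.1 h1]
    rfl

end FlowData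

/-! ### Limit directions of nearby fields along orbits close to `Λ` -/

namespace FlowData

variable {P M H : Type*} [TopologicalSpace P] [TopologicalSpace M]
  [NormedAddCommGroup H] [InnerProductSpace ℝ H] [FiniteDimensional ℝ H]
  (F : FlowData P M H) {X Y : P} {Λ : Set M}

theorem lineFlow_zero (Y : P) (b : F.Line) : F.lineFlow Y 0 b = b := F.ext.Φ_zero Y b

theorem pr_pr [Nonempty P] (x : M) (v : H) : F.pr x (F.pr x v) = F.pr x v := by
  have Y : P := Classical.arbitrary P
  have := F.D_add Y 0 0 x
  rw [add_zero, F.φ_zero, F.D_zero] at this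
  conv_rhs => rw [this]
  rfl

theorem mem_ext_fib {b : F.Line} {v : H} :
    v ∈ F.ext.fib Y b ↔ F.pr b.1.1 v = v ∧ inner ℝ b.1.2 v = 0 := by
  have : Nonempty P := ⟨Y⟩
  have e : F.ext.A Y 0 b v = orthProj b.1.2 (F.pr b.1.1 (orthProj b.1.2 v)) := by
    change orthProj (F.lineFlow Y 0 b).1.2 (F.D Y 0 b.1.1 (orthProj b.1.2 v)) = _
    rw [F.lineFlow_zero, F.D_zero]
  rw [LinCocycle.mem_fib_iff, e]
  constructor
  · intro h
    have h2 : inner ℝ b.1.2 v = 0 := by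
      rw [← h]
      exact inner_orthProj b.2.1 _
    refine ⟨?_, h2⟩
    rw [orthProj_of_inner_eq_zero h2] at h
    rw [← h, orthProj_apply, map_sub, map_smul, b.2.2, F.pr_pr]
  · rintro ⟨h1, h2⟩
    rw [orthProj_of_inner_eq_zero h2, h1, orthProj_of_inner_eq_zero h2]

theorem finrank_tan_fib (Y : P) (x : M) : finrank ℝ (F.tan.fib Y x) = F.d := by
  rw [F.tan_fib, F.finrank_range]

theorem finrank_ext_fib (Y : P) (b : F.Line) : finrank ℝ (F.ext.fib Y b) = F.d - 1 := by
  have hu : b.1.2 ≠ 0 := norm_pos_iff.1 (by rw [b.2.1]; exact one_pos)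
  have hle : (ℝ ∙ b.1.2) ≤ F.tan.fib Y b.1.1 := by
    rw [Submodule.span_singleton_le_iff_mem]
    exact b.mem_fib Y
  have h := Submodule.finrank_add_inf_finrank_orthogonal hle
  rw [finrank_span_singleton hu, F.finrank_tan_fib] at h
  have e : F.ext.fib Y b = (ℝ ∙ b.1.2)ᗮ ⊓ F.tan.fib Y b.1.1 := by
    ext v
    rw [mem_ext_fib, Submodule.mem_inf, Submodule.mem_orthogonal_singleton_iff_inner_right,
      F.mem_tan_fib, and_comm]
  rw [e]
  omega

theorem eq_of_forall_dist_lt [T1Space M] {x y : M} (h : ∀ c : ENNReal, 0 < c → F.dist y x < c) :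
    y = x := by
  by_contra hne
  obtain ⟨c, hc, hcs⟩ := F.exists_dist_lt x {y}ᶜ (compl_singleton_mem_nhds (Ne.symm hne))
  exact hcs y (h c hc) rfl

/-- The field vanishes along the whole orbit, which has length zero, and points at distance zero
coincide. -/
theorem φ_of_sing [T1Space M] {σ : M} (h : F.ξ Y σ = 0) (t : ℝ) : F.φ Y t σ = σ := by
  have hz : ∀ r, F.ξ Y (F.φ Y r σ) = 0 := fun r ↦ by rw [← F.D_ξ, h, map_zero]
  have key : ∀ s t : ℝ, s ≤ t → F.dist (F.φ Y s σ) (F.φ Y t σ) = 0 := fun s t hst ↦ by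
    have := F.dist_φ_le Y σ s t hst 0 fun r _ ↦ by rw [hz, norm_zero]
    simpa using this
  refine F.eq_of_forall_dist_lt fun c hc ↦ lt_of_eq_of_lt ?_ hc
  rcases le_total t 0 with ht | ht
  · simpa [F.φ_zero] using key t 0 ht
  · have := key 0 t ht
    rwa [F.φ_zero, F.dist_comm] at this

/-- The maximal invariant set in `U`. -/
def maxInv (Y : P) (U : Set M) : Set M := {x | ∀ t, F.φ Y t x ∈ U}

theorem maxInv_subset (Y : P) (U : Set M) : F.maxInv Y U ⊆ U := fun x hx ↦ by
  simpa [F.φ_zero] using hx 0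

theorem maxInv_inv {U : Set M} {x : M} (hx : x ∈ F.maxInv Y U) (t : ℝ) :
    F.φ Y t x ∈ F.maxInv Y U := fun s ↦ by
  rw [← F.φ_add]
  exact hx _

theorem rev_maxInv (U : Set M) : F.rev.maxInv Y U = F.maxInv Y U := by
  ext x
  refine ⟨fun h t ↦ ?_, fun h t ↦ h (-t)⟩
  have := h (-t)
  change F.φ Y (- -t) x ∈ U at this
  rwa [neg_neg] at this

/-- The filter of the pairs `(Y, x)` such that `Y` is close to `X` and the whole `Y`-orbit of `x`
is close to `Λ`. -/
def near (X : P) (Λ : Set M) : Filter (P × M) :=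
  comap (fun z : P × M ↦ (z.1, range fun t ↦ F.φ z.1 t z.2)) (𝓝 X ×ˢ (𝓝ˢ Λ).smallSets)

/-- Encoding the two neighbourhoods of the theorem in a single filter lets finitely many conclusions
be intersected, and contradictions be reached along ultrafilters. -/
theorem eventually_near_iff {p : P × M → Prop} : (∀ᶠ z in F.near X Λ, p z) ↔
    ∃ 𝒰 ∈ 𝓝 X, ∃ U ∈ 𝓝ˢ Λ, ∀ Y ∈ 𝒰, ∀ x ∈ F.maxInv Y U, p (Y, x) := by
  rw [near, eventually_comap]
  constructor
  · intro h
    rw [eventually_prod_iff] at h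
    obtain ⟨pa, ha, pb, hb, h⟩ := h
    rw [eventually_smallSets] at hb
    obtain ⟨s, hs, hsb⟩ := hb
    refine ⟨_, ha, s, hs, fun Y hY x hx ↦ h hY (hsb (range fun t ↦ F.φ Y t x) ?_) (Y, x) rfl⟩
    rintro _ ⟨t, rfl⟩
    exact hx t
  · rintro ⟨𝒰, h𝒰, U, hU, h⟩
    rw [eventually_prod_iff]
    refine ⟨_, h𝒰, fun s ↦ s ⊆ U, eventually_smallSets.2 ⟨U, hU, fun _ ↦ id⟩, ?_⟩
    rintro Y hY s hs z hz
    rw [Prod.ext_iff] at hz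
    obtain ⟨rfl, rfl⟩ := hz
    exact h _ hY _ fun t ↦ hs ⟨t, rfl⟩

variable {F} in
-- The filter only sees whole orbits, so it is invariant under the flows.
theorem eventually_near_orbit {p : P × M → Prop} (h : ∀ᶠ z in F.near X Λ, p z) :
    ∀ᶠ z in F.near X Λ, ∀ t, p (z.1, F.φ z.1 t z.2) := by
  rw [eventually_near_iff] at h ⊢
  obtain ⟨𝒰, h𝒰, U, hU, h⟩ := h
  exact ⟨𝒰, h𝒰, U, hU, fun Y hY x hx t ↦ h Y hY _ (F.maxInv_inv hx t)⟩

theorem tendsto_near_φ (t : ℝ) :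
    Tendsto (fun z : P × M ↦ (z.1, F.φ z.1 t z.2)) (F.near X Λ) (F.near X Λ) :=
  fun _ hs ↦ (eventually_near_orbit hs).mono fun _ hz ↦ hz t

theorem rev_near : F.rev.near X Λ = F.near X Λ := by
  ext s
  change (∀ᶠ z in _, z ∈ s) ↔ ∀ᶠ z in _, z ∈ s
  simp only [eventually_near_iff, rev_maxInv]

theorem tendsto_near_fst : Tendsto (fun z : P × M ↦ z.1) (F.near X Λ) (𝓝 X) := fun 𝒰 h𝒰 ↦
  F.eventually_near_iff.2 ⟨𝒰, h𝒰, univ, univ_mem, fun _ hY _ _ ↦ hY⟩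

theorem tendsto_near_snd : Tendsto (fun z : P × M ↦ z.2) (F.near X Λ) (𝓝ˢ Λ) := fun U hU ↦
  F.eventually_near_iff.2 ⟨univ, univ_mem, U, hU, fun Y _ _ hx ↦ F.maxInv_subset Y U hx⟩

theorem mem_of_tendsto_near [RegularSpace M] (hΛ : IsClosed Λ) {Z : Type*} {g : Filter Z} [g.NeBot]
    {f : Z → P × M} (hf : Tendsto f g (F.near X Λ)) {y : M}
    (hy : Tendsto (fun z ↦ (f z).2) g (𝓝 y)) : y ∈ Λ := by
  by_contra h
  rw [← hΛ.closure_eq, ← disjoint_nhdsSet_nhds] at h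
  have h1 : Tendsto (fun z ↦ (f z).2) g (𝓝ˢ Λ) := F.tendsto_near_snd.comp hf
  exact (NeBot.ne inferInstance : map (fun z ↦ (f z).2) g ≠ ⊥) (bot_unique (h h1 hy))

/-- The direction of the vector field. -/
def dir (z : P × M) : M × H := (z.2, ‖F.ξ z.1 z.2‖⁻¹ • F.ξ z.1 z.2)

/-- The pairs `(Y, x)` with `x` a regular point of `Y`. -/
def regular : Set (P × M) := {z | F.ξ z.1 z.2 ≠ 0}

/-- The direction of the vector field at a regular point, as a line. -/
def dirLine {z : P × M} (h : z ∈ F.regular) : F.Line :=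
  ⟨F.dir z, by simp [dir, norm_smul, norm_ne_zero_iff.2 h], by simp [dir, F.pr_ξ]⟩

theorem lineFlow_dirLine {x : M} (h : (Y, x) ∈ F.regular) (t : ℝ) :
    F.lineFlow Y t (F.dirLine h) =
      F.dirLine (z := (Y, F.φ Y t x)) (F.ξ_φ_ne_zero h t) := by
  refine Subtype.ext (Prod.ext rfl ?_)
  have h1 : 0 < ‖F.ξ Y x‖ := norm_pos_iff.2 h
  simp only [lineFlow, dirLine, dir, map_smul, F.D_ξ, norm_smul, norm_inv, norm_norm, smul_smul]
  congr 1
  field_simp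

/-- The limits of the directions of the fields close to `X` at the regular points whose orbits
are close to `Λ`. -/
def limLines (X : P) (Λ : Set M) : Set F.Line :=
  -- The cluster points are taken in `M × H`, since `dir` is not a unit vector at singular points.
  {b | MapClusterPt b.1 (F.near X Λ ⊓ 𝓟 F.regular) F.dir}

theorem rev_limLines : F.rev.limLines X Λ = F.limLines X Λ := by
  unfold limLines
  rw [F.rev_near]
  rfl

theorem isClosed_limLines : IsClosed (F.limLines X Λ) :=
  (isClosed_setOfPred_clusterPt (f := map F.dir (F.near X Λ ⊓ 𝓟 F.regular))).preimage
    F.continuous_line_val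

theorem mem_limLines_iff {b : F.Line} : b ∈ F.limLines X Λ ↔
    ∃ g : Ultrafilter (P × M), ↑g ≤ F.near X Λ ∧ F.regular ∈ g ∧ Tendsto F.dir g (𝓝 b.1) := by
  change MapClusterPt _ _ _ ↔ _
  rw [mapClusterPt_iff_ultrafilter]
  simp only [le_inf_iff, le_principal_iff, Ultrafilter.mem_coe, and_assoc]

theorem exists_limLine [CompactSpace M] {g : Ultrafilter (P × M)} (hg : ↑g ≤ F.near X Λ)
    (hr : F.regular ∈ g) : ∃ b ∈ F.limLines X Λ, Tendsto F.dir g (𝓝 b.1) := by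
  have : Nonempty P := ⟨X⟩
  have hc : IsCompact {z : M × H | ‖z.2‖ = 1 ∧ F.pr z.1 z.2 = z.2} :=
    isCompact_iff_compactSpace.2 (inferInstanceAs (CompactSpace F.Line))
  obtain ⟨b, hb, hgb⟩ := hc.ultrafilter_le_nhds (g.map F.dir) (by
    rw [le_principal_iff, Ultrafilter.mem_coe, Ultrafilter.mem_map]
    exact mem_of_superset hr fun z hz ↦ (F.dirLine hz).2)
  exact ⟨⟨b, hb⟩, F.mem_limLines_iff.2 ⟨g, hg, hr, hgb⟩, hgb⟩

theorem limLines_subset [RegularSpace M] (hΛ : IsClosed Λ) {b : F.Line}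
    (hb : b ∈ F.limLines X Λ) : b.1.1 ∈ Λ := by
  obtain ⟨g, hg, -, h⟩ := F.mem_limLines_iff.1 hb
  exact F.mem_of_tendsto_near hΛ (f := id) hg ((continuous_fst.tendsto _).comp h)

/-- Sliding the approximating regular points along their orbits preserves the filter and moves their
directions by the flow on lines. -/
theorem limLines_inv {b : F.Line} (hb : b ∈ F.limLines X Λ) (t : ℝ) :
    F.lineFlow X t b ∈ F.limLines X Λ := by
  obtain ⟨g, hg, hr, h⟩ := F.mem_limLines_iff.1 hb
  refine F.mem_limLines_iff.2 ⟨g.map fun z ↦ (z.1, F.φ z.1 t z.2), ?_, ?_, ?_⟩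
  · exact (F.tendsto_near_φ t).mono_left hg
  · rw [Ultrafilter.mem_map]
    exact mem_of_superset hr fun z hz ↦ F.ξ_φ_ne_zero hz t
  · have h1 : Tendsto (fun z : P × M ↦ z.1) g (𝓝 X) := F.tendsto_near_fst.mono_left hg
    have h2 : Tendsto (fun z : P × M ↦ F.D z.1 t (F.dir z).1 (F.dir z).2) g
        (𝓝 (F.D X t b.1.1 b.1.2)) := by
      have c : Continuous fun z : P × M × H ↦ F.D z.1 t z.2.1 z.2.2 :=
        F.tan.continuous_A_apply.comp (f := fun z : P × M × H ↦ (z.1, t, z.2.1, z.2.2))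
          (by fun_prop)
      exact (c.tendsto (X, b.1)).comp (h1.prodMk_nhds h)
    have h3 : Tendsto (fun z : P × M ↦ F.φ z.1 t (F.dir z).1) g (𝓝 (F.φ X t b.1.1)) := by
      have c : Continuous fun z : P × M × H ↦ F.φ z.1 t z.2.1 :=
        F.continuous_φ.comp (f := fun z : P × M × H ↦ (z.1, t, z.2.1)) (by fun_prop)
      exact (c.tendsto (X, b.1)).comp (h1.prodMk_nhds h)
    have h4 := h3.prodMk_nhds ((h2.norm.inv₀ (Line.D_pos X t b).ne').smul h2)
    refine tendsto_map'_iff.2 (Tendsto.congr' ?_ h4)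
    filter_upwards [hr] with z hz
    exact congrArg Subtype.val (F.lineFlow_dirLine hz t)

/-- Where `X` does not vanish, the direction depends continuously on the field and the point, so
only one limit is possible. -/
theorem limLines_regular [T2Space M] {b : F.Line} (hb : b ∈ F.limLines X Λ)
    (hx : (X, b.1.1) ∈ F.regular) : b = F.dirLine hx := by
  obtain ⟨g, hg, -, h⟩ := F.mem_limLines_iff.1 hb
  have h1 : Tendsto (fun z : P × M ↦ z.1) g (𝓝 X) := F.tendsto_near_fst.mono_left hg
  have h2 : Tendsto (fun z : P × M ↦ z.2) g (𝓝 b.1.1) := (continuous_fst.tendsto _).comp h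
  have h3 : Tendsto (fun z : P × M ↦ F.ξ z.1 z.2) g (𝓝 (F.ξ X b.1.1)) :=
    (F.continuous_ξ.tendsto (X, b.1.1)).comp (h1.prodMk_nhds h2)
  have h4 := (h3.norm.inv₀ (norm_ne_zero_iff.2 hx)).smul h3
  exact Subtype.ext (tendsto_nhds_unique h (h2.prodMk_nhds h4))

/-- Along an ultrafilter of exceptional pairs the directions would converge, by compactness, to a
limit line; `O` is a neighbourhood of this limit, a contradiction. -/
theorem eventually_near_dirLine [CompactSpace M] {O : Set (P × F.Line)} (hO : IsOpen O)
    (h : ∀ b ∈ F.limLines X Λ, (X, b) ∈ O) :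
    ∀ᶠ z in F.near X Λ, ∀ hz : z ∈ F.regular, (z.1, F.dirLine hz) ∈ O := by
  by_contra hcon
  rw [not_eventually, frequently_iff_neBot] at hcon
  let g := Ultrafilter.of (F.near X Λ ⊓ 𝓟 {z | ¬∀ hz : z ∈ F.regular, (z.1, F.dirLine hz) ∈ O})
  have hg := Ultrafilter.of_le (F.near X Λ ⊓
    𝓟 {z | ¬∀ hz : z ∈ F.regular, (z.1, F.dirLine hz) ∈ O})
  have hg1 : ↑g ≤ F.near X Λ := hg.trans inf_le_left
  have hg2 : ∀ᶠ z in (g : Filter (P × M)), ¬∀ hz : z ∈ F.regular, (z.1, F.dirLine hz) ∈ O :=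
    hg (mem_inf_of_right (mem_principal_self _))
  have hr : F.regular ∈ g := by
    filter_upwards [hg2] with z hz
    by_contra h
    exact hz fun h' ↦ absurd h' h
  obtain ⟨b, hb, hgb⟩ := F.exists_limLine hg1 hr
  classical
  let f : P × M → F.Line := fun z ↦ if hz : z ∈ F.regular then F.dirLine hz else b
  have hf : Tendsto f g (𝓝 b) := by
    refine tendsto_subtype_rng.2 ?_
    refine Tendsto.congr' ?_ hgb
    filter_upwards [hr] with z hz
    simp only [f, dif_pos hz]
    rfl
  have h1 := (F.tendsto_near_fst.mono_left hg1).prodMk_nhds hf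
  have h2 := h1 (hO.mem_nhds (h b hb))
  have h3 : ∀ᶠ z in (g : Filter (P × M)), False := by
    filter_upwards [hg2, h2, hr] with z hz1 hz2 hz
    refine hz1 fun _ ↦ ?_
    simp only [mem_preimage, f, dif_pos hz] at hz2
    exact hz2
  exact g.neBot.ne (by simpa using h3)

end FlowData

/-! ### The condition at a singularity and the lines in the complementary bundle -/

theorem exists_projection {H : Type*} [NormedAddCommGroup H] [InnerProductSpace ℝ H]
    [FiniteDimensional ℝ H] {E G : Submodule ℝ H} (h : Disjoint E G) :
    ∃ p : H →L[ℝ] H, (∀ v ∈ E, p v = v) ∧ ∀ w ∈ G, p w = 0 := by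
  obtain ⟨G', hG, hc⟩ := h.symm.exists_isCompl
  exact ⟨LinearMap.toContinuousLinearMap (E.projection G' hc.symm),
    fun v hv ↦ Submodule.projection_apply_of_mem_left hc.symm hv,
    fun w hw ↦ (Submodule.projection_apply_eq_zero_iff hc.symm).2 (hG hw)⟩

namespace FlowData

variable {P M H : Type*} [TopologicalSpace P] [TopologicalSpace M]
  [NormedAddCommGroup H] [InnerProductSpace ℝ H] [FiniteDimensional ℝ H]
  {F : FlowData P M H} {X Y : P} {Λ : Set M} {σ : M} {E G : Submodule ℝ H} {i : ℕ}

variable (F Y) in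
/-- The strong stable set associated to the complementary direction `G`. -/
def strongStable (σ : M) (G : Submodule ℝ H) : Set M :=
  {y | ∃ l l' c : ℝ, 0 < l ∧ l' < l ∧
    (∀ t : ℝ, 0 ≤ t → F.dist (F.φ Y t y) σ ≤ ENNReal.ofReal (c * Real.exp (-(l * t)))) ∧
    (∀ t : ℝ, 0 ≤ t → ∀ w ∈ G, ‖F.D Y (-t) σ w‖ ≤ c * Real.exp (l' * t) * ‖w‖)}

variable (F Y Λ) in
/-- `T_σ M = E ⊕ G` is dominated, `E` is contracted of dimension `i` and the strong stable set of
`σ` meets `Λ` at most at `σ`. -/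
structure IsEscape (i : ℕ) (σ : M) (E G : Submodule ℝ H) : Prop where
  split : F.tan.IsSplit Y {σ} (fun _ ↦ E) (fun _ ↦ G) i
  dom : ∃ η > 0, ∃ T > 0, F.tan.DomAt Y σ E G η T
  contr : ∃ η > 0, ∃ T > 0, ∀ t ≥ T, ∀ v ∈ E, ‖F.D Y t σ v‖ ≤ Real.exp (-(η * t)) * ‖v‖
  escape : ∀ y ∈ Λ, y ∈ F.strongStable Y σ G → y = σ

theorem IsEscape.mono {Λ' : Set M} (h : F.IsEscape Y Λ i σ E G) (hΛ : Λ' ⊆ Λ) :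
    F.IsEscape Y Λ' i σ E G :=
  ⟨h.split, h.dom, h.contr, fun y hy ↦ h.escape y (hΛ hy)⟩

variable (F) in
/-- The lines at `σ` contained in `G`. -/
def linesIn (σ : M) (G : Submodule ℝ H) : Set F.Line := {b | b.1.1 = σ ∧ b.1.2 ∈ G}

theorem isClosed_linesIn [T1Space M] : IsClosed (F.linesIn σ G) := by
  have h1 : IsClosed {b : F.Line | b.1.1 = σ} :=
    isClosed_singleton.preimage (continuous_fst.comp F.continuous_line_val)
  exact h1.inter ((Submodule.closed_of_finiteDimensional G).preimage
    (continuous_snd.comp F.continuous_line_val))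

theorem ext_A_apply (Y : P) (t : ℝ) (b : F.Line) (v : H) :
    F.ext.A Y t b v = orthProj (F.lineFlow Y t b).1.2 (F.D Y t b.1.1 v) :=
  F.orthProj_D_orthProj (F.lineFlow Y t b).2.1 (F.D_line Y t b) v

theorem ext_A_orthProj (Y : P) (t : ℝ) (b : F.Line) (v : H) :
    F.ext.A Y t b (orthProj b.1.2 v) = orthProj (F.lineFlow Y t b).1.2 (F.D Y t b.1.1 v) := by
  rw [ext_A_apply]
  exact F.orthProj_D_orthProj (F.lineFlow Y t b).2.1 (F.D_line Y t b) v

theorem linesIn_inv (h : F.tan.IsSplit Y {σ} (fun _ ↦ E) (fun _ ↦ G) i) {b : F.Line}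
    (hb : b ∈ F.linesIn σ G) (t : ℝ) : F.lineFlow Y t b ∈ F.linesIn σ G := by
  obtain ⟨h1, h2⟩ := hb
  refine ⟨?_, Submodule.smul_mem _ _ ?_⟩
  · change F.φ Y t b.1.1 = σ
    rw [h1]
    exact h.inv σ rfl t
  · rw [h1]
    exact h.map_right σ rfl t _ h2

variable (i) in
/-- Over the lines contained in `G`, the projections of `E` and `G` split the normal space. -/
theorem isSplit_linesIn (h : F.tan.IsSplit Y {σ} (fun _ ↦ E) (fun _ ↦ G) i) :
    F.ext.IsSplit Y (F.linesIn σ G) (fun b ↦ E.map (orthProj b.1.2).toLinearMap)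
      (fun b ↦ G.map (orthProj b.1.2).toLinearMap) i where
  inv b hb t := linesIn_inv h hb t
  sup_eq b hb := by
    have : Nonempty P := ⟨Y⟩
    rw [← Submodule.map_sup, h.sup_eq σ rfl]
    ext v
    rw [F.mem_ext_fib, ← hb.1]
    constructor
    · rintro ⟨w, hw, rfl⟩
      have hw' := F.mem_tan_fib.1 hw
      refine ⟨?_, inner_orthProj b.2.1 w⟩
      simp only [ContinuousLinearMap.coe_coe, orthProj_apply, map_sub, map_smul, hw', b.2.2]
    · rintro ⟨h1, h2⟩
      exact ⟨v, F.mem_tan_fib.2 h1, orthProj_of_inner_eq_zero h2⟩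
  disj b hb := by
    rw [Submodule.disjoint_def]
    rintro _ ⟨e, he, rfl⟩ ⟨g, hg, hge⟩
    simp only [ContinuousLinearMap.coe_coe, orthProj_apply] at hge ⊢
    have : e ∈ G := by
      have e1 : e = g - inner ℝ b.1.2 g • b.1.2 + inner ℝ b.1.2 e • b.1.2 := by
        rw [hge]; simp
      rw [e1]
      exact G.add_mem (G.sub_mem hg (G.smul_mem _ hb.2)) (G.smul_mem _ hb.2)
    rw [Submodule.disjoint_def.1 (h.disj σ rfl) e he this]
    simp
  rank b hb := by
    have hinj : Function.Injective ((orthProj b.1.2).toLinearMap.domRestrict E) := by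
      refine (injective_iff_map_eq_zero _).2 fun x hx ↦ ?_
      have hx' : (x : H) - inner ℝ b.1.2 (x : H) • b.1.2 = 0 := by
        rw [← orthProj_apply]
        exact hx
      have hxG : (x : H) ∈ G := by
        rw [sub_eq_zero.1 hx']
        exact G.smul_mem _ hb.2
      exact Subtype.ext (Submodule.disjoint_def.1 (h.disj σ rfl) x x.2 hxG)
    have h2 := LinearMap.finrank_range_of_inj hinj
    rw [LinearMap.range_domRestrict] at h2
    rw [h2]
    exact h.rank σ rfl
  map_left b hb t := by
    rintro _ ⟨e, he, rfl⟩
    refine ⟨F.D Y t b.1.1 e, ?_, (ext_A_orthProj Y t b e).symm⟩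
    rw [hb.1]
    exact h.map_left σ rfl t e he
  map_right b hb t := by
    rintro _ ⟨e, he, rfl⟩
    refine ⟨F.D Y t b.1.1 e, ?_, (ext_A_orthProj Y t b e).symm⟩
    rw [hb.1]
    exact h.map_right σ rfl t e he

/-- Let `u ∈ G`. The component of a vector in `E` is recovered from its projection orthogonal to `u`
by a fixed map killing `G`. On the side of `G`, projecting orthogonally amounts to adding multiples
of `u`, which stays in `G`. Domination passes to the projections up to a constant, absorbed by half
of the rate. -/
theorem exists_isDom_linesIn (h : F.tan.IsSplit Y {σ} (fun _ ↦ E) (fun _ ↦ G) i)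
    (hd : ∃ η > 0, ∃ T > 0, F.tan.DomAt Y σ E G η T) :
    ∃ η > 0, ∃ T > 0, F.ext.IsDom Y (F.linesIn σ G)
      (fun b ↦ E.map (orthProj b.1.2).toLinearMap)
      (fun b ↦ G.map (orthProj b.1.2).toLinearMap) η T := by
  obtain ⟨η, hη, T, hT, hd⟩ := hd
  obtain ⟨p, hpE, hpG⟩ := exists_projection (h.disj σ rfl)
  have hη2 : 0 < η / 2 := by positivity
  have h1 : Tendsto (fun t : ℝ ↦ ‖p‖ * Real.exp (-(η / 2 * t))) atTop (𝓝 0) := by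
    simpa using (tendsto_exp_neg_mul hη2).const_mul ‖p‖
  obtain ⟨T', hT'⟩ := eventually_atTop.1 (h1.eventually (gt_mem_nhds one_pos))
  refine ⟨η / 2, hη2, max T T', lt_max_of_lt_left hT, fun b hb t ht ↦ ?_⟩
  rintro _ ⟨e, he, rfl⟩ _ ⟨g, hg, rfl⟩
  have hbσ := hb.1
  simp only [ContinuousLinearMap.coe_coe]
  rw [ext_A_orthProj, ext_A_orthProj]
  set w := orthProj b.1.2 g with hw
  have hwG : w ∈ G := by
    rw [hw, orthProj_apply]
    exact G.sub_mem hg (G.smul_mem _ hb.2)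
  -- The projection orthogonal to the image of `u` is realized before applying the tangent flow, by
  -- adding a multiple of `u`. Since `w` is orthogonal to `u`, this does not shorten `w`.
  obtain ⟨c, hc⟩ : ∃ c : ℝ, orthProj (F.lineFlow Y t b).1.2 (F.D Y t b.1.1 g) =
      F.D Y t b.1.1 (w + c • b.1.2) := by
    have e1 : F.D Y t b.1.1 g = F.D Y t b.1.1 (w + inner ℝ b.1.2 g • b.1.2) := by
      rw [hw, orthProj_apply]; simp
    rw [orthProj_apply]
    refine ⟨inner ℝ b.1.2 g - inner ℝ (F.lineFlow Y t b).1.2 (F.D Y t b.1.1 g) *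
      ‖F.D Y t b.1.1 b.1.2‖⁻¹, ?_⟩
    set k := inner ℝ (F.lineFlow Y t b).1.2 (F.D Y t b.1.1 g)
    rw [e1]
    simp only [map_add, map_smul, sub_smul, mul_smul, lineFlow, map_sub]
    abel
  have hle : ‖w‖ ≤ ‖w + c • b.1.2‖ := by
    have : orthProj b.1.2 (w + c • b.1.2) = w := by
      rw [map_add, map_smul, orthProj_self b.2.1, smul_zero, add_zero,
        orthProj_of_inner_eq_zero (inner_orthProj b.2.1 g)]
    calc ‖w‖ = ‖orthProj b.1.2 (w + c • b.1.2)‖ := by rw [this]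
      _ ≤ _ := norm_orthProj_le b.2.1 _
  have hwc : w + c • b.1.2 ∈ G := G.add_mem hwG (G.smul_mem _ hb.2)
  have h2 := hd t (le_of_max_le_left ht) e he _ hwc
  have h3 : ‖e‖ ≤ ‖p‖ * ‖orthProj b.1.2 e‖ := by
    have : p (orthProj b.1.2 e) = e := by
      rw [orthProj_apply, map_sub, map_smul, hpE e he, hpG _ hb.2, smul_zero, sub_zero]
    calc ‖e‖ = ‖p (orthProj b.1.2 e)‖ := by rw [this]
      _ ≤ _ := p.le_opNorm _
  have h4 := (hT' t (le_of_max_le_right ht)).le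
  rw [hc, hbσ]
  have hexp : Real.exp (-(η * t)) = Real.exp (-(η / 2 * t)) * Real.exp (-(η / 2 * t)) := by
    rw [← Real.exp_add]; ring_nf
  calc ‖orthProj (F.lineFlow Y t b).1.2 (F.D Y t σ e)‖ * ‖w‖
      ≤ ‖F.D Y t σ e‖ * ‖w + c • b.1.2‖ := by
        gcongr
        exact norm_orthProj_le (F.lineFlow Y t b).2.1 _
    _ ≤ Real.exp (-(η * t)) * (‖e‖ * ‖F.D Y t σ (w + c • b.1.2)‖) := h2
    _ ≤ Real.exp (-(η * t)) * ((‖p‖ * ‖orthProj b.1.2 e‖) * ‖F.D Y t σ (w + c • b.1.2)‖) := by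
        gcongr
    _ = Real.exp (-(η / 2 * t)) * (‖p‖ * Real.exp (-(η / 2 * t))) *
        (‖orthProj b.1.2 e‖ * ‖F.D Y t σ (w + c • b.1.2)‖) := by
        rw [hexp]; ring
    _ ≤ Real.exp (-(η / 2 * t)) * 1 *
        (‖orthProj b.1.2 e‖ * ‖F.D Y t σ (w + c • b.1.2)‖) := by gcongr
    _ = _ := by rw [mul_one]

end FlowData

/-! ### Limit lines at a singularity lie in the complementary bundle -/

theorem exists_eventually_forall_le {P Q : Type*} [TopologicalSpace P] [TopologicalSpace Q]
    {f : P × Q → ℝ} (hf : Continuous f) {S : Set Q} (hS : IsCompact S) (X : P) :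
    ∃ c > 0, ∀ᶠ Y in 𝓝 X, ∀ q ∈ S, f (Y, q) ≤ c := by
  obtain ⟨c, hc⟩ := hS.exists_bound_of_continuousOn (f := fun q ↦ f (X, q))
    (hf.comp (by fun_prop : Continuous fun q : Q ↦ (X, q))).continuousOn
  refine ⟨max c 0 + 1, by positivity, hS.eventually_forall_of_forall_eventually fun q hq ↦ ?_⟩
  have h1 : f (X, q) < max c 0 + 1 :=
    ((le_abs_self _).trans ((hc q hq).trans (le_max_left _ _))).trans_lt (lt_add_one _)
  exact ((hf.tendsto (X, q)).eventually (gt_mem_nhds h1)).mono fun z hz ↦ hz.le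

/-- The constants of a cone field around a contracted subspace `E`. -/
theorem exists_aperture {k : ℝ} (hk : 1 < k) : ∃ ε > 0, ε < 1 ∧ 1 + ε < k * (1 - ε) := by
  refine ⟨(k - 1) / (2 * (k + 1)), by apply div_pos <;> linarith, ?_, ?_⟩
  · rw [div_lt_one (by linarith)]
    linarith
  · have h1 : (k - 1) / (2 * (k + 1)) * (k + 1) = (k - 1) / 2 := by
      field_simp
    nlinarith

theorem exists_floor_mul_add {τ : ℝ} (hτ : 0 < τ) {r : ℝ} (hr : 0 ≤ r) :
    ∃ j : ℕ, ∃ s ∈ Icc 0 τ, r = s + j * τ := by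
  have h1 := Nat.floor_le (div_nonneg hr hτ.le)
  have h2 := Nat.lt_floor_add_one (r / τ)
  rw [le_div_iff₀ hτ] at h1
  rw [div_lt_iff₀ hτ] at h2
  exact ⟨⌊r / τ⌋₊, r - ⌊r / τ⌋₊ * τ, ⟨by linarith, by linarith⟩, by ring⟩

namespace FlowData

variable {P M H : Type*} [TopologicalSpace P] [TopologicalSpace M]
  [NormedAddCommGroup H] [InnerProductSpace ℝ H] [FiniteDimensional ℝ H]
  {F : FlowData P M H} {X Y : P} {Λ : Set M} {σ : M} {E G : Submodule ℝ H} {i : ℕ}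

/-- Pieces of orbit of unit duration have lengths bounded by a geometric series of ratio `exp (-l)`.
The bound does not depend on `T`, which may then tend to infinity. -/
theorem dist_le_of_decay {y : M} {l c T : ℝ} (hl : 0 < l) (hc : 0 ≤ c)
    (h : ∀ r ∈ Icc 0 T, ‖F.ξ Y (F.φ Y r y)‖ ≤ c * Real.exp (-(l * r))) {s : ℝ}
    (hs : s ∈ Icc 0 T) : F.dist (F.φ Y s y) (F.φ Y T y) ≤
      ENNReal.ofReal (c / (1 - Real.exp (-l)) * Real.exp (-(l * s))) := by
  have he1 : Real.exp (-l) < 1 := by rw [Real.exp_lt_one_iff]; linarith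
  have hpos : 0 < 1 - Real.exp (-l) := by linarith
  have step : ∀ s s' : ℝ, 0 ≤ s → s ≤ s' → s' ≤ T → s' ≤ s + 1 →
      F.dist (F.φ Y s y) (F.φ Y s' y) ≤ ENNReal.ofReal (c * Real.exp (-(l * s))) := by
    intro s s' h0 h1 h2 h3
    refine (F.dist_φ_le Y y s s' h1 (c * Real.exp (-(l * s))) fun r hr ↦ ?_).trans ?_
    · refine (h r ⟨h0.trans hr.1, hr.2.trans h2⟩).trans ?_
      have := hr.1
      gcongr
    · refine ENNReal.ofReal_le_ofReal (mul_le_of_le_one_right (by positivity) (by linarith))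
  have key : ∀ n : ℕ, ∀ s : ℝ, 0 ≤ s → s ≤ T → T ≤ s + n →
      F.dist (F.φ Y s y) (F.φ Y T y) ≤
        ENNReal.ofReal (c / (1 - Real.exp (-l)) * Real.exp (-(l * s))) := by
    intro n
    induction n with
    | zero =>
      intro s _ h1 h2
      have : s = T := le_antisymm h1 (by simpa using h2)
      rw [this, F.dist_self]
      exact zero_le
    | succ n ih =>
      intro s h0 h1 h2
      push_cast at h2
      rcases le_total T (s + 1) with h3 | h3
      · refine (step s T h0 h1 le_rfl h3).trans (ENNReal.ofReal_le_ofReal ?_)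
        gcongr
        rw [le_div_iff₀ hpos]
        nlinarith [Real.exp_pos (-l)]
      · refine (F.dist_triangle _ (F.φ Y (s + 1) y) _).trans ?_
        refine (add_le_add (step s (s + 1) h0 (by linarith) h3 le_rfl)
          (ih (s + 1) (by linarith) h3 (by linarith))).trans ?_
        rw [← ENNReal.ofReal_add (by positivity) (by positivity)]
        refine ENNReal.ofReal_le_ofReal (le_of_eq ?_)
        have : Real.exp (-(l * (s + 1))) = Real.exp (-l) * Real.exp (-(l * s)) := by
          rw [← Real.exp_add]; ring_nf
        rw [this]
        field_simp
        ring
  obtain ⟨n, hn⟩ := exists_nat_ge (T - s)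
  exact key n s hs.1 hs.2 (by linarith)

theorem dist_le_of_tendsto {Z : Type*} {g : Filter Z} [g.NeBot] {f f' : Z → M} {a b : M}
    {r : ENNReal} (hf : Tendsto f g (𝓝 a)) (hf' : Tendsto f' g (𝓝 b))
    (h : ∀ᶠ z in g, F.dist (f z) (f' z) ≤ r) : F.dist a b ≤ r := by
  refine ENNReal.le_of_forall_pos_le_add fun ε hε _ ↦ ?_
  have hε2 : (0 : ENNReal) < (ε / 2 : NNReal) := by exact_mod_cast half_pos hε
  obtain ⟨z, h1, h2, h3⟩ := (h.and ((hf.eventually (F.eventually_dist_lt a _ hε2)).and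
    (hf'.eventually (F.eventually_dist_lt b _ hε2)))).exists
  calc F.dist a b ≤ F.dist a (f z) + F.dist (f z) b := F.dist_triangle _ _ _
    _ ≤ F.dist a (f z) + (F.dist (f z) (f' z) + F.dist (f' z) b) := by
        gcongr
        exact F.dist_triangle _ _ _
    _ ≤ (ε / 2 : NNReal) + (r + (ε / 2 : NNReal)) := by
        rw [F.dist_comm a]
        gcongr
    _ = r + ((ε / 2 : NNReal) + (ε / 2 : NNReal)) := by ring
    _ = r + ε := by rw [← ENNReal.coe_add, add_halves]

/-- A backward invariant cone field around the contracted direction of a singularity: vectors in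
the cones grow, backward, faster than the vectors of the complementary direction. -/
theorem exists_backward_cone (h : F.IsEscape X Λ i σ E G) (hE : E ≠ ⊥) :
    ∃ (p : H →L[ℝ] H) (τ κ g ε : ℝ), 0 < τ ∧ 0 < κ ∧ κ < 1 ∧ 0 < g ∧ κ * g < 1 ∧
      (∀ w ∈ G, ‖F.D X (-τ) σ w‖ ≤ g * ‖w‖) ∧
      (∀ᶠ z in 𝓝 (X, σ), ∀ v, F.pr z.2 v = v → v ≠ 0 → ‖v - p v‖ ≤ ε * ‖p v‖ →
        ‖F.D z.1 (-τ) z.2 v - p (F.D z.1 (-τ) z.2 v)‖ ≤ ε * ‖p (F.D z.1 (-τ) z.2 v)‖ ∧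
        ‖v‖ ≤ κ * ‖F.D z.1 (-τ) z.2 v‖) ∧
      ∀ u ∈ F.tan.fib X σ, u ∉ G → ∃ t, ‖F.D X (-t) σ u - p (F.D X (-t) σ u)‖ <
        ε * ‖p (F.D X (-t) σ u)‖ := by
  have : Nonempty P := ⟨X⟩
  obtain ⟨η₁, hη₁, T₁, hT₁, hd⟩ := h.dom
  obtain ⟨η₂, hη₂, T₂, hT₂, hc⟩ := h.contr
  obtain ⟨p, hpE, hpG⟩ := exists_projection (h.split.disj σ rfl)
  have hfix : ∀ t, F.φ X t σ = σ := fun t ↦ h.split.inv σ rfl t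
  have hEm : ∀ t, ∀ v ∈ E, F.D X t σ v ∈ E := h.split.map_left σ rfl
  have hGm : ∀ t, ∀ v ∈ G, F.D X t σ v ∈ G := h.split.map_right σ rfl
  have hET : E ≤ F.tan.fib X σ := h.split.left_le rfl
  have hGT : G ≤ F.tan.fib X σ := h.split.right_le rfl
  have hinv : ∀ t, ∀ v ∈ F.tan.fib X σ, F.D X t σ (F.D X (-t) σ v) = v := fun t v hv ↦ by
    have := F.tan.A_A_neg X σ hv t
    change F.D X t (F.φ X (-t) σ) (F.D X (-t) σ v) = v at this
    rwa [hfix] at this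
  set η := min η₁ η₂
  have hη : 0 < η := lt_min hη₁ hη₂
  have hrev : ∀ t ≥ T₁, ∀ v ∈ E, ∀ w ∈ G,
      ‖F.D X (-t) σ w‖ * ‖v‖ ≤ Real.exp (-(η * t)) * (‖w‖ * ‖F.D X (-t) σ v‖) := by
    intro t ht v hv w hw
    have := hd t ht _ (hEm (-t) v hv) _ (hGm (-t) w hw)
    change ‖F.D X t σ (F.D X (-t) σ v)‖ * _ ≤ _ * (_ * ‖F.D X t σ (F.D X (-t) σ w)‖) at this
    rw [hinv t v (hET hv), hinv t w (hGT hw)] at this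
    calc _ = ‖v‖ * ‖F.D X (-t) σ w‖ := by ring
      _ ≤ _ := this
      _ = Real.exp (-(η₁ * t)) * (‖w‖ * ‖F.D X (-t) σ v‖) := by ring
      _ ≤ _ := by
        have : η ≤ η₁ := min_le_left _ _
        have : 0 ≤ t := hT₁.le.trans ht
        gcongr
  set τ := max T₁ T₂
  have hτ : 0 < τ := lt_max_of_lt_left hT₁
  have hctr : ∀ v ∈ E, ‖F.D X τ σ v‖ ≤ Real.exp (-(η * τ)) * ‖v‖ := fun v hv ↦
    (hc τ (le_max_right _ _) v hv).trans (by
      have : η ≤ η₂ := min_le_right _ _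
      gcongr)
  obtain ⟨e₀, he₀, he₀n⟩ := Submodule.exists_mem_ne_zero_of_ne_bot hE
  have hcomp : IsCompact ((E : Set H) ∩ Metric.sphere 0 1) :=
    (isCompact_sphere (0 : H) 1).inter_left (Submodule.closed_of_finiteDimensional E)
  have hne : ((E : Set H) ∩ Metric.sphere 0 1).Nonempty :=
    ⟨‖e₀‖⁻¹ • e₀, E.smul_mem _ he₀, by simp [norm_smul, he₀n]⟩
  obtain ⟨v₀, ⟨hv₀E, hv₀1⟩, hmax⟩ := hcomp.exists_isMaxOn hne
    ((F.D X τ σ).continuous.norm.continuousOn)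
  rw [mem_sphere_zero_iff_norm] at hv₀1
  have hv₀ : v₀ ≠ 0 := norm_pos_iff.1 (by rw [hv₀1]; exact one_pos)
  set a := ‖F.D X τ σ v₀‖ with ha
  have ha0 : 0 < a := F.tan.A_pos X σ (hET hv₀E) hv₀ τ
  have haE : ∀ v ∈ E, ‖F.D X τ σ v‖ ≤ a * ‖v‖ := by
    intro v hv
    by_cases hv0 : v = 0
    · simp [hv0]
    have hvp := norm_pos_iff.2 hv0
    have := hmax (show ‖v‖⁻¹ • v ∈ _ from ⟨E.smul_mem _ hv, by simp [norm_smul, hv0]⟩)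
    simp only [mem_ofPred_eq, map_smul, norm_smul, norm_inv, norm_norm] at this
    rw [inv_mul_le_iff₀ hvp] at this
    linarith
  have hk : 1 < Real.exp (η / 2 * τ) := Real.one_lt_exp_iff.2 (by positivity)
  set k := Real.exp (η / 2 * τ) with hkdef
  have hkk : Real.exp (-(η * τ)) * (k * k) = 1 := by
    rw [hkdef, ← Real.exp_add, ← Real.exp_add, ← Real.exp_zero]; ring_nf
  have hexp : 0 < Real.exp (-(η * τ)) := Real.exp_pos _
  have haexp : a ≤ Real.exp (-(η * τ)) := by simpa [hv₀1] using hctr v₀ hv₀E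
  obtain ⟨ε, hε, hε1, hεk⟩ := exists_aperture hk
  -- `a` is the norm of the time-`τ` map on `E`, and `k = exp (η τ / 2)` spends half of the
  -- domination on the opening of the cone. Backward, vectors of the cone are expanded by at least
  -- `1 / (a k)` and those of `G` by at most `exp (-η τ) / a`. The product of the two constants is
  -- `exp (-η τ / 2)`, so the cone expands faster than `G`.
  refine ⟨p, τ, a * k, Real.exp (-(η * τ)) / a, ε, hτ, by positivity, ?_, by positivity, ?_, ?_,
    ?_, ?_⟩
  · calc a * k ≤ Real.exp (-(η * τ)) * k := by gcongr
      _ < Real.exp (-(η * τ)) * (k * k) := by gcongr; nlinarith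
      _ = 1 := hkk
  · have : a * k * (Real.exp (-(η * τ)) / a) = Real.exp (-(η * τ)) * k := by field_simp
    rw [this]
    calc Real.exp (-(η * τ)) * k < Real.exp (-(η * τ)) * (k * k) := by gcongr; nlinarith
      _ = 1 := hkk
  · intro w hw
    -- Domination is tested on `F.D X τ σ v₀`, of norm `a`, whose backward image is the unit vector
    -- `v₀`: it is the least expanded direction of `E` backward.
    have h1 := hrev τ (le_max_left _ _) _ (hEm τ v₀ hv₀E) w hw
    have h2 : F.D X (-τ) σ (F.D X τ σ v₀) = v₀ := by
      have := hinv (-τ) v₀ (hET hv₀E)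
      rwa [neg_neg] at this
    rw [h2, hv₀1, mul_one] at h1
    rw [div_mul_eq_mul_div, le_div_iff₀ ha0]
    exact h1
  · have hunit : ∀ᶠ z in 𝓝 (X, σ), ∀ v ∈ Metric.sphere (0 : H) 1,
        (F.pr z.2 v = v ∧ ‖v - p v‖ ≤ ε * ‖p v‖) →
        ‖F.D z.1 (-τ) z.2 v - p (F.D z.1 (-τ) z.2 v)‖ < ε * ‖p (F.D z.1 (-τ) z.2 v)‖ ∧
        ‖v‖ < a * k * ‖F.D z.1 (-τ) z.2 v‖ := by
      refine (isCompact_sphere (0 : H) 1).eventually_forall_of_forall_eventually fun v hv ↦ ?_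
      have hv1 : ‖v‖ = 1 := by simpa using hv
      have cD : Continuous fun z : (P × M) × H ↦ F.D z.1.1 (-τ) z.1.2 z.2 :=
        F.tan.continuous_A_apply.comp (f := fun z : (P × M) × H ↦ (z.1.1, -τ, z.1.2, z.2))
          (by fun_prop)
      have cp : Continuous fun z : (P × M) × H ↦ F.pr z.1.2 z.2 :=
        (F.continuous_pr.comp (by fun_prop : Continuous fun z : (P × M) × H ↦ z.1.2)).clm_apply
          continuous_snd
      have o1 : IsOpen {z : (P × M) × H | ‖F.D z.1.1 (-τ) z.1.2 z.2 -
          p (F.D z.1.1 (-τ) z.1.2 z.2)‖ < ε * ‖p (F.D z.1.1 (-τ) z.1.2 z.2)‖} :=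
        isOpen_lt (by fun_prop) (by fun_prop)
      have o2 : IsOpen {z : (P × M) × H | ‖z.2‖ < a * k * ‖F.D z.1.1 (-τ) z.1.2 z.2‖} :=
        isOpen_lt (by fun_prop) (by fun_prop)
      have c2 : IsClosed {z : (P × M) × H | ‖z.2 - p z.2‖ ≤ ε * ‖p z.2‖} :=
        isClosed_le (by fun_prop) (by fun_prop)
      refine eventually_imp_of_isClosed_isOpen (Z := (P × M) × H)
        (R := fun z ↦ F.pr z.1.2 z.2 = z.2 ∧ ‖z.2 - p z.2‖ ≤ ε * ‖p z.2‖)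
        (Q := fun z ↦ ‖F.D z.1.1 (-τ) z.1.2 z.2 - p (F.D z.1.1 (-τ) z.1.2 z.2)‖ <
          ε * ‖p (F.D z.1.1 (-τ) z.1.2 z.2)‖ ∧ ‖z.2‖ < a * k * ‖F.D z.1.1 (-τ) z.1.2 z.2‖)
        ((isClosed_eq cp continuous_snd).inter c2) (o1.inter o2) ?_
      rintro ⟨hvT, hvc⟩
      have hvT' : v ∈ E ⊔ G := by
        rw [h.split.sup_eq σ rfl]
        exact F.mem_tan_fib.2 hvT
      obtain ⟨e, he, w, hw, rfl⟩ := Submodule.mem_sup.1 hvT'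
      have hpv : p (e + w) = e := by rw [map_add, hpE e he, hpG w hw, add_zero]
      have hpD : p (F.D X (-τ) σ (e + w)) = F.D X (-τ) σ e := by
        rw [map_add, map_add, hpE _ (hEm _ e he), hpG _ (hGm _ w hw), add_zero]
      simp only [hpD]
      simp only [hpv, add_sub_cancel_left] at hvc
      have he0 : e ≠ 0 := by
        rintro rfl
        have : w = 0 := by simpa using hvc
        rw [this] at hv1
        simp at hv1
      have hep := norm_pos_iff.2 he0
      have hDe : 0 < ‖F.D X (-τ) σ e‖ := F.tan.A_pos X σ (hET he) he0 (-τ)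
      have hexp1 : Real.exp (-(η * τ)) < 1 := by
        rw [Real.exp_lt_one_iff]
        have := mul_pos hη hτ
        linarith
      have hDw : ‖F.D X (-τ) σ w‖ < ε * ‖F.D X (-τ) σ e‖ := by
        refine lt_of_mul_lt_mul_right ?_ hep.le
        calc ‖F.D X (-τ) σ w‖ * ‖e‖ ≤ Real.exp (-(η * τ)) * (‖w‖ * ‖F.D X (-τ) σ e‖) :=
              hrev τ (le_max_left _ _) e he w hw
          _ ≤ Real.exp (-(η * τ)) * ((ε * ‖e‖) * ‖F.D X (-τ) σ e‖) := by gcongr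
          _ < 1 * ((ε * ‖e‖) * ‖F.D X (-τ) σ e‖) := by gcongr
          _ = _ := by ring
      refine ⟨?_, ?_⟩
      · rw [map_add, add_sub_cancel_left]
        exact hDw
      · have h1 : ‖e‖ ≤ a * ‖F.D X (-τ) σ e‖ := by
          have := haE _ (hEm (-τ) e he)
          rwa [hinv τ e (hET he)] at this
        have h2 : ‖F.D X (-τ) σ e‖ - ‖F.D X (-τ) σ w‖ ≤ ‖F.D X (-τ) σ (e + w)‖ := by
          rw [map_add]
          have := norm_sub_norm_le (F.D X (-τ) σ e) (-F.D X (-τ) σ w)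
          rwa [norm_neg, sub_neg_eq_add] at this
        calc ‖e + w‖ ≤ ‖e‖ + ‖w‖ := norm_add_le _ _
          _ ≤ (1 + ε) * ‖e‖ := by linarith
          _ ≤ (1 + ε) * (a * ‖F.D X (-τ) σ e‖) := by gcongr
          _ < (k * (1 - ε)) * (a * ‖F.D X (-τ) σ e‖) := by gcongr
          _ = a * k * (‖F.D X (-τ) σ e‖ - ε * ‖F.D X (-τ) σ e‖) := by ring
          _ ≤ a * k * ‖F.D X (-τ) σ (e + w)‖ := by gcongr; linarith
    filter_upwards [hunit] with z hz v hvT hv0 hvc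
    have hvp := norm_pos_iff.2 hv0
    have := hz (‖v‖⁻¹ • v) (by simp [norm_smul, hv0]) ⟨by rw [map_smul, hvT], by
      rw [map_smul, ← smul_sub, norm_smul, norm_smul]
      calc _ ≤ ‖‖v‖⁻¹‖ * (ε * ‖p v‖) := by gcongr
        _ = _ := by ring⟩
    simp only [map_smul, ← smul_sub, norm_smul, norm_inv, norm_norm] at this
    have hvi := inv_pos.2 hvp
    refine ⟨le_of_mul_le_mul_left ?_ hvi, le_of_mul_le_mul_left ?_ hvi⟩
    · calc _ ≤ _ := this.1.le
        _ = _ := by ring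
    · calc _ ≤ _ := this.2.le
        _ = _ := by ring
  · intro u huT huG
    rw [← h.split.sup_eq σ rfl] at huT
    obtain ⟨e, he, w, hw, rfl⟩ := Submodule.mem_sup.1 huT
    have he0 : e ≠ 0 := by
      rintro rfl
      exact huG (by simpa using hw)
    have hep := norm_pos_iff.2 he0
    -- Backward in time the component in `E` prevails over the one in `G`, whatever their initial
    -- sizes.
    have hlim : Tendsto (fun t : ℝ ↦ Real.exp (-(η * t)) * ‖w‖) atTop (𝓝 0) := by
      simpa using (tendsto_exp_neg_mul hη).mul_const ‖w‖
    obtain ⟨t, ht, htT⟩ := ((hlim.eventually (gt_mem_nhds (show 0 < ε * ‖e‖ by positivity))).and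
      (eventually_ge_atTop T₁)).exists
    refine ⟨t, ?_⟩
    have hpD : p (F.D X (-t) σ (e + w)) = F.D X (-t) σ e := by
      rw [map_add, map_add, hpE _ (hEm _ e he), hpG _ (hGm _ w hw), add_zero]
    rw [hpD, map_add, add_sub_cancel_left]
    have hDe : 0 < ‖F.D X (-t) σ e‖ := F.tan.A_pos X σ (hET he) he0 (-t)
    refine lt_of_mul_lt_mul_right ?_ hep.le
    calc _ ≤ Real.exp (-(η * t)) * (‖w‖ * ‖F.D X (-t) σ e‖) := hrev t htT e he w hw
      _ = (Real.exp (-(η * t)) * ‖w‖) * ‖F.D X (-t) σ e‖ := by ring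
      _ < (ε * ‖e‖) * ‖F.D X (-t) σ e‖ := by gcongr
      _ = _ := by ring

end FlowData

namespace FlowData

variable {P M H : Type*} [TopologicalSpace P] [TopologicalSpace M]
  [NormedAddCommGroup H] [InnerProductSpace ℝ H] [FiniteDimensional ℝ H]
  {F : FlowData P M H} {X Y : P} {Λ : Set M} {σ : M} {E G : Submodule ℝ H} {i : ℕ}

theorem exists_norm_ξ_le [CompactSpace M] (F : FlowData P M H) (X : P) :
    ∃ c > 0, ∀ᶠ Y in 𝓝 X, ∀ x, ‖F.ξ Y x‖ ≤ c := by
  obtain ⟨c, hc, h⟩ := exists_eventually_forall_le F.continuous_ξ.norm isCompact_univ X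
  exact ⟨c, hc, h.mono fun Y hY x ↦ hY x (mem_univ x)⟩

theorem exists_norm_D_le [CompactSpace M] (F : FlowData P M H) (X : P) (a b : ℝ) :
    ∃ c > 0, ∀ᶠ Y in 𝓝 X, ∀ r ∈ Icc a b, ∀ x, ‖F.D Y r x‖ ≤ c := by
  obtain ⟨c, hc, h⟩ := exists_eventually_forall_le F.continuous_D.norm
    (isCompact_Icc.prod isCompact_univ : IsCompact (Icc a b ×ˢ (univ : Set M))) X
  exact ⟨c, hc, h.mono fun Y hY r hr x ↦ hY (r, x) ⟨hr, mem_univ x⟩⟩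

/-- The one-step bound is iterated and interpolated between multiples of `τ`. The absolute value of
`log g / τ` enters the constant because `g` may be smaller or larger than one. -/
theorem norm_D_neg_le_of_step {τ g : ℝ} (hτ : 0 < τ) (hg : 0 < g)
    (hfix : ∀ t, F.φ X t σ = σ) (hGm : ∀ t, ∀ w ∈ G, F.D X t σ w ∈ G)
    (hGT : G ≤ F.tan.fib X σ)
    (h : ∀ w ∈ G, ‖F.D X (-τ) σ w‖ ≤ g * ‖w‖) :
    ∃ c > 0, ∀ t : ℝ, 0 ≤ t → ∀ w ∈ G,
      ‖F.D X (-t) σ w‖ ≤ c * Real.exp (Real.log g / τ * t) * ‖w‖ := by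
  have cont : Continuous fun s : ℝ ↦ F.D X (-s) σ :=
    F.continuous_D.comp (f := fun s : ℝ ↦ (X, -s, σ)) (by fun_prop)
  obtain ⟨L, hL⟩ := isCompact_Icc.exists_bound_of_continuousOn (s := Icc 0 τ) cont.continuousOn
  have hstep : ∀ n : ℕ, ∀ w ∈ G, ‖F.D X (-(n * τ)) σ w‖ ≤ g ^ n * ‖w‖ := by
    intro n
    induction n with
    | zero =>
      intro w hw
      have : F.D X 0 σ w = w := F.tan.A_zero_apply_of_mem X σ (hGT hw)
      simp [this]
    | succ n ih =>
      intro w hw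
      have e : -(((n + 1 : ℕ) : ℝ) * τ) = -τ + -(n * τ) := by push_cast; ring
      rw [e, F.D_add, hfix]
      calc _ ≤ g * ‖F.D X (-(n * τ)) σ w‖ := h _ (hGm _ w hw)
        _ ≤ g * (g ^ n * ‖w‖) := by gcongr; exact ih w hw
        _ = _ := by ring
  have hL0 : 0 ≤ L := (norm_nonneg _).trans (hL 0 ⟨le_rfl, hτ.le⟩)
  refine ⟨(L + 1) * Real.exp (|Real.log g / τ| * τ), by positivity, fun t ht w hw ↦ ?_⟩
  obtain ⟨j, s, hs, rfl⟩ := exists_floor_mul_add hτ ht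
  have e : -(s + j * τ) = -s + -(j * τ) := by ring
  have hgj : g ^ j = Real.exp (Real.log g / τ * (j * τ)) := by
    have : Real.log g / τ * (j * τ) = j * Real.log g := by field_simp
    rw [this, Real.exp_nat_mul, Real.exp_log hg]
  have habs : Real.log g / τ * (j * τ) ≤ |Real.log g / τ| * τ + Real.log g / τ * (s + j * τ) := by
    have h1 : -(Real.log g / τ) * s ≤ |Real.log g / τ| * τ :=
      mul_le_mul (neg_le_abs _) hs.2 hs.1 (abs_nonneg _)
    linarith
  rw [e, F.D_add, hfix]
  calc _ ≤ ‖F.D X (-s) σ‖ * ‖F.D X (-(j * τ)) σ w‖ := (F.D X (-s) σ).le_opNorm _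
    _ ≤ (L + 1) * (g ^ j * ‖w‖) := by
      gcongr
      · exact (hL s hs).trans (by linarith)
      · exact hstep j w hw
    _ ≤ (L + 1) * (Real.exp (|Real.log g / τ| * τ + Real.log g / τ * (s + j * τ)) * ‖w‖) := by
      rw [hgj]
      gcongr
    _ = _ := by rw [Real.exp_add]; ring

/-- An orbit that starts in a backward invariant cone field has to leave its domain in backward
time; up to that moment, the norm of the field decays exponentially along the forward orbit. -/
theorem exists_exit {p : H →L[ℝ] H} {τ κ ε c : ℝ} (hκ : 0 < κ) (hκ1 : κ < 1) {W : Set (P × M)}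
    (hW : ∀ z ∈ W, ∀ v, F.pr z.2 v = v → v ≠ 0 → ‖v - p v‖ ≤ ε * ‖p v‖ →
        ‖F.D z.1 (-τ) z.2 v - p (F.D z.1 (-τ) z.2 v)‖ ≤ ε * ‖p (F.D z.1 (-τ) z.2 v)‖ ∧
        ‖v‖ ≤ κ * ‖F.D z.1 (-τ) z.2 v‖) (hY : ∀ x, ‖F.ξ Y x‖ ≤ c) {x : M} (hx : F.ξ Y x ≠ 0)
    (hcone : ‖F.ξ Y x - p (F.ξ Y x)‖ ≤ ε * ‖p (F.ξ Y x)‖) :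
    ∃ n : ℕ, (Y, F.φ Y (-(n * τ)) x) ∉ W ∧
      ∀ j ≤ n, ‖F.ξ Y (F.φ Y (-((n - j : ℕ) * τ)) x)‖ ≤ c * κ ^ j := by
  set y : ℕ → M := fun n ↦ F.φ Y (-(n * τ)) x with hy
  have hy0 : y 0 = x := by simp [hy, F.φ_zero]
  have hsucc : ∀ n, y (n + 1) = F.φ Y (-τ) (y n) := fun n ↦ by
    simp only [hy]
    rw [← F.φ_add]
    congr 1
    push_cast
    ring
  have hD : ∀ n, F.ξ Y (y (n + 1)) = F.D Y (-τ) (y n) (F.ξ Y (y n)) := fun n ↦ by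
    rw [F.D_ξ, hsucc]
  have key : ∀ n, (∀ j < n, (Y, y j) ∈ W) →
      ‖F.ξ Y (y n) - p (F.ξ Y (y n))‖ ≤ ε * ‖p (F.ξ Y (y n))‖ ∧
      ∀ j ≤ n, ‖F.ξ Y (y (n - j))‖ ≤ κ ^ j * ‖F.ξ Y (y n)‖ := by
    intro n
    induction n with
    | zero =>
      intro _
      refine ⟨by rwa [hy0], fun j hj ↦ ?_⟩
      obtain rfl : j = 0 := by omega
      simp
    | succ n ih =>
      intro h
      obtain ⟨h1, h2⟩ := ih fun j hj ↦ h j (by omega)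
      have h3 := hW (Y, y n) (h n (by omega)) _ (F.pr_ξ Y (y n)) (F.ξ_φ_ne_zero hx _) h1
      simp only [← hD] at h3
      refine ⟨h3.1, fun j hj ↦ ?_⟩
      rcases j with _ | j
      · simp
      · have e : n + 1 - (j + 1) = n - j := by omega
        rw [e]
        calc _ ≤ κ ^ j * ‖F.ξ Y (y n)‖ := h2 j (by omega)
          _ ≤ κ ^ j * (κ * ‖F.ξ Y (y (n + 1))‖) := by gcongr; exact h3.2
          _ = _ := by ring
  -- Without exit, the norm of the field at `x` would be at most `κ ^ n * c` for all `n`, and the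
  -- field would vanish at `x`.
  have hex : ∃ n, (Y, y n) ∉ W := by
    by_contra hcon
    push Not at hcon
    have h1 : Tendsto (fun n : ℕ ↦ κ ^ n * c) atTop (𝓝 0) := by
      simpa using (tendsto_pow_atTop_nhds_zero_of_lt_one hκ.le hκ1).mul_const c
    have h2 : ‖F.ξ Y x‖ ≤ 0 := ge_of_tendsto' h1 fun n ↦ by
      have := (key n fun j _ ↦ hcon j).2 n le_rfl
      rw [Nat.sub_self, hy0] at this
      exact this.trans (by gcongr; exact hY _)
    exact hx (norm_le_zero_iff.1 h2)
  classical
  refine ⟨Nat.find hex, Nat.find_spec hex, fun j hj ↦ ?_⟩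
  have := (key (Nat.find hex) fun j hj ↦ not_not.1 (Nat.find_min hex hj)).2 j hj
  refine this.trans ?_
  rw [mul_comm]
  gcongr
  exact hY _

/-- The limit lines over a singularity with an escaping strong stable direction are contained in the
complementary direction. -/
theorem IsEscape.limLines_mem [CompactSpace M] [T2Space M] (hΛ : IsClosed Λ)
    (h : F.IsEscape X Λ i σ E G) {b : F.Line} (hb : b ∈ F.limLines X Λ) (hbσ : b.1.1 = σ) :
    b.1.2 ∈ G := by
  by_contra hbG
  have hfix : ∀ t, F.φ X t σ = σ := fun t ↦ h.split.inv σ rfl t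
  have huT : b.1.2 ∈ F.tan.fib X σ := hbσ ▸ b.mem_fib X
  have hE : E ≠ ⊥ := by
    rintro rfl
    refine hbG ?_
    rwa [← h.split.sup_eq σ rfl, bot_sup_eq] at huT
  obtain ⟨p, τ, κ, g₀, ε, hτ, hκ, hκ1, hg₀, hκg, hG, hcone, henter⟩ := exists_backward_cone h hE
  -- A line outside `G` enters the open cone around `E` in backward time, and it remains a limit
  -- line.
  obtain ⟨t₀, ht₀⟩ := henter _ huT hbG
  have hb' := F.limLines_inv hb (-t₀)
  obtain ⟨g, hg, hr, hdir⟩ := F.mem_limLines_iff.1 hb'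
  have hσ' : (F.lineFlow X (-t₀) b).1.1 = σ := by
    change F.φ X (-t₀) b.1.1 = σ
    rw [hbσ, hfix]
  set u := (F.lineFlow X (-t₀) b).1.2 with hu
  have hucone : ‖u - p u‖ < ε * ‖p u‖ := by
    have hpos := Line.D_pos X (-t₀) b
    simp only [hu, lineFlow, map_smul, ← smul_sub, norm_smul, norm_inv, norm_norm]
    rw [mul_left_comm]
    refine mul_lt_mul_of_pos_left ?_ (inv_pos.2 hpos)
    rw [hbσ]
    exact ht₀
  have hY : Tendsto (fun z : P × M ↦ z.1) g (𝓝 X) := F.tendsto_near_fst.mono_left hg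
  have hx : Tendsto (fun z : P × M ↦ z.2) g (𝓝 σ) := by
    have := (continuous_fst.tendsto _).comp hdir
    rw [hσ'] at this
    exact this
  have hcone' : ∀ᶠ z in (g : Filter (P × M)),
      ‖F.ξ z.1 z.2 - p (F.ξ z.1 z.2)‖ ≤ ε * ‖p (F.ξ z.1 z.2)‖ := by
    have ho : IsOpen {v : H | ‖v - p v‖ < ε * ‖p v‖} := isOpen_lt (by fun_prop) (by fun_prop)
    have h1 : Tendsto (fun z ↦ (F.dir z).2) g (𝓝 u) := (continuous_snd.tendsto _).comp hdir
    filter_upwards [h1 (ho.mem_nhds hucone), hr] with z hz hzr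
    have hpos : 0 < ‖F.ξ z.1 z.2‖ := norm_pos_iff.2 hzr
    simp only [mem_preimage, mem_ofPred_eq, dir, map_smul, ← smul_sub, norm_smul, norm_inv,
      norm_norm] at hz
    rw [mul_left_comm] at hz
    exact (lt_of_mul_lt_mul_left hz (inv_pos.2 hpos).le).le
  obtain ⟨c, hc, hcY⟩ := F.exists_norm_ξ_le X
  obtain ⟨L, hL, hLY⟩ := F.exists_norm_D_le X 0 τ
  set W : Set (P × M) := {z | ∀ v, F.pr z.2 v = v → v ≠ 0 → ‖v - p v‖ ≤ ε * ‖p v‖ →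
        ‖F.D z.1 (-τ) z.2 v - p (F.D z.1 (-τ) z.2 v)‖ ≤ ε * ‖p (F.D z.1 (-τ) z.2 v)‖ ∧
        ‖v‖ ≤ κ * ‖F.D z.1 (-τ) z.2 v‖} with hWdef
  have hW : W ∈ 𝓝 (X, σ) := hcone
  have hexit : ∀ᶠ z in (g : Filter (P × M)), ∃ n : ℕ, (z.1, F.φ z.1 (-(n * τ)) z.2) ∉ W ∧
      ∀ j ≤ n, ‖F.ξ z.1 (F.φ z.1 (-((n - j : ℕ) * τ)) z.2)‖ ≤ c * κ ^ j := by
    filter_upwards [hcone', hr, hY hcY] with z h1 h2 h3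
    exact exists_exit hκ hκ1 (fun z hz ↦ hz) h3 h2 h1
  obtain ⟨n, hn⟩ : ∃ n : P × M → ℕ, ∀ᶠ z in (g : Filter (P × M)),
      (z.1, F.φ z.1 (-(n z * τ)) z.2) ∉ W ∧
      ∀ j ≤ n z, ‖F.ξ z.1 (F.φ z.1 (-((n z - j : ℕ) * τ)) z.2)‖ ≤ c * κ ^ j := hexit.choice
  -- The singularity is fixed, so any given number of backward steps started close enough to it
  -- stays in `W`: the exit times tend to infinity.
  have hnlim : ∀ m : ℕ, ∀ᶠ z in (g : Filter (P × M)), m ≤ n z := by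
    intro m
    have h1 : ∀ᶠ z in (g : Filter (P × M)), ∀ j ∈ Finset.range m,
        (z.1, F.φ z.1 (-(j * τ)) z.2) ∈ W := by
      refine (Finset.eventually_all _).2 fun j _ ↦ ?_
      have c1 : Continuous fun z : P × M ↦ (z.1, F.φ z.1 (-(j * τ)) z.2) :=
        continuous_fst.prodMk (F.continuous_φ.comp
          (f := fun z : P × M ↦ (z.1, -(j * τ), z.2)) (by fun_prop))
      have c2 := (c1.tendsto (X, σ)).comp (hY.prodMk_nhds hx)
      simp only [hfix] at c2
      exact c2 hW
    filter_upwards [h1, hn] with z h1 h2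
    by_contra hlt
    exact h2.1 (h1 (n z) (Finset.mem_range.2 (not_le.1 hlt)))
  set y : P × M → M := fun z ↦ F.φ z.1 (-(n z * τ)) z.2 with hydef
  -- A limit of the exit points. It lies in `Λ`, differs from `σ` because the exit points avoid the
  -- neighbourhood `W`, and inherits exponential convergence to `σ` for all positive times.
  obtain ⟨y₀, -, hy₀⟩ := isCompact_univ.ultrafilter_le_nhds (g.map y) (by simp)
  have hy₀' : Tendsto y g (𝓝 y₀) := hy₀
  have hy₀Λ : y₀ ∈ Λ := by
    refine F.mem_of_tendsto_near (X := X) hΛ (f := fun z ↦ (z.1, y z)) (g := (g : Filter (P × M)))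
      (fun s hs ↦ ?_) hy₀'
    have h1 : ∀ᶠ z in (g : Filter (P × M)), ∀ t, (z.1, F.φ z.1 t z.2) ∈ s :=
      hg (eventually_near_orbit hs)
    exact h1.mono fun z hz ↦ hz _
  have hy₀σ : y₀ ≠ σ := by
    rintro rfl
    have h1 := (hY.prodMk_nhds hy₀') hW
    obtain ⟨z, hz1, hz2⟩ := (hn.and h1).exists
    exact hz1.1 hz2
  set l := -Real.log κ / τ with hl
  have hlpos : 0 < l := div_pos (neg_pos.2 (Real.log_neg hκ hκ1)) hτ
  have hκl : ∀ j : ℕ, κ ^ j = Real.exp (-(l * (j * τ))) := by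
    intro j
    have : -(l * (j * τ)) = j * Real.log κ := by rw [hl]; field_simp
    rw [this, Real.exp_nat_mul, Real.exp_log hκ]
  -- The factors `L` and `exp (l * τ)` pay for the times between multiples of `τ`.
  set c' := L * c * Real.exp (l * τ) with hc'
  have hdecay : ∀ᶠ z in (g : Filter (P × M)), ∀ r ∈ Icc 0 (n z * τ),
      ‖F.ξ z.1 (F.φ z.1 r (y z))‖ ≤ c' * Real.exp (-(l * r)) := by
    filter_upwards [hn, hY hLY] with z hz hzL r hr
    obtain ⟨j, s, hs, rfl⟩ := exists_floor_mul_add hτ hr.1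
    have hjn : j ≤ n z := by
      have : (j : ℝ) * τ ≤ n z * τ := by linarith [hr.2, hs.1]
      exact_mod_cast le_of_mul_le_mul_right this hτ
    have e1 : F.φ z.1 (j * τ) (y z) = F.φ z.1 (-((n z - j : ℕ) * τ)) z.2 := by
      simp only [hydef]
      rw [← F.φ_add]
      congr 1
      rw [Nat.cast_sub hjn]
      ring
    rw [F.φ_add, ← F.D_ξ, e1]
    calc _ ≤ ‖F.D z.1 s (F.φ z.1 (-((n z - j : ℕ) * τ)) z.2)‖ *
          ‖F.ξ z.1 (F.φ z.1 (-((n z - j : ℕ) * τ)) z.2)‖ := ContinuousLinearMap.le_opNorm _ _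
      _ ≤ L * (c * κ ^ j) := by
        gcongr
        · exact hzL s hs _
        · exact hz.2 j hjn
      _ = L * c * Real.exp (-(l * (j * τ))) := by rw [hκl]; ring
      _ ≤ L * c * Real.exp (l * τ + -(l * (s + j * τ))) := by
        have : l * s ≤ l * τ := by gcongr; exact hs.2
        gcongr
        linarith
      _ = _ := by rw [Real.exp_add, hc']; ring
  have hdist : ∀ t : ℝ, 0 ≤ t → F.dist (F.φ X t y₀) σ ≤
      ENNReal.ofReal (c' / (1 - Real.exp (-l)) * Real.exp (-(l * t))) := by
    intro t ht
    have c1 : Tendsto (fun z : P × M ↦ F.φ z.1 t (y z)) g (𝓝 (F.φ X t y₀)) := by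
      have : Continuous fun z : P × M ↦ F.φ z.1 t z.2 :=
        F.continuous_φ.comp (f := fun z : P × M ↦ (z.1, t, z.2)) (by fun_prop)
      exact (this.tendsto (X, y₀)).comp (hY.prodMk_nhds hy₀')
    refine dist_le_of_tendsto c1 hx ?_
    obtain ⟨m, hm⟩ := exists_nat_ge (t / τ)
    rw [div_le_iff₀ hτ] at hm
    filter_upwards [hdecay, hnlim m] with z hz hmz
    have h1 := dist_le_of_decay hlpos (by positivity) hz (s := t)
      ⟨ht, hm.trans (by gcongr)⟩
    have h2 : F.φ z.1 (n z * τ) (y z) = z.2 := by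
      simp only [hydef]
      rw [← F.φ_add, add_neg_cancel, F.φ_zero]
    rwa [h2] at h1
  obtain ⟨c'', hc'', hG'⟩ := norm_D_neg_le_of_step hτ hg₀ hfix (h.split.map_right σ rfl)
    (h.split.right_le rfl) hG
  -- The inequality `κ * g₀ < 1` says exactly that `log g₀ / τ < l`, so the convergence is fast
  -- enough for `y₀` to be in the strong stable set.
  refine hy₀σ (h.escape y₀ hy₀Λ ⟨l, Real.log g₀ / τ,
    max (c' / (1 - Real.exp (-l))) c'', hlpos, ?_, fun t ht ↦ (hdist t ht).trans ?_,
    fun t ht w hw ↦ (hG' t ht w hw).trans ?_⟩)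
  · rw [hl]
    refine div_lt_div_of_pos_right ?_ hτ
    have := Real.log_neg (by positivity) hκg
    rw [Real.log_mul hκ.ne' hg₀.ne'] at this
    linarith
  · refine ENNReal.ofReal_le_ofReal ?_
    gcongr
    exact le_max_left _ _
  · gcongr
    exact le_max_right _ _

end FlowData

/-! ### Robustness of the condition at a singularity -/

namespace FlowData

variable {P M H : Type*} [TopologicalSpace P] [TopologicalSpace M]
  [NormedAddCommGroup H] [InnerProductSpace ℝ H] [FiniteDimensional ℝ H]
  {F : FlowData P M H} {X Y : P} {Λ : Set M} {σ : M} {E G : Submodule ℝ H} {i : ℕ}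

theorem isSplit_singleton (hfix : ∀ t, F.φ Y t σ = σ) {K : Set M} {V W : M → Submodule ℝ H}
    (h : F.tan.IsSplit Y K V W i) (hσ : σ ∈ K) :
    F.tan.IsSplit Y {σ} (fun _ ↦ V σ) (fun _ ↦ W σ) i where
  inv b hb t := by
    rw [mem_singleton_iff] at hb ⊢
    rw [hb]
    exact hfix t
  sup_eq b hb := by rw [mem_singleton_iff.1 hb]; exact h.sup_eq σ hσ
  disj b hb := h.disj σ hσ
  rank b hb := h.rank σ hσ
  map_left b hb t v hv := by
    rw [mem_singleton_iff.1 hb]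
    have := h.map_left σ hσ t v hv
    rwa [show F.tan.Φ Y t σ = σ from hfix t] at this
  map_right b hb t v hv := by
    rw [mem_singleton_iff.1 hb]
    have := h.map_right σ hσ t v hv
    rwa [show F.tan.Φ Y t σ = σ from hfix t] at this

theorem mem_orbitIn_of_sing [T1Space M] {O : Set (P × M)} (hσ : F.ξ Y σ = 0) (h : (Y, σ) ∈ O) :
    σ ∈ F.tan.orbitIn Y O := fun t ↦ by
  rw [show F.tan.Φ Y t σ = σ from F.φ_of_sing hσ t]
  exact h

/-- Uniform contraction is reduced to an inequality at a single time, which is an open condition on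
the system. Half of the resulting rate absorbs the constant. -/
theorem exists_contraction_of_step {τ : ℝ} (hτ : 0 < τ) (hfix : ∀ t, F.φ Y t σ = σ)
    (hEm : ∀ t, ∀ w ∈ E, F.D Y t σ w ∈ E) (hET : E ≤ F.tan.fib Y σ)
    (h : ∀ w ∈ E, ‖F.D Y τ σ w‖ ≤ 1 / 2 * ‖w‖) :
    ∃ η > 0, ∃ T > 0, ∀ t ≥ T, ∀ v ∈ E, ‖F.D Y t σ v‖ ≤ Real.exp (-(η * t)) * ‖v‖ := by
  have hD : ∀ t w, F.rev.D Y (-t) σ w = F.D Y t σ w := fun t w ↦ by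
    change F.D Y (- -t) σ w = _
    rw [neg_neg]
  obtain ⟨c, hc, hcE⟩ := norm_D_neg_le_of_step (F := F.rev) (X := Y) (σ := σ) (G := E) hτ
    (g := 1 / 2) (by norm_num) (fun t ↦ hfix (-t)) (fun t w hw ↦ hEm (-t) w hw)
    (by rw [F.rev_tan, LinCocycle.rev_fib]; exact hET) (fun w hw ↦ by rw [hD]; exact h w hw)
  have hlog : Real.log (1 / 2) < 0 := Real.log_neg (by norm_num) (by norm_num)
  set η := -(Real.log (1 / 2) / τ) / 2 with hη
  have hηp : 0 < η := by
    have := div_neg_of_neg_of_pos hlog hτ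
    rw [hη]
    linarith
  have h1 : Tendsto (fun t : ℝ ↦ c * Real.exp (-(η * t))) atTop (𝓝 0) := by
    simpa using (tendsto_exp_neg_mul hηp).const_mul c
  obtain ⟨T', hT'⟩ := eventually_atTop.1 (h1.eventually (gt_mem_nhds one_pos))
  refine ⟨η, hηp, max T' 1, by positivity, fun t ht v hv ↦ ?_⟩
  have h2 := hcE t (zero_le_one.trans ((le_max_right _ _).trans ht)) v hv
  rw [hD] at h2
  refine h2.trans ?_
  gcongr
  have e : Real.log (1 / 2) / τ * t = -(η * t) + -(η * t) := by rw [hη]; ring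
  rw [e, Real.exp_add, ← mul_assoc]
  exact mul_le_of_le_one_left (Real.exp_pos _).le (hT' t ((le_max_left _ _).trans ht)).le

/-- At the points close to the singularity, the directions of the field are far from `E`. -/
theorem IsEscape.eventually_far [CompactSpace M] [T2Space M] (hΛ : IsClosed Λ)
    (h : F.IsEscape X Λ i σ E G) {p : H →L[ℝ] H} (hpG : ∀ w ∈ G, p w = 0) :
    ∃ N ∈ 𝓝 σ, ∀ᶠ z in F.near X Λ, z.2 ∈ N → ‖p (F.ξ z.1 z.2)‖ ≤ 1 / 2 * ‖F.ξ z.1 z.2‖ := by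
  have : Nonempty P := ⟨X⟩
  have hl := F.continuous_line_val
  -- The base points of these lines form a closed set that misses `σ`: the limit lines at `σ` lie in
  -- `G`, which `p` kills. Any closed neighbourhood of `σ` avoiding this set will do.
  have cK : IsCompact (F.limLines X Λ ∩ {b : F.Line | 1 / 2 ≤ ‖p b.1.2‖}) :=
    (F.isClosed_limLines.inter (isClosed_le (by fun_prop) (by fun_prop))).isCompact
  have cK' := (cK.image (continuous_fst.comp hl)).isClosed
  have hσ : ((fun b : F.Line ↦ b.1.1) '' (F.limLines X Λ ∩ {b : F.Line | 1 / 2 ≤ ‖p b.1.2‖}))ᶜ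
      ∈ 𝓝 σ := by
    refine cK'.isOpen_compl.mem_nhds ?_
    rintro ⟨b, ⟨hb, hb2⟩, hbσ⟩
    have := hpG _ (h.limLines_mem hΛ hb hbσ)
    simp only [mem_ofPred_eq] at hb2
    rw [this, norm_zero] at hb2
    norm_num at hb2
  obtain ⟨N, hN, hNc, hNs⟩ := exists_mem_nhds_isClosed_subset hσ
  refine ⟨N, hN, ?_⟩
  have hO : IsOpen {z : P × F.Line | z.2.1.1 ∈ Nᶜ ∨ ‖p z.2.1.2‖ < 1 / 2} := by
    have o2 : IsOpen {z : P × F.Line | ‖p z.2.1.2‖ < 1 / 2} :=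
      isOpen_lt (by fun_prop) (by fun_prop)
    exact (hNc.isOpen_compl.preimage (f := fun z : P × F.Line ↦ z.2.1.1) (by fun_prop)).union o2
  refine (F.eventually_near_dirLine hO fun b hb ↦ ?_).mono fun z hz hzN ↦ ?_
  · by_contra hcon
    simp only [mem_ofPred_eq, not_or, mem_compl_iff, not_not, not_lt] at hcon
    exact hNs hcon.1 ⟨b, ⟨hb, hcon.2⟩, rfl⟩
  · by_cases hzr : z ∈ F.regular
    · have hpos : 0 < ‖F.ξ z.1 z.2‖ := norm_pos_iff.2 hzr
      rcases hz hzr with h1 | h1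
      · exact absurd hzN h1
      · simp only [dirLine, dir, map_smul, norm_smul, norm_inv, norm_norm] at h1
        rw [inv_mul_lt_iff₀ hpos] at h1
        linarith
    · have : F.ξ z.1 z.2 = 0 := not_not.1 hzr
      simp [this]

/-- A vector whose backward iterates stay away from the directions close to `E` lies in `G`. -/
theorem mem_of_forall_far (h : F.tan.IsSplit Y {σ} (fun _ ↦ E) (fun _ ↦ G) i) {η T : ℝ}
    (hη : 0 < η) (hd : F.tan.DomAt Y σ E G η T) {p : H →L[ℝ] H}
    (hpE : ∀ v ∈ E, 3 / 4 * ‖v‖ ≤ ‖p v‖) {u : H} (hu : u ∈ F.tan.fib Y σ)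
    (hfar : ∀ s, ‖p (F.D Y s σ u)‖ ≤ 1 / 2 * ‖F.D Y s σ u‖) : u ∈ G := by
  by_contra huG
  have hET : E ≤ F.tan.fib Y σ := h.left_le rfl
  rw [← h.sup_eq σ rfl] at hu
  obtain ⟨e, he, w, hw, rfl⟩ := Submodule.mem_sup.1 hu
  have he0 : e ≠ 0 := by
    rintro rfl
    exact huG (by simpa using hw)
  have hep := norm_pos_iff.2 he0
  have hd' : F.tan.rev.IsDom Y {σ} (fun _ ↦ G) (fun _ ↦ E) η T :=
    LinCocycle.IsDom.rev h fun b hb ↦ by rw [mem_singleton_iff.1 hb]; exact hd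
  have hlim : Tendsto (fun t : ℝ ↦ (‖p‖ + 1 / 2) * (Real.exp (-(η * t)) * ‖w‖)) atTop (𝓝 0) := by
    simpa using ((tendsto_exp_neg_mul hη).mul_const ‖w‖).const_mul (‖p‖ + 1 / 2)
  obtain ⟨t, ht, htT⟩ := ((hlim.eventually (gt_mem_nhds (show 0 < 1 / 4 * ‖e‖ by positivity))).and
    (eventually_ge_atTop T)).exists
  have h1 : ‖F.D Y (-t) σ w‖ * ‖e‖ ≤ Real.exp (-(η * t)) * (‖w‖ * ‖F.D Y (-t) σ e‖) :=
    hd' σ rfl t htT w hw e he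
  have h2 := hpE _ (h.map_left σ rfl (-t) e he)
  change 3 / 4 * ‖F.D Y (-t) σ e‖ ≤ ‖p (F.D Y (-t) σ e)‖ at h2
  have h3 := hfar (-t)
  rw [map_add, map_add] at h3
  set De := F.D Y (-t) σ e
  set Dw := F.D Y (-t) σ w
  have h4 : ‖p De‖ - ‖p Dw‖ ≤ ‖p De + p Dw‖ := by
    have := norm_sub_norm_le (p De) (-p Dw)
    rwa [norm_neg, sub_neg_eq_add] at this
  have h5 := p.le_opNorm Dw
  have h6 := norm_add_le De Dw
  have hDe : 0 < ‖De‖ := F.tan.A_pos Y σ (hET he) he0 (-t)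
  -- The gap between the constants `3/4` on `E` and `1/2` along the orbit forces the component in
  -- `G` to remain comparable with the one in `E`, contrary to domination backward in time.
  have h7 : 1 / 4 * ‖De‖ ≤ (‖p‖ + 1 / 2) * ‖Dw‖ := by linarith
  have h8 : 1 / 4 * ‖De‖ * ‖e‖ ≤ (‖p‖ + 1 / 2) * (Real.exp (-(η * t)) * ‖w‖) * ‖De‖ :=
    calc 1 / 4 * ‖De‖ * ‖e‖ ≤ ((‖p‖ + 1 / 2) * ‖Dw‖) * ‖e‖ := by gcongr
      _ = (‖p‖ + 1 / 2) * (‖Dw‖ * ‖e‖) := by ring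
      _ ≤ (‖p‖ + 1 / 2) * (Real.exp (-(η * t)) * (‖w‖ * ‖De‖)) := by gcongr
      _ = _ := by ring
  have h9 : (‖p‖ + 1 / 2) * (Real.exp (-(η * t)) * ‖w‖) * ‖De‖ < 1 / 4 * ‖e‖ * ‖De‖ := by gcongr
  linarith

/-- A point of the strong stable set of a singularity, near which the field is far from the strong
stable direction along the orbit of the point, is the singularity. -/
theorem eq_of_mem_strongStable [CompactSpace M] [T2Space M] (hσ : F.ξ Y σ = 0)
    (h : F.tan.IsSplit Y {σ} (fun _ ↦ E) (fun _ ↦ G) i) {η T : ℝ}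
    (hη : 0 < η) (hd : F.tan.DomAt Y σ E G η T) {p : H →L[ℝ] H}
    (hpE : ∀ v ∈ E, 3 / 4 * ‖v‖ ≤ ‖p v‖) {y : M} {N : Set M} (hN : N ∈ 𝓝 σ)
    (hy : ∀ t, F.φ Y t y ∈ N →
      ‖p (F.ξ Y (F.φ Y t y))‖ ≤ 1 / 2 * ‖F.ξ Y (F.φ Y t y)‖)
    (hyW : y ∈ F.strongStable Y σ G) : y = σ := by
  have : Nonempty P := ⟨Y⟩
  obtain ⟨l, l', c, hl, hll', hdist, hG⟩ := hyW
  have hlim0 : Tendsto (fun t : ℝ ↦ c * Real.exp (-(l * t))) atTop (𝓝 0) := by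
    simpa using (tendsto_exp_neg_mul hl).const_mul c
  have hdist0 : ∀ c' : ENNReal, 0 < c' → ∀ᶠ t in atTop, F.dist (F.φ Y t y) σ < c' := by
    intro c' hc'
    have h1 : Tendsto (fun t : ℝ ↦ ENNReal.ofReal (c * Real.exp (-(l * t)))) atTop (𝓝 0) := by
      simpa using ENNReal.tendsto_ofReal hlim0
    filter_upwards [h1.eventually (gt_mem_nhds hc'), eventually_ge_atTop 0] with t ht ht0
    exact (hdist t ht0).trans_lt ht
  have htend : Tendsto (fun t ↦ F.φ Y t y) atTop (𝓝 σ) := by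
    intro s hs
    obtain ⟨c', hc', hcs⟩ := F.exists_dist_lt σ s hs
    exact (hdist0 c' hc').mono fun t ht ↦ hcs _ ht
  by_contra hne
  have hreg : F.ξ Y y ≠ 0 := by
    intro h0
    refine hne (tendsto_nhds_unique (f := fun _ : ℝ ↦ y) (l := atTop) tendsto_const_nhds ?_)
    exact htend.congr fun t ↦ F.φ_of_sing h0 t
  have hregt : ∀ t, (Y, F.φ Y t y) ∈ F.regular := fun t ↦ F.ξ_φ_ne_zero hreg t
  -- An intermediate rate. The field turns out to decay more slowly than `exp (-l'' t)`, whereas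
  -- convergence at rate `l` makes it decay like `exp (-l t)`.
  set l'' := (l + l') / 2 with hl''
  obtain ⟨τ, hτc, hτ⟩ : ∃ τ : ℝ, c * Real.exp (-((l'' - l') * τ)) < 1 ∧ 0 < τ := by
    have h1 : Tendsto (fun t : ℝ ↦ c * Real.exp (-((l'' - l') * t))) atTop (𝓝 0) := by
      simpa using (tendsto_exp_neg_mul (show 0 < l'' - l' by linarith)).const_mul c
    exact ((h1.eventually (gt_mem_nhds one_pos)).and (eventually_gt_atTop 0)).exists
  -- Otherwise the directions of the field, at suitable times, converge to a unit vector at `σ`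
  -- contracted by at least `exp (-l'' τ)` in time `τ`. The condition in `N` puts this vector in
  -- `G`, where the bound of rate `l'` forbids such a contraction for the chosen `τ`.
  have hgrow : ∀ᶠ t in atTop,
      Real.exp (-(l'' * τ)) * ‖F.ξ Y (F.φ Y t y)‖ < ‖F.ξ Y (F.φ Y (τ + t) y)‖ := by
    by_contra hcon
    rw [not_eventually, frequently_iff_neBot] at hcon
    let S : Set ℝ := {t | ¬Real.exp (-(l'' * τ)) * ‖F.ξ Y (F.φ Y t y)‖ <
      ‖F.ξ Y (F.φ Y (τ + t) y)‖}
    have : (atTop ⊓ 𝓟 S).NeBot := hcon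
    let g := Ultrafilter.of (atTop ⊓ 𝓟 S)
    have hg1 : (g : Filter ℝ) ≤ atTop := (Ultrafilter.of_le (atTop ⊓ 𝓟 S)).trans inf_le_left
    have hg2 : ∀ᶠ t in (g : Filter ℝ), t ∈ S :=
      (Ultrafilter.of_le (atTop ⊓ 𝓟 S)) (mem_inf_of_right (mem_principal_self _))
    obtain ⟨b, -, hb⟩ := (isCompact_univ (X := F.Line)).ultrafilter_le_nhds
      (g.map fun t ↦ F.dirLine (hregt t)) (by simp)
    have hb' : Tendsto (fun t ↦ F.dirLine (hregt t)) g (𝓝 b) := hb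
    have hb1 : Tendsto (fun t ↦ F.dir (Y, F.φ Y t y)) g (𝓝 b.1) :=
      (F.continuous_line_val.tendsto b).comp hb'
    have hbσ : b.1.1 = σ :=
      tendsto_nhds_unique ((continuous_fst.tendsto _).comp hb1) (htend.mono_left hg1)
    have hDlim : ∀ s, Tendsto (fun t ↦ F.D Y s (F.φ Y t y) (F.dir (Y, F.φ Y t y)).2) g
        (𝓝 (F.D Y s σ b.1.2)) := by
      intro s
      have c1 : Continuous fun z : M × H ↦ F.D Y s z.1 z.2 :=
        F.tan.continuous_A_apply.comp (f := fun z : M × H ↦ (Y, s, z.1, z.2)) (by fun_prop)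
      have := (c1.tendsto b.1).comp hb1
      rw [hbσ] at this
      exact this
    have hDdir : ∀ s t, F.D Y s (F.φ Y t y) (F.dir (Y, F.φ Y t y)).2 =
        ‖F.ξ Y (F.φ Y t y)‖⁻¹ • F.ξ Y (F.φ Y (s + t) y) := by
      intro s t
      simp only [dir, map_smul, F.D_ξ, F.φ_add]
    have huG : b.1.2 ∈ G := by
      refine mem_of_forall_far h hη hd hpE (hbσ ▸ b.mem_fib Y) fun s ↦ ?_
      have h1 := hDlim s
      refine le_of_tendsto_of_tendsto ((p.continuous.tendsto _).comp h1).norm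
        (h1.norm.const_mul (1 / 2)) ?_
      have h2 : Tendsto (fun t ↦ F.φ Y (s + t) y) atTop (𝓝 σ) :=
        htend.comp (tendsto_atTop_add_const_left _ s tendsto_id)
      filter_upwards [hg1 (h2 hN)] with t ht
      simp only [Function.comp, hDdir, map_smul, norm_smul]
      calc _ ≤ ‖‖F.ξ Y (F.φ Y t y)‖⁻¹‖ * (1 / 2 * ‖F.ξ Y (F.φ Y (s + t) y)‖) := by
            gcongr
            exact hy _ ht
        _ = _ := by ring
    have hle : ‖F.D Y τ σ b.1.2‖ ≤ Real.exp (-(l'' * τ)) := by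
      refine le_of_tendsto (hDlim τ).norm ?_
      filter_upwards [hg2] with t ht
      have hpos : 0 < ‖F.ξ Y (F.φ Y t y)‖ := norm_pos_iff.2 (hregt t)
      rw [hDdir, norm_smul, norm_inv, norm_norm, inv_mul_le_iff₀ hpos, mul_comm]
      exact not_lt.1 ht
    have h1 := hG τ hτ.le _ (h.map_right σ rfl τ _ huG)
    have h2 : F.D Y (-τ) σ (F.D Y τ σ b.1.2) = b.1.2 := by
      have := F.tan.A_neg_A Y σ (h.right_le rfl huG) τ
      rwa [show F.tan.Φ Y τ σ = σ from h.inv σ rfl τ] at this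
    change ‖F.D Y (-τ) σ (F.D Y τ σ b.1.2)‖ ≤ c * Real.exp (l' * τ) * ‖F.D Y τ σ b.1.2‖ at h1
    rw [h2, b.2.1] at h1
    have hc0 : 0 < c := by
      by_contra hc0
      have : c * Real.exp (l' * τ) * ‖F.D Y τ σ b.1.2‖ ≤ 0 :=
        mul_nonpos_of_nonpos_of_nonneg
          (mul_nonpos_of_nonpos_of_nonneg (not_lt.1 hc0) (Real.exp_pos _).le) (norm_nonneg _)
      linarith
    have h3 : c * Real.exp (l' * τ) * ‖F.D Y τ σ b.1.2‖ ≤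
        c * Real.exp (l' * τ) * Real.exp (-(l'' * τ)) := by gcongr
    rw [mul_assoc c (Real.exp (l' * τ)) (Real.exp (-(l'' * τ))), ← Real.exp_add,
      show l' * τ + -(l'' * τ) = -((l'' - l') * τ) by ring] at h3
    linarith
  -- Near a zero the field is bounded by a multiple of the distance to it, which transfers the rate
  -- `l` from the distance to the field.
  obtain ⟨c₂, hc₂⟩ := F.ξ_le_dist Y σ hσ
  have hup : ∀ᶠ t in atTop, ‖F.ξ Y (F.φ Y t y)‖ ≤ c₂ * (max c 0 * Real.exp (-(l * t))) := by
    filter_upwards [htend.eventually hc₂, eventually_ge_atTop 0] with t ht ht0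
    refine ht _ (by positivity) ((hdist t ht0).trans (ENNReal.ofReal_le_ofReal ?_))
    gcongr
    exact le_max_left _ _
  obtain ⟨t₀, ht₀⟩ := eventually_atTop.1 (hgrow.and hup)
  have hlow : ∀ n : ℕ, Real.exp (-(l'' * τ)) ^ n * ‖F.ξ Y (F.φ Y t₀ y)‖ ≤
      ‖F.ξ Y (F.φ Y (n * τ + t₀) y)‖ := by
    intro n
    induction n with
    | zero => simp
    | succ n ih =>
      have h1 := (ht₀ (n * τ + t₀) (by
        have : 0 ≤ n * τ := by positivity
        linarith)).1
      have e : ((n + 1 : ℕ) : ℝ) * τ + t₀ = τ + (n * τ + t₀) := by push_cast; ring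
      rw [e]
      calc _ = Real.exp (-(l'' * τ)) * (Real.exp (-(l'' * τ)) ^ n * ‖F.ξ Y (F.φ Y t₀ y)‖) := by ring
        _ ≤ Real.exp (-(l'' * τ)) * ‖F.ξ Y (F.φ Y (n * τ + t₀) y)‖ := by gcongr
        _ ≤ _ := h1.le
  have ha : 0 < ‖F.ξ Y (F.φ Y t₀ y)‖ := norm_pos_iff.2 (hregt t₀)
  have hcmp : ∀ n : ℕ, ‖F.ξ Y (F.φ Y t₀ y)‖ ≤
      c₂ * (max c 0) * Real.exp (-(l * t₀)) * Real.exp (-((l - l'') * τ)) ^ n := by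
    intro n
    have h1 := (hlow n).trans (ht₀ (n * τ + t₀) (by
        have : 0 ≤ n * τ := by positivity
        linarith)).2
    rw [← Real.exp_nat_mul] at h1 ⊢
    have h2 := mul_le_mul_of_nonneg_left h1 (Real.exp_pos (n * (l'' * τ))).le
    rw [← mul_assoc, ← Real.exp_add] at h2
    have e1 : (n : ℝ) * (l'' * τ) + n * -(l'' * τ) = 0 := by ring
    rw [e1, Real.exp_zero, one_mul] at h2
    refine h2.trans (le_of_eq ?_)
    have e2 : Real.exp (n * (l'' * τ)) * Real.exp (-(l * (n * τ + t₀))) =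
        Real.exp (-(l * t₀)) * Real.exp (n * -((l - l'') * τ)) := by
      rw [← Real.exp_add, ← Real.exp_add]; ring_nf
    calc _ = c₂ * max c 0 * (Real.exp (n * (l'' * τ)) * Real.exp (-(l * (n * τ + t₀)))) := by ring
      _ = _ := by rw [e2]; ring
  have hq : Real.exp (-((l - l'') * τ)) < 1 := by
    rw [Real.exp_lt_one_iff]
    have : 0 < (l - l'') * τ := mul_pos (by linarith) hτ
    linarith
  have hz : Tendsto (fun n : ℕ ↦ c₂ * (max c 0) * Real.exp (-(l * t₀)) *
      Real.exp (-((l - l'') * τ)) ^ n) atTop (𝓝 0) := by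
    simpa using (tendsto_pow_atTop_nhds_zero_of_lt_one (Real.exp_pos _).le hq).const_mul
      (c₂ * (max c 0) * Real.exp (-(l * t₀)))
  exact absurd (ge_of_tendsto' hz hcmp) (not_le.2 ha)

end FlowData

theorem LinCocycle.IsSplit.strictAt_rev {P B H : Type*} [TopologicalSpace P] [TopologicalSpace B]
    [NormedAddCommGroup H] [InnerProductSpace ℝ H] [FiniteDimensional ℝ H]
    {C : LinCocycle P B H} {Y : P} {K : Set B} {V W : B → Submodule ℝ H} {i : ℕ} {η t : ℝ}
    (h : C.IsSplit Y K V W i) (hs : ∀ b ∈ K, C.StrictAt Y b (V b) (W b) η t) :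
    ∀ b ∈ K, C.rev.StrictAt Y b (W b) (V b) η t := by
  intro b hb w hw v hv hw0 hv0
  have h1 := hs (C.Φ Y (-t) b) (h.inv b hb _) _ (h.map_left b hb (-t) v hv) _
    (h.map_right b hb (-t) w hw) (norm_pos_iff.1 (C.A_pos Y b (h.left_le hb hv) hv0 _))
    (norm_pos_iff.1 (C.A_pos Y b (h.right_le hb hw) hw0 _))
  rw [C.A_A_neg Y b (h.left_le hb hv), C.A_A_neg Y b (h.right_le hb hw)] at h1
  simp only [rev_A]
  calc _ = ‖v‖ * ‖C.A Y (-t) b w‖ := by ring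
    _ < _ := h1
    _ = _ := by ring

namespace FlowData

variable {P M H : Type*} [TopologicalSpace P] [TopologicalSpace M]
  [NormedAddCommGroup H] [InnerProductSpace ℝ H] [FiniteDimensional ℝ H]
  {F : FlowData P M H} {X Y : P} {Λ : Set M} {σ : M} {E G : Submodule ℝ H} {i : ℕ}

/-- The fibres of unit vectors are compact, so an open condition on all lines over one point extends
to the lines over nearby points. -/
theorem eventually_forall_line [CompactSpace M] [T2Space M] {Q : Set (P × F.Line)} (hQ : IsOpen Q)
    (h : ∀ b : F.Line, b.1.1 = σ → (X, b) ∈ Q) :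
    ∀ᶠ z in 𝓝 (X, σ), ∀ b : F.Line, b.1.1 = z.2 → (z.1, b) ∈ Q := by
  have : Nonempty P := ⟨X⟩
  have hl := F.continuous_line_val
  have : ∀ᶠ z in 𝓝 (X, σ), ∀ b ∈ (univ : Set F.Line), b.1.1 = z.2 → (z.1, b) ∈ Q := by
    refine isCompact_univ.eventually_forall_of_forall_eventually fun b _ ↦ ?_
    exact eventually_imp_of_isClosed_isOpen (Z := (P × M) × F.Line) (R := fun z ↦ z.2.1.1 = z.1.2)
      (Q := fun z ↦ (z.1.1, z.2) ∈ Q) (isClosed_eq (by fun_prop) (by fun_prop))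
      (hQ.preimage (f := fun z : (P × M) × F.Line ↦ (z.1.1, z.2)) (by fun_prop)) (h b)
  exact this.mono fun z hz b ↦ hz b (mem_univ b)

variable (F) in
/-- Strict domination over the lines contained in `G`. -/
def LineStrict (Y : P) (σ : M) (E G : Submodule ℝ H) (η T : ℝ) : Prop :=
  ∀ b ∈ F.linesIn σ G, ∀ t ≥ T, F.ext.StrictAt Y b (E.map (orthProj b.1.2).toLinearMap)
    (G.map (orthProj b.1.2).toLinearMap) η t

/-- The condition at a singularity is robust. -/
theorem IsEscape.persist [CompactSpace M] [T2Space M] (hΛ : IsClosed Λ)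
    (h : F.IsEscape X Λ i σ E G) (hi : i ≤ F.d - 1) (η : ℝ) {T : ℝ} (hT : 0 < T) :
    ∃ N ∈ 𝓝 (X, σ), ∃ S ∈ F.near X Λ, ∀ z ∈ N, F.ξ z.1 z.2 = 0 → ∃ E' G',
      F.IsEscape z.1 {y | (z.1, y) ∈ S} i z.2 E' G' ∧
      (F.LineStrict X σ E G η T → F.LineStrict z.1 z.2 E' G' η T) := by
  have : Nonempty P := ⟨X⟩
  have hl := F.continuous_line_val
  obtain ⟨η₁, hη₁, T₁, hT₁, hd⟩ := h.dom
  have hdom : F.tan.IsDom X {σ} (fun _ ↦ E) (fun _ ↦ G) η₁ T₁ := fun b hb ↦ by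
    rw [mem_singleton_iff.1 hb]
    exact hd
  -- Robustness for the tangent cocycle over the single point `σ` provides the splittings at the
  -- nearby singularities.
  obtain ⟨O, 𝒱, 𝒲, hO, hσO⟩ := LinCocycle.exists_isRobustSplit (F.finrank_tan_fib)
    (hi.trans (Nat.sub_le _ _)) isClosed_singleton h.split hη₁ hdom
  have hσin : σ ∈ F.tan.orbitIn X O := fun t ↦ hσO _ (h.split.inv σ rfl t)
  obtain ⟨η₂, hη₂, T₂, hT₂, hd₂⟩ := hO.dom
  obtain ⟨hEeq, hGeq⟩ := LinCocycle.IsSplit.eq_of_isDom hη₂ hη₁ (hO.split X) (hd₂ X) h.split hdom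
    hσin rfl
  obtain ⟨S₁, hS₁, hS₁m⟩ := hO.closed_left
  obtain ⟨S₂, hS₂, hS₂m⟩ := hO.closed_right
  obtain ⟨p, hpE, hpG⟩ := exists_projection (h.split.disj σ rfl)
  obtain ⟨η₃, hη₃, T₃, hT₃, hc⟩ := h.contr
  obtain ⟨τ, hτ, hτT⟩ := (((tendsto_exp_neg_mul hη₃).eventually
    (gt_mem_nhds (show (0 : ℝ) < 1 / 2 by norm_num))).and (eventually_ge_atTop T₃)).exists
  have hτ0 : 0 < τ := hT₃.trans_le hτT
  -- Two open conditions on the unit vectors of the left bundle: contraction at time `τ`, and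
  -- proximity to `E` measured by `p`, with the constant required by `eq_of_mem_strongStable`.
  have hunit : ∀ᶠ z in 𝓝 (X, σ), ∀ v ∈ Metric.sphere (0 : H) 1, (z.1, z.2, v) ∈ S₁ →
      ‖F.D z.1 τ z.2 v‖ < 1 / 2 ∧ 3 / 4 < ‖p v‖ := by
    refine (isCompact_sphere (0 : H) 1).eventually_forall_of_forall_eventually fun v hv ↦ ?_
    have hv1 : ‖v‖ = 1 := by simpa using hv
    have cD : Continuous fun z : (P × M) × H ↦ F.D z.1.1 τ z.1.2 z.2 :=
      F.tan.continuous_A_apply.comp (f := fun z : (P × M) × H ↦ (z.1.1, τ, z.1.2, z.2))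
        (by fun_prop)
    have o1 : IsOpen {z : (P × M) × H | ‖F.D z.1.1 τ z.1.2 z.2‖ < 1 / 2} :=
      isOpen_lt (by fun_prop) (by fun_prop)
    have o2 : IsOpen {z : (P × M) × H | 3 / 4 < ‖p z.2‖} := isOpen_lt (by fun_prop) (by fun_prop)
    refine eventually_imp_of_isClosed_isOpen (Z := (P × M) × H)
      (R := fun z ↦ (z.1.1, z.1.2, z.2) ∈ S₁)
      (Q := fun z ↦ ‖F.D z.1.1 τ z.1.2 z.2‖ < 1 / 2 ∧ 3 / 4 < ‖p z.2‖)
      (hS₁.preimage (f := fun z : (P × M) × H ↦ (z.1.1, z.1.2, z.2)) (by fun_prop))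
      (o1.inter o2) fun hvS ↦ ?_
    have hvE : v ∈ E := by
      rw [← hEeq]
      exact (hS₁m X σ hσin v).2 hvS
    refine ⟨?_, by rw [hpE v hvE, hv1]; norm_num⟩
    have := hc τ hτT v hvE
    rw [hv1, mul_one] at this
    exact this.trans_lt hτ
  obtain ⟨N₁, hN₁, hfar⟩ := h.eventually_far hΛ hpG
  -- Here robustness is applied once more, to the extended Poincaré cocycle over the lines in `G`,
  -- together with the strict inequalities. Uniqueness of dominated splittings shows that the
  -- bundles so obtained are the projections of `𝒱` and `𝒲`.
  have hlines : ∀ᶠ z in 𝓝 (X, σ), F.ξ z.1 z.2 = 0 → z.2 ∈ F.tan.orbitIn z.1 O →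
      (F.LineStrict X σ E G η T → F.LineStrict z.1 z.2 (𝒱 z.1 z.2) (𝒲 z.1 z.2) η T) := by
    by_cases hs : F.LineStrict X σ E G η T
    swap
    · exact Eventually.of_forall fun z _ _ hs' ↦ absurd hs' hs
    have sp := isSplit_linesIn i h.split
    obtain ⟨η₄, hη₄, T₄, hT₄, hd₄⟩ := exists_isDom_linesIn h.split h.dom
    obtain ⟨O₂, 𝒱₂, 𝒲₂, hO₂, hQO₂⟩ := LinCocycle.exists_isRobustSplit F.finrank_ext_fib hi
      isClosed_linesIn sp hη₄ hd₄
    obtain ⟨η₅, hη₅, T₅, hT₅, hd₅⟩ := hO₂.dom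
    obtain ⟨O₃, hO₃₂, hO₃, hQO₃, hst⟩ := hO₂.exists_strict hQO₂ sp.inv (η := η) hT
      fun b hb t ht ↦ by
        obtain ⟨e1, e2⟩ := LinCocycle.IsSplit.eq_of_isDom hη₅ hη₄ (hO₂.split X) (hd₅ X) sp hd₄
          (fun t ↦ hQO₂ _ (sp.inv b hb t)) hb
        rw [e1, e2]
        exact hs b hb t ht.1
    have hQ : IsOpen {z : P × F.Line | (z.1, z.2.1.1, z.2.1.2) ∈ S₂ → (z.1, z.2) ∈ O₃} := by
      have e : {z : P × F.Line | (z.1, z.2.1.1, z.2.1.2) ∈ S₂ → (z.1, z.2) ∈ O₃} =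
          {z : P × F.Line | (z.1, z.2.1.1, z.2.1.2) ∈ S₂}ᶜ ∪ O₃ := by
        ext z
        simp [imp_iff_not_or]
      rw [e]
      exact (hS₂.preimage (f := fun z : P × F.Line ↦ (z.1, z.2.1.1, z.2.1.2))
        (by fun_prop)).isOpen_compl.union hO₃.isOpen
    refine (eventually_forall_line hQ fun b hb hbS ↦ ?_).mono fun z hz hzs hzO _ b hb t ht ↦ ?_
    · refine hQO₃ b ⟨hb, ?_⟩
      simp only at hbS
      rw [hb] at hbS
      rw [← hGeq]
      exact (hS₂m X σ hσin _).2 hbS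
    · have hsp' := isSplit_singleton (F.φ_of_sing hzs) (hO.split z.1) hzO
      have sp' := isSplit_linesIn i hsp'
      obtain ⟨η₆, hη₆, T₆, hT₆, hd₆⟩ := exists_isDom_linesIn hsp'
        ⟨η₂, hη₂, T₂, hT₂, hd₂ z.1 z.2 hzO⟩
      have hbO : ∀ b ∈ F.linesIn z.2 (𝒲 z.1 z.2), (z.1, b) ∈ O₃ := fun b hb ↦
        hz b hb.1 (by
          change (z.1, b.1.1, b.1.2) ∈ S₂
          rw [hb.1]
          exact (hS₂m z.1 z.2 hzO _).1 hb.2)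
      have hbin : b ∈ F.ext.orbitIn z.1 O₃ := fun t ↦ hbO _ (sp'.inv b hb t)
      obtain ⟨e1, e2⟩ := LinCocycle.IsSplit.eq_of_isDom hη₅ hη₆ (hO₂.split z.1) (hd₅ z.1) sp' hd₆
        (fun t ↦ hO₃₂ (hbin t)) hb
      have := hst z.1 b hbin t ht
      rwa [e1, e2] at this
  have hN₁' : ∀ᶠ z in 𝓝 (X, σ), N₁ ∈ 𝓝 z.2 :=
    (continuous_snd.tendsto (X, σ)).eventually (eventually_mem_nhds_iff.2 hN₁)
  refine ⟨_, (hunit.and hlines).and (hN₁'.and (hO.isOpen.mem_nhds (hσO σ rfl))), _,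
    eventually_near_orbit hfar, ?_⟩
  rintro ⟨Y, σ'⟩ ⟨⟨hu, hln⟩, hN', hz⟩ hsing
  have hσ'in := mem_orbitIn_of_sing hsing hz
  have hsp' := isSplit_singleton (F.φ_of_sing hsing) (hO.split Y) hσ'in
  have hbd : ∀ v ∈ 𝒱 Y σ', ‖F.D Y τ σ' v‖ ≤ 1 / 2 * ‖v‖ ∧ 3 / 4 * ‖v‖ ≤ ‖p v‖ := by
    intro v hv
    by_cases hv0 : v = 0
    · simp [hv0]
    have hvp := norm_pos_iff.2 hv0
    have := hu (‖v‖⁻¹ • v) (by simp [norm_smul, hv0])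
      ((hS₁m Y σ' hσ'in _).1 (Submodule.smul_mem _ _ hv))
    simp only [map_smul, norm_smul, norm_inv, norm_norm] at this
    rw [inv_mul_lt_iff₀ hvp, lt_inv_mul_iff₀ hvp] at this
    exact ⟨by linarith [this.1], by linarith [this.2]⟩
  refine ⟨𝒱 Y σ', 𝒲 Y σ', ⟨hsp', ⟨η₂, hη₂, T₂, hT₂, hd₂ Y σ' hσ'in⟩, ?_, fun y hy hyW ↦ ?_⟩,
    hln hsing hσ'in⟩
  · exact exists_contraction_of_step hτ0 (F.φ_of_sing hsing) (hsp'.map_left σ' rfl)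
      (hsp'.left_le rfl) fun w hw ↦ (hbd w hw).1
  -- The same neighbourhood of `σ`, on which the field of every nearby system is away from `E`,
  -- serves for all nearby singularities.
  · exact eq_of_mem_strongStable hsing hsp' hη₂ (hd₂ Y σ' hσ'in) (fun v hv ↦ (hbd v hv).2) hN'
      (fun t ht ↦ hy t ht) hyW

variable (F) in
/-- The condition at a singularity; with strict `(η, T)`-domination over the lines, under `S`. -/
def SingCond (Y : P) (Λ : Set M) (i : ℕ) (σ : M) (S : Prop) (η T : ℝ) : Prop :=
  (∃ E G, F.IsEscape Y Λ i σ E G ∧ (S → F.LineStrict Y σ E G η T)) ∨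
  ∃ E G, F.rev.IsEscape Y Λ (F.d - 1 - i) σ E G ∧ (S → F.rev.LineStrict Y σ E G η T)

variable {S : Prop} {η T : ℝ}

theorem SingCond.mono {Λ' : Set M} (h : F.SingCond Y Λ i σ S η T) (hΛ : Λ' ⊆ Λ) :
    F.SingCond Y Λ' i σ S η T := by
  rcases h with ⟨E, G, h, hs⟩ | ⟨E, G, h, hs⟩
  · exact Or.inl ⟨E, G, h.mono hΛ, hs⟩
  · exact Or.inr ⟨E, G, h.mono hΛ, hs⟩

theorem SingCond.persist [CompactSpace M] [T2Space M] (hΛ : IsClosed Λ)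
    (h : F.SingCond X Λ i σ S η T) (hi : i ≤ F.d - 1) (hT : 0 < T) :
    ∃ N ∈ 𝓝 (X, σ), ∃ A ∈ F.near X Λ, ∀ z ∈ N, F.ξ z.1 z.2 = 0 →
      F.SingCond z.1 {y | (z.1, y) ∈ A} i z.2 S η T := by
  rcases h with ⟨E, G, h, hs⟩ | ⟨E, G, h, hs⟩
  · obtain ⟨N, hN, A, hA, hNA⟩ := h.persist hΛ hi η hT
    refine ⟨N, hN, A, hA, fun z hz hz0 ↦ Or.inl ?_⟩
    obtain ⟨E', G', h1, h2⟩ := hNA z hz hz0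
    exact ⟨E', G', h1, fun hS ↦ h2 (hs hS)⟩
  · obtain ⟨N, hN, A, hA, hNA⟩ := h.persist hΛ (show F.d - 1 - i ≤ F.d - 1 by omega) η hT
    rw [F.rev_near] at hA
    refine ⟨N, hN, A, hA, fun z hz hz0 ↦ Or.inr ?_⟩
    obtain ⟨E', G', h1, h2⟩ := hNA z hz hz0
    exact ⟨E', G', h1, fun hS ↦ h2 (hs hS)⟩

/-- The splitting over the limit lines at a singularity. -/
theorem SingCond.exists_split [CompactSpace M] [T2Space M] (hΛ : IsClosed Λ)
    (h : F.SingCond X Λ i σ S η T) (hi : i ≤ F.d - 1) :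
    ∃ V W, F.ext.IsSplit X (F.limLines X Λ ∩ {b | b.1.1 = σ}) V W i ∧
      (∃ η' > 0, ∃ T' > 0, F.ext.IsDom X (F.limLines X Λ ∩ {b | b.1.1 = σ}) V W η' T') ∧
      (S → ∀ b ∈ F.limLines X Λ ∩ {b | b.1.1 = σ}, ∀ t ≥ T,
        F.ext.StrictAt X b (V b) (W b) η t) := by
  rcases h with ⟨E, G, h, hs⟩ | ⟨E, G, h, hs⟩
  · have hsub : F.limLines X Λ ∩ {b | b.1.1 = σ} ⊆ F.linesIn σ G := fun b hb ↦
      ⟨hb.2, h.limLines_mem hΛ hb.1 hb.2⟩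
    obtain ⟨η', hη', T', hT', hd⟩ := exists_isDom_linesIn h.split h.dom
    refine ⟨_, _, (isSplit_linesIn i h.split).mono hsub fun b hb t ↦
      ⟨F.limLines_inv hb.1 t, (linesIn_inv h.split (hsub hb) t).1⟩,
      ⟨η', hη', T', hT', fun b hb ↦ hd b (hsub hb)⟩, fun hS b hb ↦ hs hS b (hsub hb)⟩
  · have hsub : F.rev.limLines X Λ ∩ {b | b.1.1 = σ} ⊆ F.rev.linesIn σ G := fun b hb ↦
      ⟨hb.2, h.limLines_mem hΛ hb.1 hb.2⟩
    obtain ⟨η', hη', T', hT', hd⟩ := exists_isDom_linesIn h.split h.dom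
    have hsub' : F.limLines X Λ ∩ {b | b.1.1 = σ} ⊆ F.rev.linesIn σ G := by
      rw [← F.rev_limLines]
      exact hsub
    have sp : F.ext.rev.IsSplit X (F.limLines X Λ ∩ {b | b.1.1 = σ})
        (fun b ↦ E.map (orthProj b.1.2).toLinearMap) (fun b ↦ G.map (orthProj b.1.2).toLinearMap)
        (F.d - 1 - i) := by
      have h1 := (isSplit_linesIn (F.d - 1 - i) h.split).mono hsub' fun b hb t ↦
        ⟨F.limLines_inv hb.1 (-t), (linesIn_inv h.split (hsub' hb) t).1⟩
      exact h1
    have hd' : F.ext.rev.IsDom X (F.limLines X Λ ∩ {b | b.1.1 = σ})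
        (fun b ↦ E.map (orthProj b.1.2).toLinearMap) (fun b ↦ G.map (orthProj b.1.2).toLinearMap)
        η' T' := fun b hb ↦ hd b (hsub' hb)
    have st : S → ∀ t ≥ T, ∀ b ∈ F.limLines X Λ ∩ {b | b.1.1 = σ}, F.ext.rev.StrictAt X b
        (E.map (orthProj b.1.2).toLinearMap) (G.map (orthProj b.1.2).toLinearMap) η t :=
      fun hS t ht b hb ↦ hs hS b (hsub' hb) t ht
    have sp2 := sp.rev (m := F.d - 1) (j := i)
      (fun b ↦ by rw [LinCocycle.rev_fib, F.finrank_ext_fib]) (by omega)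
    have hd2 := LinCocycle.IsDom.rev sp hd'
    have st2 := fun hS t ht ↦ sp.strictAt_rev (st hS t ht)
    rw [LinCocycle.rev_rev] at sp2 hd2
    simp only [LinCocycle.rev_rev] at st2
    exact ⟨_, _, sp2, ⟨η', hη', T', hT', hd2⟩, fun hS b hb t ht ↦ st2 hS t ht b hb⟩

end FlowData

/-! ### Robustness of singular dominated splittings for families of flows -/

namespace FlowData

variable {P M H : Type*} [TopologicalSpace P] [TopologicalSpace M]
  [NormedAddCommGroup H] [InnerProductSpace ℝ H] [FiniteDimensional ℝ H]
  {F : FlowData P M H} {X Y : P} {Λ : Set M} {σ : M} {i : ℕ} {S : Prop} {η T : ℝ}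

/-- The splittings over the singularities have uniform constants. -/
theorem exists_isDom_singular [CompactSpace M] [T2Space M] (hΛ : IsClosed Λ)
    (hi : i ≤ F.d - 1) {V W : M → F.Line → Submodule ℝ H}
    (hsp : ∀ σ ∈ Λ, F.ξ X σ = 0 →
      F.ext.IsSplit X (F.limLines X Λ ∩ {b | b.1.1 = σ}) (V σ) (W σ) i)
    (hd : ∀ σ ∈ Λ, F.ξ X σ = 0 → ∃ η > 0, ∃ T > 0,
      F.ext.IsDom X (F.limLines X Λ ∩ {b | b.1.1 = σ}) (V σ) (W σ) η T) :
    ∃ η > 0, ∃ T > 0, ∀ b ∈ F.limLines X Λ, F.ξ X b.1.1 = 0 →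
      F.ext.DomAt X b (V b.1.1 b) (W b.1.1 b) η T := by
  have : Nonempty P := ⟨X⟩
  have hl := F.continuous_line_val
  set Ks : Set F.Line := F.limLines X Λ ∩ {b | F.ξ X b.1.1 = 0} with hKs
  have hξ : Continuous fun b : F.Line ↦ F.ξ X b.1.1 :=
    F.continuous_ξ.comp (f := fun b : F.Line ↦ (X, b.1.1)) (by fun_prop)
  have hKc : IsCompact Ks := (F.isClosed_limLines.inter (isClosed_eq hξ continuous_const)).isCompact
  let p : Set F.Line → Prop := fun A ↦ ∃ η > 0, ∃ T > 0, ∀ b ∈ A, b ∈ Ks →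
    F.ext.DomAt X b (V b.1.1 b) (W b.1.1 b) η T
  suffices h : p Ks by
    obtain ⟨η, hη, T, hT, h⟩ := h
    exact ⟨η, hη, T, hT, fun b hb hb0 ↦ h b ⟨hb, hb0⟩ ⟨hb, hb0⟩⟩
  -- There may be infinitely many singularities. Near a given one, the robust extension of its
  -- splitting has common constants, and by uniqueness it coincides with the splittings chosen at
  -- the other singularities.
  refine hKc.induction_on (p := p) ⟨1, one_pos, 1, one_pos, by simp⟩ ?_ ?_ ?_
  · rintro s t hst ⟨η, hη, T, hT, h⟩
    exact ⟨η, hη, T, hT, fun b hb ↦ h b (hst hb)⟩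
  · rintro s t ⟨η, hη, T, hT, h⟩ ⟨η', hη', T', hT', h'⟩
    refine ⟨min η η', lt_min hη hη', max T T', lt_max_of_lt_left hT, fun b hb hbK ↦ ?_⟩
    rcases hb with hb | hb
    · have : F.ext.IsDom X {b} (V b.1.1) (W b.1.1) η T := by
        rintro _ rfl
        exact h _ hb hbK
      exact this.weaken (min_le_left _ _) (le_max_left _ _) hT.le b rfl
    · have : F.ext.IsDom X {b} (V b.1.1) (W b.1.1) η' T' := by
        rintro _ rfl
        exact h' _ hb hbK
      exact this.weaken (min_le_right _ _) (le_max_right _ _) hT'.le b rfl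
  · rintro b ⟨hb, hb0⟩
    have hbΛ := F.limLines_subset hΛ hb
    obtain ⟨η, hη, T, hT, hdσ⟩ := hd _ hbΛ hb0
    have hcl : IsClosed (F.limLines X Λ ∩ {b' | b'.1.1 = b.1.1}) :=
      F.isClosed_limLines.inter (isClosed_eq (by fun_prop) continuous_const)
    obtain ⟨O, 𝒱, 𝒲, hO, hbO⟩ := LinCocycle.exists_isRobustSplit F.finrank_ext_fib hi hcl
      (hsp _ hbΛ hb0) hη hdσ
    obtain ⟨η₂, hη₂, T₂, hT₂, hd₂⟩ := hO.dom
    have hQ : IsOpen {z : P × F.Line | z.2 ∈ F.limLines X Λ → z ∈ O} := by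
      have e : {z : P × F.Line | z.2 ∈ F.limLines X Λ → z ∈ O} =
          {z : P × F.Line | z.2 ∈ F.limLines X Λ}ᶜ ∪ O := by
        ext z
        simp [imp_iff_not_or]
      rw [e]
      exact (F.isClosed_limLines.preimage continuous_snd).isOpen_compl.union hO.isOpen
    have h1 := eventually_forall_line (X := X) (σ := b.1.1) hQ fun b' hb' hb'K ↦
      hbO b' ⟨hb'K, hb'⟩
    have h2 : ∀ᶠ b' : F.Line in 𝓝 b, ∀ b'' : F.Line, b''.1.1 = b'.1.1 →
        (X, b'') ∈ {z : P × F.Line | z.2 ∈ F.limLines X Λ → z ∈ O} :=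
      ((by fun_prop : Continuous fun b' : F.Line ↦ (X, b'.1.1)).tendsto b).eventually h1
    refine ⟨_, mem_nhdsWithin_of_mem_nhds h2, η₂, hη₂, T₂, hT₂, ?_⟩
    rintro b' hb' ⟨hb'K, hb'0⟩
    have hin : b' ∈ F.ext.orbitIn X O := fun t ↦
      hb' _ (F.φ_of_sing hb'0 t) (F.limLines_inv hb'K t)
    have hb'Λ := F.limLines_subset hΛ hb'K
    obtain ⟨η₃, hη₃, T₃, hT₃, hd₃⟩ := hd _ hb'Λ hb'0
    obtain ⟨e1, e2⟩ := LinCocycle.IsSplit.eq_of_isDom hη₂ hη₃ (hO.split X) (hd₂ X)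
      (hsp _ hb'Λ hb'0) hd₃ hin ⟨hb'K, rfl⟩
    rw [← e1, ← e2]
    exact hd₂ X b' hin

variable (F) in
/-- The lines spanned by the field at the regular points of a set. -/
def regLines (Y : P) (Λ : Set M) : Set F.Line :=
  {b | b.1.1 ∈ Λ ∧ ∃ h : (Y, b.1.1) ∈ F.regular, b = F.dirLine h}

/-- Singular dominated splittings are robust. -/
theorem exists_robust [CompactSpace M] [T2Space M] (hΛ : IsClosed Λ) (hi : i ≤ F.d - 1)
    {V₀ W₀ : F.Line → Submodule ℝ H} {η₀ T₀ : ℝ} (hη₀ : 0 < η₀) (hT₀ : 0 < T₀)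
    (hsp : F.ext.IsSplit X (F.regLines X Λ) V₀ W₀ i)
    (hd : F.ext.IsDom X (F.regLines X Λ) V₀ W₀ η₀ T₀) (hT : 0 < T)
    (hs : S → ∀ b ∈ F.regLines X Λ, ∀ t ≥ T, F.ext.StrictAt X b (V₀ b) (W₀ b) η t)
    (hsing : ∀ σ ∈ Λ, F.ξ X σ = 0 → F.SingCond X Λ i σ S η T) :
    ∃ O 𝒱 𝒲, F.ext.IsRobustSplit O 𝒱 𝒲 i ∧
      (∀ᶠ z in F.near X Λ, ∀ hz : z ∈ F.regular, (z.1, F.dirLine hz) ∈ O) ∧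
      (∃ A ∈ F.near X Λ, ∀ z ∈ A, F.ξ z.1 z.2 = 0 →
        F.SingCond z.1 {y | (z.1, y) ∈ A} i z.2 S η T) ∧
      (S → ∀ Y, ∀ b ∈ F.ext.orbitIn Y O, ∀ t ≥ T, F.ext.StrictAt Y b (𝒱 Y b) (𝒲 Y b) η t) := by
  classical
  have : Nonempty P := ⟨X⟩
  choose! V W hspV hdV hstV using fun (σ : M) (hσ : σ ∈ Λ) (h0 : F.ξ X σ = 0) ↦
    (hsing σ hσ h0).exists_split hΛ hi
  obtain ⟨η₁, hη₁, T₁, hT₁, hd₁⟩ := exists_isDom_singular hΛ hi hspV hdV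
  set K := F.limLines X Λ with hK
  have hKΛ : ∀ b ∈ K, b.1.1 ∈ Λ := fun b hb ↦ F.limLines_subset hΛ hb
  have hreg : ∀ b ∈ K, F.ξ X b.1.1 ≠ 0 → b ∈ F.regLines X Λ := fun b hb h0 ↦
    ⟨hKΛ b hb, h0, F.limLines_regular hb h0⟩
  -- The two pieces are glued without any continuity requirement: `LinCocycle.exists_isRobustSplit`
  -- only asks for an invariant splitting with uniform domination over a closed set.
  let V' : F.Line → Submodule ℝ H := fun b ↦ if F.ξ X b.1.1 = 0 then V b.1.1 b else V₀ b
  let W' : F.Line → Submodule ℝ H := fun b ↦ if F.ξ X b.1.1 = 0 then W b.1.1 b else W₀ b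
  have V's : ∀ b, F.ξ X b.1.1 = 0 → V' b = V b.1.1 b := fun b h ↦ if_pos h
  have V'r : ∀ b, F.ξ X b.1.1 ≠ 0 → V' b = V₀ b := fun b h ↦ if_neg h
  have W's : ∀ b, F.ξ X b.1.1 = 0 → W' b = W b.1.1 b := fun b h ↦ if_pos h
  have W'r : ∀ b, F.ξ X b.1.1 ≠ 0 → W' b = W₀ b := fun b h ↦ if_neg h
  have hΦs : ∀ (b : F.Line) t, F.ξ X b.1.1 = 0 → (F.ext.Φ X t b).1.1 = b.1.1 := fun b t h ↦
    F.φ_of_sing h t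
  have hΦr : ∀ (b : F.Line) t, F.ξ X b.1.1 ≠ 0 → F.ξ X (F.ext.Φ X t b).1.1 ≠ 0 := fun b t h ↦
    F.ξ_φ_ne_zero h t
  have sp : F.ext.IsSplit X K V' W' i := by
    refine ⟨fun b hb t ↦ F.limLines_inv hb t, fun b hb ↦ ?_, fun b hb ↦ ?_, fun b hb ↦ ?_,
      fun b hb t v hv ↦ ?_, fun b hb t v hv ↦ ?_⟩ <;> by_cases h0 : F.ξ X b.1.1 = 0
    · rw [V's b h0, W's b h0]
      exact (hspV _ (hKΛ b hb) h0).sup_eq b ⟨hb, rfl⟩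
    · rw [V'r b h0, W'r b h0]
      exact hsp.sup_eq b (hreg b hb h0)
    · rw [V's b h0, W's b h0]
      exact (hspV _ (hKΛ b hb) h0).disj b ⟨hb, rfl⟩
    · rw [V'r b h0, W'r b h0]
      exact hsp.disj b (hreg b hb h0)
    · rw [V's b h0]
      exact (hspV _ (hKΛ b hb) h0).rank b ⟨hb, rfl⟩
    · rw [V'r b h0]
      exact hsp.rank b (hreg b hb h0)
    · rw [V's b h0] at hv
      rw [V's _ (by rw [hΦs b t h0]; exact h0), hΦs b t h0]
      exact (hspV _ (hKΛ b hb) h0).map_left b ⟨hb, rfl⟩ t v hv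
    · rw [V'r b h0] at hv
      rw [V'r _ (hΦr b t h0)]
      exact hsp.map_left b (hreg b hb h0) t v hv
    · rw [W's b h0] at hv
      rw [W's _ (by rw [hΦs b t h0]; exact h0), hΦs b t h0]
      exact (hspV _ (hKΛ b hb) h0).map_right b ⟨hb, rfl⟩ t v hv
    · rw [W'r b h0] at hv
      rw [W'r _ (hΦr b t h0)]
      exact hsp.map_right b (hreg b hb h0) t v hv
  have hdom : F.ext.IsDom X K V' W' (min η₀ η₁) (max T₀ T₁) := by
    intro b hb
    by_cases h0 : F.ξ X b.1.1 = 0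
    · have h1 : F.ext.IsDom X {b} (V b.1.1) (W b.1.1) η₁ T₁ := by
        rintro _ rfl
        exact hd₁ _ hb h0
      rw [V's b h0, W's b h0]
      exact h1.weaken (min_le_right _ _) (le_max_right _ _) hT₁.le b rfl
    · rw [V'r b h0, W'r b h0]
      exact hd.weaken (min_le_left _ _) (le_max_left _ _) hT₀.le b (hreg b hb h0)
  have hηm : 0 < min η₀ η₁ := lt_min hη₀ hη₁
  have hst : S → ∀ b ∈ K, ∀ t ≥ T, F.ext.StrictAt X b (V' b) (W' b) η t := by
    intro hS b hb t ht
    by_cases h0 : F.ξ X b.1.1 = 0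
    · rw [V's b h0, W's b h0]
      exact hstV _ (hKΛ b hb) h0 hS b ⟨hb, rfl⟩ t ht
    · rw [V'r b h0, W'r b h0]
      exact hs hS b (hreg b hb h0) t ht
  have hOex : ∃ O 𝒱 𝒲, F.ext.IsRobustSplit O 𝒱 𝒲 i ∧ (∀ b ∈ K, (X, b) ∈ O) ∧
      (S → ∀ Y, ∀ b ∈ F.ext.orbitIn Y O, ∀ t ≥ T,
        F.ext.StrictAt Y b (𝒱 Y b) (𝒲 Y b) η t) := by
    obtain ⟨O, 𝒱, 𝒲, hO, hKO⟩ := LinCocycle.exists_isRobustSplit F.finrank_ext_fib hi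
      F.isClosed_limLines sp hηm hdom
    by_cases hS : S
    · obtain ⟨η₂, hη₂, T₂, hT₂, hd₂⟩ := hO.dom
      obtain ⟨O', -, hO', hKO', hst'⟩ := hO.exists_strict hKO sp.inv (η := η) hT fun b hb t ht ↦ by
        obtain ⟨e1, e2⟩ := LinCocycle.IsSplit.eq_of_isDom hη₂ hηm (hO.split X) (hd₂ X) sp hdom
          (fun t ↦ hKO _ (sp.inv b hb t)) hb
        rw [e1, e2]
        exact hst hS b hb t ht.1
      exact ⟨O', 𝒱, 𝒲, hO', hKO', fun _ ↦ hst'⟩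
    · exact ⟨O, 𝒱, 𝒲, hO, hKO, fun hS' ↦ absurd hS' hS⟩
  obtain ⟨O, 𝒱, 𝒲, hO, hKO, hstO⟩ := hOex
  refine ⟨O, 𝒱, 𝒲, hO, F.eventually_near_dirLine hO.isOpen hKO, ?_, hstO⟩
  let p : Set M → Prop := fun Q ↦ ∃ A ∈ F.near X Λ, ∃ U ∈ 𝓝ˢ Q, ∀ᶠ Y in 𝓝 X, ∀ x ∈ U,
    F.ξ Y x = 0 → F.SingCond Y {y | (Y, y) ∈ A} i x S η T
  -- Compactness of `Λ` merges the local statements into one neighbourhood. At a regular point there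
  -- is nothing to prove, since nearby fields do not vanish near it.
  have hp : p Λ := by
    refine hΛ.isCompact.induction_on (p := p) ⟨univ, univ_mem, ∅, by simp, by simp⟩ ?_ ?_ ?_
    · rintro s t hst ⟨A, hA, U, hU, h⟩
      exact ⟨A, hA, U, nhdsSet_mono hst hU, h⟩
    · rintro s t ⟨A, hA, U, hU, h⟩ ⟨A', hA', U', hU', h'⟩
      refine ⟨A ∩ A', inter_mem hA hA', U ∪ U', union_mem_nhdsSet hU hU', ?_⟩
      filter_upwards [h, h'] with Y hY hY' x hx h0
      rcases hx with hx | hx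
      · exact (hY x hx h0).mono fun y hy ↦ hy.1
      · exact (hY' x hx h0).mono fun y hy ↦ hy.2
    · intro σ hσ
      have hloc : ∃ N ∈ 𝓝 (X, σ), ∃ A ∈ F.near X Λ, ∀ z ∈ N, F.ξ z.1 z.2 = 0 →
          F.SingCond z.1 {y | (z.1, y) ∈ A} i z.2 S η T := by
        by_cases h0 : F.ξ X σ = 0
        · exact (hsing σ hσ h0).persist hΛ hi hT
        · refine ⟨F.regular, ?_, univ, univ_mem, fun z hz hz0 ↦ absurd hz0 hz⟩
          exact (F.continuous_ξ.tendsto (X, σ)).eventually_ne h0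
      obtain ⟨N, hN, A, hA, h⟩ := hloc
      obtain ⟨𝒰, h𝒰, U, hU, hsub⟩ := mem_nhds_prod_iff.1 hN
      refine ⟨interior U, mem_nhdsWithin_of_mem_nhds (interior_mem_nhds.2 hU), A, hA, U,
        subset_interior_iff_mem_nhdsSet.1 Subset.rfl, ?_⟩
      filter_upwards [h𝒰] with Y hY x hx h0
      exact h (Y, x) (hsub ⟨hY, hx⟩) h0
  obtain ⟨A, hA, U, hU, h⟩ := hp
  refine ⟨A ∩ ({z | ∀ x ∈ U, F.ξ z.1 x = 0 → F.SingCond z.1 {y | (z.1, y) ∈ A} i x S η T} ∩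
    {z | z.2 ∈ U}), inter_mem hA (inter_mem (F.tendsto_near_fst.eventually h)
      (F.tendsto_near_snd hU)), fun z hz hz0 ↦ ?_⟩
  exact (hz.2.1 z.2 hz.2.2 hz0).mono fun y hy ↦ hy.1

end FlowData

/-! ### Time-one maps of small `C¹` fields on a ball -/

section LocalFlow

variable {E : Type*} [NormedAddCommGroup E] [NormedSpace ℝ E]

/-- Grönwall with constant `1/2` on the unit interval, where `exp (1/2) ≤ 2` gives explicit
constants. It serves for solutions, fundamental solutions and remainders alike. -/
theorem norm_le_of_deriv_le {f f' : ℝ → E} {δ ε : ℝ} (hδ : 0 ≤ δ) (hε : 0 ≤ ε)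
    (hf : ∀ t ∈ Icc (0 : ℝ) 1, HasDerivWithinAt f (f' t) (Icc 0 1) t) (h0 : ‖f 0‖ ≤ δ)
    (hb : ∀ t ∈ Icc (0 : ℝ) 1, ‖f' t‖ ≤ 1 / 2 * ‖f t‖ + ε) {t : ℝ} (ht : t ∈ Icc (0 : ℝ) 1) :
    ‖f t‖ ≤ 2 * (δ + ε) := by
  have h1 := norm_le_gronwallBound_of_norm_deriv_right_le (K := 1 / 2) (a := 0) (b := 1)
    (fun t ht ↦ (hf t ht).continuousWithinAt)
    (fun t ht ↦ (hf t ⟨ht.1, ht.2.le⟩).mono_of_mem_nhdsWithin (Icc_mem_nhdsGE_of_mem ht)) h0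
    (fun t ht ↦ hb t ⟨ht.1, ht.2.le⟩) t ht
  refine h1.trans ?_
  rw [gronwallBound_of_K_ne_0 (by norm_num)]
  have h2 : Real.exp (1 / 2 * (t - 0)) ≤ 2 := by
    have h3 : Real.exp (1 / 2 * (t - 0)) ≤ Real.exp (1 / 2) := by
      apply Real.exp_le_exp.2
      linarith [ht.2]
    refine h3.trans ?_
    have h4 : Real.exp (1 / 2) * Real.exp (1 / 2) = Real.exp 1 := by
      rw [← Real.exp_add]; norm_num
    nlinarith [Real.exp_one_lt_d9, Real.exp_pos (1 / 2)]
  have h5 := mul_le_mul_of_nonneg_left h2 hδ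
  have h6 := mul_le_mul_of_nonneg_left h2 hε
  have : ε / (1 / 2) * (Real.exp (1 / 2 * (t - 0)) - 1) =
      2 * (ε * Real.exp (1 / 2 * (t - 0))) - 2 * ε := by ring
  beta_reduce
  rw [this]
  linarith

/-- A `C¹` field on the ball of radius `r` which is small enough for the orbits of the points of the
ball of radius `r / 2` to be defined for times in `[-1, 1]`. -/
structure IsSmallField (p₀ : E) (r : ℝ) (f : E → E) (f' : E → E →L[ℝ] E) : Prop where
  hasFDerivAt : ∀ p ∈ Metric.closedBall p₀ r, HasFDerivAt f (f' p) p
  continuousOn : ContinuousOn f' (Metric.closedBall p₀ r)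
  norm_le : ∀ p ∈ Metric.closedBall p₀ r, ‖f p‖ ≤ r / 2
  norm_deriv_le : ∀ p ∈ Metric.closedBall p₀ r, ‖f' p‖ ≤ 1 / 2

/-- Integral curves on `[0, 1]`. -/
def IsSol (p₀ : E) (r : ℝ) (f : E → E) (x : ℝ → E) : Prop :=
  ∀ t ∈ Icc (0 : ℝ) 1, x t ∈ Metric.closedBall p₀ r ∧ HasDerivWithinAt x (f (x t)) (Icc 0 1) t

/-- Fundamental solutions on `[0, 1]` of a linear differential equation. -/
def IsFund (A : ℝ → E →L[ℝ] E) (Φ : ℝ → E →L[ℝ] E) : Prop :=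
  Φ 0 = ContinuousLinearMap.id ℝ E ∧
    ∀ t ∈ Icc (0 : ℝ) 1, HasDerivWithinAt Φ ((A t).comp (Φ t)) (Icc 0 1) t

variable {p₀ : E} {r : ℝ} {f g : E → E} {f' g' : E → E →L[ℝ] E} {x y : ℝ → E}

theorem IsSmallField.lipschitz (hf : IsSmallField p₀ r f f') {p q : E}
    (hp : p ∈ Metric.closedBall p₀ r) (hq : q ∈ Metric.closedBall p₀ r) :
    ‖f q - f p‖ ≤ 1 / 2 * ‖q - p‖ :=
  (convex_closedBall p₀ r).norm_image_sub_le_of_norm_hasFDerivWithin_le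
    (fun z hz ↦ (hf.hasFDerivAt z hz).hasFDerivWithinAt) hf.norm_deriv_le hp hq

/-- The estimates on the field hold on a ball only, so the solution has to come with the information
that it stays there. -/
theorem exists_integral_of_picard [CompleteSpace E] {f : ℝ → E → E} {tmin tmax : ℝ}
    {t₀ : Icc tmin tmax} {x₀ x : E} {a r L K : NNReal} (hf : IsPicardLindelof f t₀ x₀ a r L K)
    (hx : x ∈ Metric.closedBall x₀ r) : ∃ α : ℝ → E, α t₀ = x ∧ ∀ t ∈ Icc tmin tmax,
      α t ∈ Metric.closedBall x₀ a ∧ HasDerivWithinAt α (f t (α t)) (Icc tmin tmax) t := by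
  obtain ⟨α, hα⟩ := ODE.FunSpace.exists_isFixedPt_next hf hx
  refine ⟨α.compProj, by rw [ODE.FunSpace.compProj_val, ← hα, ODE.FunSpace.next_apply₀],
    fun t ht ↦ ⟨α.compProj_mem_closedBall hf.mul_max_le, ?_⟩⟩
  apply ODE.hasDerivWithinAt_picard_Icc t₀.2 hf.continuousOn_uncurry
    α.continuous_compProj.continuousOn (fun _ ht' ↦ α.compProj_mem_closedBall hf.mul_max_le)
    x ht |>.congr_of_mem _ ht
  intro t' ht'
  nth_rw 1 [← hα]
  rw [ODE.FunSpace.compProj_of_mem ht', ODE.FunSpace.next_apply]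

theorem IsSmallField.exists_sol [CompleteSpace E] (hr : 0 < r) (hf : IsSmallField p₀ r f f') {p : E}
    (hp : p ∈ Metric.closedBall p₀ (r / 2)) : ∃ x : ℝ → E, x 0 = p ∧ ∀ t ∈ Icc (-1 : ℝ) 1,
      x t ∈ Metric.closedBall p₀ r ∧ HasDerivWithinAt x (f (x t)) (Icc (-1) 1) t := by
  have hpl : IsPicardLindelof (fun _ ↦ f) (tmin := -1) (tmax := 1) ⟨0, by norm_num⟩ p₀
      ⟨r, hr.le⟩ ⟨r / 2, by positivity⟩ ⟨r / 2, by positivity⟩ ⟨1 / 2, by norm_num⟩ := by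
    refine IsPicardLindelof.of_time_independent hf.norm_le ?_ ?_
    · refine LipschitzOnWith.of_dist_le_mul fun p hp q hq ↦ ?_
      rw [dist_eq_norm, dist_eq_norm]
      exact hf.lipschitz hq hp
    · change (r / 2) * max ((1 : ℝ) - 0) (0 - (-1)) ≤ r - r / 2
      norm_num
      linarith
  exact exists_integral_of_picard hpl hp

/-- The linear equation is solved by the same Picard argument in the space of operators, on the ball
of radius 2 around zero. -/
theorem exists_isFund [CompleteSpace E] {A : ℝ → E →L[ℝ] E} (hA : ContinuousOn A (Icc 0 1))
    (hA1 : ∀ t ∈ Icc (0 : ℝ) 1, ‖A t‖ ≤ 1 / 2) : ∃ Φ, IsFund A Φ := by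
  have hpl : IsPicardLindelof (fun t (B : E →L[ℝ] E) ↦ (A t).comp B) (tmin := 0) (tmax := 1)
      ⟨0, by norm_num⟩ 0 2 1 1 ⟨1 / 2, by norm_num⟩ := by
    refine ⟨fun t ht ↦ ?_, fun B _ ↦ ?_, fun t ht B hB ↦ ?_, ?_⟩
    · refine LipschitzOnWith.of_dist_le_mul fun B _ B' _ ↦ ?_
      rw [dist_eq_norm, dist_eq_norm, ← ContinuousLinearMap.comp_sub]
      refine (ContinuousLinearMap.opNorm_comp_le _ _).trans ?_
      gcongr
      exact hA1 t ht
    · exact hA.clm_comp continuousOn_const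
    · refine (ContinuousLinearMap.opNorm_comp_le _ _).trans ?_
      have h1 := hA1 t ht
      have h2 : ‖B‖ ≤ 2 := by simpa using hB
      calc ‖A t‖ * ‖B‖ ≤ 1 / 2 * 2 := by gcongr
        _ = _ := by norm_num
    · simp
      norm_num
  obtain ⟨Φ, h0, hΦ⟩ := exists_integral_of_picard hpl (x := ContinuousLinearMap.id ℝ E) (by
    simpa using ContinuousLinearMap.norm_id_le)
  exact ⟨Φ, h0, fun t ht ↦ (hΦ t ht).2⟩

theorem IsFund.norm_le {A Φ : ℝ → E →L[ℝ] E} (h : IsFund A Φ)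
    (hA1 : ∀ t ∈ Icc (0 : ℝ) 1, ‖A t‖ ≤ 1 / 2) {t : ℝ} (ht : t ∈ Icc (0 : ℝ) 1) : ‖Φ t‖ ≤ 2 := by
  have := norm_le_of_deriv_le zero_le_one le_rfl h.2 (by
    rw [h.1]
    exact ContinuousLinearMap.norm_id_le) (fun t ht ↦ ?_) ht
  · simpa using this
  · rw [add_zero]
    exact (ContinuousLinearMap.opNorm_comp_le _ _).trans (by gcongr; exact hA1 t ht)

theorem IsFund.norm_sub_le {A A' Φ Φ' : ℝ → E →L[ℝ] E} (h : IsFund A Φ) (h' : IsFund A' Φ')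
    (hA1 : ∀ t ∈ Icc (0 : ℝ) 1, ‖A t‖ ≤ 1 / 2) (hA1' : ∀ t ∈ Icc (0 : ℝ) 1, ‖A' t‖ ≤ 1 / 2) {ε : ℝ}
    (hε : 0 ≤ ε) (hAA : ∀ t ∈ Icc (0 : ℝ) 1, ‖A t - A' t‖ ≤ ε) {t : ℝ} (ht : t ∈ Icc (0 : ℝ) 1) :
    ‖Φ t - Φ' t‖ ≤ 4 * ε := by
  have := norm_le_of_deriv_le (δ := 0) (ε := ε * 2) le_rfl (by positivity)
    (fun t ht ↦ (h.2 t ht).sub (h'.2 t ht)) (by simp [h.1, h'.1]) (fun t ht ↦ ?_) ht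
  · simp only [Pi.sub_apply] at this
    linarith
  · have e : (A t).comp (Φ t) - (A' t).comp (Φ' t) =
        (A t).comp (Φ t - Φ' t) + (A t - A' t).comp (Φ' t) := by
      simp only [ContinuousLinearMap.comp_sub, ContinuousLinearMap.sub_comp]
      abel
    rw [e]
    refine (norm_add_le _ _).trans (add_le_add ?_ ?_)
    · exact (ContinuousLinearMap.opNorm_comp_le _ _).trans (by
        gcongr
        · exact hA1 t ht
        · rfl)
    · refine (ContinuousLinearMap.opNorm_comp_le _ _).trans ?_
      gcongr
      · exact hAA t ht
      · exact h'.norm_le hA1' ht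

theorem IsSol.norm_sub_le (hf : IsSmallField p₀ r f f') (hx : IsSol p₀ r f x) (hy : IsSol p₀ r g y)
    {δ ε : ℝ} (hε : 0 ≤ ε) (hfg : ∀ p ∈ Metric.closedBall p₀ r, ‖f p - g p‖ ≤ ε)
    (h0 : ‖x 0 - y 0‖ ≤ δ) {t : ℝ} (ht : t ∈ Icc (0 : ℝ) 1) : ‖x t - y t‖ ≤ 2 * (δ + ε) := by
  refine norm_le_of_deriv_le ((norm_nonneg _).trans h0) hε
    (fun t ht ↦ (hx t ht).2.sub (hy t ht).2) h0 (fun t ht ↦ ?_) ht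
  calc ‖f (x t) - g (y t)‖ = ‖(f (x t) - f (y t)) + (f (y t) - g (y t))‖ := by
        congr 1; abel
    _ ≤ 1 / 2 * ‖x t - y t‖ + ε := (norm_add_le _ _).trans
        (add_le_add (hf.lipschitz (hy t ht).1 (hx t ht).1) (hfg _ (hy t ht).1))

theorem IsSol.continuousOn (hx : IsSol p₀ r f x) : ContinuousOn x (Icc 0 1) :=
  fun t ht ↦ (hx t ht).2.continuousWithinAt

theorem IsSmallField.exists_isFund [CompleteSpace E] (hf : IsSmallField p₀ r f f')
    (hx : IsSol p₀ r f x) : ∃ Φ, IsFund (fun t ↦ f' (x t)) Φ :=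
  SingDom.exists_isFund (hf.continuousOn.comp hx.continuousOn fun t ht ↦ (hx t ht).1)
    fun t ht ↦ hf.norm_deriv_le _ (hx t ht).1

variable [FiniteDimensional ℝ E]

theorem IsSmallField.exists_delta (hf : IsSmallField p₀ r f f') {ε : ℝ} (hε : 0 < ε) :
    ∃ δ > 0, ∀ p ∈ Metric.closedBall p₀ r, ∀ q ∈ Metric.closedBall p₀ r, ‖p - q‖ ≤ δ →
      ‖f' p - f' q‖ ≤ ε := by
  have : ProperSpace E := FiniteDimensional.proper ℝ E
  have hu := (isCompact_closedBall p₀ r).uniformContinuousOn_of_continuous hf.continuousOn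
  obtain ⟨δ, hδ, h⟩ := Metric.uniformContinuousOn_iff.1 hu ε hε
  refine ⟨δ / 2, by positivity, fun p hp q hq hpq ↦ ?_⟩
  have := h p hp q hq (by rw [dist_eq_norm]; linarith)
  rw [dist_eq_norm] at this
  exact this.le

/-- The time one map of a small field is differentiable. -/
theorem IsSmallField.hasFDerivAt_flow (hf : IsSmallField p₀ r f f') {X : E → ℝ → E} {p : E}
    (hX : ∀ᶠ q in 𝓝 p, X q 0 = q ∧ IsSol p₀ r f (X q)) {Φ : ℝ → E →L[ℝ] E}
    (hΦ : IsFund (fun t ↦ f' (X p t)) Φ) : HasFDerivAt (fun q ↦ X q 1) (Φ 1) p := by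
  obtain ⟨hp0, hp⟩ := hX.self_of_nhds
  rw [hasFDerivAt_iff_isLittleO, Asymptotics.isLittleO_iff]
  intro c hc
  obtain ⟨δ, hδ, hδ'⟩ := hf.exists_delta (show 0 < c / 4 by positivity)
  filter_upwards [hX, Metric.closedBall_mem_nhds p (show 0 < δ / 2 by positivity)] with q hq hqδ
  obtain ⟨hq0, hq⟩ := hq
  rw [mem_closedBall_iff_norm] at hqδ
  have hclose : ∀ t ∈ Icc (0 : ℝ) 1, ‖X q t - X p t‖ ≤ 2 * ‖q - p‖ := by
    intro t ht
    have := IsSol.norm_sub_le hf hq hp le_rfl (fun p _ ↦ by simp)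
      (show ‖X q 0 - X p 0‖ ≤ ‖q - p‖ by rw [hq0, hp0]) ht
    simpa using this
  -- The remainder of the expected linear approximation vanishes at time zero. It solves the
  -- linearized equation up to the Taylor error of `f`, which is small by uniform continuity of
  -- `f'`.
  have key := norm_le_of_deriv_le (f := fun t ↦ X q t - X p t - Φ t (q - p)) (δ := 0)
    (ε := c / 2 * ‖q - p‖) le_rfl (by positivity)
    (fun t ht ↦ ((hq t ht).2.sub (hp t ht).2).sub
      ((hΦ.2 t ht).clm_apply (hasDerivWithinAt_const t _ (q - p))))
    (by simp [hΦ.1, hq0, hp0]) (fun t ht ↦ ?_) (right_mem_Icc.2 zero_le_one)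
  · simpa using key.trans (le_of_eq (by ring))
  · simp only [ContinuousLinearMap.comp_apply, map_zero, add_zero]
    have hxp := (hp t ht).1
    have hxq := (hq t ht).1
    have h1 : ‖f (X q t) - f (X p t) - f' (X p t) (X q t - X p t)‖ ≤
        c / 4 * ‖X q t - X p t‖ := by
      have hcv : Convex ℝ (Metric.closedBall p₀ r ∩ Metric.closedBall (X p t) δ) :=
        (convex_closedBall _ _).inter (convex_closedBall _ _)
      refine hcv.norm_image_sub_le_of_norm_hasFDerivWithin_le' (f' := f')
        (fun z hz ↦ (hf.hasFDerivAt z hz.1).hasFDerivWithinAt) (fun z hz ↦ ?_)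
        ⟨hxp, Metric.mem_closedBall_self hδ.le⟩ ⟨hxq, ?_⟩
      · exact hδ' z hz.1 _ hxp (by rw [← dist_eq_norm]; exact hz.2)
      · rw [mem_closedBall_iff_norm]
        linarith [hclose t ht]
    calc ‖f (X q t) - f (X p t) - f' (X p t) (Φ t (q - p))‖
        = ‖f' (X p t) (X q t - X p t - Φ t (q - p)) +
          (f (X q t) - f (X p t) - f' (X p t) (X q t - X p t))‖ := by
          congr 1
          rw [map_sub (f' (X p t)) (X q t - X p t) (Φ t (q - p))]
          abel
      _ ≤ 1 / 2 * ‖X q t - X p t - Φ t (q - p)‖ + c / 4 * ‖X q t - X p t‖ :=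
          (norm_add_le _ _).trans (add_le_add (((f' (X p t)).le_opNorm _).trans (by
            gcongr
            exact hf.norm_deriv_le _ hxp)) h1)
      _ ≤ 1 / 2 * ‖X q t - X p t - Φ t (q - p)‖ + c / 4 * (2 * ‖q - p‖) := by
          gcongr
          exact hclose t ht
      _ = _ := by ring

/-- The time one map of a small field and its derivative depend continuously on the field and on
the initial point. -/
theorem IsSmallField.exists_close (hf : IsSmallField p₀ r f f') (hx : IsSol p₀ r f x)
    {Φ : ℝ → E →L[ℝ] E} (hΦ : IsFund (fun t ↦ f' (x t)) Φ) {ε : ℝ} (hε : 0 < ε) :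
    ∃ δ > 0, ∀ g g' y Ψ, IsSmallField p₀ r g g' → IsSol p₀ r g y → IsFund (fun t ↦ g' (y t)) Ψ →
      (∀ p ∈ Metric.closedBall p₀ r, ‖g p - f p‖ ≤ δ ∧ ‖g' p - f' p‖ ≤ δ) →
      ‖y 0 - x 0‖ ≤ δ → ‖y 1 - x 1‖ ≤ ε ∧ ‖Ψ 1 - Φ 1‖ ≤ ε := by
  obtain ⟨δ, hδ, hδ'⟩ := hf.exists_delta (show 0 < ε / 8 by positivity)
  have hm : 0 < min (δ / 4) (ε / 8) := by positivity
  refine ⟨min (δ / 4) (ε / 8), hm, ?_⟩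
  intro g g' y Ψ hg hy hΨ hfg h0
  have hxy : ∀ t ∈ Icc (0 : ℝ) 1, ‖y t - x t‖ ≤ 4 * min (δ / 4) (ε / 8) := by
    intro t ht
    have := IsSol.norm_sub_le hg hy hx hm.le (fun p hp ↦ (hfg p hp).1) h0 ht
    linarith
  have hm1 := min_le_left (δ / 4) (ε / 8)
  have hm2 := min_le_right (δ / 4) (ε / 8)
  refine ⟨(hxy 1 (right_mem_Icc.2 zero_le_one)).trans (by linarith), ?_⟩
  have := hΨ.norm_sub_le hΦ (fun t ht ↦ hg.norm_deriv_le _ (hy t ht).1)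
    (fun t ht ↦ hf.norm_deriv_le _ (hx t ht).1) (ε := ε / 4) (by positivity) (fun t ht ↦ ?_)
    (right_mem_Icc.2 zero_le_one)
  · linarith
  · have h1 := (hfg (y t) (hy t ht).1).2
    have h2 := hδ' (y t) (hy t ht).1 (x t) (hx t ht).1 ((hxy t ht).trans (by linarith))
    calc ‖g' (y t) - f' (x t)‖ = ‖(g' (y t) - f' (y t)) + (f' (y t) - f' (x t))‖ := by
          congr 1; abel
      _ ≤ min (δ / 4) (ε / 8) + ε / 8 := (norm_add_le _ _).trans (add_le_add h1 h2)
      _ ≤ ε / 4 := by linarith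

end LocalFlow

/-! ### Flows of `C¹` fields on the manifold, in charts -/

section ManifoldFlow

variable {d : ℕ} {M : Type*} [TopologicalSpace M] [ChartedSpace (EuclideanSpace ℝ (Fin d)) M]
  [IsManifold (𝓡 d) ∞ M]

theorem trivializationAt_snd {x₀ x : M} (hx : x ∈ (extChartAt (𝓡 d) x₀).source) (v : Tan d x) :
    (trivializationAt (EuclideanSpace ℝ (Fin d)) (fun x : M ↦ TangentSpace (𝓡 d) x) x₀ ⟨x, v⟩).2 =
      mfderiv (𝓡 d) 𝓘(ℝ, EuclideanSpace ℝ (Fin d)) (extChartAt (𝓡 d) x₀) x v := by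
  rw [extChartAt_source] at hx
  have h : (trivializationAt (EuclideanSpace ℝ (Fin d)) (fun x : M ↦ TangentSpace (𝓡 d) x)
      x₀).continuousLinearMapAt ℝ x v = (trivializationAt (EuclideanSpace ℝ (Fin d))
        (fun x : M ↦ TangentSpace (𝓡 d) x) x₀ ⟨x, v⟩).2 := by
    rw [Trivialization.continuousLinearMapAt_apply,
      Trivialization.coe_linearMapAt_of_mem _ (by simpa)]
  exact h.symm.trans
    (DFunLike.congr_fun (TangentBundle.continuousLinearMapAt_trivializationAt hx) v)

theorem chartRep_eq (X : VectorField d M) (x₀ : M) {p : EuclideanSpace ℝ (Fin d)}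
    (hp : p ∈ (extChartAt (𝓡 d) x₀).target) :
    chartRep X x₀ p = mfderiv (𝓡 d) 𝓘(ℝ, EuclideanSpace ℝ (Fin d)) (extChartAt (𝓡 d) x₀)
      ((extChartAt (𝓡 d) x₀).symm p) (X ((extChartAt (𝓡 d) x₀).symm p)) :=
  trivializationAt_snd ((extChartAt (𝓡 d) x₀).map_target hp) _

theorem contDiffOn_chartRep (X : VectorField d M) (x₀ : M) :
    ContDiffOn ℝ 1 (chartRep X x₀) (extChartAt (𝓡 d) x₀).target := by
  rw [← contMDiffOn_iff_contDiffOn]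
  have h1 : ContMDiffOn 𝓘(ℝ, EuclideanSpace ℝ (Fin d)) ((𝓡 d).prod 𝓘(ℝ, EuclideanSpace ℝ (Fin d))) 1
      (fun p ↦ (⟨(extChartAt (𝓡 d) x₀).symm p, X ((extChartAt (𝓡 d) x₀).symm p)⟩ :
        TotalSpace (EuclideanSpace ℝ (Fin d)) (fun x : M ↦ TangentSpace (𝓡 d) x)))
      (extChartAt (𝓡 d) x₀).target :=
    X.contMDiff.comp_contMDiffOn (contMDiffOn_extChartAt_symm x₀)
  refine (((trivializationAt (EuclideanSpace ℝ (Fin d)) (fun x : M ↦ TangentSpace (𝓡 d) x)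
    x₀).contMDiffOn_iff (fun p hp ↦ ?_)).1 h1).2
  rw [Trivialization.mem_source]
  have := (extChartAt (𝓡 d) x₀).map_target hp
  rw [extChartAt_source] at this
  simpa using this

theorem hasMFDerivAt_extChartAt_symm (x₀ : M) {p : EuclideanSpace ℝ (Fin d)}
    (hp : p ∈ (extChartAt (𝓡 d) x₀).target) :
    HasMFDerivAt 𝓘(ℝ, EuclideanSpace ℝ (Fin d)) (𝓡 d) (extChartAt (𝓡 d) x₀).symm p
      (mfderiv 𝓘(ℝ, EuclideanSpace ℝ (Fin d)) (𝓡 d) (extChartAt (𝓡 d) x₀).symm p) := by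
  have := mdifferentiableWithinAt_extChartAt_symm (I := 𝓡 d) hp
  rw [(𝓡 d).range_eq_univ, mdifferentiableWithinAt_univ] at this
  exact this.hasMFDerivAt

theorem mfderiv_symm_mfderiv (x₀ : M) {p : EuclideanSpace ℝ (Fin d)}
    (hp : p ∈ (extChartAt (𝓡 d) x₀).target) (v : Tan d ((extChartAt (𝓡 d) x₀).symm p)) :
    mfderiv 𝓘(ℝ, EuclideanSpace ℝ (Fin d)) (𝓡 d) (extChartAt (𝓡 d) x₀).symm p
      (mfderiv (𝓡 d) 𝓘(ℝ, EuclideanSpace ℝ (Fin d)) (extChartAt (𝓡 d) x₀)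
        ((extChartAt (𝓡 d) x₀).symm p) v) = v := by
  have := mfderivWithin_extChartAt_symm_comp_mfderiv_extChartAt (I := 𝓡 d) hp
  rw [(𝓡 d).range_eq_univ, mfderivWithin_univ] at this
  exact DFunLike.congr_fun this v

theorem mfderiv_mfderiv_symm (x₀ : M) {p : EuclideanSpace ℝ (Fin d)}
    (hp : p ∈ (extChartAt (𝓡 d) x₀).target) (v : EuclideanSpace ℝ (Fin d)) :
    mfderiv (𝓡 d) 𝓘(ℝ, EuclideanSpace ℝ (Fin d)) (extChartAt (𝓡 d) x₀)
        ((extChartAt (𝓡 d) x₀).symm p)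
      (mfderiv 𝓘(ℝ, EuclideanSpace ℝ (Fin d)) (𝓡 d) (extChartAt (𝓡 d) x₀).symm p v) = v := by
  have := mfderiv_extChartAt_comp_mfderivWithin_extChartAt_symm (I := 𝓡 d) hp
  rw [(𝓡 d).range_eq_univ, mfderivWithin_univ] at this
  exact DFunLike.congr_fun this v

theorem mem_nhds_c1Close (X : VectorField d M) (x₀ : M) {K : Set (EuclideanSpace ℝ (Fin d))}
    (hK : IsCompact K) (hK' : K ⊆ (extChartAt (𝓡 d) x₀).target) {ε : ℝ} (hε : 0 < ε) :
    c1Close X x₀ K ε ∈ 𝓝 X := by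
  refine IsOpen.mem_nhds (TopologicalSpace.isOpen_generateFrom_of_mem
    ⟨X, x₀, K, ε, hK, hK', hε, rfl⟩) fun p _ ↦ ?_
  simpa using hε

/-- In a chart, the fields `t • Y` are small for small `t` and `Y` close to a given field. -/
theorem exists_isSmallField (X : VectorField d M) (x₀ : M) :
    ∃ r > 0, Metric.closedBall (extChartAt (𝓡 d) x₀ x₀) r ⊆ (extChartAt (𝓡 d) x₀).target ∧
      ∃ δ > 0, ∀ᶠ Y in 𝓝 X, ∀ t : ℝ, |t| ≤ δ → IsSmallField (extChartAt (𝓡 d) x₀ x₀) r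
        (fun p ↦ t • chartRep Y x₀ p) (fun p ↦ t • fderiv ℝ (chartRep Y x₀) p) := by
  obtain ⟨r, hr, hrt⟩ := Metric.nhds_basis_closedBall.mem_iff.1
    (extChartAt_target_mem_nhds (I := 𝓡 d) x₀)
  refine ⟨r, hr, hrt, ?_⟩
  have ho : IsOpen (extChartAt (𝓡 d) x₀).target := isOpen_extChartAt_target x₀
  have hc : IsCompact (Metric.closedBall (extChartAt (𝓡 d) x₀ x₀) r) := isCompact_closedBall _ _
  have hfc : ∀ Y : VectorField d M, ContinuousOn (fderiv ℝ (chartRep Y x₀))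
      (Metric.closedBall (extChartAt (𝓡 d) x₀ x₀) r) := fun Y ↦
    ((contDiffOn_chartRep Y x₀).continuousOn_fderiv_of_isOpen ho le_rfl).mono hrt
  obtain ⟨C₁, hC₁⟩ := hc.exists_bound_of_continuousOn
    ((contDiffOn_chartRep X x₀).continuousOn.mono hrt)
  obtain ⟨C₂, hC₂⟩ := hc.exists_bound_of_continuousOn (hfc X)
  set C := max (max C₁ C₂ + 1) 1
  have hC : 0 < C := lt_of_lt_of_le one_pos (le_max_right _ _)
  have hC' : ∀ a, a ≤ C₁ + 1 ∨ a ≤ C₂ + 1 → a ≤ C := by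
    rintro a (h | h)
    · exact h.trans (le_trans (by gcongr; exact le_max_left _ _) (le_max_left _ _))
    · exact h.trans (le_trans (by gcongr; exact le_max_right _ _) (le_max_left _ _))
  -- `C` bounds, on the ball, every field at `C¹`-distance less than one from `X` together with its
  -- derivative. Multiplication by such a small time brings the bounds down to `r / 2` and `1 / 2`.
  refine ⟨min (r / 2 / C) (1 / 2 / C), by positivity, ?_⟩
  filter_upwards [mem_nhds_c1Close X x₀ hc hrt one_pos] with Y hY t ht
  have hb : ∀ p ∈ Metric.closedBall (extChartAt (𝓡 d) x₀ x₀) r,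
      ‖chartRep Y x₀ p‖ ≤ C ∧ ‖fderiv ℝ (chartRep Y x₀) p‖ ≤ C := by
    intro p hp
    obtain ⟨h1, h2⟩ := hY p hp
    have h3 := hC₁ p hp
    have h4 := hC₂ p hp
    refine ⟨hC' _ (Or.inl ?_), hC' _ (Or.inr ?_)⟩
    · have := norm_add_le (chartRep Y x₀ p - chartRep X x₀ p) (chartRep X x₀ p)
      rw [sub_add_cancel] at this
      linarith
    · have := norm_add_le (fderiv ℝ (chartRep Y x₀) p - fderiv ℝ (chartRep X x₀) p)
        (fderiv ℝ (chartRep X x₀) p)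
      rw [sub_add_cancel] at this
      linarith
  refine ⟨fun p hp ↦ ?_, (hfc Y).const_smul t, fun p hp ↦ ?_, fun p hp ↦ ?_⟩
  · exact (((contDiffOn_chartRep Y x₀).differentiableOn one_ne_zero).differentiableAt
      (ho.mem_nhds (hrt hp))).hasFDerivAt.const_smul t
  · rw [norm_smul, Real.norm_eq_abs]
    calc |t| * ‖chartRep Y x₀ p‖ ≤ (r / 2 / C) * C := by
          gcongr
          · exact ht.trans (min_le_left _ _)
          · exact (hb p hp).1
      _ = r / 2 := by field_simp
  · rw [norm_smul, Real.norm_eq_abs]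
    calc |t| * ‖fderiv ℝ (chartRep Y x₀) p‖ ≤ (1 / 2 / C) * C := by
          gcongr
          · exact ht.trans (min_le_right _ _)
          · exact (hb p hp).2
      _ = 1 / 2 := by field_simp

theorem exists_local_curve {Y : VectorField d M} {x₀ : M} {r δ : ℝ} (hr : 0 < r) (hδ : 0 < δ)
    (hY : IsSmallField (extChartAt (𝓡 d) x₀ x₀) r
        (fun p ↦ δ • chartRep Y x₀ p) (fun p ↦ δ • fderiv ℝ (chartRep Y x₀) p))
    {p : EuclideanSpace ℝ (Fin d)} (hp : p ∈ Metric.closedBall (extChartAt (𝓡 d) x₀ x₀) (r / 2)) :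
    ∃ z : ℝ → EuclideanSpace ℝ (Fin d), z 0 = p ∧ ∀ t ∈ Ioo (-δ) δ,
      z t ∈ Metric.closedBall (extChartAt (𝓡 d) x₀ x₀) r ∧
        HasDerivAt z (chartRep Y x₀ (z t)) t := by
  obtain ⟨x, hx0, hx⟩ := hY.exists_sol hr hp
  refine ⟨fun t ↦ x (t / δ), by simpa using hx0, fun t ht ↦ ?_⟩
  have h1 : t / δ ∈ Ioo (-1 : ℝ) 1 := by
    rw [mem_Ioo, lt_div_iff₀ hδ, div_lt_iff₀ hδ]
    simpa using ht
  obtain ⟨h2, h3⟩ := hx (t / δ) (Ioo_subset_Icc_self h1)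
  refine ⟨h2, ?_⟩
  have h4 := (h3.hasDerivAt (Icc_mem_nhds h1.1 h1.2)).scomp t ((hasDerivAt_id t).div_const δ)
  rw [smul_smul, one_div_mul_cancel hδ.ne', one_smul] at h4
  exact h4

theorem isMIntegralCurveOn_of_chart {Y : VectorField d M} {x₀ : M} {s : Set ℝ}
    {z : ℝ → EuclideanSpace ℝ (Fin d)}
    (hz : ∀ t ∈ s, z t ∈ (extChartAt (𝓡 d) x₀).target ∧ HasDerivAt z (chartRep Y x₀ (z t)) t) :
    IsMIntegralCurveOn (I := 𝓡 d) (fun t ↦ (extChartAt (𝓡 d) x₀).symm (z t)) (fun x ↦ Y x) s := by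
  intro t ht
  obtain ⟨h1, h2⟩ := hz t ht
  have h3 := (hasMFDerivAt_extChartAt_symm x₀ h1).comp t h2.hasFDerivAt.hasMFDerivAt
  have h4 : (mfderiv 𝓘(ℝ, EuclideanSpace ℝ (Fin d)) (𝓡 d) (extChartAt (𝓡 d) x₀).symm (z t)).comp
      (ContinuousLinearMap.toSpanSingleton ℝ (chartRep Y x₀ (z t))) =
      (1 : ℝ →L[ℝ] ℝ).smulRight (Y ((extChartAt (𝓡 d) x₀).symm (z t))) := by
    ext
    change mfderiv 𝓘(ℝ, EuclideanSpace ℝ (Fin d)) (𝓡 d) (extChartAt (𝓡 d) x₀).symm (z t)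
      ((1 : ℝ) • chartRep Y x₀ (z t)) = (1 : ℝ) • Y ((extChartAt (𝓡 d) x₀).symm (z t))
    rw [one_smul, one_smul, chartRep_eq Y x₀ h1, mfderiv_symm_mfderiv x₀ h1]
  have h5 := h4 ▸ h3
  exact h5.hasMFDerivWithinAt

variable [T2Space M] [CompactSpace M]

/-- Compactness gives a time of existence independent of the initial point, and uniform local
existence implies completeness. The default branch in the definition of `flow` is therefore never
taken. -/
theorem exists_isMIntegralCurve (Y : VectorField d M) (x : M) :
    ∃ γ : ℝ → M, γ 0 = x ∧ IsMIntegralCurve (I := 𝓡 d) γ (fun y ↦ Y y) := by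
  have h1 : ∀ x₀ : M, ∃ δ > 0, ∀ᶠ x in 𝓝 x₀, ∃ γ : ℝ → M, γ 0 = x ∧
      IsMIntegralCurveOn (I := 𝓡 d) γ (fun y ↦ Y y) (Ioo (-δ) δ) := by
    intro x₀
    obtain ⟨r, hr, hrt, δ, hδ, h⟩ := exists_isSmallField Y x₀
    have h := h.self_of_nhds δ (abs_of_pos hδ).le
    refine ⟨δ, hδ, ?_⟩
    filter_upwards [(continuousAt_extChartAt (I := 𝓡 d) x₀).preimage_mem_nhds
      (Metric.closedBall_mem_nhds _ (half_pos hr)), extChartAt_source_mem_nhds (I := 𝓡 d) x₀]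
      with x hx hxs
    obtain ⟨z, hz0, hz⟩ := exists_local_curve hr hδ h hx
    exact ⟨_, by rw [hz0, PartialEquiv.left_inv _ hxs],
      isMIntegralCurveOn_of_chart fun t ht ↦ ⟨hrt (hz t ht).1, (hz t ht).2⟩⟩
  have h2 : ∃ δ > 0, ∀ x ∈ (univ : Set M), ∃ γ : ℝ → M, γ 0 = x ∧
      IsMIntegralCurveOn (I := 𝓡 d) γ (fun y ↦ Y y) (Ioo (-δ) δ) := by
    refine isCompact_univ.induction_on (p := fun s ↦ ∃ δ > 0, ∀ x ∈ s, ∃ γ : ℝ → M, γ 0 = x ∧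
      IsMIntegralCurveOn (I := 𝓡 d) γ (fun y ↦ Y y) (Ioo (-δ) δ)) ⟨1, one_pos, by simp⟩ ?_ ?_ ?_
    · rintro s t hst ⟨δ, hδ, h⟩
      exact ⟨δ, hδ, fun x hx ↦ h x (hst hx)⟩
    · rintro s t ⟨δ, hδ, h⟩ ⟨δ', hδ', h'⟩
      refine ⟨min δ δ', lt_min hδ hδ', ?_⟩
      rintro x (hx | hx)
      · obtain ⟨γ, h0, hγ⟩ := h x hx
        exact ⟨γ, h0, hγ.mono (Ioo_subset_Ioo (neg_le_neg (min_le_left _ _)) (min_le_left _ _))⟩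
      · obtain ⟨γ, h0, hγ⟩ := h' x hx
        exact ⟨γ, h0, hγ.mono (Ioo_subset_Ioo (neg_le_neg (min_le_right _ _)) (min_le_right _ _))⟩
    · intro x _
      obtain ⟨δ, hδ, h⟩ := h1 x
      exact ⟨_, mem_nhdsWithin_of_mem_nhds h, δ, hδ, fun x hx ↦ hx⟩
  obtain ⟨δ, hδ, h⟩ := h2
  exact exists_isMIntegralCurve_of_isMIntegralCurveOn Y.contMDiff hδ (fun x ↦ h x (mem_univ x)) x

theorem flow_zero (Y : VectorField d M) (x : M) : flow Y 0 x = x := by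
  rw [flow, dif_pos (exists_isMIntegralCurve Y x)]
  exact (exists_isMIntegralCurve Y x).choose_spec.1

theorem isMIntegralCurve_flow (Y : VectorField d M) (x : M) :
    IsMIntegralCurve (I := 𝓡 d) (fun t ↦ flow Y t x) (fun y ↦ Y y) := by
  have : (fun t ↦ flow Y t x) = (exists_isMIntegralCurve Y x).choose := by
    funext t
    rw [flow, dif_pos (exists_isMIntegralCurve Y x)]
  rw [this]
  exact (exists_isMIntegralCurve Y x).choose_spec.2

theorem flow_add (Y : VectorField d M) (s t : ℝ) (x : M) :
    flow Y (s + t) x = flow Y s (flow Y t x) := by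
  have h := isMIntegralCurve_Ioo_eq_of_contMDiff_boundaryless (t₀ := 0) Y.contMDiff
    ((isMIntegralCurve_flow Y x).comp_add t) (isMIntegralCurve_flow Y (flow Y t x)) (by
      simp [flow_zero])
  exact congr_fun h s

theorem flow_eq_of_chart {Y : VectorField d M} {x₀ : M} {δ : ℝ}
    {z : ℝ → EuclideanSpace ℝ (Fin d)} (hz : ∀ t ∈ Ioo (-δ) δ,
      z t ∈ (extChartAt (𝓡 d) x₀).target ∧ HasDerivAt z (chartRep Y x₀ (z t)) t)
    {t : ℝ} (ht : t ∈ Ioo (-δ) δ) :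
    flow Y t ((extChartAt (𝓡 d) x₀).symm (z 0)) = (extChartAt (𝓡 d) x₀).symm (z t) := by
  have hδ : 0 < δ := by linarith [ht.1, ht.2]
  refine isMIntegralCurveOn_Ioo_eqOn_of_contMDiff_boundaryless (t₀ := 0) ⟨by linarith, hδ⟩
    Y.contMDiff ((isMIntegralCurve_flow Y ((extChartAt (𝓡 d) x₀).symm (z 0))).isMIntegralCurveOn _)
    (isMIntegralCurveOn_of_chart hz) ?_ ht
  rw [flow_zero]

/-- The flow in a chart, for small times, as the time one map of a small field. -/
theorem exists_sol_flow {Y : VectorField d M} {x₀ : M} {r δ : ℝ} (hr : 0 < r)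
    (hrt : Metric.closedBall (extChartAt (𝓡 d) x₀ x₀) r ⊆ (extChartAt (𝓡 d) x₀).target)
    (hδ : 0 < δ) (hY : IsSmallField (extChartAt (𝓡 d) x₀ x₀) r
        (fun p ↦ δ • chartRep Y x₀ p) (fun p ↦ δ • fderiv ℝ (chartRep Y x₀) p))
    {p : EuclideanSpace ℝ (Fin d)} (hp : p ∈ Metric.closedBall (extChartAt (𝓡 d) x₀ x₀) (r / 2))
    {t : ℝ} (ht : |t| < δ) :
    ∃ z : ℝ → EuclideanSpace ℝ (Fin d), z 0 = p ∧
      IsSol (extChartAt (𝓡 d) x₀ x₀) r (fun p ↦ t • chartRep Y x₀ p) z ∧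
      flow Y t ((extChartAt (𝓡 d) x₀).symm p) = (extChartAt (𝓡 d) x₀).symm (z 1) := by
  obtain ⟨z, hz0, hz⟩ := exists_local_curve hr hδ hY hp
  refine ⟨fun s ↦ z (t * s), by simpa using hz0, fun s hs ↦ ?_, ?_⟩
  · have h1 : t * s ∈ Ioo (-δ) δ := by
      rw [mem_Ioo, ← abs_lt, abs_mul, abs_of_nonneg hs.1]
      nlinarith [abs_nonneg t, hs.2]
    obtain ⟨h2, h3⟩ := hz _ h1
    refine ⟨h2, HasDerivAt.hasDerivWithinAt ?_⟩
    have h4 := h3.scomp s ((hasDerivAt_id s).const_mul t)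
    rwa [mul_one] at h4
  · simp only [mul_one]
    rw [← flow_eq_of_chart (fun t ht ↦ ⟨hrt (hz t ht).1, (hz t ht).2⟩) (abs_lt.1 ht), hz0]

end ManifoldFlow

/-! ### Joint continuity of the tangent flow in the field, the time and the vector -/

section TangentFlow

variable {d : ℕ} {M : Type*} [TopologicalSpace M] [ChartedSpace (EuclideanSpace ℝ (Fin d)) M]
  [IsManifold (𝓡 d) ∞ M]

theorem tangentBundle_ext {y y' : M} (h : y = y') {a b : EuclideanSpace ℝ (Fin d)} (hab : a = b) :
    (⟨y, a⟩ : TangentBundle (𝓡 d) M) = ⟨y', b⟩ := by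
  subst h hab
  rfl

theorem tangentMap_congr {f g : M → M} {x : M} (h : f =ᶠ[𝓝 x] g) (v : Tan d x) :
    tangentMap (𝓡 d) (𝓡 d) f ⟨x, v⟩ = tangentMap (𝓡 d) (𝓡 d) g ⟨x, v⟩ :=
  tangentBundle_ext h.eq_of_nhds (DFunLike.congr_fun (h.mfderiv_eq (I := 𝓡 d) (I' := 𝓡 d)) v)

theorem tangentMap_extChartAt_symm (x₀ : M) {p : EuclideanSpace ℝ (Fin d)}
    (hp : p ∈ (extChartAt (𝓡 d) x₀).target) (v : EuclideanSpace ℝ (Fin d)) :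
    tangentMap 𝓘(ℝ, EuclideanSpace ℝ (Fin d)) (𝓡 d) (extChartAt (𝓡 d) x₀).symm ⟨p, v⟩ =
      (trivializationAt (EuclideanSpace ℝ (Fin d)) (fun x : M ↦ TangentSpace (𝓡 d) x)
        x₀).toOpenPartialHomeomorph.symm ((extChartAt (𝓡 d) x₀).symm p, v) := by
  set T := trivializationAt (EuclideanSpace ℝ (Fin d)) (fun x : M ↦ TangentSpace (𝓡 d) x) x₀
  have hs := (extChartAt (𝓡 d) x₀).map_target hp
  have h1 : tangentMap 𝓘(ℝ, EuclideanSpace ℝ (Fin d)) (𝓡 d) (extChartAt (𝓡 d) x₀).symm ⟨p, v⟩ ∈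
      T.source := by
    rw [Trivialization.mem_source]
    rw [extChartAt_source] at hs
    simpa [T] using hs
  have h2 : T (tangentMap 𝓘(ℝ, EuclideanSpace ℝ (Fin d)) (𝓡 d) (extChartAt (𝓡 d) x₀).symm ⟨p, v⟩) =
      ((extChartAt (𝓡 d) x₀).symm p, v) := by
    refine Prod.ext (T.coe_fst h1) ?_
    exact (trivializationAt_snd hs _).trans (mfderiv_mfderiv_symm x₀ hp v)
  rw [← h2]
  exact (T.toOpenPartialHomeomorph.left_inv h1).symm

variable [T2Space M] [CompactSpace M]

/-- In the chart, the time-`t` map of `Y` is the time-one map of the small field `t • Y`, whose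
derivative is a fundamental solution. As the unit time interval and the ball are the same for all
`t` and `Y`, different times and fields can be compared. -/
theorem exists_local_tangentMap {Y : VectorField d M} {x₀ : M} {r δ : ℝ} (hr : 0 < r)
    (hrt : Metric.closedBall (extChartAt (𝓡 d) x₀ x₀) r ⊆ (extChartAt (𝓡 d) x₀).target)
    (hδ : 0 < δ) (hY : ∀ t : ℝ, |t| ≤ δ → IsSmallField (extChartAt (𝓡 d) x₀ x₀) r
        (fun p ↦ t • chartRep Y x₀ p) (fun p ↦ t • fderiv ℝ (chartRep Y x₀) p))
    {x : M} (hxs : x ∈ (extChartAt (𝓡 d) x₀).source)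
    (hx : extChartAt (𝓡 d) x₀ x ∈ Metric.ball (extChartAt (𝓡 d) x₀ x₀) (r / 2))
    {t : ℝ} (ht : |t| < δ) :
    MDifferentiableAt (𝓡 d) (𝓡 d) (flow Y t) x ∧
    ∃ (z : ℝ → EuclideanSpace ℝ (Fin d))
      (Φ : ℝ → EuclideanSpace ℝ (Fin d) →L[ℝ] EuclideanSpace ℝ (Fin d)),
      z 0 = extChartAt (𝓡 d) x₀ x ∧
      IsSol (extChartAt (𝓡 d) x₀ x₀) r (fun p ↦ t • chartRep Y x₀ p) z ∧
      IsFund (fun s ↦ t • fderiv ℝ (chartRep Y x₀) (z s)) Φ ∧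
      ∀ v : Tan d x, tangentMap (𝓡 d) (𝓡 d) (flow Y t) ⟨x, v⟩ =
        (trivializationAt (EuclideanSpace ℝ (Fin d)) (fun x : M ↦ TangentSpace (𝓡 d) x)
          x₀).toOpenPartialHomeomorph.symm ((extChartAt (𝓡 d) x₀).symm (z 1),
            Φ 1 (trivializationAt (EuclideanSpace ℝ (Fin d)) (fun x : M ↦ TangentSpace (𝓡 d) x)
              x₀ ⟨x, v⟩).2) := by
  have hZ : ∀ p : EuclideanSpace ℝ (Fin d), ∃ z : ℝ → EuclideanSpace ℝ (Fin d),
      p ∈ Metric.ball (extChartAt (𝓡 d) x₀ x₀) (r / 2) → z 0 = p ∧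
      IsSol (extChartAt (𝓡 d) x₀ x₀) r (fun p ↦ t • chartRep Y x₀ p) z ∧
      flow Y t ((extChartAt (𝓡 d) x₀).symm p) = (extChartAt (𝓡 d) x₀).symm (z 1) := by
    intro p
    by_cases hp : p ∈ Metric.ball (extChartAt (𝓡 d) x₀ x₀) (r / 2)
    · obtain ⟨z, hz⟩ := exists_sol_flow hr hrt hδ (hY δ (abs_of_pos hδ).le)
        (Metric.ball_subset_closedBall hp) ht
      exact ⟨z, fun _ ↦ hz⟩
    · exact ⟨0, fun h ↦ (hp h).elim⟩
  choose Z hZ using hZ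
  obtain ⟨Φ, hΦ⟩ := (hY t ht.le).exists_isFund (hZ _ hx).2.1
  have hd : HasFDerivAt (fun q ↦ Z q 1) (Φ 1) (extChartAt (𝓡 d) x₀ x) :=
    (hY t ht.le).hasFDerivAt_flow (by
      filter_upwards [Metric.isOpen_ball.mem_nhds hx] with q hq
      exact ⟨(hZ q hq).1, (hZ q hq).2.1⟩) hΦ
  have hz1 : Z (extChartAt (𝓡 d) x₀ x) 1 ∈ (extChartAt (𝓡 d) x₀).target :=
    hrt ((hZ _ hx).2.1 1 (right_mem_Icc.2 zero_le_one)).1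
  have hev : flow Y t =ᶠ[𝓝 x]
      (extChartAt (𝓡 d) x₀).symm ∘ ((fun q ↦ Z q 1) ∘ extChartAt (𝓡 d) x₀) := by
    filter_upwards [(continuousAt_extChartAt' (I := 𝓡 d) hxs).preimage_mem_nhds
      (Metric.isOpen_ball.mem_nhds hx), extChartAt_source_mem_nhds' (I := 𝓡 d) hxs] with y hy hys
    rw [Function.comp_apply, Function.comp_apply, ← (hZ _ hy).2.2, PartialEquiv.left_inv _ hys]
  have m1 : MDifferentiableAt (𝓡 d) 𝓘(ℝ, EuclideanSpace ℝ (Fin d)) (extChartAt (𝓡 d) x₀) x :=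
    mdifferentiableAt_extChartAt (by rwa [← extChartAt_source (𝓡 d)])
  have m2 : MDifferentiableAt 𝓘(ℝ, EuclideanSpace ℝ (Fin d)) 𝓘(ℝ, EuclideanSpace ℝ (Fin d))
      (fun q ↦ Z q 1) (extChartAt (𝓡 d) x₀ x) := hd.differentiableAt.mdifferentiableAt
  have m3 : MDifferentiableAt 𝓘(ℝ, EuclideanSpace ℝ (Fin d)) (𝓡 d) (extChartAt (𝓡 d) x₀).symm
      (((fun q ↦ Z q 1) ∘ extChartAt (𝓡 d) x₀) x) :=
    (hasMFDerivAt_extChartAt_symm x₀ hz1).mdifferentiableAt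
  refine ⟨(m3.comp x (m2.comp x m1)).congr_of_eventuallyEq hev, Z (extChartAt (𝓡 d) x₀ x), Φ,
    (hZ _ hx).1, (hZ _ hx).2.1, hΦ, fun v ↦ ?_⟩
  rw [tangentMap_congr hev, tangentMap_comp_at ⟨x, v⟩ m3 (m2.comp x m1),
    tangentMap_comp_at ⟨x, v⟩ m2 m1, ← tangentMap_extChartAt_symm x₀ hz1, trivializationAt_snd hxs]
  congr 1
  have : mfderiv 𝓘(ℝ, EuclideanSpace ℝ (Fin d)) 𝓘(ℝ, EuclideanSpace ℝ (Fin d)) (fun q ↦ Z q 1)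
      (extChartAt (𝓡 d) x₀ x) = Φ 1 := by
    rw [mfderiv_eq_fderiv, hd.fderiv]
  exact tangentBundle_ext rfl (DFunLike.congr_fun this _)

/-- Continuity of the action of the flow on the tangent bundle, for small times. -/
theorem exists_local_continuousAt (X : VectorField d M) (x₀ : M) :
    ∃ δ > 0, ∀ᶠ x in 𝓝 x₀, ∀ t : ℝ, |t| < δ → MDifferentiableAt (𝓡 d) (𝓡 d) (flow X t) x ∧
      ∀ v : Tan d x, ContinuousAt (fun q : VectorField d M × ℝ × TangentBundle (𝓡 d) M ↦
        tangentMap (𝓡 d) (𝓡 d) (flow q.1 q.2.1) q.2.2) (X, t, ⟨x, v⟩) := by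
  obtain ⟨r, hr, hrt, δ, hδ, h⟩ := exists_isSmallField X x₀
  refine ⟨δ, hδ, ?_⟩
  set e := extChartAt (𝓡 d) x₀ with he
  set T := trivializationAt (EuclideanSpace ℝ (Fin d)) (fun x : M ↦ TangentSpace (𝓡 d) x) x₀ with hT
  have ho : IsOpen (e.source ∩ e ⁻¹' Metric.ball (e x₀) (r / 2)) :=
    (continuousOn_extChartAt (I := 𝓡 d) x₀).isOpen_inter_preimage (isOpen_extChartAt_source x₀)
      Metric.isOpen_ball
  filter_upwards [ho.mem_nhds ⟨mem_extChartAt_source (I := 𝓡 d) x₀,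
    Metric.mem_ball_self (half_pos hr)⟩] with x hx t ht
  refine ⟨(exists_local_tangentMap hr hrt hδ h.self_of_nhds hx.1 hx.2 ht).1, fun v ↦ ?_⟩
  have hq : ∀ᶠ q : VectorField d M × ℝ × TangentBundle (𝓡 d) M in 𝓝 (X, t, ⟨x, v⟩),
      (∀ t : ℝ, |t| ≤ δ → IsSmallField (e x₀) r
        (fun p ↦ t • chartRep q.1 x₀ p) (fun p ↦ t • fderiv ℝ (chartRep q.1 x₀) p)) ∧
      |q.2.1| < δ ∧ q.2.2.proj ∈ e.source ∩ e ⁻¹' Metric.ball (e x₀) (r / 2) := by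
    have c1 : Tendsto (fun q : VectorField d M × ℝ × TangentBundle (𝓡 d) M ↦ q.1)
      (𝓝 (X, t, ⟨x, v⟩)) (𝓝 X) := continuous_fst.continuousAt
    have c2 : Continuous (fun q : VectorField d M × ℝ × TangentBundle (𝓡 d) M ↦ |q.2.1|) := by
      fun_prop
    have c3 : Continuous (fun q : VectorField d M × ℝ × TangentBundle (𝓡 d) M ↦ q.2.2.proj) :=
      (FiberBundle.continuous_proj _ _).comp (continuous_snd.comp continuous_snd)
    exact (c1.eventually h).and ((c2.continuousAt.eventually (gt_mem_nhds ht)).and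
      (c3.continuousAt.eventually (ho.mem_nhds hx)))
  -- Solutions and fundamental solutions are chosen as functions of all the data, with default
  -- values where the chart does not apply, so that limits can be taken.
  have hex : ∀ q : VectorField d M × ℝ × TangentBundle (𝓡 d) M,
      ∃ (z : ℝ → EuclideanSpace ℝ (Fin d))
      (Φ : ℝ → EuclideanSpace ℝ (Fin d) →L[ℝ] EuclideanSpace ℝ (Fin d)),
      ((∀ t : ℝ, |t| ≤ δ → IsSmallField (e x₀) r
        (fun p ↦ t • chartRep q.1 x₀ p) (fun p ↦ t • fderiv ℝ (chartRep q.1 x₀) p)) ∧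
      |q.2.1| < δ ∧ q.2.2.proj ∈ e.source ∩ e ⁻¹' Metric.ball (e x₀) (r / 2)) →
      z 0 = e q.2.2.proj ∧
      IsSol (e x₀) r (fun p ↦ q.2.1 • chartRep q.1 x₀ p) z ∧
      IsFund (fun s ↦ q.2.1 • fderiv ℝ (chartRep q.1 x₀) (z s)) Φ ∧
      tangentMap (𝓡 d) (𝓡 d) (flow q.1 q.2.1) q.2.2 =
        T.toOpenPartialHomeomorph.symm (e.symm (z 1), Φ 1 (T q.2.2).2) := by
    rintro ⟨Y, s, y, w⟩
    by_cases hc : (∀ t : ℝ, |t| ≤ δ → IsSmallField (e x₀) r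
        (fun p ↦ t • chartRep Y x₀ p) (fun p ↦ t • fderiv ℝ (chartRep Y x₀) p)) ∧
      |s| < δ ∧ y ∈ e.source ∩ e ⁻¹' Metric.ball (e x₀) (r / 2)
    · obtain ⟨-, z, Φ, h1, h2, h3, h4⟩ :=
        exists_local_tangentMap hr hrt hδ hc.1 hc.2.2.1 hc.2.2.2 hc.2.1
      exact ⟨z, Φ, fun _ ↦ ⟨h1, h2, h3, h4 w⟩⟩
    · exact ⟨0, 0, fun h ↦ (hc h).elim⟩
  choose z Φ hzΦ using hex
  obtain ⟨b1, b2, b3, b4⟩ := hzΦ _ hq.self_of_nhds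
  have hs : IsSmallField (e x₀) r (fun p ↦ t • chartRep X x₀ p)
      (fun p ↦ t • fderiv ℝ (chartRep X x₀) p) := h.self_of_nhds t ht.le
  have hlim : Tendsto (fun q ↦ (z q 1, Φ q 1)) (𝓝 (X, t, ⟨x, v⟩))
      (𝓝 (z (X, t, ⟨x, v⟩) 1, Φ (X, t, ⟨x, v⟩) 1)) := by
    rw [Metric.tendsto_nhds]
    intro ε hε
    obtain ⟨η, hη, hclose⟩ := hs.exists_close b2 b3 (half_pos hε)
    have hcb : IsCompact (Metric.closedBall (e x₀) r) := isCompact_closedBall _ _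
    obtain ⟨C₁, hC₁⟩ := hcb.exists_bound_of_continuousOn
      ((contDiffOn_chartRep X x₀).continuousOn.mono hrt)
    obtain ⟨C₂, hC₂⟩ := hcb.exists_bound_of_continuousOn
      (((contDiffOn_chartRep X x₀).continuousOn_fderiv_of_isOpen
        (isOpen_extChartAt_target x₀) le_rfl).mono hrt)
    set C := max (max C₁ C₂) 1
    have hC : 0 < C := lt_of_lt_of_le one_pos (le_max_right _ _)
    have c1 : Tendsto (fun q : VectorField d M × ℝ × TangentBundle (𝓡 d) M ↦ q.1)
      (𝓝 (X, t, ⟨x, v⟩)) (𝓝 X) := continuous_fst.continuousAt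
    have c2 : Continuous (fun q : VectorField d M × ℝ × TangentBundle (𝓡 d) M ↦ |q.2.1 - t|) := by
      fun_prop
    have c3 : ContinuousAt (fun q : VectorField d M × ℝ × TangentBundle (𝓡 d) M ↦ e q.2.2.proj)
        (X, t, ⟨x, v⟩) :=
      ContinuousAt.comp (f := fun q : VectorField d M × ℝ × TangentBundle (𝓡 d) M ↦ q.2.2.proj)
        (g := e) (continuousAt_extChartAt' hx.1)
        ((FiberBundle.continuous_proj _ _).comp (continuous_snd.comp continuous_snd)).continuousAt
    filter_upwards [hq, c1.eventually (mem_nhds_c1Close X x₀ hcb hrt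
        (show 0 < η / (2 * δ) by positivity)),
      c2.continuousAt.eventually (gt_mem_nhds (show |t - t| < η / (2 * C) by
        rw [sub_self, abs_zero]; positivity)),
      c3.eventually (Metric.closedBall_mem_nhds _ hη)] with q hq h1 h2 h3
    obtain ⟨a1, a2, a3, a4⟩ := hzΦ q hq
    have hb : ∀ {F : Type} [NormedAddCommGroup F] [NormedSpace ℝ F] (a b : F),
        ‖a - b‖ < η / (2 * δ) → ‖b‖ ≤ C → ‖q.2.1 • a - t • b‖ ≤ η := by
      intro F _ _ a b hab hb
      have : q.2.1 • a - t • b = q.2.1 • (a - b) + (q.2.1 - t) • b := by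
        rw [smul_sub, sub_smul]; abel
      rw [this]
      refine (norm_add_le _ _).trans ?_
      rw [norm_smul, norm_smul, Real.norm_eq_abs, Real.norm_eq_abs]
      calc |q.2.1| * ‖a - b‖ + |q.2.1 - t| * ‖b‖ ≤ δ * (η / (2 * δ)) + η / (2 * C) * C := by
            gcongr
            exact hq.2.1.le
        _ = η := by field_simp; norm_num
    have := hclose _ _ _ _ (hq.1 q.2.1 hq.2.1.le) a2 a3 (fun p hp ↦
      ⟨hb _ _ (h1 p hp).1 ((hC₁ p hp).trans ((le_max_left _ _).trans (le_max_left _ _))),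
        hb _ _ (h1 p hp).2 ((hC₂ p hp).trans ((le_max_right _ _).trans (le_max_left _ _)))⟩) (by
        rw [a1, b1, ← dist_eq_norm]
        exact h3)
    rw [Prod.dist_eq, max_lt_iff, dist_eq_norm, dist_eq_norm]
    exact ⟨by linarith [this.1], by linarith [this.2]⟩
  have hev : (fun q : VectorField d M × ℝ × TangentBundle (𝓡 d) M ↦
        tangentMap (𝓡 d) (𝓡 d) (flow q.1 q.2.1) q.2.2) =ᶠ[𝓝 (X, t, ⟨x, v⟩)]
      fun q ↦ T.toOpenPartialHomeomorph.symm (e.symm (z q 1), Φ q 1 (T q.2.2).2) := by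
    filter_upwards [hq] with q hq using (hzΦ q hq).2.2.2
  refine ContinuousAt.congr ?_ hev.symm
  have hz1 : z (X, t, ⟨x, v⟩) 1 ∈ e.target := hrt (b2 1 (right_mem_Icc.2 zero_le_one)).1
  have hbase : ∀ y ∈ e.source, y ∈ T.baseSet := by
    intro y hy
    rw [he, extChartAt_source] at hy
    simpa [hT] using hy
  have cT : ContinuousAt (fun q : VectorField d M × ℝ × TangentBundle (𝓡 d) M ↦ (T q.2.2).2)
      (X, t, ⟨x, v⟩) := by
    have : ContinuousAt T ⟨x, v⟩ := T.continuousOn.continuousAt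
      (T.open_source.mem_nhds (T.mem_source.2 (hbase x hx.1)))
    exact continuousAt_snd.comp (ContinuousAt.comp
      (f := fun q : VectorField d M × ℝ × TangentBundle (𝓡 d) M ↦ q.2.2) (g := T) this
        (continuous_snd.comp continuous_snd).continuousAt)
  have cz : ContinuousAt (fun q ↦ e.symm (z q 1)) (X, t, ⟨x, v⟩) :=
    ContinuousAt.comp (g := e.symm) (f := fun q ↦ z q 1) (continuousAt_extChartAt_symm'' hz1)
      (continuous_fst.continuousAt.tendsto.comp hlim)
  have cΦ : ContinuousAt (fun q ↦ Φ q 1) (X, t, ⟨x, v⟩) :=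
    continuous_snd.continuousAt.tendsto.comp hlim
  refine ContinuousAt.comp (g := T.toOpenPartialHomeomorph.symm)
    (f := fun q ↦ (e.symm (z q 1), Φ q 1 (T q.2.2).2)) ?_ (cz.prodMk (cΦ.clm_apply cT))
  exact T.toOpenPartialHomeomorph.symm.continuousAt (T.mem_target.2 (hbase _ (e.map_target hz1)))

theorem exists_uniform_continuousAt (X : VectorField d M) :
    ∃ δ > 0, ∀ x : M, ∀ t : ℝ, |t| < δ → MDifferentiableAt (𝓡 d) (𝓡 d) (flow X t) x ∧
      ∀ v : Tan d x, ContinuousAt (fun q : VectorField d M × ℝ × TangentBundle (𝓡 d) M ↦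
        tangentMap (𝓡 d) (𝓡 d) (flow q.1 q.2.1) q.2.2) (X, t, ⟨x, v⟩) := by
  suffices h : ∃ δ > 0, ∀ x ∈ (univ : Set M), ∀ t : ℝ, |t| < δ →
      MDifferentiableAt (𝓡 d) (𝓡 d) (flow X t) x ∧
      ∀ v : Tan d x, ContinuousAt (fun q : VectorField d M × ℝ × TangentBundle (𝓡 d) M ↦
        tangentMap (𝓡 d) (𝓡 d) (flow q.1 q.2.1) q.2.2) (X, t, ⟨x, v⟩) by
    simpa using h
  refine isCompact_univ.induction_on (p := fun s ↦ ∃ δ > 0, ∀ x ∈ s, ∀ t : ℝ, |t| < δ →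
      MDifferentiableAt (𝓡 d) (𝓡 d) (flow X t) x ∧
      ∀ v : Tan d x, ContinuousAt (fun q : VectorField d M × ℝ × TangentBundle (𝓡 d) M ↦
        tangentMap (𝓡 d) (𝓡 d) (flow q.1 q.2.1) q.2.2) (X, t, ⟨x, v⟩))
    ⟨1, one_pos, by simp⟩ ?_ ?_ ?_
  · rintro s t hst ⟨δ, hδ, h⟩
    exact ⟨δ, hδ, fun x hx ↦ h x (hst hx)⟩
  · rintro s t ⟨δ, hδ, h⟩ ⟨δ', hδ', h'⟩
    refine ⟨min δ δ', lt_min hδ hδ', ?_⟩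
    rintro x (hx | hx) t ht
    · exact h x hx t (ht.trans_le (min_le_left _ _))
    · exact h' x hx t (ht.trans_le (min_le_right _ _))
  · intro x _
    obtain ⟨δ, hδ, h⟩ := exists_local_continuousAt X x
    exact ⟨_, mem_nhdsWithin_of_mem_nhds h, δ, hδ, fun x hx ↦ hx⟩

theorem mdifferentiable_flow (X : VectorField d M) (t : ℝ) :
    MDifferentiable (𝓡 d) (𝓡 d) (flow X t) := by
  obtain ⟨δ, hδ, h⟩ := exists_uniform_continuousAt X
  obtain ⟨n, hn⟩ := exists_nat_gt (|t| / δ)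
  have hn0 : (0 : ℝ) < n := lt_of_le_of_lt (by positivity) hn
  have hk : ∀ k : ℕ, MDifferentiable (𝓡 d) (𝓡 d) (flow X (k * (t / n))) := by
    intro k
    induction k with
    | zero =>
      have : flow X ((0 : ℕ) * (t / n)) = id := by
        funext x; simp [flow_zero]
      rw [this]
      exact mdifferentiable_id
    | succ k ih =>
      have : flow X ((k + 1 : ℕ) * (t / n)) = flow X (t / n) ∘ flow X (k * (t / n)) := by
        funext x
        rw [Function.comp_apply, ← flow_add]
        congr 1
        push_cast
        ring
      rw [this]
      refine MDifferentiable.comp (fun x ↦ (h x _ ?_).1) ih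
      rw [abs_div, abs_of_pos hn0, div_lt_iff₀ hn0]
      rw [div_lt_iff₀ hδ] at hn
      linarith
  have := hk n
  rwa [mul_div_cancel₀ _ hn0.ne'] at this

theorem tangentMap_flow_add (X : VectorField d M) (s t : ℝ) (w : TangentBundle (𝓡 d) M) :
    tangentMap (𝓡 d) (𝓡 d) (flow X (s + t)) w =
      tangentMap (𝓡 d) (𝓡 d) (flow X s) (tangentMap (𝓡 d) (𝓡 d) (flow X t) w) := by
  have : flow X (s + t) = flow X s ∘ flow X t := funext fun x ↦ flow_add X s t x
  rw [this]
  exact tangentMap_comp_at w (mdifferentiable_flow X s _) (mdifferentiable_flow X t _)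

theorem tangentMap_flow_zero (X : VectorField d M) (w : TangentBundle (𝓡 d) M) :
    tangentMap (𝓡 d) (𝓡 d) (flow X 0) w = w := by
  have : flow X 0 = id := funext fun x ↦ flow_zero X x
  rw [this, tangentMap_id]
  rfl

/-- The time-`t` map is the `n`-fold iterate of the time-`t / n` map. For `n` large, fixed in terms
of the given time, this involves only times where continuity is known. -/
theorem continuousAt_of_small_times {P W : Type*} [TopologicalSpace P] [TopologicalSpace W]
    {G : P → ℝ → W → W} (h0 : ∀ p w, G p 0 w = w)
    (hadd : ∀ p s t w, G p (s + t) w = G p s (G p t w)) {p : P} {δ : ℝ} (hδ : 0 < δ)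
    (h : ∀ s w, |s| < δ → ContinuousAt (fun q : P × ℝ × W ↦ G q.1 q.2.1 q.2.2) (p, s, w))
    (t : ℝ) (w : W) : ContinuousAt (fun q : P × ℝ × W ↦ G q.1 q.2.1 q.2.2) (p, t, w) := by
  obtain ⟨n, hn⟩ := exists_nat_gt (|t| / δ)
  have hn0 : (0 : ℝ) < n := lt_of_le_of_lt (by positivity) hn
  have htn : |t / n| < δ := by
    rw [abs_div, abs_of_pos hn0, div_lt_iff₀ hn0]
    rw [div_lt_iff₀ hδ] at hn
    linarith
  have hk : ∀ k : ℕ,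
      ContinuousAt (fun q : P × ℝ × W ↦ G q.1 (k * (q.2.1 / n)) q.2.2) (p, t, w) := by
    intro k
    induction k with
    | zero =>
      simp only [Nat.cast_zero, zero_mul, h0]
      exact (continuous_snd.comp continuous_snd).continuousAt
    | succ k ih =>
      have : (fun q : P × ℝ × W ↦ G q.1 ((k + 1 : ℕ) * (q.2.1 / n)) q.2.2) =
          fun q ↦ G q.1 (q.2.1 / n) (G q.1 (k * (q.2.1 / n)) q.2.2) := by
        funext q
        rw [← hadd]
        congr 1
        push_cast
        ring
      rw [this]
      have c1 : ContinuousAt (fun q : P × ℝ × W ↦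
          (q.1, q.2.1 / (n : ℝ), G q.1 (k * (q.2.1 / n)) q.2.2)) (p, t, w) :=
        continuousAt_fst.prodMk
          ((((continuous_fst.comp continuous_snd).div_const _).continuousAt).prodMk ih)
      exact ContinuousAt.comp (x := (p, t, w)) (f := fun q : P × ℝ × W ↦ (q.1, q.2.1 / (n : ℝ),
          G q.1 (k * (q.2.1 / n)) q.2.2))
        (g := fun q : P × ℝ × W ↦ G q.1 q.2.1 q.2.2) (h _ _ htn) c1
  have := hk n
  simp only [mul_div_cancel₀ _ hn0.ne'] at this
  exact this

/-- The action of the flow on the tangent bundle depends continuously on the vector field, on the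
time and on the tangent vector. -/
theorem continuous_tangentMap_flow :
    Continuous (fun q : VectorField d M × ℝ × TangentBundle (𝓡 d) M ↦
      tangentMap (𝓡 d) (𝓡 d) (flow q.1 q.2.1) q.2.2) := by
  rw [continuous_iff_continuousAt]
  rintro ⟨X, t, w⟩
  obtain ⟨δ, hδ, h⟩ := exists_uniform_continuousAt X
  exact continuousAt_of_small_times (G := fun X t w ↦ tangentMap (𝓡 d) (𝓡 d) (flow X t) w)
    tangentMap_flow_zero tangentMap_flow_add hδ (fun s w hs ↦ (h w.proj s hs).2 w.snd) t w

/-- Both sides are the derivative at zero of `s ↦ flow X t (flow X s x) = flow X s (flow X t x)`. -/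
theorem tangentMap_flow_apply_self (X : VectorField d M) (t : ℝ) (x : M) :
    tangentMap (𝓡 d) (𝓡 d) (flow X t) ⟨x, X x⟩ =
      (⟨flow X t x, X (flow X t x)⟩ : TangentBundle (𝓡 d) M) := by
  have h1 := isMIntegralCurve_flow X x 0
  have h2 := ((mdifferentiable_flow X t (flow X 0 x)).hasMFDerivAt).comp 0 h1
  have h3 : (flow X t ∘ fun s ↦ flow X s x) = fun s ↦ flow X s (flow X t x) := by
    funext s
    rw [Function.comp_apply, ← flow_add, ← flow_add, add_comm]
  have h4 := isMIntegralCurve_flow X (flow X t x) 0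
  have h5 : tangentMap 𝓘(ℝ, ℝ) (𝓡 d) (flow X t ∘ fun s ↦ flow X s x) ⟨0, (1 : ℝ)⟩ =
      tangentMap 𝓘(ℝ, ℝ) (𝓡 d) (fun s ↦ flow X s (flow X t x)) ⟨0, (1 : ℝ)⟩ := by rw [h3]
  simp only [tangentMap] at h5
  rw [h2.mfderiv, h4.mfderiv] at h5
  have h6 : ∀ y : M, y = x → tangentMap (𝓡 d) (𝓡 d) (flow X t) ⟨x, X x⟩ =
      tangentMap (𝓡 d) (𝓡 d) (flow X t) ⟨y, X y⟩ := by rintro y rfl; rfl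
  have h7 : ∀ y : M, y = flow X t x → (⟨flow X t x, X (flow X t x)⟩ : TangentBundle (𝓡 d) M) =
      ⟨y, X y⟩ := by rintro y rfl; rfl
  rw [h6 _ (flow_zero X x), h7 _ (flow_zero X (flow X t x))]
  refine Eq.trans ?_ (h5.trans ?_)
  · refine tangentBundle_ext rfl ?_
    change _ = mfderiv (𝓡 d) (𝓡 d) (flow X t) (flow X 0 x) ((1 : ℝ) • X (flow X 0 x))
    rw [one_smul]
  · refine tangentBundle_ext rfl ?_
    change (1 : ℝ) • X (flow X 0 (flow X t x)) = _
    rw [one_smul]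

end TangentFlow

/-! ### An isometric embedding of the tangent bundle in a trivial bundle -/

section Frame

variable {d : ℕ} {M : Type*} [TopologicalSpace M] [ChartedSpace (EuclideanSpace ℝ (Fin d)) M]
  [IsManifold (𝓡 d) ∞ M] [RiemannianBundle (fun x : M ↦ TangentSpace (𝓡 d) x)]
  [IsContinuousRiemannianBundle (EuclideanSpace ℝ (Fin d)) (fun x : M ↦ TangentSpace (𝓡 d) x)]

theorem finrank_tan (x : M) : finrank ℝ (Tan d x) = d :=
  (finrank_euclideanSpace_fin : finrank ℝ (EuclideanSpace ℝ (Fin d)) = d)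

instance finiteDimensional_tan (x : M) : FiniteDimensional ℝ (Tan d x) :=
  inferInstanceAs (FiniteDimensional ℝ (EuclideanSpace ℝ (Fin d)))

open InnerProductSpace in
-- The construction is rational in the inner products, with nonzero denominators. Regularity zero is
-- all that a merely continuous metric gives.
theorem continuousOn_gramSchmidt {u : Set M} {f : Fin d → (x : M) → Tan d x}
    (hf : ∀ i, ContMDiffOn (𝓡 d) ((𝓡 d).prod 𝓘(ℝ, EuclideanSpace ℝ (Fin d))) 0
      (fun x ↦ (⟨x, f i x⟩ : TangentBundle (𝓡 d) M)) u)
    (hl : ∀ x ∈ u, LinearIndependent ℝ (fun i ↦ f i x)) (i : Fin d) :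
    ContMDiffOn (𝓡 d) ((𝓡 d).prod 𝓘(ℝ, EuclideanSpace ℝ (Fin d))) 0
      (fun x ↦ (⟨x, gramSchmidt ℝ (fun i ↦ f i x) i⟩ : TangentBundle (𝓡 d) M)) u := by
  induction i using WellFoundedLT.induction with
  | ind i ih =>
    have h1 : ∀ x, gramSchmidt ℝ (fun i ↦ f i x) i = f i x - ∑ j ∈ Finset.Iio i,
        (inner ℝ (gramSchmidt ℝ (fun i ↦ f i x) j) (f i x) /
          (‖gramSchmidt ℝ (fun i ↦ f i x) j‖ ^ 2)) • gramSchmidt ℝ (fun i ↦ f i x) j := by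
      intro x
      rw [gramSchmidt_def]
      simp only [Submodule.starProjection_singleton]
      rfl
    simp only [h1]
    refine (hf i).sub_section (ContMDiffOn.sum_section fun j hj ↦ ?_)
    have hj := ih j (Finset.mem_Iio.1 hj)
    refine ContMDiffOn.smul_section ?_ hj
    rw [contMDiffOn_zero_iff]
    have h2 : ∀ x, ‖gramSchmidt ℝ (fun i ↦ f i x) j‖ ^ 2 =
        inner ℝ (gramSchmidt ℝ (fun i ↦ f i x) j) (gramSchmidt ℝ (fun i ↦ f i x) j) :=
      fun x ↦ (real_inner_self_eq_norm_sq _).symm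
    simp only [h2]
    refine ContinuousOn.div (hj.continuousOn.inner_bundle (hf i).continuousOn)
      (hj.continuousOn.inner_bundle hj.continuousOn) fun x hx ↦ ?_
    rw [real_inner_self_eq_norm_sq]
    have := gramSchmidt_ne_zero (𝕜 := ℝ) j (hl x hx)
    positivity

open InnerProductSpace in
theorem exists_local_orthonormal (x₀ : M) : ∃ u ∈ 𝓝 x₀, IsOpen u ∧
    ∃ f : Fin d → (x : M) → Tan d x,
      (∀ i, ContMDiffOn (𝓡 d) ((𝓡 d).prod 𝓘(ℝ, EuclideanSpace ℝ (Fin d))) 0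
        (fun x ↦ (⟨x, f i x⟩ : TangentBundle (𝓡 d) M)) u) ∧
      ∀ x ∈ u, ∀ v : Tan d x, ∑ i, (inner ℝ (f i x) v) • f i x = v := by
  set T := trivializationAt (EuclideanSpace ℝ (Fin d)) (fun x : M ↦ TangentSpace (𝓡 d) x) x₀
  set b := (EuclideanSpace.basisFun (Fin d) ℝ).toBasis
  have hF := T.isLocalFrameOn_localFrame_baseSet (𝓡 d) 0 b
  have hl : ∀ x ∈ T.baseSet, LinearIndependent ℝ (fun i ↦ T.localFrame b i x) :=
    fun x hx ↦ hF.linearIndependent hx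
  have hc := continuousOn_gramSchmidt hF.contMDiffOn hl
  refine ⟨T.baseSet, T.open_baseSet.mem_nhds (FiberBundle.mem_baseSet_trivializationAt' x₀),
    T.open_baseSet, fun i x ↦ gramSchmidtNormed ℝ (fun i ↦ T.localFrame b i x) i, fun i ↦ ?_,
    fun x hx v ↦ ?_⟩
  · refine ContMDiffOn.smul_section ?_ (hc i)
    rw [contMDiffOn_zero_iff]
    have h2 : ∀ x, ‖gramSchmidt ℝ (fun i ↦ T.localFrame b i x) i‖ =
        √(inner ℝ (gramSchmidt ℝ (fun i ↦ T.localFrame b i x) i)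
          (gramSchmidt ℝ (fun i ↦ T.localFrame b i x) i)) :=
      fun x ↦ norm_eq_sqrt_real_inner _
    refine ContinuousOn.inv₀ ?_ fun x hx ↦ ?_
    · change ContinuousOn (fun x ↦ ‖gramSchmidt ℝ (fun i ↦ T.localFrame b i x) i‖) _
      simp only [h2]
      exact ((hc i).continuousOn.inner_bundle (hc i).continuousOn).sqrt
    · exact norm_ne_zero_iff.2 (gramSchmidt_ne_zero (𝕜 := ℝ) i (hl x hx))
  · have hcard : finrank ℝ (Tan d x) = Fintype.card (Fin d) := by rw [finrank_tan, Fintype.card_fin]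
    have hb : ∀ i, gramSchmidtOrthonormalBasis hcard (fun i ↦ T.localFrame b i x) i =
        gramSchmidtNormed ℝ (fun i ↦ T.localFrame b i x) i := by
      intro i
      refine gramSchmidtOrthonormalBasis_apply hcard fun h ↦ ?_
      have := gramSchmidtNormed_unit_length (𝕜 := ℝ) i (hl x hx)
      rw [h, norm_zero] at this
      exact zero_ne_one this
    have := (gramSchmidtOrthonormalBasis hcard (fun i ↦ T.localFrame b i x)).sum_repr' v
    simpa only [hb] using this

variable (d M) in
/-- A finite family of continuous vector fields giving an isometric embedding of the tangent bundle
into a trivial bundle. -/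
structure ParsevalFrame (ι : Type*) [Fintype ι] where
  sec : ι → (x : M) → Tan d x
  continuous_sec : ∀ k, Continuous (fun x ↦ (⟨x, sec k x⟩ : TangentBundle (𝓡 d) M))
  sum_inner : ∀ x (v : Tan d x), ∑ k, (inner ℝ (sec k x) v) • sec k x = v

variable (d M) in
-- Local orthonormal frames are weighted by the square roots of a partition of unity, because the
-- weight appears twice in the reproducing formula.
theorem exists_parsevalFrame [T2Space M] [CompactSpace M] :
    ∃ t : Finset M, Nonempty (ParsevalFrame d M (t × Fin d)) := by
  choose u hu huo f hf hfs using fun x₀ : M ↦ exists_local_orthonormal (d := d) x₀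
  obtain ⟨t, ht⟩ := isCompact_univ.elim_nhds_subcover u fun x _ ↦ hu x
  obtain ⟨ρ, hρ⟩ := PartitionOfUnity.exists_isSubordinate (isClosed_univ (X := M))
    (fun j : t ↦ u j) (fun j ↦ huo j) (by
      intro x hx
      obtain ⟨y, hy, hxy⟩ := mem_iUnion₂.1 (ht.2 hx)
      exact mem_iUnion.2 ⟨⟨y, hy⟩, hxy⟩)
  have hsup : ∀ j, tsupport (fun x ↦ √(ρ j x)) ⊆ u j := fun j ↦
    (closure_mono fun x (hx : √(ρ j x) ≠ 0) (h : ρ j x = 0) ↦ hx (by rw [h, Real.sqrt_zero])).trans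
      (hρ j)
  refine ⟨t, ⟨⟨fun k x ↦ √(ρ k.1 x) • f k.1 k.2 x, fun k ↦ ?_,
    fun x v ↦ ?_⟩⟩⟩
  · have h1 : ContMDiffOn (𝓡 d) 𝓘(ℝ, ℝ) 0 (fun x ↦ √(ρ k.1 x)) (u k.1) := by
      rw [contMDiffOn_zero_iff]
      exact ((ρ k.1).continuous.sqrt).continuousOn
    exact (h1.smul_section_of_tsupport (huo _) (hsup _) (hf k.1 k.2)).continuous
  · rw [Fintype.sum_prod_type]
    have h1 : ∀ j : t, ∑ i, (inner ℝ (√(ρ j x) • f j i x) v) • √(ρ j x) • f j i x = ρ j x • v := by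
      intro j
      have h2 : ∀ i, (inner ℝ (√(ρ j x) • f j i x) v) • √(ρ j x) • f j i x =
          ρ j x • ((inner ℝ (f j i x) v) • f j i x) := by
        intro i
        rw [real_inner_smul_left, smul_smul, smul_smul]
        congr 1
        have := Real.mul_self_sqrt (ρ.nonneg j x)
        linear_combination (inner ℝ (f j i x) v) * this
      simp only [h2]
      rw [← Finset.smul_sum]
      by_cases hx : x ∈ u j
      · rw [hfs j x hx]
      · have : ρ j x = 0 := by
          by_contra h
          exact hx (hρ j (subset_tsupport _ h))
        rw [this, zero_smul, zero_smul]
    simp only [h1]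
    rw [← Finset.sum_smul, ← finsum_eq_sum_of_fintype, ρ.sum_eq_one (mem_univ x), one_smul]

namespace ParsevalFrame

variable {ι : Type*} [Fintype ι] (S : ParsevalFrame d M ι)

/-- The coordinates of a tangent vector. -/
def coord (x : M) : Tan d x →L[ℝ] EuclideanSpace ℝ ι :=
  LinearMap.toContinuousLinearMap
    { toFun := fun v ↦ WithLp.toLp 2 fun k ↦ inner ℝ (S.sec k x) v
      map_add' := fun v w ↦ by ext k; simp [inner_add_right]
      map_smul' := fun c v ↦ by ext k; simp [real_inner_smul_right] }

/-- The tangent vector with given coordinates. -/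
def comb (x : M) : EuclideanSpace ℝ ι →L[ℝ] Tan d x :=
  LinearMap.toContinuousLinearMap
    { toFun := fun c ↦ ∑ k, c k • S.sec k x
      map_add' := fun v w ↦ by simp [add_smul, Finset.sum_add_distrib]
      map_smul' := fun c v ↦ by simp [mul_smul, Finset.smul_sum] }

theorem coord_apply (x : M) (v : Tan d x) (k : ι) : S.coord x v k = inner ℝ (S.sec k x) v := rfl

theorem comb_apply (x : M) (c : EuclideanSpace ℝ ι) : S.comb x c = ∑ k, c k • S.sec k x := rfl

theorem comb_coord (x : M) (v : Tan d x) : S.comb x (S.coord x v) = v := S.sum_inner x v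

/-- `comb` is the adjoint of `coord` and also a left inverse of it, so `coord` is isometric and
`coord ∘ comb` is the orthogonal projection on its range. -/
theorem inner_coord (x : M) (v : Tan d x) (c : EuclideanSpace ℝ ι) :
    inner ℝ (S.coord x v) c = inner ℝ v (S.comb x c) := by
  rw [comb_apply, inner_sum, PiLp.inner_apply]
  refine Finset.sum_congr rfl fun k _ ↦ ?_
  rw [coord_apply, real_inner_smul_right, real_inner_comm v]
  rfl

theorem inner_coord_coord (x : M) (v w : Tan d x) :
    inner ℝ (S.coord x v) (S.coord x w) = inner ℝ v w := by
  rw [inner_coord, comb_coord]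

theorem norm_coord (x : M) (v : Tan d x) : ‖S.coord x v‖ = ‖v‖ := by
  rw [norm_eq_sqrt_real_inner, norm_eq_sqrt_real_inner, inner_coord_coord]

theorem coord_injective (x : M) : Function.Injective (S.coord x) := fun v w h ↦ by
  rw [← S.comb_coord x v, h, comb_coord]

theorem continuous_coord :
    Continuous (fun w : TangentBundle (𝓡 d) M ↦ S.coord w.proj w.snd) := by
  refine (PiLp.continuous_toLp 2 _).comp (continuous_pi fun k ↦ ?_)
  exact Continuous.inner_bundle (F := EuclideanSpace ℝ (Fin d))
    (E := fun x : M ↦ TangentSpace (𝓡 d) x)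
    (b := fun w : TangentBundle (𝓡 d) M ↦ w.proj) (v := fun w ↦ S.sec k w.proj)
    (w := fun w ↦ w.snd) ((S.continuous_sec k).comp (FiberBundle.continuous_proj _ _)) continuous_id

theorem continuous_comb : Continuous (fun q : M × EuclideanSpace ℝ ι ↦
    (⟨q.1, S.comb q.1 q.2⟩ : TangentBundle (𝓡 d) M)) := by
  rw [continuous_iff_continuousAt]
  rintro ⟨x, c⟩
  rw [FiberBundle.continuousAt_totalSpace]
  refine ⟨continuousAt_fst, ?_⟩
  set T := trivializationAt (EuclideanSpace ℝ (Fin d)) (fun x : M ↦ TangentSpace (𝓡 d) x) x with hT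
  have h1 : ∀ k, ContinuousAt (fun q : M × EuclideanSpace ℝ ι ↦ (T ⟨q.1, S.sec k q.1⟩).2) (x, c) := by
    intro k
    have := ((FiberBundle.continuousAt_totalSpace _ _ (x₀ := x)).1
      (S.continuous_sec k).continuousAt).2
    exact ContinuousAt.comp (g := fun y ↦ (T ⟨y, S.sec k y⟩).2) this continuousAt_fst
  have h2 : ContinuousAt (fun q : M × EuclideanSpace ℝ ι ↦ ∑ k, q.2 k • (T ⟨q.1, S.sec k q.1⟩).2)
      (x, c) :=
    tendsto_finsetSum _ fun k _ ↦ Tendsto.smul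
      (Continuous.continuousAt (by fun_prop : Continuous fun q : M × EuclideanSpace ℝ ι ↦ q.2 k))
      (h1 k)
  refine h2.congr ?_
  have hb : T.baseSet ∈ 𝓝 x := T.open_baseSet.mem_nhds (FiberBundle.mem_baseSet_trivializationAt' x)
  filter_upwards [continuousAt_fst.preimage_mem_nhds hb] with q hq
  have h3 : ∀ v : Tan d q.1, (T ⟨q.1, v⟩).2 = T.linearMapAt ℝ q.1 v := fun v ↦ by
    rw [Trivialization.coe_linearMapAt_of_mem _ hq]
  change _ = (T ⟨q.1, S.comb q.1 q.2⟩).2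
  rw [h3, comb_apply, map_sum]
  refine Finset.sum_congr rfl fun k _ ↦ ?_
  rw [map_smul, ← h3]

end ParsevalFrame

end Frame

/-! ### The Riemannian distance along orbits and near a zero of the field -/

section Distance

variable {d : ℕ} {M : Type*} [TopologicalSpace M] [ChartedSpace (EuclideanSpace ℝ (Fin d)) M]
  [IsManifold (𝓡 d) ∞ M]

theorem hasDerivAt_extChartAt_comp {γ : ℝ → M} {t : ℝ} (hγ : MDifferentiableAt 𝓘(ℝ, ℝ) (𝓡 d) γ t)
    {x₀ : M} (hs : γ t ∈ (extChartAt (𝓡 d) x₀).source) :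
    HasDerivAt (fun s ↦ extChartAt (𝓡 d) x₀ (γ s))
      (trivializationAt (EuclideanSpace ℝ (Fin d)) (fun x : M ↦ TangentSpace (𝓡 d) x) x₀
        ⟨γ t, mfderiv 𝓘(ℝ, ℝ) (𝓡 d) γ t (1 : ℝ)⟩).2 t := by
  rw [trivializationAt_snd hs]
  have h1 : MDifferentiableAt (𝓡 d) 𝓘(ℝ, EuclideanSpace ℝ (Fin d)) (extChartAt (𝓡 d) x₀) (γ t) :=
    mdifferentiableAt_extChartAt (by rwa [← extChartAt_source (𝓡 d)])
  have h2 : ∀ L : ℝ →L[ℝ] EuclideanSpace ℝ (Fin d), HasFDerivAt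
      (fun s ↦ extChartAt (𝓡 d) x₀ (γ s)) L t →
      HasDerivAt (fun s ↦ extChartAt (𝓡 d) x₀ (γ s)) (L 1) t := fun L hL ↦ hL.hasDerivAt
  exact h2 _ (h1.hasMFDerivAt.comp t hγ.hasMFDerivAt).hasFDerivAt

theorem mfderiv_integralCurve {Y : VectorField d M} {γ : ℝ → M}
    (hγ : IsMIntegralCurve (I := 𝓡 d) γ (fun y ↦ Y y)) (t : ℝ) :
    mfderiv 𝓘(ℝ, ℝ) (𝓡 d) γ t (1 : ℝ) = Y (γ t) := by
  rw [(hγ t).mfderiv]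
  change (1 : ℝ) • Y (γ t) = _
  rw [one_smul]

theorem contMDiff_integralCurve {Y : VectorField d M} {γ : ℝ → M}
    (hγ : IsMIntegralCurve (I := 𝓡 d) γ (fun y ↦ Y y)) : ContMDiff 𝓘(ℝ, ℝ) (𝓡 d) 1 γ := by
  intro t₀
  have hc := hγ.continuous
  rw [contMDiffAt_iff_target]
  refine ⟨hc.continuousAt, ?_⟩
  rw [contMDiffAt_iff_contDiffAt, contDiffAt_one_iff]
  set T := trivializationAt (EuclideanSpace ℝ (Fin d)) (fun x : M ↦ TangentSpace (𝓡 d) x) (γ t₀)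
    with hT
  refine ⟨fun t ↦ ContinuousLinearMap.toSpanSingleton ℝ (T ⟨γ t, Y (γ t)⟩).2,
    γ ⁻¹' (extChartAt (𝓡 d) (γ t₀)).source,
    hc.continuousAt.preimage_mem_nhds (extChartAt_source_mem_nhds _), ?_, fun t ht ↦ ?_⟩
  · have h1 : ContinuousOn (fun t ↦ (T ⟨γ t, Y (γ t)⟩).2)
        (γ ⁻¹' (extChartAt (𝓡 d) (γ t₀)).source) := by
      refine continuous_snd.comp_continuousOn (T.continuousOn.comp
        ((Y.contMDiff.continuous.comp hc).continuousOn) fun t ht ↦ ?_)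
      rw [T.mem_source]
      rw [mem_preimage, extChartAt_source] at ht
      simpa [hT] using ht
    have h2 : Continuous (fun v : EuclideanSpace ℝ (Fin d) ↦
        ContinuousLinearMap.toSpanSingleton ℝ v) :=
      LinearMap.continuous_of_finiteDimensional
        (ContinuousLinearMap.toSpanSingletonLE ℝ ℝ (EuclideanSpace ℝ (Fin d))).toLinearMap
    exact h2.comp_continuousOn h1
  · have := hasDerivAt_extChartAt_comp (hγ t).mdifferentiableAt ht
    rw [mfderiv_integralCurve hγ] at this
    exact this.hasFDerivAt

variable [RiemannianBundle (fun x : M ↦ TangentSpace (𝓡 d) x)]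
  [IsContinuousRiemannianBundle (EuclideanSpace ℝ (Fin d)) (fun x : M ↦ TangentSpace (𝓡 d) x)]

theorem riemannianEDist_integralCurve_le {Y : VectorField d M} {γ : ℝ → M}
    (hγ : IsMIntegralCurve (I := 𝓡 d) γ (fun y ↦ Y y)) {s t : ℝ} (hst : s ≤ t) {c : ℝ}
    (hc : ∀ r ∈ Icc s t, ‖Y (γ r)‖ ≤ c) :
    Manifold.riemannianEDist (𝓡 d) (γ s) (γ t) ≤ ENNReal.ofReal (c * (t - s)) := by
  refine (Manifold.riemannianEDist_le_pathELength (contMDiff_integralCurve hγ).contMDiffOn rfl rfl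
    hst).trans ?_
  rw [Manifold.pathELength_eq_lintegral_mfderiv_Icc]
  have h1 : ∀ r ∈ Icc s t, ‖mfderiv 𝓘(ℝ, ℝ) (𝓡 d) γ r (1 : ℝ)‖ₑ ≤ ENNReal.ofReal c := by
    intro r hr
    rw [mfderiv_integralCurve hγ, ← ofReal_norm]
    exact ENNReal.ofReal_le_ofReal (hc r hr)
  refine (MeasureTheory.setLIntegral_mono' measurableSet_Icc h1).trans ?_
  rw [MeasureTheory.setLIntegral_const, Real.volume_Icc,
    ← ENNReal.ofReal_mul ((norm_nonneg _).trans (hc s (left_mem_Icc.2 hst)))]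

theorem eventually_norm_trivializationAt_le (x₀ : M) : ∃ C : ℝ, 0 < C ∧ ∀ᶠ y in 𝓝 x₀,
    ∀ v : Tan d y, ‖(trivializationAt (EuclideanSpace ℝ (Fin d))
      (fun x : M ↦ TangentSpace (𝓡 d) x) x₀ ⟨y, v⟩).2‖ ≤ C * ‖v‖ ∧
      ‖v‖ ≤ C * ‖(trivializationAt (EuclideanSpace ℝ (Fin d))
      (fun x : M ↦ TangentSpace (𝓡 d) x) x₀ ⟨y, v⟩).2‖ := by
  obtain ⟨C₁, hC₁, h1⟩ := eventually_norm_trivializationAt_lt (EuclideanSpace ℝ (Fin d))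
    (fun x : M ↦ TangentSpace (𝓡 d) x) x₀
  obtain ⟨C₂, hC₂, h2⟩ := eventually_norm_symmL_trivializationAt_lt (EuclideanSpace ℝ (Fin d))
    (fun x : M ↦ TangentSpace (𝓡 d) x) x₀
  set T := trivializationAt (EuclideanSpace ℝ (Fin d)) (fun x : M ↦ TangentSpace (𝓡 d) x) x₀
  refine ⟨max C₁ C₂, lt_max_of_lt_left hC₁, ?_⟩
  filter_upwards [h1, h2, T.open_baseSet.mem_nhds (FiberBundle.mem_baseSet_trivializationAt' x₀)]
    with y h1 h2 hy v
  have e : (T ⟨y, v⟩).2 = T.continuousLinearMapAt ℝ y v := by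
    rw [Trivialization.continuousLinearMapAt_apply, Trivialization.coe_linearMapAt_of_mem _ hy]
  rw [e]
  constructor
  · refine ((T.continuousLinearMapAt ℝ y).le_opNorm v).trans ?_
    gcongr
    exact h1.le.trans (le_max_left _ _)
  · have e2 : v = T.symmL ℝ y (T.continuousLinearMapAt ℝ y v) :=
      (T.symmL_continuousLinearMapAt hy v).symm
    conv_lhs => rw [e2]
    refine ((T.symmL ℝ y).le_opNorm _).trans ?_
    gcongr
    exact h2.le.trans (le_max_right _ _)

/-- A path from `x₀` that is short enough stays where the chart expands lengths by at most `C`. If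
the distance were too small, a nearly shortest path would be too short to cover the displacement in
the chart. -/
theorem eventually_edist_extChartAt_le [RegularSpace M] (x₀ : M) : ∃ C : NNReal, 0 < C ∧
    ∀ᶠ y in 𝓝 x₀, y ∈ (extChartAt (𝓡 d) x₀).source ∧
      ‖extChartAt (𝓡 d) x₀ y - extChartAt (𝓡 d) x₀ x₀‖ₑ ≤
        C * Manifold.riemannianEDist (𝓡 d) x₀ y := by
  obtain ⟨C, hC, h1⟩ := eventually_norm_trivializationAt_le (d := d) x₀
  lift C to NNReal using hC.le
  have hC0 : C ≠ 0 := by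
    rintro rfl
    simp at hC
  obtain ⟨c, hc, hcs⟩ := setOfPred_riemannianEDist_lt_subset_nhds' (𝓡 d)
    (inter_mem h1 (extChartAt_source_mem_nhds (I := 𝓡 d) x₀))
  refine ⟨C, pos_iff_ne_zero.2 hC0, ?_⟩
  filter_upwards [eventually_riemannianEDist_lt (𝓡 d) x₀ hc] with y hy
  refine ⟨(hcs hy).2, ?_⟩
  by_contra! hlt
  have hlt' : Manifold.riemannianEDist (𝓡 d) x₀ y <
      min c (‖extChartAt (𝓡 d) x₀ y - extChartAt (𝓡 d) x₀ x₀‖ₑ / C) := by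
    refine lt_min hy ?_
    rw [ENNReal.lt_div_iff_mul_lt (Or.inl (by exact_mod_cast hC0)) (Or.inl ENNReal.coe_ne_top),
      mul_comm]
    exact hlt
  obtain ⟨γ, hγ0, hγ1, hγs, hγl, -⟩ :=
    Manifold.exists_lt_locally_constant_of_riemannianEDist_lt hlt' zero_lt_one
  have hmem : ∀ t ∈ Icc (0 : ℝ) 1, (∀ v : Tan d (γ t), ‖(trivializationAt (EuclideanSpace ℝ (Fin d))
      (fun x : M ↦ TangentSpace (𝓡 d) x) x₀ ⟨γ t, v⟩).2‖ ≤ C * ‖v‖) ∧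
      γ t ∈ (extChartAt (𝓡 d) x₀).source := by
    intro t ht
    have : Manifold.riemannianEDist (𝓡 d) x₀ (γ t) < c := by
      refine lt_of_le_of_lt (Manifold.riemannianEDist_le_pathELength hγs.contMDiffOn hγ0 rfl ht.1) ?_
      exact (Manifold.pathELength_mono le_rfl ht.2).trans_lt (hγl.trans_le (min_le_left _ _))
    exact ⟨fun v ↦ ((hcs this).1 v).1, (hcs this).2⟩
  have hd : ∀ t ∈ Icc (0 : ℝ) 1, _ := fun t ht ↦
    hasDerivAt_extChartAt_comp (hγs.mdifferentiable one_ne_zero t) (hmem t ht).2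
  have hcd : ContDiffOn ℝ 1 (fun s ↦ extChartAt (𝓡 d) x₀ (γ s)) (Icc 0 1) := by
    rw [← contMDiffOn_iff_contDiffOn]
    refine contMDiffOn_extChartAt.comp (t := (chartAt (EuclideanSpace ℝ (Fin d)) x₀).source)
      hγs.contMDiffOn fun t ht ↦ ?_
    have := (hmem t ht).2
    rwa [extChartAt_source] at this
  have h3 := enorm_sub_le_lintegral_derivWithin_Icc_of_contDiffOn_Icc hcd zero_le_one
  have h4 : ∫⁻ t in Icc (0 : ℝ) 1, ‖derivWithin (fun s ↦ extChartAt (𝓡 d) x₀ (γ s)) (Icc 0 1) t‖ₑ ≤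
      C * Manifold.pathELength (𝓡 d) γ 0 1 := by
    rw [Manifold.pathELength_eq_lintegral_mfderiv_Icc,
      ← MeasureTheory.lintegral_const_mul' _ _ ENNReal.coe_ne_top]
    refine MeasureTheory.setLIntegral_mono' measurableSet_Icc fun t ht ↦ ?_
    rw [(hd t ht).hasDerivWithinAt.derivWithin (uniqueDiffOn_Icc zero_lt_one t ht)]
    have := (hmem t ht).1 (mfderiv 𝓘(ℝ, ℝ) (𝓡 d) γ t (1 : ℝ))
    rw [← ofReal_norm, ← ofReal_norm, ← ENNReal.ofReal_coe_nnreal,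
      ← ENNReal.ofReal_mul C.coe_nonneg]
    exact ENNReal.ofReal_le_ofReal this
  rw [hγ0, hγ1] at h3
  have h5 := h3.trans h4
  have h6 := hγl.trans_le (min_le_right _ _)
  rw [ENNReal.lt_div_iff_mul_lt (Or.inl (by exact_mod_cast hC0)) (Or.inl ENNReal.coe_ne_top),
    mul_comm] at h6
  exact absurd h6 (not_lt.2 h5)

/-- In the chart the field vanishes at `σ` and is differentiable there, hence is bounded by the
distance in the chart, which the Riemannian distance controls. -/
theorem norm_le_riemannianEDist [RegularSpace M] (Y : VectorField d M) {σ : M} (hσ : Y σ = 0) :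
    ∃ c : ℝ, ∀ᶠ y in 𝓝 σ, ∀ r : ℝ, 0 ≤ r → Manifold.riemannianEDist (𝓡 d) y σ ≤ ENNReal.ofReal r →
      ‖Y y‖ ≤ c * r := by
  obtain ⟨C, hC, h1⟩ := eventually_norm_trivializationAt_le (d := d) σ
  obtain ⟨C', hC', h2⟩ := eventually_edist_extChartAt_le (d := d) σ
  have hd : DifferentiableAt ℝ (chartRep Y σ) (extChartAt (𝓡 d) σ σ) :=
    ((contDiffOn_chartRep Y σ).differentiableOn one_ne_zero).differentiableAt
      (extChartAt_target_mem_nhds σ)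
  obtain ⟨L, hL, h3⟩ := hd.isBigO_sub.exists_pos
  rw [Asymptotics.isBigOWith_iff] at h3
  refine ⟨C * (L * C'), ?_⟩
  filter_upwards [h1, h2, (continuousAt_extChartAt (I := 𝓡 d) σ).eventually h3] with y h1 h2 h3 r hr hy
  have e : ∀ z ∈ (extChartAt (𝓡 d) σ).source, chartRep Y σ (extChartAt (𝓡 d) σ z) =
      (trivializationAt (EuclideanSpace ℝ (Fin d)) (fun x : M ↦ TangentSpace (𝓡 d) x) σ
        ⟨z, Y z⟩).2 := by
    intro z hz
    rw [chartRep, (extChartAt (𝓡 d) σ).left_inv hz]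
  have h0 : chartRep Y σ (extChartAt (𝓡 d) σ σ) = 0 := by
    rw [e σ (mem_extChartAt_source σ), trivializationAt_snd (mem_extChartAt_source σ), hσ, map_zero]
    rfl
  rw [h0, sub_zero, e y h2.1] at h3
  have h4 : ‖extChartAt (𝓡 d) σ y - extChartAt (𝓡 d) σ σ‖ ≤ C' * r := by
    have h5 : ‖extChartAt (𝓡 d) σ y - extChartAt (𝓡 d) σ σ‖ₑ ≤ ENNReal.ofReal (C' * r) := by
      rw [ENNReal.ofReal_mul C'.coe_nonneg, ENNReal.ofReal_coe_nnreal]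
      refine h2.2.trans ?_
      gcongr
      rwa [Manifold.riemannianEDist_comm]
    rw [← ofReal_norm] at h5
    exact (ENNReal.ofReal_le_ofReal_iff (by positivity)).1 h5
  calc ‖Y y‖ ≤ C * ‖_‖ := (h1 (Y y)).2
    _ ≤ C * (L * (C' * r)) := by
        gcongr
        exact h3.trans (by gcongr)
    _ = _ := by ring

end Distance

/-! ### The family of flows attached to the manifold -/

section ToFlowData

variable {d : ℕ} {M : Type*} [TopologicalSpace M] [ChartedSpace (EuclideanSpace ℝ (Fin d)) M]
  [IsManifold (𝓡 d) ∞ M]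

theorem continuous_eval_vectorField : Continuous (fun q : VectorField d M × M ↦
    (⟨q.2, q.1 q.2⟩ : TangentBundle (𝓡 d) M)) := by
  rw [continuous_iff_continuousAt]
  rintro ⟨X, x⟩
  rw [FiberBundle.continuousAt_totalSpace]
  refine ⟨continuousAt_snd, ?_⟩
  set T := trivializationAt (EuclideanSpace ℝ (Fin d)) (fun x : M ↦ TangentSpace (𝓡 d) x) x with hT
  have h1 : ContinuousAt (fun q : VectorField d M × M ↦ (T ⟨q.2, X q.2⟩).2) (X, x) :=
    ContinuousAt.comp (g := fun y ↦ (T ⟨y, X y⟩).2) (((FiberBundle.continuousAt_totalSpace _ _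
      (x₀ := x)).1 X.contMDiff.continuous.continuousAt).2) continuousAt_snd
  obtain ⟨r, hr, hrt⟩ := Metric.nhds_basis_closedBall.mem_iff.1
    (extChartAt_target_mem_nhds (I := 𝓡 d) x)
  change Tendsto (fun q : VectorField d M × M ↦ (T ⟨q.2, q.1 q.2⟩).2) _ (𝓝 (T ⟨x, X x⟩).2)
  rw [Metric.tendsto_nhds]
  intro ε hε
  filter_upwards [Metric.tendsto_nhds.1 h1 (ε / 2) (half_pos hε),
    continuousAt_fst.eventually (mem_nhds_c1Close X x (isCompact_closedBall _ _) hrt (half_pos hε)),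
    continuousAt_snd.preimage_mem_nhds (inter_mem (extChartAt_source_mem_nhds (I := 𝓡 d) x)
      ((continuousAt_extChartAt (I := 𝓡 d) x).preimage_mem_nhds (Metric.closedBall_mem_nhds _ hr)))]
    with q h2 h3 h4
  have e : ∀ Y : VectorField d M, chartRep Y x (extChartAt (𝓡 d) x q.2) = (T ⟨q.2, Y q.2⟩).2 := by
    intro Y
    rw [chartRep, (extChartAt (𝓡 d) x).left_inv h4.1]
  have h5 := (h3 _ h4.2).1
  rw [e, e, ← dist_eq_norm] at h5
  calc dist (T ⟨q.2, q.1 q.2⟩).2 (T ⟨x, X x⟩).2 ≤ _ := dist_triangle _ (T ⟨q.2, X q.2⟩).2 _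
    _ < ε := by linarith

variable [RiemannianBundle (fun x : M ↦ TangentSpace (𝓡 d) x)]
  [IsContinuousRiemannianBundle (EuclideanSpace ℝ (Fin d)) (fun x : M ↦ TangentSpace (𝓡 d) x)]
  [T2Space M] [CompactSpace M]

/-- The flows of `C¹` vector fields and their derivatives, in the coordinates given by a frame. -/
def ParsevalFrame.flowData {ι : Type*} [Fintype ι] (S : ParsevalFrame d M ι) :
    FlowData (VectorField d M) M (EuclideanSpace ℝ ι) where
  φ := flow
  D Y t x := (S.coord (flow Y t x)).comp ((tangentFlow Y t x).comp (S.comb x))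
  ξ Y x := S.coord x (Y x)
  pr x := (S.coord x).comp (S.comb x)
  d := d
  dist := Manifold.riemannianEDist (𝓡 d)
  continuous_φ := by
    have h1 : Continuous (fun z : VectorField d M × ℝ × M ↦
        (z.1, z.2.1, (⟨z.2.2, S.comb z.2.2 0⟩ : TangentBundle (𝓡 d) M))) :=
      continuous_fst.prodMk ((continuous_fst.comp continuous_snd).prodMk
        (S.continuous_comb.comp ((continuous_snd.comp continuous_snd).prodMk continuous_const)))
    exact (FiberBundle.continuous_proj _ _).comp (continuous_tangentMap_flow.comp h1)
  continuous_D := by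
    rw [continuous_clm_apply]
    intro c
    have h1 : Continuous (fun z : VectorField d M × ℝ × M ↦
        (z.1, z.2.1, (⟨z.2.2, S.comb z.2.2 c⟩ : TangentBundle (𝓡 d) M))) :=
      continuous_fst.prodMk ((continuous_fst.comp continuous_snd).prodMk
        (S.continuous_comb.comp ((continuous_snd.comp continuous_snd).prodMk continuous_const)))
    exact S.continuous_coord.comp (continuous_tangentMap_flow.comp h1)
  continuous_ξ := S.continuous_coord.comp continuous_eval_vectorField
  φ_zero := flow_zero
  φ_add := flow_add
  D_zero Y x := by
    ext1 c
    exact congrArg (fun w : TangentBundle (𝓡 d) M ↦ S.coord w.proj w.snd)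
      (tangentMap_flow_zero Y ⟨x, S.comb x c⟩)
  D_add Y s t x := by
    ext1 c
    simp only [ContinuousLinearMap.comp_apply, S.comb_coord]
    exact congrArg (fun w : TangentBundle (𝓡 d) M ↦ S.coord w.proj w.snd)
      (tangentMap_flow_add Y s t ⟨x, S.comb x c⟩)
  finrank_range x := by
    have h1 : ((S.coord x).comp (S.comb x)).range = (S.coord x).range := by
      refine le_antisymm ?_ ?_
      · rintro _ ⟨c, rfl⟩
        exact ⟨S.comb x c, rfl⟩
      · rintro _ ⟨v, rfl⟩
        exact ⟨S.coord x v, congrArg (S.coord x) (S.comb_coord x v)⟩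
    rw [h1]
    exact (LinearMap.finrank_range_of_inj (f := (S.coord x).toLinearMap)
      (S.coord_injective x)).trans (finrank_tan x)
  pr_symm x u v := by
    rw [ContinuousLinearMap.comp_apply, ContinuousLinearMap.comp_apply, S.inner_coord,
      real_inner_comm, real_inner_comm _ u, S.inner_coord, real_inner_comm]
  pr_ξ Y x := congrArg (S.coord x) (S.comb_coord x _)
  D_ξ Y t x := by
    simp only [ContinuousLinearMap.comp_apply, S.comb_coord]
    exact congrArg (fun w : TangentBundle (𝓡 d) M ↦ S.coord w.proj w.snd)
      (tangentMap_flow_apply_self Y t x)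
  dist_self x := Manifold.riemannianEDist_self
  dist_comm x y := Manifold.riemannianEDist_comm
  dist_triangle x y z := Manifold.riemannianEDist_triangle
  eventually_dist_lt x c hc := by
    filter_upwards [eventually_riemannianEDist_lt (𝓡 d) x hc] with y hy
    rwa [Manifold.riemannianEDist_comm]
  exists_dist_lt x s hs := by
    obtain ⟨c, hc, h⟩ := setOfPred_riemannianEDist_lt_subset_nhds' (𝓡 d) hs
    exact ⟨c, hc, fun y hy ↦ h (by rwa [Manifold.riemannianEDist_comm] at hy)⟩
  dist_φ_le Y x s t hst c hc :=
    riemannianEDist_integralCurve_le (isMIntegralCurve_flow Y x) hst fun r hr ↦ by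
      rw [← S.norm_coord]
      exact hc r hr
  ξ_le_dist Y σ hσ := by
    obtain ⟨c, hc⟩ := norm_le_riemannianEDist Y
      ((S.coord_injective σ) (hσ.trans (map_zero _).symm))
    refine ⟨c, hc.mono fun y hy r hr hd ↦ ?_⟩
    rw [S.norm_coord]
    exact hy r hr hd

end ToFlowData

theorem inv_norm_smul_smul {H : Type*} [NormedAddCommGroup H] [NormedSpace ℝ H] {c : ℝ}
    (hc : 0 < c) (w : H) : ‖c • w‖⁻¹ • c • w = ‖w‖⁻¹ • w := by
  rw [norm_smul, Real.norm_of_nonneg hc.le, smul_smul]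
  congr 1
  field_simp

/-! ### Domination by norms of restrictions and domination by vectors -/

section RestrictedNorm

variable {E E' E'' : Type*} [NormedAddCommGroup E] [NormedSpace ℝ E] [FiniteDimensional ℝ E]
  [NormedAddCommGroup E'] [NormedSpace ℝ E']
  [NormedAddCommGroup E''] [NormedSpace ℝ E'']

theorem norm_comp_subtypeL_le_iff {A : E →L[ℝ] E'} {V : Submodule ℝ E} {c : ℝ} (hc : 0 ≤ c) :
    ‖A.comp V.subtypeL‖ ≤ c ↔ ∀ v ∈ V, ‖A v‖ ≤ c * ‖v‖ := by
  rw [ContinuousLinearMap.opNorm_le_iff hc]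
  exact ⟨fun h v hv ↦ h ⟨v, hv⟩, fun h v ↦ h v v.2⟩

theorem exists_norm_eq_norm_comp_subtypeL (A : E →L[ℝ] E') (V : Submodule ℝ E) :
    ‖A.comp V.subtypeL‖ = 0 ∨ ∃ v ∈ V, v ≠ 0 ∧ ‖A v‖ = ‖A.comp V.subtypeL‖ * ‖v‖ := by
  rcases eq_or_ne V ⊥ with rfl | hV
  · left
    refine le_antisymm ((norm_comp_subtypeL_le_iff le_rfl).2 fun v hv ↦ ?_) (ContinuousLinearMap.opNorm_nonneg _)
    rw [(Submodule.mem_bot ℝ).1 hv]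
    simp
  · right
    have hn : Nontrivial V := Submodule.nontrivial_iff_ne_bot.2 hV
    obtain ⟨v, hv, hm⟩ := (isCompact_sphere (0 : V) 1).exists_isMaxOn
      (NormedSpace.sphere_nonempty.2 zero_le_one) (f := fun v ↦ ‖A.comp V.subtypeL v‖)
      (by fun_prop)
    have hv1 : ‖v‖ = 1 := by simpa using hv
    have hv1' : ‖(v : E)‖ = 1 := hv1
    refine ⟨v, v.2, fun h ↦ by rw [h, norm_zero] at hv1'; exact zero_ne_one hv1', ?_⟩
    rw [hv1', mul_one]
    refine le_antisymm ?_ (ContinuousLinearMap.opNorm_le_of_unit_norm (norm_nonneg _)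
      fun w hw ↦ hm (by simpa using hw))
    have := (A.comp V.subtypeL).le_opNorm v
    rwa [hv1, mul_one] at this

/-- `B` inverts `A` on `W`, so its norm on the image is the inverse of the least expansion of `A` on
`W`. In finite dimension both norms are attained, which preserves strictness. If one of the norms is
zero, the product is trivially smaller than `c`. -/
theorem norm_mul_norm_lt_iff [FiniteDimensional ℝ E'] {A : E →L[ℝ] E'} {B : E' →L[ℝ] E''} {V W : Submodule ℝ E}
    {W' : Submodule ℝ E'} (hW : W.map A.toLinearMap = W') (hB : ∀ w ∈ W, ‖B (A w)‖ = ‖w‖) {c : ℝ}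
    (hc : 0 < c) : ‖A.comp V.subtypeL‖ * ‖B.comp W'.subtypeL‖ < c ↔
      ∀ v ∈ V, ∀ w ∈ W, v ≠ 0 → w ≠ 0 → ‖A v‖ * ‖w‖ < c * (‖v‖ * ‖A w‖) := by
  constructor
  · intro h v hv w hw hv0 hw0
    have h1 := (norm_comp_subtypeL_le_iff (ContinuousLinearMap.opNorm_nonneg _)).1
      (le_refl ‖A.comp V.subtypeL‖) v hv
    have h2 := (norm_comp_subtypeL_le_iff (ContinuousLinearMap.opNorm_nonneg _)).1
      (le_refl ‖B.comp W'.subtypeL‖) (A w) (hW ▸ Submodule.mem_map_of_mem hw)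
    rw [hB w hw] at h2
    have hv1 := norm_pos_iff.2 hv0
    have hw1 := norm_pos_iff.2 hw0
    have hA : 0 < ‖A w‖ := by
      refine (norm_nonneg _).lt_of_ne fun h0 ↦ ?_
      rw [← h0, mul_zero] at h2
      exact hw1.not_ge h2
    calc ‖A v‖ * ‖w‖ ≤ (‖A.comp V.subtypeL‖ * ‖v‖) * (‖B.comp W'.subtypeL‖ * ‖A w‖) :=
          mul_le_mul h1 h2 (norm_nonneg _) (by positivity)
      _ = (‖A.comp V.subtypeL‖ * ‖B.comp W'.subtypeL‖) * (‖v‖ * ‖A w‖) := by ring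
      _ < c * (‖v‖ * ‖A w‖) := mul_lt_mul_of_pos_right h (by positivity)
  · intro h
    rcases exists_norm_eq_norm_comp_subtypeL A V with h0 | ⟨v, hv, hv0, hvn⟩
    · rwa [h0, zero_mul]
    rcases exists_norm_eq_norm_comp_subtypeL B W' with h0 | ⟨w', hw', hw0, hwn⟩
    · rwa [h0, mul_zero]
    subst hW
    obtain ⟨w, hw, rfl⟩ := hw'
    change A w ≠ 0 at hw0
    change ‖B (A w)‖ = _ * ‖A w‖ at hwn
    rw [hB w hw] at hwn
    have h1 := h v hv w hw hv0 (fun h ↦ hw0 (by rw [h, map_zero]))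
    rw [hvn, hwn] at h1
    have h2 : 0 < ‖v‖ * ‖A w‖ := mul_pos (norm_pos_iff.2 hv0) (norm_pos_iff.2 hw0)
    refine lt_of_mul_lt_mul_right (lt_of_eq_of_lt ?_ h1) h2.le
    ring

end RestrictedNorm

/-! ### Dictionary between tangent vectors and their coordinates in the frame -/

section Dictionary

variable {d : ℕ} {M : Type*} [TopologicalSpace M] [ChartedSpace (EuclideanSpace ℝ (Fin d)) M]
  [IsManifold (𝓡 d) ∞ M] [RiemannianBundle (fun x : M ↦ TangentSpace (𝓡 d) x)]
  [IsContinuousRiemannianBundle (EuclideanSpace ℝ (Fin d)) (fun x : M ↦ TangentSpace (𝓡 d) x)]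
  [T2Space M] [CompactSpace M] {ι : Type*} [Fintype ι] (S : ParsevalFrame d M ι)

theorem restrNorm_le_iff {x y : M} {A : Tan d x →L[ℝ] Tan d y} {V : Submodule ℝ (Tan d x)} {c : ℝ}
    (hc : 0 ≤ c) : restrNorm A V ≤ c ↔ ∀ v ∈ V, ‖A v‖ ≤ c * ‖v‖ :=
  norm_comp_subtypeL_le_iff hc

theorem restrNorm_nonneg {x y : M} (A : Tan d x →L[ℝ] Tan d y) (V : Submodule ℝ (Tan d x)) :
    0 ≤ restrNorm A V := ContinuousLinearMap.opNorm_nonneg _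

theorem normalProj_apply {x : M} (u v : Tan d x) :
    normalProj u v = v - (inner ℝ u v / ‖u‖ ^ 2) • u := by
  rw [normalProj, Submodule.starProjection_orthogonal_val, Submodule.starProjection_singleton]
  rfl

namespace ParsevalFrame

theorem map_comap_coord {x : M} {V : Submodule ℝ (EuclideanSpace ℝ ι)}
    (h : V ≤ (⊤ : Submodule ℝ (Tan d x)).map (S.coord x).toLinearMap) :
    (V.comap (S.coord x).toLinearMap).map (S.coord x).toLinearMap = V := by
  refine Submodule.map_comap_eq_of_le (h.trans ?_)
  rw [Submodule.map_top]

theorem map_coord_inj {x : M} {V W : Submodule ℝ (Tan d x)}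
    (h : V.map (S.coord x).toLinearMap = W.map (S.coord x).toLinearMap) : V = W :=
  Submodule.map_injective_of_injective (S.coord_injective x) h

theorem coord_ne_zero {x : M} {v : Tan d x} (h : v ≠ 0) : S.coord x v ≠ 0 := fun h' ↦
  h (S.coord_injective x (h'.trans (map_zero _).symm))

theorem restrNorm_mul_lt_iff {B : Type*} [TopologicalSpace B]
    {C : LinCocycle (VectorField d M) B (EuclideanSpace ℝ ι)} {Y : VectorField d M} {b : B} {t : ℝ}
    {x y z : M} {A₁ : Tan d x →L[ℝ] Tan d y} {A₂ : Tan d y →L[ℝ] Tan d z}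
    {V W : Submodule ℝ (Tan d x)} {W' : Submodule ℝ (Tan d y)} (η : ℝ)
    (h₁ : ∀ v, C.A Y t b (S.coord x v) = S.coord y (A₁ v))
    (h₂ : ∀ v, C.A Y (-t) (C.Φ Y t b) (S.coord y v) = S.coord z (A₂ v))
    (hW : W.map (S.coord x).toLinearMap ≤ C.fib Y b) (hW' : W.map A₁.toLinearMap = W') :
    restrNorm A₁ V * restrNorm A₂ W' < Real.exp (-(η * t)) ↔
      C.StrictAt Y b (V.map (S.coord x).toLinearMap) (W.map (S.coord x).toLinearMap) η t := by
  refine (norm_mul_norm_lt_iff hW' (fun w hw ↦ ?_) (Real.exp_pos _)).trans ⟨fun h ↦ ?_, fun h ↦ ?_⟩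
  · have := C.A_neg_A Y b (hW (Submodule.mem_map_of_mem hw)) t
    rw [← S.norm_coord z, ← h₂, ← h₁]
    exact (congrArg norm this).trans (S.norm_coord x w)
  · rintro _ ⟨v, hv, rfl⟩ _ ⟨w, hw, rfl⟩ hv0 hw0
    have := h v hv w hw (fun h ↦ hv0 (by rw [h, map_zero])) (fun h ↦ hw0 (by rw [h, map_zero]))
    rw [← S.norm_coord y, ← S.norm_coord y, ← S.norm_coord x, ← S.norm_coord x, ← h₁, ← h₁] at this
    exact this
  · intro v hv w hw hv0 hw0
    have := h _ ((Submodule.mem_map_of_mem hv)) _ ((Submodule.mem_map_of_mem hw))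
      (S.coord_ne_zero hv0) (S.coord_ne_zero hw0)
    rw [← S.norm_coord y, ← S.norm_coord y, ← S.norm_coord x, ← S.norm_coord x, ← h₁, ← h₁]
    exact this

theorem D_coord (Y : VectorField d M) (t : ℝ) (x : M) (v : Tan d x) :
    S.flowData.D Y t x (S.coord x v) = S.coord (flow Y t x) (tangentFlow Y t x v) :=
  congrArg (fun w ↦ S.coord (flow Y t x) (tangentFlow Y t x w)) (S.comb_coord x v)

theorem tan_fib (Y : VectorField d M) (x : M) :
    S.flowData.tan.fib Y x = (⊤ : Submodule ℝ (Tan d x)).map (S.coord x).toLinearMap := by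
  ext c
  rw [FlowData.mem_tan_fib]
  constructor
  · intro h
    exact ⟨S.comb x c, trivial, h⟩
  · rintro ⟨v, -, rfl⟩
    exact congrArg (S.coord x) (S.comb_coord x v)

/-- The unit vector spanned by a tangent vector. -/
def lineOf (x : M) (u : Tan d x) (hu : u ≠ 0) : S.flowData.Line :=
  ⟨(x, ‖S.coord x u‖⁻¹ • S.coord x u),
    by simp [norm_smul, norm_ne_zero_iff.2 (S.coord_ne_zero hu)],
    (map_smul (S.flowData.pr x) _ _).trans
      (congrArg (‖S.coord x u‖⁻¹ • S.coord x ·) (S.comb_coord x u))⟩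

theorem lineOf_fst {x : M} {u : Tan d x} (hu : u ≠ 0) : (S.lineOf x u hu).1.1 = x := rfl

theorem tangentFlow_ne_zero (S : ParsevalFrame d M ι) (Y : VectorField d M) (t : ℝ) {x : M} {u : Tan d x} (hu : u ≠ 0) :
    tangentFlow Y t x u ≠ 0 := by
  intro h
  have h1 := S.flowData.tan.A_pos Y x (x := S.coord x u)
    ((S.tan_fib Y x).symm ▸ Submodule.mem_map_of_mem trivial) (S.coord_ne_zero hu) t
  have h2 : S.flowData.tan.A Y t x (S.coord x u) = 0 :=
    (S.D_coord Y t x u).trans (by rw [h, map_zero])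
  rw [h2, norm_zero] at h1
  exact h1.false

theorem lineFlow_lineOf (Y : VectorField d M) (t : ℝ) {x : M} {u : Tan d x} (hu : u ≠ 0) :
    S.flowData.lineFlow Y t (S.lineOf x u hu) =
      S.lineOf (flow Y t x) (tangentFlow Y t x u) (S.tangentFlow_ne_zero Y t hu) := by
  have h1 : 0 < ‖S.coord x u‖⁻¹ := inv_pos.2 (norm_pos_iff.2 (S.coord_ne_zero hu))
  have h2 : S.flowData.D Y t x (‖S.coord x u‖⁻¹ • S.coord x u) =
      ‖S.coord x u‖⁻¹ • S.coord (flow Y t x) (tangentFlow Y t x u) :=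
    (map_smul _ _ _).trans (congrArg _ (S.D_coord Y t x u))
  have h3 : (S.flowData.lineFlow Y t (S.lineOf x u hu)).1.1 = flow Y t x := rfl
  exact Subtype.ext (Prod.ext (h3.trans (S.lineOf_fst _).symm) ((congrArg (fun w ↦ ‖w‖⁻¹ • w) h2).trans
    (inv_norm_smul_smul h1 _)))

theorem orthProj_coord {x : M} (u v : Tan d x) :
    FlowData.orthProj (‖S.coord x u‖⁻¹ • S.coord x u) (S.coord x v) =
      S.coord x (normalProj u v) := by
  rw [FlowData.orthProj_apply, normalProj_apply, map_sub, map_smul, real_inner_smul_left,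
    S.inner_coord_coord, S.norm_coord, smul_smul]
  congr 2
  ring

theorem ext_A_lineOf (Y : VectorField d M) (t : ℝ) {x : M} {u : Tan d x} (hu : u ≠ 0)
    (v : Tan d x) : S.flowData.ext.A Y t (S.lineOf x u hu) (S.coord x v) =
      S.coord (flow Y t x) (extPoincareFlow Y t x u v) := by
  rw [FlowData.ext_A_apply, S.lineFlow_lineOf]
  exact (congrArg _ (S.D_coord Y t x v)).trans (S.orthProj_coord _ _)

theorem ext_fib_lineOf (Y : VectorField d M) {x : M} {u : Tan d x} (hu : u ≠ 0) :
    S.flowData.ext.fib Y (S.lineOf x u hu) = (ℝ ∙ u)ᗮ.map (S.coord x).toLinearMap := by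
  have h1 : ‖S.coord x u‖⁻¹ ≠ 0 := inv_ne_zero (norm_ne_zero_iff.2 (S.coord_ne_zero hu))
  have key : ∀ v, inner ℝ (‖S.coord x u‖⁻¹ • S.coord x u) (S.coord x v) = 0 ↔ v ∈ (ℝ ∙ u)ᗮ := by
    intro v
    rw [Submodule.mem_orthogonal_singleton_iff_inner_right, real_inner_smul_left,
      S.inner_coord_coord, mul_eq_zero, or_iff_right h1]
  ext c
  rw [FlowData.mem_ext_fib]
  constructor
  · rintro ⟨h2, h3⟩
    have h2 : S.coord x (S.comb x c) = c := h2
    rw [← h2] at h3 ⊢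
    exact ⟨_, (key _).1 h3, rfl⟩
  · rintro ⟨v, hv, rfl⟩
    exact ⟨congrArg (S.coord x) (S.comb_coord x v), (key v).2 hv⟩

theorem dirLine_eq {Y : VectorField d M} {x : M} (h : (Y, x) ∈ S.flowData.regular) :
    S.flowData.dirLine h = S.lineOf x (Y x) (fun h0 ↦ h (by
      change S.coord x (Y x) = 0
      rw [h0, map_zero])) := rfl

theorem mem_regular {Y : VectorField d M} {x : M} : (Y, x) ∈ S.flowData.regular ↔ x ∉ Sing Y :=
  not_congr ⟨fun h ↦ S.coord_injective x (h.trans (map_zero _).symm), fun h ↦ by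
    change S.coord x (Y x) = 0
    rw [show Y x = 0 from h, map_zero]⟩

theorem tangentFlow_self (S : ParsevalFrame d M ι) (Y : VectorField d M) (t : ℝ) (x : M) :
    tangentFlow Y t x (Y x) = Y (flow Y t x) :=
  S.coord_injective _ ((S.D_coord Y t x (Y x)).symm.trans (S.flowData.D_ξ Y t x))

theorem ext_A_dirLine {Y : VectorField d M} (t : ℝ) {x : M} (h : (Y, x) ∈ S.flowData.regular)
    (v : Tan d x) : S.flowData.ext.A Y t (S.flowData.dirLine h) (S.coord x v) =
      S.coord (flow Y t x) (poincareFlow Y t x v) := by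
  rw [dirLine_eq, ext_A_lineOf, extPoincareFlow, poincareFlow, S.tangentFlow_self]

theorem ext_fib_dirLine {Y : VectorField d M} {x : M} (h : (Y, x) ∈ S.flowData.regular) :
    S.flowData.ext.fib Y (S.flowData.dirLine h) =
      (normalSpace Y x).map (S.coord x).toLinearMap := S.ext_fib_lineOf Y (fun h0 ↦ h (by
        change S.coord x (Y x) = 0
        rw [h0, map_zero]))

end ParsevalFrame

end Dictionary

namespace LinCocycle

variable {P B H : Type*} [TopologicalSpace P] [TopologicalSpace B]
  [NormedAddCommGroup H] [InnerProductSpace ℝ H] [FiniteDimensional ℝ H]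
  {C : LinCocycle P B H} {Y : P} {b : B} {V W : Submodule ℝ H} {η T : ℝ}

theorem domAt_of_strictAt (h : ∀ t ≥ T, C.StrictAt Y b V W η t) : C.DomAt Y b V W η T := by
  intro t ht v hv w hw
  rcases eq_or_ne v 0 with rfl | hv0
  · simp
  rcases eq_or_ne w 0 with rfl | hw0
  · simp
  exact (h t ht v hv w hw hv0 hw0).le

theorem DomAt.strictAt (h : C.DomAt Y b V W η T) (hW : W ≤ C.fib Y b) {η' t : ℝ} (hη : η' < η)
    (hT : 0 < T) (ht : T ≤ t) : C.StrictAt Y b V W η' t := by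
  intro v hv w hw hv0 hw0
  refine (h t ht v hv w hw).trans_lt (mul_lt_mul_of_pos_right (Real.exp_lt_exp.2 ?_)
    (mul_pos (norm_pos_iff.2 hv0) (C.A_pos Y b (hW hw) hw0 t)))
  exact neg_lt_neg (mul_lt_mul_of_pos_right hη (hT.trans_le ht))

end LinCocycle

/-! ### Transfer of dominated splittings between bundles and cocycles -/

section Lift

variable {d : ℕ} {M : Type*} [TopologicalSpace M] [ChartedSpace (EuclideanSpace ℝ (Fin d)) M]
  [IsManifold (𝓡 d) ∞ M] [RiemannianBundle (fun x : M ↦ TangentSpace (𝓡 d) x)]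
  [IsContinuousRiemannianBundle (EuclideanSpace ℝ (Fin d)) (fun x : M ↦ TangentSpace (𝓡 d) x)]
  [T2Space M] [CompactSpace M] {ι : Type*} [Fintype ι]

namespace ParsevalFrame

/-- In the coordinates of the frame, the linear flow `A` on the bundle `N` over `Λ` is the
restriction of a cocycle. -/
structure IsLift (S : ParsevalFrame d M ι) {B : Type*} [TopologicalSpace B]
    (C : LinCocycle (VectorField d M) B (EuclideanSpace ℝ ι)) (Y : VectorField d M)
    (A : (t : ℝ) → (x : M) → Tan d x →L[ℝ] Tan d (flow Y t x)) (Λ : Set M)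
    (N : (x : M) → Submodule ℝ (Tan d x)) (β : (x : M) → x ∈ Λ → B) : Prop where
  inv : ∀ x ∈ Λ, ∀ t, flow Y t x ∈ Λ
  Φ_eq : ∀ x (hx : x ∈ Λ) t, C.Φ Y t (β x hx) = β (flow Y t x) (inv x hx t)
  A_coord : ∀ x (hx : x ∈ Λ) t v,
    C.A Y t (β x hx) (S.coord x v) = S.coord (flow Y t x) (A t x v)
  fib_eq : ∀ x (hx : x ∈ Λ), C.fib Y (β x hx) = (N x).map (S.coord x).toLinearMap

variable {S : ParsevalFrame d M ι} {B : Type*} [TopologicalSpace B]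
  {C : LinCocycle (VectorField d M) B (EuclideanSpace ℝ ι)} {Y : VectorField d M}
  {A : (t : ℝ) → (x : M) → Tan d x →L[ℝ] Tan d (flow Y t x)} {Λ : Set M}
  {N V W : (x : M) → Submodule ℝ (Tan d x)} {β : (x : M) → x ∈ Λ → B}
  {K : Set B} {V' W' : B → Submodule ℝ (EuclideanSpace ℝ ι)} {i : ℕ} {η T : ℝ}

theorem IsLift.restrNorm_mul_lt_iff (h : S.IsLift C Y A Λ N β) {x : M} (hx : x ∈ Λ) {t : ℝ}
    (hV : (V x).map (S.coord x).toLinearMap = V' (β x hx))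
    (hW : (W x).map (S.coord x).toLinearMap = W' (β x hx))
    (hWN : W x ≤ N x) (hWA : (W x).map (A t x).toLinearMap = W (flow Y t x)) :
    restrNorm (A t x) (V x) * restrNorm (A (-t) (flow Y t x)) (W (flow Y t x))
      < Real.exp (-(η * t)) ↔ C.StrictAt Y (β x hx) (V' (β x hx)) (W' (β x hx)) η t := by
  rw [← hV, ← hW]
  refine S.restrNorm_mul_lt_iff η (h.A_coord x hx t) (fun v ↦ ?_) ?_ hWA
  · rw [h.Φ_eq]
    exact h.A_coord _ _ _ _
  · rw [h.fib_eq]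
    exact Submodule.map_mono hWN

theorem IsLift.isSplit (h : S.IsLift C Y A Λ N β)
    (hd : IsDominatedSplitting Y A Λ N V W i η T) (hK : ∀ b ∈ K, ∃ x hx, b = β x hx)
    (hβ : ∀ x hx, β x hx ∈ K)
    (hV : ∀ x hx, (V x).map (S.coord x).toLinearMap = V' (β x hx))
    (hW : ∀ x hx, (W x).map (S.coord x).toLinearMap = W' (β x hx)) :
    C.IsSplit Y K V' W' i where
  inv b hb t := by
    obtain ⟨x, hx, rfl⟩ := hK b hb
    rw [h.Φ_eq]
    exact hβ _ _
  sup_eq b hb := by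
    obtain ⟨x, hx, rfl⟩ := hK b hb
    rw [← hV, ← hW, h.fib_eq, ← hd.sup_eq x hx, Submodule.map_sup]
  disj b hb := by
    obtain ⟨x, hx, rfl⟩ := hK b hb
    rw [← hV, ← hW]
    exact Submodule.disjoint_map (S.coord_injective x) (hd.disjoint x hx)
  rank b hb := by
    obtain ⟨x, hx, rfl⟩ := hK b hb
    rw [← hV, ← hd.index_eq x hx]
    exact (Submodule.equivMapOfInjective _ (S.coord_injective x) _).finrank_eq.symm
  map_left b hb t := by
    obtain ⟨x, hx, rfl⟩ := hK b hb
    rw [h.Φ_eq, ← hV, ← hV, ← hd.invariant_left x hx t]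
    rintro _ ⟨v, hv, rfl⟩
    exact ⟨A t x v, ⟨v, hv, rfl⟩, (h.A_coord x hx t v).symm⟩
  map_right b hb t := by
    obtain ⟨x, hx, rfl⟩ := hK b hb
    rw [h.Φ_eq, ← hW, ← hW, ← hd.invariant_right x hx t]
    rintro _ ⟨v, hv, rfl⟩
    exact ⟨A t x v, ⟨v, hv, rfl⟩, (h.A_coord x hx t v).symm⟩

theorem _root_.SingDom.IsDominatedSplitting.right_le
    (hd : IsDominatedSplitting Y A Λ N V W i η T) {x : M} (hx : x ∈ Λ) : W x ≤ N x :=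
  hd.sup_eq x hx ▸ le_sup_right

/-- The definition of domination has `t > T` and the cocycle version `t ≥ T`, whence the shift by
one. -/
theorem IsLift.isDom (h : S.IsLift C Y A Λ N β)
    (hd : IsDominatedSplitting Y A Λ N V W i η T) (hK : ∀ b ∈ K, ∃ x hx, b = β x hx)
    (hV : ∀ x hx, (V x).map (S.coord x).toLinearMap = V' (β x hx))
    (hW : ∀ x hx, (W x).map (S.coord x).toLinearMap = W' (β x hx)) :
    C.IsDom Y K V' W' η (T + 1) := by
  intro b hb
  obtain ⟨x, hx, rfl⟩ := hK b hb
  exact LinCocycle.domAt_of_strictAt fun t ht ↦ (h.restrNorm_mul_lt_iff hx (hV x hx) (hW x hx)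
    (hd.right_le hx) (hd.invariant_right x hx t)).1
    (hd.dominated x hx t ((lt_add_one T).trans_le ht))

/-- One inclusion is invariance at time `t`, the other is invariance at time `-t` from the image
point. -/
theorem IsLift.map_eq (h : S.IsLift C Y A Λ N β)
    (hV : ∀ x hx, (V x).map (S.coord x).toLinearMap = V' (β x hx))
    (hVN : ∀ x ∈ Λ, V x ≤ N x)
    (hV' : ∀ x hx t, ∀ v ∈ V' (β x hx), C.A Y t (β x hx) v ∈ V' (C.Φ Y t (β x hx)))
    {x : M} (hx : x ∈ Λ) (t : ℝ) : (V x).map (A t x).toLinearMap = V (flow Y t x) := by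
  refine S.map_coord_inj (le_antisymm ?_ ?_)
  · rw [hV _ (h.inv x hx t), ← h.Φ_eq]
    rintro _ ⟨_, ⟨v, hv, rfl⟩, rfl⟩
    have := hV' x hx t (S.coord x v) (hV x hx ▸ Submodule.mem_map_of_mem hv)
    rw [h.A_coord] at this
    exact this
  · rintro _ ⟨w, hw, rfl⟩
    have h1 : S.coord _ w ∈ V' (β _ (h.inv x hx t)) :=
      hV _ (h.inv x hx t) ▸ Submodule.mem_map_of_mem hw
    have h2 : S.coord _ w ∈ C.fib Y (β _ (h.inv x hx t)) := by
      rw [h.fib_eq]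
      exact Submodule.mem_map_of_mem (hVN _ (h.inv x hx t) hw)
    have h3 := hV' _ (h.inv x hx t) (-t) _ h1
    have h4 := C.A_A_neg Y _ h2 t
    rw [← h.Φ_eq x hx, C.Φ_neg_Φ] at h3 h4
    rw [← hV] at h3
    obtain ⟨v, hv, hvw⟩ := h3
    refine ⟨A t x v, ⟨v, hv, rfl⟩, ?_⟩
    rw [← hvw] at h4
    exact (h.A_coord x hx t v).symm.trans h4

/-- Halving the rate turns the non-strict inequality into the strict one of the definition. -/
theorem IsLift.isDominatedSplitting (h : S.IsLift C Y A Λ N β) (hβ : ∀ x hx, β x hx ∈ K)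
    (hs : C.IsSplit Y K V' W' i) (hd : C.IsDom Y K V' W' η T) (hη : 0 < η) (hT : 0 < T)
    (hV : ∀ x hx, (V x).map (S.coord x).toLinearMap = V' (β x hx))
    (hW : ∀ x hx, (W x).map (S.coord x).toLinearMap = W' (β x hx))
    (hcV : IsContinuousFamily Λ V) (hcW : IsContinuousFamily Λ W) :
    IsDominatedSplitting Y A Λ N V W i (η / 2) T := by
  have hsup : ∀ x ∈ Λ, V x ⊔ W x = N x := by
    intro x hx
    apply S.map_coord_inj
    rw [Submodule.map_sup, hV x hx, hW x hx, hs.sup_eq _ (hβ x hx), h.fib_eq]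
  have hVN : ∀ x (hx : x ∈ Λ), V x ≤ N x := fun x hx ↦ hsup x hx ▸ le_sup_left
  have hWN : ∀ x (hx : x ∈ Λ), W x ≤ N x := fun x hx ↦ hsup x hx ▸ le_sup_right
  have hinv : ∀ x ∈ Λ, ∀ t, (W x).map (A t x).toLinearMap = W (flow Y t x) :=
    fun x hx t ↦ h.map_eq hW hWN (fun x hx t ↦ hs.map_right _ (hβ x hx) t) hx t
  exact
  { continuous_left := hcV
    continuous_right := hcW
    sup_eq := hsup
    disjoint := fun x hx ↦ by
      have := hs.disj _ (hβ x hx)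
      rw [← hV, ← hW] at this
      rw [Submodule.disjoint_def] at this ⊢
      intro v hv hw
      exact S.coord_injective x ((this _ (Submodule.mem_map_of_mem hv)
        (Submodule.mem_map_of_mem hw)).trans (map_zero _).symm)
    index_eq := fun x hx ↦ by
      rw [← hs.rank _ (hβ x hx), ← hV]
      exact (Submodule.equivMapOfInjective _ (S.coord_injective x) _).finrank_eq
    invariant_left := fun x hx t ↦
      h.map_eq hV hVN (fun x hx t ↦ hs.map_left _ (hβ x hx) t) hx t
    invariant_right := hinv
    dominated := fun x hx t ht ↦
      (h.restrNorm_mul_lt_iff hx (hV x hx) (hW x hx) (hWN x hx) (hinv x hx t)).2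
        ((hd _ (hβ x hx)).strictAt (hs.right_le (hβ x hx)) (half_lt_self hη) hT ht.le) }

end ParsevalFrame

end Lift

/-- A fixed point converges to itself at every rate, so it suffices to exceed some exponential bound
for the backward tangent flow. This supplies the inclusion of `σ` in the intersection of its strong
stable set with `Λ`. -/
theorem FlowData.mem_strongStable_self {P M H : Type*} [TopologicalSpace P] [TopologicalSpace M]
    [NormedAddCommGroup H] [InnerProductSpace ℝ H] [FiniteDimensional ℝ H] (F : FlowData P M H)
    {Y : P} {σ : M} (hσ : ∀ t, F.φ Y t σ = σ) (G : Submodule ℝ H) :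
    σ ∈ F.strongStable Y σ G := by
  obtain ⟨L, hL⟩ := (isCompact_Icc (a := (-1 : ℝ)) (b := 0)).exists_bound_of_continuousOn
    (f := fun s ↦ F.D Y s σ)
    (F.continuous_D.comp (f := fun s : ℝ ↦ (Y, s, σ)) (by fun_prop)).continuousOn
  set l := max L 0
  have hl : 0 ≤ l := le_max_right _ _
  have hLl : L ≤ Real.exp l := by
    linarith [le_max_left L 0, Real.add_one_le_exp l]
  have h1 : ∀ t ∈ Icc (0 : ℝ) 1, ∀ w, ‖F.D Y (-t) σ w‖ ≤ Real.exp l * ‖w‖ := fun t ht w ↦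
    ((F.D Y (-t) σ).le_opNorm w).trans (mul_le_mul_of_nonneg_right
      ((hL _ ⟨by linarith [ht.2], by linarith [ht.1]⟩).trans hLl) (norm_nonneg w))
  have h2 : ∀ n : ℕ, ∀ t ∈ Icc (0 : ℝ) (n + 1), ∀ w,
      ‖F.D Y (-t) σ w‖ ≤ Real.exp l * Real.exp (l * t) * ‖w‖ := by
    have h0 : ∀ t ∈ Icc (0 : ℝ) 1, ∀ w,
        ‖F.D Y (-t) σ w‖ ≤ Real.exp l * Real.exp (l * t) * ‖w‖ := fun t ht w ↦ by
      refine (h1 t ht w).trans (mul_le_mul_of_nonneg_right ?_ (norm_nonneg w))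
      exact le_mul_of_one_le_right (Real.exp_pos _).le (Real.one_le_exp (mul_nonneg hl ht.1))
    intro n
    induction n with
    | zero => simpa using h0
    | succ n ih =>
      intro t ht w
      rcases le_total t 1 with h | h
      · exact h0 t ⟨ht.1, h⟩ w
      have e : -t = -1 + -(t - 1) := by ring
      rw [e, F.D_add, hσ, ContinuousLinearMap.comp_apply]
      refine (h1 1 (by simp) _).trans ?_
      have h3 := ih (t - 1) ⟨by linarith, by have := ht.2; push_cast at this; linarith⟩ w
      calc _ ≤ Real.exp l * (Real.exp l * Real.exp (l * (t - 1)) * ‖w‖) := by gcongr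
        _ = Real.exp l * (Real.exp l * Real.exp (l * (t - 1))) * ‖w‖ := by ring
        _ = _ := by rw [← Real.exp_add l (l * (t - 1))]; ring_nf
  refine ⟨l + 1, l, Real.exp l, by linarith, by linarith, fun t _ ↦ ?_, fun t ht w _ ↦ ?_⟩
  · rw [hσ, F.dist_self]
    exact zero_le
  · obtain ⟨n, hn⟩ := exists_nat_ge t
    exact h2 n t ⟨ht, by linarith⟩ w

/-- On a zero subspace the pointwise inequality holds even for negative constants, unlike the one
for norms; replacing `c` by `max c 0` reconciles the two. -/
theorem exists_rate_iff {δ : ℝ → ENNReal} {n : ℝ → ℝ} {m : ℝ → ℝ → Prop} (hn : ∀ t, 0 ≤ n t)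
    (h : ∀ t c, 0 ≤ c → (n t ≤ c ↔ m t c)) (hm : ∀ t c c', c ≤ c' → m t c → m t c') :
    (∃ l l' c : ℝ, 0 < l ∧ l' < l ∧
      (∀ t : ℝ, 0 ≤ t → δ t ≤ ENNReal.ofReal (c * Real.exp (-(l * t)))) ∧
      ∀ t : ℝ, 0 ≤ t → n t ≤ c * Real.exp (l' * t)) ↔
    ∃ l l' c : ℝ, 0 < l ∧ l' < l ∧
      (∀ t : ℝ, 0 ≤ t → δ t ≤ ENNReal.ofReal (c * Real.exp (-(l * t)))) ∧
      ∀ t : ℝ, 0 ≤ t → m t (c * Real.exp (l' * t)) := by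
  constructor
  · rintro ⟨l, l', c, h1, h2, h3, h4⟩
    exact ⟨l, l', c, h1, h2, h3, fun t ht ↦ (h t _ ((hn t).trans (h4 t ht))).1 (h4 t ht)⟩
  · rintro ⟨l, l', c, h1, h2, h3, h4⟩
    refine ⟨l, l', max c 0, h1, h2, fun t ht ↦ (h3 t ht).trans (ENNReal.ofReal_le_ofReal ?_),
      fun t ht ↦ (h t _ (by positivity)).2 (hm _ _ _ ?_ (h4 t ht))⟩ <;>
    exact mul_le_mul_of_nonneg_right (le_max_left _ _) (Real.exp_pos _).le

/-! ### Transfer of the condition at a singularity -/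

section Singularity

variable {d : ℕ} {M : Type*} [TopologicalSpace M] [ChartedSpace (EuclideanSpace ℝ (Fin d)) M]
  [IsManifold (𝓡 d) ∞ M] [RiemannianBundle (fun x : M ↦ TangentSpace (𝓡 d) x)]
  [IsContinuousRiemannianBundle (EuclideanSpace ℝ (Fin d)) (fun x : M ↦ TangentSpace (𝓡 d) x)]
  [T2Space M] [CompactSpace M] {ι : Type*} [Fintype ι]

namespace ParsevalFrame

variable {S : ParsevalFrame d M ι} {Y : VectorField d M} {σ : M} {Λ : Set M}
  {E G Q : (x : M) → Submodule ℝ (Tan d x)} {E' G' Q' : Submodule ℝ (EuclideanSpace ℝ ι)} {i : ℕ}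

theorem ξ_eq_zero_iff {x : M} : S.flowData.ξ Y x = 0 ↔ x ∈ Sing Y :=
  not_iff_not.1 S.mem_regular

theorem flow_of_mem_sing (S : ParsevalFrame d M ι) (hσ : σ ∈ Sing Y) (t : ℝ) :
    flow Y t σ = σ := S.flowData.φ_of_sing (S.ξ_eq_zero_iff.2 hσ) t

theorem isLift_tan (hσ : σ ∈ Sing Y) :
    S.IsLift S.flowData.tan Y (tangentFlow Y) {σ} (fun _ ↦ ⊤) (fun x _ ↦ x) where
  inv := by
    rintro x rfl t
    exact S.flow_of_mem_sing hσ t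
  Φ_eq _ _ _ := rfl
  A_coord x _ t v := S.D_coord Y t x v
  fib_eq x _ := S.tan_fib Y x

theorem isLift_ext (hΛ : IsInvariantSet Y Λ) :
    S.IsLift S.flowData.ext Y (poincareFlow Y) (Λ \ Sing Y) (normalSpace Y)
      (fun _ hx ↦ S.flowData.dirLine (S.mem_regular.2 hx.2)) where
  inv x hx t := ⟨hΛ x hx.1 t,
    S.mem_regular.1 (S.flowData.ξ_φ_ne_zero (S.mem_regular.2 hx.2) t)⟩
  Φ_eq _ hx t := S.flowData.lineFlow_dirLine (S.mem_regular.2 hx.2) t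
  A_coord _ hx t v := S.ext_A_dirLine t (S.mem_regular.2 hx.2) v
  fib_eq _ hx := S.ext_fib_dirLine (S.mem_regular.2 hx.2)

theorem restrNorm_tangentFlow_le_iff (hG : (G σ).map (S.coord σ).toLinearMap = G') (t : ℝ) {c : ℝ}
    (hc : 0 ≤ c) : restrNorm (tangentFlow Y t σ) (G σ) ≤ c ↔
      ∀ w ∈ G', ‖S.flowData.D Y t σ w‖ ≤ c * ‖w‖ := by
  rw [restrNorm_le_iff hc, ← hG]
  constructor
  · rintro h _ ⟨w, hw, rfl⟩
    have := h w hw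
    rw [← S.norm_coord, ← S.norm_coord, ← S.D_coord] at this
    exact this
  · intro h w hw
    rw [← S.norm_coord, ← S.norm_coord, ← S.D_coord]
    exact h _ ⟨w, hw, rfl⟩

theorem strongStable_eq (hG : (G σ).map (S.coord σ).toLinearMap = G') :
    strongStable Y σ G = S.flowData.strongStable Y σ G' := by
  ext y
  exact exists_rate_iff (m := fun t c ↦ ∀ w ∈ G', ‖S.flowData.D Y (-t) σ w‖ ≤ c * ‖w‖)
    (fun t ↦ restrNorm_nonneg _ _) (fun t c hc ↦ restrNorm_tangentFlow_le_iff hG (-t) hc)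
    fun t c c' hc h w hw ↦ (h w hw).trans (mul_le_mul_of_nonneg_right hc (norm_nonneg w))

theorem strongUnstable_eq (hE : (E σ).map (S.coord σ).toLinearMap = E') :
    strongUnstable Y σ E = S.flowData.rev.strongStable Y σ E' := by
  ext y
  refine exists_rate_iff (m := fun t c ↦ ∀ w ∈ E', ‖S.flowData.rev.D Y (-t) σ w‖ ≤ c * ‖w‖)
    (fun t ↦ restrNorm_nonneg _ _) (fun t c hc ↦ ?_)
    fun t c c' hc h w hw ↦ (h w hw).trans (mul_le_mul_of_nonneg_right hc (norm_nonneg w))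
  change _ ↔ ∀ w ∈ E', ‖S.flowData.D Y (- -t) σ w‖ ≤ c * ‖w‖
  rw [neg_neg]
  exact restrNorm_tangentFlow_le_iff hE t hc

theorem restrNorm_contracted_iff (hE : (E σ).map (S.coord σ).toLinearMap = E') (s : ℝ → ℝ) :
    (∃ η T : ℝ, 0 < η ∧ 0 < T ∧ ∀ t : ℝ, T < t →
      restrNorm (tangentFlow Y (s t) σ) (E σ) < Real.exp (-(η * t))) ↔
    ∃ η > 0, ∃ T > 0, ∀ t ≥ T, ∀ v ∈ E',
      ‖S.flowData.D Y (s t) σ v‖ ≤ Real.exp (-(η * t)) * ‖v‖ := by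
  constructor
  · rintro ⟨η, T, hη, hT, h⟩
    exact ⟨η, hη, T + 1, by linarith, fun t ht ↦
      (restrNorm_tangentFlow_le_iff hE (s t) (Real.exp_pos _).le).1
        (h t ((lt_add_one T).trans_le ht)).le⟩
  · rintro ⟨η, hη, T, hT, h⟩
    refine ⟨η / 2, T, half_pos hη, hT, fun t ht ↦
      ((restrNorm_tangentFlow_le_iff hE (s t) (Real.exp_pos _).le).2 (h t ht.le)).trans_lt
        (Real.exp_lt_exp.2 (neg_lt_neg (mul_lt_mul_of_pos_right (half_lt_self hη)
          (hT.trans ht))))⟩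

/-- The definitions at a singularity ask for families over the whole manifold, of which only the
value at `σ` matters. Pulling one fixed subspace back by the coordinates gives such a family with
closed total space. -/
theorem isContinuousFamily_comap (s : Set M) (E' : Submodule ℝ (EuclideanSpace ℝ ι)) :
    IsContinuousFamily s (fun x ↦ E'.comap (S.coord x).toLinearMap) :=
  ⟨_, (Submodule.closed_of_finiteDimensional E').preimage S.continuous_coord,
    fun _ _ _ ↦ Iff.rfl⟩

theorem _root_.SingDom.IsStableEscape.isEscape (hσ : σ ∈ Sing Y) (h : IsStableEscape Y Λ i σ E G)
    (hE : (E σ).map (S.coord σ).toLinearMap = E') (hG : (G σ).map (S.coord σ).toLinearMap = G') :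
    S.flowData.IsEscape Y Λ i σ E' G' := by
  obtain ⟨⟨η, T, hη, hT, hd⟩, hc, he⟩ := h
  have hK : ∀ b ∈ ({σ} : Set M), ∃ (x : M) (_ : x ∈ ({σ} : Set M)), b = x := fun b hb ↦ ⟨b, hb, rfl⟩
  have hE1 : ∀ x (_ : x ∈ ({σ} : Set M)), (E x).map (S.coord x).toLinearMap = E' := by
    rintro x rfl
    exact hE
  have hG1 : ∀ x (_ : x ∈ ({σ} : Set M)), (G x).map (S.coord x).toLinearMap = G' := by
    rintro x rfl
    exact hG
  refine ⟨(isLift_tan hσ).isSplit hd hK (fun _ hx ↦ hx) hE1 hG1, ⟨η, hη, T + 1, by linarith, ?_⟩,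
    (restrNorm_contracted_iff hE id).1 hc, fun y hy hys ↦ ?_⟩
  · exact (isLift_tan hσ).isDom (V' := fun _ ↦ E') (W' := fun _ ↦ G') hd hK hE1 hG1 σ rfl
  · have : y ∈ strongStable Y σ G ∩ Λ := ⟨strongStable_eq hG ▸ hys, hy⟩
    rwa [he] at this

/-- Reversing time makes the expanded bundle `F` the contracted one, of dimension `d - 1 - i`, and
`E` the complementary bundle that contains the limit lines. -/
theorem _root_.SingDom.IsUnstableEscape.isEscape (hσ : σ ∈ Sing Y)
    (h : IsUnstableEscape Y Λ i σ E G)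
    (hE : (E σ).map (S.coord σ).toLinearMap = E') (hG : (G σ).map (S.coord σ).toLinearMap = G') :
    S.flowData.rev.IsEscape Y Λ (d - 1 - i) σ G' E' := by
  obtain ⟨⟨η, T, hη, hT, hd⟩, hr, hc, he⟩ := h
  have hK : ∀ b ∈ ({σ} : Set M), ∃ (x : M) (_ : x ∈ ({σ} : Set M)), b = x := fun b hb ↦ ⟨b, hb, rfl⟩
  have hE1 : ∀ x (_ : x ∈ ({σ} : Set M)), (E x).map (S.coord x).toLinearMap = E' := by
    rintro x rfl
    exact hE
  have hG1 : ∀ x (_ : x ∈ ({σ} : Set M)), (G x).map (S.coord x).toLinearMap = G' := by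
    rintro x rfl
    exact hG
  have sp := (isLift_tan hσ).isSplit (V' := fun _ ↦ E') (W' := fun _ ↦ G') hd hK (fun _ hx ↦ hx)
    hE1 hG1
  have hdm := (isLift_tan hσ).isDom (V' := fun _ ↦ E') (W' := fun _ ↦ G') hd hK hE1 hG1
  refine ⟨sp.rev (m := d) (fun b ↦ S.flowData.finrank_tan_fib Y b) (by omega),
    ⟨η, hη, T + 1, by linarith, LinCocycle.IsDom.rev sp hdm σ rfl⟩,
    (restrNorm_contracted_iff hG Neg.neg).1 hc, fun y hy hys ↦ ?_⟩
  have : y ∈ strongUnstable Y σ E ∩ Λ := ⟨strongUnstable_eq hE ▸ hys, hy⟩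
  rwa [he] at this

theorem isStableEscape_comap (hσ : σ ∈ Sing Y) (hσΛ : σ ∈ Λ)
    (h : S.flowData.IsEscape Y Λ i σ E' G') : IsStableEscape Y Λ i σ
      (fun x ↦ E'.comap (S.coord x).toLinearMap) (fun x ↦ G'.comap (S.coord x).toLinearMap) := by
  obtain ⟨sp, ⟨η, hη, T, hT, hdm⟩, hc, he⟩ := h
  have hE1 : ∀ x (_ : x ∈ ({σ} : Set M)),
      (E'.comap (S.coord x).toLinearMap).map (S.coord x).toLinearMap = E' := by
    rintro x rfl
    exact S.map_comap_coord (S.tan_fib Y x ▸ sp.left_le rfl)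
  have hG1 : ∀ x (_ : x ∈ ({σ} : Set M)),
      (G'.comap (S.coord x).toLinearMap).map (S.coord x).toLinearMap = G' := by
    rintro x rfl
    exact S.map_comap_coord (S.tan_fib Y x ▸ sp.right_le rfl)
  refine ⟨⟨η / 2, T, half_pos hη, hT, (isLift_tan hσ).isDominatedSplitting (fun _ hx ↦ hx) sp
    (fun b hb ↦ ?_) hη hT hE1 hG1 (isContinuousFamily_comap _ _) (isContinuousFamily_comap _ _)⟩,
    (restrNorm_contracted_iff (E := fun x ↦ E'.comap (S.coord x).toLinearMap) (hE1 σ rfl) id).2 hc,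
    ?_⟩
  · obtain rfl : b = σ := hb
    exact hdm
  · rw [strongStable_eq (G := fun x ↦ G'.comap (S.coord x).toLinearMap) (hG1 σ rfl)]
    refine Subset.antisymm (fun y hy ↦ he y hy.2 hy.1) ?_
    rintro _ rfl
    exact ⟨S.flowData.mem_strongStable_self (S.flow_of_mem_sing hσ) G', hσΛ⟩

theorem isUnstableEscape_comap (hσ : σ ∈ Sing Y) (hσΛ : σ ∈ Λ) (hi : i < d)
    (h : S.flowData.rev.IsEscape Y Λ (d - 1 - i) σ G' E') : IsUnstableEscape Y Λ i σ
      (fun x ↦ E'.comap (S.coord x).toLinearMap) (fun x ↦ G'.comap (S.coord x).toLinearMap) := by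
  obtain ⟨sp, ⟨η, hη, T, hT, hdm⟩, hc, he⟩ := h
  have sp' : S.flowData.tan.IsSplit Y {σ} (fun _ ↦ E') (fun _ ↦ G') (i + 1) := by
    have := sp.rev (m := d) (j := i + 1) (fun b ↦ S.flowData.rev.finrank_tan_fib Y b) (by omega)
    rwa [FlowData.rev_tan, LinCocycle.rev_rev] at this
  have hdm' : S.flowData.tan.IsDom Y {σ} (fun _ ↦ E') (fun _ ↦ G') η T := by
    have : S.flowData.tan.rev.IsDom Y {σ} (fun _ ↦ G') (fun _ ↦ E') η T := by
      rintro b rfl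
      exact hdm
    have := LinCocycle.IsDom.rev sp this
    rwa [FlowData.rev_tan, LinCocycle.rev_rev] at this
  have hE1 : ∀ x (_ : x ∈ ({σ} : Set M)),
      (E'.comap (S.coord x).toLinearMap).map (S.coord x).toLinearMap = E' := by
    rintro x rfl
    exact S.map_comap_coord (S.tan_fib Y x ▸ sp'.left_le rfl)
  have hG1 : ∀ x (_ : x ∈ ({σ} : Set M)),
      (G'.comap (S.coord x).toLinearMap).map (S.coord x).toLinearMap = G' := by
    rintro x rfl
    exact S.map_comap_coord (S.tan_fib Y x ▸ sp'.right_le rfl)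
  refine ⟨⟨η / 2, T, half_pos hη, hT, (isLift_tan hσ).isDominatedSplitting (fun _ hx ↦ hx) sp'
    hdm' hη hT hE1 hG1 (isContinuousFamily_comap _ _) (isContinuousFamily_comap _ _)⟩, ?_,
    (restrNorm_contracted_iff (E := fun x ↦ G'.comap (S.coord x).toLinearMap) (hG1 σ rfl)
      Neg.neg).2 hc, ?_⟩
  · have h1 := sp.rank σ rfl
    rw [← hG1 σ rfl, ← (Submodule.equivMapOfInjective _ (S.coord_injective σ) _).finrank_eq] at h1
    rw [h1]
    omega
  · rw [strongUnstable_eq (E := fun x ↦ E'.comap (S.coord x).toLinearMap) (hE1 σ rfl)]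
    refine Subset.antisymm (fun y hy ↦ he y hy.2 hy.1) ?_
    rintro _ rfl
    exact ⟨S.flowData.rev.mem_strongStable_self (fun t ↦ S.flow_of_mem_sing hσ (-t)) E', hσΛ⟩

end ParsevalFrame

end Singularity

/-! ### Transfer of the domination over the lines at a singularity -/

section Lines

variable {d : ℕ} {M : Type*} [TopologicalSpace M] [ChartedSpace (EuclideanSpace ℝ (Fin d)) M]
  [IsManifold (𝓡 d) ∞ M] [RiemannianBundle (fun x : M ↦ TangentSpace (𝓡 d) x)]
  [IsContinuousRiemannianBundle (EuclideanSpace ℝ (Fin d)) (fun x : M ↦ TangentSpace (𝓡 d) x)]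
  [T2Space M] [CompactSpace M] {ι : Type*} [Fintype ι]

theorem extPoincareFlow_normalProj (Y : VectorField d M) (t : ℝ) {x : M} (u v : Tan d x) :
    extPoincareFlow Y t x u (normalProj u v) =
      normalProj (tangentFlow Y t x u) (tangentFlow Y t x v) := by
  have h : normalProj (tangentFlow Y t x u) (tangentFlow Y t x u) = 0 :=
    Submodule.starProjection_orthogonalComplement_singleton_eq_zero _
  rw [extPoincareFlow, ContinuousLinearMap.comp_apply, normalProj_apply u v, map_sub, map_sub,
    map_smul, map_smul, h, smul_zero, sub_zero]

namespace ParsevalFrame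

variable {S : ParsevalFrame d M ι} {Y : VectorField d M} {σ : M} {Λ : Set M}
  {E G Q : (x : M) → Submodule ℝ (Tan d x)} {E' G' Q' : Submodule ℝ (EuclideanSpace ℝ ι)} {i : ℕ}
  {η T : ℝ} {p : Prop}

theorem map_normalProj_coord {x : M} {u : Tan d x} (hu : u ≠ 0) (V : Submodule ℝ (Tan d x)) :
    (V.map (normalProj u).toLinearMap).map (S.coord x).toLinearMap =
      (V.map (S.coord x).toLinearMap).map
        (FlowData.orthProj (S.lineOf x u hu).1.2).toLinearMap := by
  ext c
  constructor
  · rintro ⟨_, ⟨v, hv, rfl⟩, rfl⟩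
    exact ⟨_, ⟨v, hv, rfl⟩, S.orthProj_coord u v⟩
  · rintro ⟨_, ⟨v, hv, rfl⟩, rfl⟩
    exact ⟨_, ⟨v, hv, rfl⟩, (S.orthProj_coord u v).symm⟩

theorem lineDominated_iff (hE : (E σ).map (S.coord σ).toLinearMap = E')
    (hG : (G σ).map (S.coord σ).toLinearMap = G') {t : ℝ}
    (hGt : (G σ).map (tangentFlow Y t σ).toLinearMap = G (flow Y t σ)) {u : Tan d σ} (hu : u ≠ 0) :
    restrNorm (extPoincareFlow Y t σ u) ((E σ).map (normalProj u).toLinearMap) *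
      restrNorm (extPoincareFlow Y (-t) (flow Y t σ) (tangentFlow Y t σ u))
        ((G (flow Y t σ)).map (normalProj (tangentFlow Y t σ u)).toLinearMap)
      < Real.exp (-(η * t)) ↔ S.flowData.ext.StrictAt Y (S.lineOf σ u hu)
        (E'.map (FlowData.orthProj (S.lineOf σ u hu).1.2).toLinearMap)
        (G'.map (FlowData.orthProj (S.lineOf σ u hu).1.2).toLinearMap) η t := by
  rw [← hE, ← hG, ← S.map_normalProj_coord, ← S.map_normalProj_coord]
  refine S.restrNorm_mul_lt_iff η (S.ext_A_lineOf Y t hu) (fun v ↦ ?_) ?_ ?_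
  · have h := S.lineFlow_lineOf Y t hu
    change S.flowData.ext.A Y (-t) (S.flowData.lineFlow Y t (S.lineOf σ u hu)) _ = _
    rw [h]
    exact S.ext_A_lineOf Y (-t) (S.tangentFlow_ne_zero Y t hu) v
  · rw [S.ext_fib_lineOf]
    refine Submodule.map_mono ?_
    rintro _ ⟨v, hv, rfl⟩
    exact Submodule.starProjection_apply_mem _ _
  · rw [← hGt]
    ext w
    constructor
    · rintro ⟨_, ⟨v, hv, rfl⟩, rfl⟩
      exact ⟨_, ⟨v, hv, rfl⟩, (extPoincareFlow_normalProj Y t u v).symm⟩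
    · rintro ⟨_, ⟨v, hv, rfl⟩, rfl⟩
      exact ⟨_, ⟨v, hv, rfl⟩, extPoincareFlow_normalProj Y t u v⟩

theorem isLineDominated_iff (hE : (E σ).map (S.coord σ).toLinearMap = E')
    (hG : (G σ).map (S.coord σ).toLinearMap = G') (hQ : (Q σ).map (S.coord σ).toLinearMap = Q')
    (hGt : ∀ t, (G σ).map (tangentFlow Y t σ).toLinearMap = G (flow Y t σ)) :
    IsLineDominated Y σ E G Q η T ↔ ∀ b ∈ S.flowData.linesIn σ Q', ∀ t ≥ T,
      S.flowData.ext.StrictAt Y b (E'.map (FlowData.orthProj b.1.2).toLinearMap)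
        (G'.map (FlowData.orthProj b.1.2).toLinearMap) η t := by
  constructor
  · rintro h b ⟨hb, hbQ⟩ t ht
    rw [← hQ] at hbQ
    obtain ⟨u, hu, hub⟩ := hbQ
    have hub : S.coord σ u = b.1.2 := hub
    have hn : ‖S.coord σ u‖ = 1 := hub ▸ b.2.1
    have hu0 : u ≠ 0 := fun h0 ↦ by
      rw [h0, map_zero, norm_zero] at hn
      exact zero_ne_one hn
    have hbu : b = S.lineOf σ u hu0 := by
      refine Subtype.ext (Prod.ext (hb.trans (S.lineOf_fst hu0).symm) (hub.symm.trans ?_))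
      change _ = ‖S.coord σ u‖⁻¹ • S.coord σ u
      rw [hn, inv_one, one_smul]
    rw [hbu]
    exact (lineDominated_iff hE hG (hGt t) hu0).1 (h u hu hu0 t ht)
  · intro h u hu hu0 t ht
    refine (lineDominated_iff hE hG (hGt t) hu0).2 (h _ ⟨rfl, ?_⟩ t ht)
    rw [← hQ]
    exact Submodule.smul_mem _ _ (Submodule.mem_map_of_mem hu)

theorem rev_lineStrict_iff (hi : i < d) (h : S.flowData.rev.IsEscape Y Λ (d - 1 - i) σ G' E') :
    S.flowData.rev.LineStrict Y σ G' E' η T ↔ ∀ b ∈ S.flowData.linesIn σ E', ∀ t ≥ T,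
      S.flowData.ext.StrictAt Y b (E'.map (FlowData.orthProj b.1.2).toLinearMap)
        (G'.map (FlowData.orthProj b.1.2).toLinearMap) η t := by
  have sp : S.flowData.ext.rev.IsSplit Y (S.flowData.linesIn σ E')
      (fun b ↦ G'.map (FlowData.orthProj b.1.2).toLinearMap)
      (fun b ↦ E'.map (FlowData.orthProj b.1.2).toLinearMap) (d - 1 - i) :=
    FlowData.isSplit_linesIn (d - 1 - i) h.split
  have sp' := sp.rev (m := d - 1) (j := i)
    (fun b ↦ by rw [LinCocycle.rev_fib, S.flowData.finrank_ext_fib]; rfl) (by omega)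
  rw [LinCocycle.rev_rev] at sp'
  constructor
  · intro hs b hb t ht
    have := sp.strictAt_rev (η := η) (t := t) (fun b hb ↦ hs b hb t ht) b hb
    rwa [LinCocycle.rev_rev] at this
  · intro hs b hb t ht
    exact sp'.strictAt_rev (η := η) (t := t) (fun b hb ↦ hs b hb t ht) b hb

theorem singCond_of_stable (hσ : σ ∈ Sing Y) (h : IsStableEscape Y Λ i σ E G)
    (hl : p → IsLineDominated Y σ E G G η T) : S.flowData.SingCond Y Λ i σ p η T := by
  obtain ⟨⟨_, _, _, _, hd⟩, -, -⟩ := id h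
  exact Or.inl ⟨_, _, h.isEscape hσ rfl rfl, fun hp ↦
    (isLineDominated_iff rfl rfl rfl (hd.invariant_right σ rfl)).1 (hl hp)⟩

theorem singCond_of_unstable (hi : i < d) (hσ : σ ∈ Sing Y) (h : IsUnstableEscape Y Λ i σ E G)
    (hl : p → IsLineDominated Y σ E G E η T) : S.flowData.SingCond Y Λ i σ p η T := by
  obtain ⟨⟨_, _, _, _, hd⟩, -, -, -⟩ := id h
  have h1 : S.flowData.rev.IsEscape Y Λ (d - 1 - i) σ _ _ := h.isEscape hσ rfl rfl
  exact Or.inr ⟨_, _, h1, fun hp ↦ (rev_lineStrict_iff hi h1).2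
    ((isLineDominated_iff rfl rfl rfl (hd.invariant_right σ rfl)).1 (hl hp))⟩

theorem exists_escape_of_singCond (hi : i < d) (hσ : σ ∈ Sing Y) (hσΛ : σ ∈ Λ)
    (h : S.flowData.SingCond Y Λ i σ p η T) :
    (∃ E G, IsStableEscape Y Λ i σ E G ∧ (p → IsLineDominated Y σ E G G η T)) ∨
      ∃ E G, IsUnstableEscape Y Λ i σ E G ∧ (p → IsLineDominated Y σ E G E η T) := by
  rcases h with ⟨E', G', h, hs⟩ | ⟨G', E', h, hs⟩
  · have h1 := isStableEscape_comap hσ hσΛ h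
    obtain ⟨⟨_, _, _, _, hd⟩, -, -⟩ := id h1
    have hE := S.map_comap_coord (S.tan_fib Y σ ▸ h.split.left_le rfl)
    have hG := S.map_comap_coord (S.tan_fib Y σ ▸ h.split.right_le rfl)
    exact Or.inl ⟨_, _, h1, fun hp ↦ (isLineDominated_iff
      (E := fun x ↦ E'.comap (S.coord x).toLinearMap)
      (G := fun x ↦ G'.comap (S.coord x).toLinearMap)
      (Q := fun x ↦ G'.comap (S.coord x).toLinearMap) hE hG hG
      (hd.invariant_right σ rfl)).2 (hs hp)⟩
  · have h : S.flowData.rev.IsEscape Y Λ (d - 1 - i) σ G' E' := h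
    have h1 := isUnstableEscape_comap hσ hσΛ hi h
    obtain ⟨⟨_, _, _, _, hd⟩, -, -, -⟩ := id h1
    have e : S.flowData.rev.tan.fib Y σ =
        (⊤ : Submodule ℝ (Tan d σ)).map (S.coord σ).toLinearMap := by
      rw [FlowData.rev_tan, LinCocycle.rev_fib, S.tan_fib]
    have hG := S.map_comap_coord (e ▸ h.split.left_le rfl)
    have hE := S.map_comap_coord (e ▸ h.split.right_le rfl)
    exact Or.inr ⟨_, _, h1, fun hp ↦ (isLineDominated_iff
      (E := fun x ↦ E'.comap (S.coord x).toLinearMap)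
      (G := fun x ↦ G'.comap (S.coord x).toLinearMap)
      (Q := fun x ↦ E'.comap (S.coord x).toLinearMap) hE hG hE
      (hd.invariant_right σ rfl)).2 ((rev_lineStrict_iff hi h).1 (hs hp))⟩

end ParsevalFrame

end Lines

/-! ### The robustness statement on the manifold -/

section Robust

variable {d : ℕ} {M : Type*} [TopologicalSpace M] [ChartedSpace (EuclideanSpace ℝ (Fin d)) M]
  [IsManifold (𝓡 d) ∞ M] [RiemannianBundle (fun x : M ↦ TangentSpace (𝓡 d) x)]
  [IsContinuousRiemannianBundle (EuclideanSpace ℝ (Fin d)) (fun x : M ↦ TangentSpace (𝓡 d) x)]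
  [T2Space M] [CompactSpace M] {ι : Type*} [Fintype ι]

open Classical in
/-- The spaces of normal vectors whose coordinates lie in a given family of subspaces. -/
def ParsevalFrame.pullback (S : ParsevalFrame d M ι) (Y : VectorField d M)
    (V : S.flowData.Line → Submodule ℝ (EuclideanSpace ℝ ι)) (x : M) : Submodule ℝ (Tan d x) :=
  if h : (Y, x) ∈ S.flowData.regular then
    (V (S.flowData.dirLine h)).comap (S.coord x).toLinearMap else ⊥

namespace ParsevalFrame

variable {S : ParsevalFrame d M ι} {Y : VectorField d M}
  {V : S.flowData.Line → Submodule ℝ (EuclideanSpace ℝ ι)}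

theorem pullback_of_regular {x : M} (h : (Y, x) ∈ S.flowData.regular) :
    S.pullback Y V x = (V (S.flowData.dirLine h)).comap (S.coord x).toLinearMap := dif_pos h

theorem map_pullback {x : M} (h : (Y, x) ∈ S.flowData.regular)
    (hV : V (S.flowData.dirLine h) ≤ S.flowData.ext.fib Y (S.flowData.dirLine h)) :
    (S.pullback Y V x).map (S.coord x).toLinearMap = V (S.flowData.dirLine h) := by
  rw [pullback_of_regular h]
  refine S.map_comap_coord (hV.trans ?_)
  rw [S.ext_fib_dirLine]
  exact Submodule.map_mono le_top

/-- The direction of the field is continuous only where the field does not vanish. Closedness is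
obtained over the regular points, and a relatively closed set there is the trace of a closed subset
of the tangent bundle. -/
theorem isContinuousFamily_pullback {s : Set M}
    {Z : Set (VectorField d M × S.flowData.Line × EuclideanSpace ℝ ι)} (hZ : IsClosed Z)
    (hr : ∀ x ∈ s, (Y, x) ∈ S.flowData.regular)
    (h : ∀ x (hx : x ∈ s), ∀ v, v ∈ V (S.flowData.dirLine (hr x hx)) ↔
      (Y, S.flowData.dirLine (hr x hx), v) ∈ Z) : IsContinuousFamily s (S.pullback Y V) := by
  have hp : Continuous (fun w : {w : TangentBundle (𝓡 d) M // (Y, w.proj) ∈ S.flowData.regular} ↦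
      w.1.proj) := (FiberBundle.continuous_proj (EuclideanSpace ℝ (Fin d))
        (fun x : M ↦ TangentSpace (𝓡 d) x)).comp continuous_subtype_val
  have hξ : Continuous (fun w : {w : TangentBundle (𝓡 d) M // (Y, w.proj) ∈ S.flowData.regular} ↦
      S.flowData.ξ Y w.1.proj) := S.flowData.continuous_ξ.comp (continuous_const.prodMk hp)
  have hl : Continuous (fun w : {w : TangentBundle (𝓡 d) M // (Y, w.proj) ∈ S.flowData.regular} ↦
      S.flowData.dirLine w.2) :=
    Continuous.subtype_mk (hp.prodMk ((hξ.norm.inv₀ fun w ↦ norm_ne_zero_iff.2 w.2).smul hξ)) _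
  obtain ⟨C, hC, hCe⟩ := isClosed_induced_iff.1 (hZ.preimage (continuous_const (y := Y).prodMk
    (hl.prodMk (S.continuous_coord.comp continuous_subtype_val))))
  refine ⟨C, hC, fun x hx v ↦ ?_⟩
  rw [pullback_of_regular (hr x hx)]
  refine (h x hx _).trans ?_
  exact (Set.ext_iff.1 hCe ⟨⟨x, v⟩, hr x hx⟩).symm

end ParsevalFrame

theorem isClosed_maxInvariant (S : ParsevalFrame d M ι) (Y : VectorField d M) {U : Set M}
    (hU : IsClosed U) : IsClosed (maxInvariant Y U) := by
  have h : maxInvariant Y U = ⋂ t, flow Y t ⁻¹' U := by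
    ext x
    simp [maxInvariant]
  rw [h]
  exact isClosed_iInter fun t ↦ hU.preimage (S.flowData.continuous_φ.comp
    (f := fun x : M ↦ (Y, t, x)) (by fun_prop))

theorem isInvariantSet_maxInvariant (Y : VectorField d M) (U : Set M) :
    IsInvariantSet Y (maxInvariant Y U) := fun x hx t s ↦ by
  rw [← flow_add]
  exact hx _

/-- Singular dominated splittings are robust, together with the strict domination inequalities for
all times larger than `T` when these are satisfied (if `p` holds). -/
theorem IsSingularDominated.exists_nhds {X : VectorField d M} {Λ : Set M} {i : ℕ}
    {N₁ N₂ : (x : M) → Submodule ℝ (Tan d x)} (hΛ : IsSingularDominated X Λ i N₁ N₂) (p : Prop)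
    {η T : ℝ} (hT : 0 < T)
    (hreg : p → ∀ x ∈ Λ \ Sing X, ∀ t : ℝ, T ≤ t → restrNorm (poincareFlow X t x) (N₁ x) *
      restrNorm (poincareFlow X (-t) (flow X t x)) (N₂ (flow X t x)) < Real.exp (-(η * t)))
    (hsing : ∀ σ ∈ Λ ∩ Sing X,
      (∃ E F, IsStableEscape X Λ i σ E F ∧ (p → IsLineDominated X σ E F F η T)) ∨
      (∃ E F, IsUnstableEscape X Λ i σ E F ∧ (p → IsLineDominated X σ E F E η T))) :
    ∃ η' T' : ℝ, 0 < η' ∧ 0 < T' ∧ ∃ 𝒰 ∈ 𝓝 X, ∃ U ∈ 𝓝ˢ Λ, ∀ Y ∈ 𝒰,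
      ∃ N₁' N₂' : (x : M) → Submodule ℝ (Tan d x),
        IsSingularDominated Y (maxInvariant Y U) i N₁' N₂' ∧
        IsDominatedSplitting Y (poincareFlow Y) (maxInvariant Y U \ Sing Y) (normalSpace Y)
          N₁' N₂' i η' T' ∧
        (p → IsCompletelyDominated Y (maxInvariant Y U) i N₁' N₂' η T) := by
  obtain ⟨ι, ⟨S⟩⟩ := exists_parsevalFrame d M
  have hi := hΛ.index_lt
  obtain ⟨η₀, T₀, hη₀, hT₀, hd⟩ := hΛ.dominated
  have hcl := hΛ.isCompact.isClosed
  have lift := S.isLift_ext hΛ.isInvariant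
  have hK : ∀ b ∈ S.flowData.regLines X Λ, ∃ (x : M) (hx : x ∈ Λ \ Sing X),
      b = S.flowData.dirLine (S.mem_regular.2 hx.2) := by
    rintro b ⟨hb, h, e⟩
    exact ⟨b.1.1, ⟨hb, S.mem_regular.1 h⟩, e⟩
  have hβ : ∀ x (hx : x ∈ Λ \ Sing X),
      S.flowData.dirLine (S.mem_regular.2 hx.2) ∈ S.flowData.regLines X Λ :=
    fun x hx ↦ ⟨hx.1, S.mem_regular.2 hx.2, rfl⟩
  let V₀ : S.flowData.Line → Submodule ℝ (EuclideanSpace ℝ (ι × Fin d)) := fun b ↦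
    (N₁ b.1.1).map (S.coord b.1.1).toLinearMap
  let W₀ : S.flowData.Line → Submodule ℝ (EuclideanSpace ℝ (ι × Fin d)) := fun b ↦
    (N₂ b.1.1).map (S.coord b.1.1).toLinearMap
  have hsp := lift.isSplit (V' := V₀) (W' := W₀) hd hK hβ (fun _ _ ↦ rfl) (fun _ _ ↦ rfl)
  have hdm := lift.isDom (V' := V₀) (W' := W₀) hd hK (fun _ _ ↦ rfl) (fun _ _ ↦ rfl)
  obtain ⟨O, 𝒱, 𝒲, hR, hO, ⟨A, hA, hAs⟩, hst⟩ := FlowData.exists_robust (S := p) (η := η) hcl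
    (show i ≤ d - 1 by omega) hη₀ (by linarith : 0 < T₀ + 1) hsp hdm hT
    (fun hp b hb t ht ↦ by
      obtain ⟨x, hx, rfl⟩ := hK b hb
      exact (lift.restrNorm_mul_lt_iff hx (V' := V₀) (W' := W₀) rfl rfl (hd.right_le hx)
        (hd.invariant_right x hx t)).1 (hreg hp x hx t ht))
    (fun σ hσ h0 ↦ by
      have h0 := S.ξ_eq_zero_iff.1 h0
      rcases hsing σ ⟨hσ, h0⟩ with ⟨E, F, h, hl⟩ | ⟨E, F, h, hl⟩
      · exact S.singCond_of_stable h0 h hl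
      · exact S.singCond_of_unstable hi h0 h hl)
  obtain ⟨η₁, hη₁, T₁, hT₁, hd₁⟩ := hR.dom
  obtain ⟨𝒰, h𝒰, U₀, hU₀, hU⟩ := S.flowData.eventually_near_iff.1 (hO.and hA)
  -- A closed neighbourhood inside `U₀` makes the maximal invariant set closed, hence compact.
  -- Shrinking the neighbourhood only shrinks that set, so all conclusions are kept.
  obtain ⟨W, hWo, hΛW, hWU⟩ := normal_exists_closure_subset hcl isOpen_interior
    (subset_interior_iff_mem_nhdsSet.2 hU₀)
  refine ⟨η₁ / 2, T₁, half_pos hη₁, hT₁, 𝒰, h𝒰, closure W,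
    mem_of_superset (hWo.mem_nhdsSet.2 hΛW) subset_closure, fun Y hY ↦ ?_⟩
  set ΛY := maxInvariant Y (closure W)
  have hmax : ∀ x ∈ ΛY, x ∈ S.flowData.maxInv Y U₀ := fun x hx t ↦
    interior_subset (hWU (hx t))
  have hinv : IsInvariantSet Y ΛY := isInvariantSet_maxInvariant Y _
  have hr : ∀ x ∈ ΛY \ Sing Y, (Y, x) ∈ S.flowData.regular := fun x hx ↦ S.mem_regular.2 hx.2
  have horb : ∀ x (hx : x ∈ ΛY \ Sing Y),
      S.flowData.dirLine (hr x hx) ∈ S.flowData.ext.orbitIn Y O := by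
    intro x hx t
    have h1 := (hU Y hY _ (hmax _ (hinv x hx.1 t))).1
      (S.flowData.ξ_φ_ne_zero (hr x hx) t)
    exact (congrArg (fun b ↦ (Y, b) ∈ O) (S.flowData.lineFlow_dirLine (hr x hx) t)).mpr h1
  have sp := hR.split Y
  have liftY := S.isLift_ext hinv
  obtain ⟨Z₁, hZ₁, hZ₁e⟩ := hR.closed_left
  obtain ⟨Z₂, hZ₂, hZ₂e⟩ := hR.closed_right
  have hV : ∀ x (hx : x ∈ ΛY \ Sing Y), (S.pullback Y (𝒱 Y) x).map (S.coord x).toLinearMap =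
      𝒱 Y (S.flowData.dirLine (hr x hx)) := fun x hx ↦
    S.map_pullback (hr x hx) (sp.left_le (horb x hx))
  have hW : ∀ x (hx : x ∈ ΛY \ Sing Y), (S.pullback Y (𝒲 Y) x).map (S.coord x).toLinearMap =
      𝒲 Y (S.flowData.dirLine (hr x hx)) := fun x hx ↦
    S.map_pullback (hr x hx) (sp.right_le (horb x hx))
  have hdY : IsDominatedSplitting Y (poincareFlow Y) (ΛY \ Sing Y) (normalSpace Y)
      (S.pullback Y (𝒱 Y)) (S.pullback Y (𝒲 Y)) i (η₁ / 2) T₁ :=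
    liftY.isDominatedSplitting horb sp (hd₁ Y) hη₁ hT₁ hV hW
      (S.isContinuousFamily_pullback hZ₁ hr fun x hx v ↦ hZ₁e Y _ (horb x hx) v)
      (S.isContinuousFamily_pullback hZ₂ hr fun x hx v ↦ hZ₂e Y _ (horb x hx) v)
  have hsY : ∀ σ ∈ ΛY ∩ Sing Y,
      (∃ E F, IsStableEscape Y ΛY i σ E F ∧ (p → IsLineDominated Y σ E F F η T)) ∨
      (∃ E F, IsUnstableEscape Y ΛY i σ E F ∧ (p → IsLineDominated Y σ E F E η T)) := by
    rintro σ ⟨hσ, h0⟩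
    exact S.exists_escape_of_singCond hi h0 hσ ((hAs (Y, σ) (hU Y hY σ (hmax σ hσ)).2
      (S.ξ_eq_zero_iff.2 h0)).mono fun y hy ↦ (hU Y hY y (hmax y hy)).2)
  have hmain : IsSingularDominated Y ΛY i (S.pullback Y (𝒱 Y)) (S.pullback Y (𝒲 Y)) :=
    { isCompact := (isClosed_maxInvariant S Y isClosed_closure).isCompact
      isInvariant := hinv
      index_lt := hi
      dominated := ⟨_, _, half_pos hη₁, hT₁, hdY⟩
      singular := fun σ hσ ↦ (hsY σ hσ).imp (fun ⟨E, F, h, _⟩ ↦ ⟨E, F, h⟩)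
        fun ⟨E, F, h, _⟩ ↦ ⟨E, F, h⟩ }
  refine ⟨_, _, hmain, hdY, fun hp ↦ ⟨hmain, fun x hx t ht ↦ ?_, fun σ hσ ↦
    (hsY σ hσ).imp (fun ⟨E, F, h, hl⟩ ↦ ⟨E, F, h, hl hp⟩) fun ⟨E, F, h, hl⟩ ↦ ⟨E, F, h, hl hp⟩⟩⟩
  exact (liftY.restrNorm_mul_lt_iff hx (hV x hx) (hW x hx) (hdY.right_le hx)
    (hdY.invariant_right x hx t)).2 (hst hp Y _ (horb x hx) t ht)

end Robust

end SingDom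

end

open SingDom in
theorem theoremA {d : ℕ} {M : Type*} [TopologicalSpace M] [T2Space M] [CompactSpace M]
    [ChartedSpace (EuclideanSpace ℝ (Fin d)) M] [IsManifold (𝓡 d) ∞ M]
    [RiemannianBundle (fun x : M ↦ TangentSpace (𝓡 d) x)]
    [IsContinuousRiemannianBundle (EuclideanSpace ℝ (Fin d))
      (fun x : M ↦ TangentSpace (𝓡 d) x)]
    (X : VectorField d M) (Λ : Set M) (i : ℕ)
    (N₁ N₂ : (x : M) → Submodule ℝ (Tan d x)) (hΛ : IsSingularDominated X Λ i N₁ N₂) :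
    (∃ η' T' : ℝ, 0 < η' ∧ 0 < T' ∧ ∃ 𝒰 ∈ 𝓝 X, ∃ U ∈ 𝓝ˢ Λ, ∀ Y ∈ 𝒰,
      ∃ N₁' N₂' : (x : M) → Submodule ℝ (Tan d x),
        IsSingularDominated Y (maxInvariant Y U) i N₁' N₂' ∧
        IsDominatedSplitting Y (poincareFlow Y) (maxInvariant Y U \ Sing Y) (normalSpace Y)
          N₁' N₂' i η' T') ∧
    (∀ η T : ℝ, 0 < η → 0 < T → IsCompletelyDominated X Λ i N₁ N₂ η T →
      ∃ 𝒰 ∈ 𝓝 X, ∃ U ∈ 𝓝ˢ Λ, ∀ Y ∈ 𝒰,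
        ∃ N₁' N₂' : (x : M) → Submodule ℝ (Tan d x),
          IsCompletelyDominated Y (maxInvariant Y U) i N₁' N₂' η T) := by
  refine ⟨?_, fun η T _ hT h ↦ ?_⟩
  -- With `False` as flag the strict inequalities are not requested, and the values of `η` and `T`
  -- are immaterial.
  · obtain ⟨η', T', hη', hT', 𝒰, h𝒰, U, hU, h⟩ := hΛ.exists_nhds False (η := 1) one_pos
      (fun hp ↦ hp.elim) fun σ hσ ↦ (hΛ.singular σ hσ).imp
        (fun ⟨E, F, h⟩ ↦ ⟨E, F, h, fun hp ↦ hp.elim⟩) fun ⟨E, F, h⟩ ↦ ⟨E, F, h, fun hp ↦ hp.elim⟩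
    refine ⟨η', T', hη', hT', 𝒰, h𝒰, U, hU, fun Y hY ↦ ?_⟩
    obtain ⟨N₁', N₂', h1, h2, -⟩ := h Y hY
    exact ⟨N₁', N₂', h1, h2⟩
  · obtain ⟨_, _, _, _, 𝒰, h𝒰, U, hU, h⟩ := hΛ.exists_nhds True hT (fun _ ↦ h.regular)
      fun σ hσ ↦ (h.singular σ hσ).imp (fun ⟨E, F, h, hl⟩ ↦ ⟨E, F, h, fun _ ↦ hl⟩)
        fun ⟨E, F, h, hl⟩ ↦ ⟨E, F, h, fun _ ↦ hl⟩
    refine ⟨𝒰, h𝒰, U, hU, fun Y hY ↦ ?_⟩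
    obtain ⟨N₁', N₂', -, -, h3⟩ := h Y hY
    exact ⟨N₁', N₂', h3 trivial⟩
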